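/- Consider the following single-machine scheduling problem with rejection. An instance consists of $n$ jobs and an integer $s\ge 0$; each job $j$ has a release date $r_j$, a processing time $p_j>0$, a rejection cost $e_j$, and a private cost function $w_j$ that is non-decreasing on $[r_j,\infty)$. All times and costs are elements of an ordered commutative ring $K$ (such as $\mathbb Z$, $\mathbb Q$ or $\mathbb R$). A set $S$ of jobs is scheduled on one machine, which processes at most one job at a time; each job $j\in S$ is processed for a total of $p_j$ time units, not before $r_j$, and is completed at time $C_j$. The other jobs, which form the set $\bar S$, are rejected, and at least $n-s$ jobs must be rejected. The goal is to minimize $$\sum_{j\in S} w_j(C_j)+\sum_{j\in\bar S}e_j .$$ In the preemptive variant a job may be processed in finitely many disjoint time intervals; in the non-preemptive variant each scheduled job is processed in one interval. Let $\overline p$ be the number of distinct processing times of the instance. The model of computation is a deterministic random access machine (one fixed program for all instances and all $K$) with indirect addressing, in which addition, subtraction and comparison of natural numbers and of elements of $K$ take unit time; there is no multiplication. The functions $w_j$ are given by an oracle, and a query $(j,t)\mapsto w_j(t)$ takes unit time. For each of the two variants (preemptive and non-preemptive) there is a deterministic algorithm that, for every such instance, halts and outputs an optimal schedule. Its running time is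 $2^{O(s)}\,s^{O(\overline p)}\,n^4\log n$; that is, there is a constant $c$ such that the algorithm takes at most $2^{cs}\,s^{c\overline p}\,n^4\log n$ steps on every instance with $n\ge 2$ and $s\ge 1$. In particular, this covers (with job weights $\omega_j\ge 0$ and due dates $d_j$) weighted flow time with rejection, $\sum_{j\in S}\omega_j(C_j-r_j)+\sum_{j\in\bar S}e_j$, weighted tardiness with rejection, $\sum_{j\in S}\omega_j\max\{0,C_j-d_j\}+\sum_{j\in\bar S}e_j$, and weighted sum of completion times with rejection, $\sum_{j\in S}\omega_jC_j+\sum_{j\in\bar S}e_j$: each of them is an objective of the above form with non-decreasing cost functions. -/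

import Mathlib

namespace RejSched

/-! ### The problem: one machine, release dates, rejection -/

/-- An instance with `n` jobs of which at most `s` may be scheduled, i.e. at least `n - s` must be
rejected. Job `j` has release date `r j`, processing time `p j`, rejection cost `e j` and a private
cost function `w j` of its completion time. All numbers are from an ordered ring `K`
(`ℤ`, `ℚ`, `ℝ`, ...). -/
structure Problem (K : Type) where
  n : ℕ
  s : ℕ
  r : Fin n → K
  p : Fin n → K
  e : Fin n → K
  w : Fin n → K → K

/-- The two variants of the problem. -/
inductive Mode where
  | preemptive
  | nonpreemptive

/-- The machine works on `job` throughout the time interval `[start, finish)`. -/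
structure Piece (K : Type) (n : ℕ) where
  job : Fin n
  start : K
  finish : K

/-- A schedule is a finite list of pieces; the jobs that have a piece are the scheduled ones. -/
abbrev Schedule (K : Type) (n : ℕ) : Type := List (Piece K n)

namespace Schedule

variable {K : Type} {n : ℕ}

/-- The list of the pieces of job `j`. -/
def piecesOf (S : Schedule K n) (j : Fin n) : List (Piece K n) :=
  S.filter (fun q => decide (q.job = j))

/-- The set of scheduled jobs. -/
def scheduled (S : Schedule K n) : Finset (Fin n) := (S.map Piece.job).toFinset

/-- The set of rejected jobs. -/
def rejected (S : Schedule K n) : Finset (Fin n) := Finset.univ \ S.scheduled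

end Schedule

namespace Problem

variable {K : Type} [CommRing K] [LinearOrder K] [IsStrictOrderedRing K]

/-- Processing times are positive and the cost functions are non-decreasing from the release date
on. -/
def Admissible (I : Problem K) : Prop :=
  (∀ j, 0 < I.p j) ∧ ∀ j, MonotoneOn (I.w j) (Set.Ici (I.r j))

/-- The number of distinct processing times. -/
def numProcTimes (I : Problem K) : ℕ := (Finset.univ.image I.p).card

/-- The time at which the last piece of job `j` ends. (In a feasible schedule all pieces of `j` end
after `r j`, so for a scheduled job the start value `r j` of the maximum plays no role.) -/
def completion (I : Problem K) (S : Schedule K I.n) (j : Fin I.n) : K :=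
  ((S.piecesOf j).map Piece.finish).foldr max (I.r j)

/-- Feasibility: every piece is a non-empty interval after the release date of its job, the machine
works on one job at a time, every scheduled job is processed for exactly its processing time, at
least `n - s` jobs are rejected, and without preemption every scheduled job is one single piece. -/
def Feasible (I : Problem K) (mode : Mode) (S : Schedule K I.n) : Prop :=
  (∀ q ∈ S, I.r q.job ≤ q.start ∧ q.start < q.finish) ∧
  S.Pairwise (fun q q' => q.finish ≤ q'.start ∨ q'.finish ≤ q.start) ∧
  (∀ j ∈ S.scheduled, ((S.piecesOf j).map (fun q => q.finish - q.start)).sum = I.p j) ∧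
  I.n - I.s ≤ S.rejected.card ∧
  (match mode with
    | Mode.preemptive => True
    | Mode.nonpreemptive => (S.map Piece.job).Nodup)

/-- The objective: private costs of the scheduled jobs plus rejection costs. -/
def cost (I : Problem K) (S : Schedule K I.n) : K :=
  ∑ j ∈ S.scheduled, I.w j (I.completion S j) + ∑ j ∈ S.rejected, I.e j

/-- `S` is a feasible schedule of minimum total cost. -/
def IsOptimal (I : Problem K) (mode : Mode) (S : Schedule K I.n) : Prop :=
  I.Feasible mode S ∧ ∀ S' : Schedule K I.n, I.Feasible mode S' → I.cost S ≤ I.cost S'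

end Problem

/-! ### The machine: a random access machine with unit-cost addition, subtraction, comparison

A program is a fixed structured program over finitely many one-dimensional arrays. There are
arrays of natural numbers (used for addressing, counting) and arrays of elements of `K`. Array
names are fixed in the program text, positions in an array are computed (indirect addressing).
There is no multiplication and no division. Elements of `K` can only be added, subtracted, compared
and passed to the oracle for the cost functions. -/

/-- Expressions for natural numbers. -/
inductive NExp where
  | const (c : ℕ)
  | read (arr : ℕ) (pos : NExp)
  | add (x y : NExp)
  | sub (x y : NExp)

/-- Expressions for elements of `K`; `query j t` asks the oracle for the cost of completing job `j`
at time `t`. -/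
inductive KExp where
  | zero
  | read (arr : ℕ) (pos : NExp)
  | add (x y : KExp)
  | sub (x y : KExp)
  | query (j : NExp) (t : KExp)

/-- Tests. -/
inductive Cond where
  | natLe (x y : NExp)
  | numLe (x y : KExp)
  | neg (b : Cond)
  | and (b b' : Cond)

/-- Programs. -/
inductive Cmd where
  | skip
  | setNat (arr : ℕ) (pos x : NExp)
  | setNum (arr : ℕ) (pos : NExp) (x : KExp)
  | seq (c d : Cmd)
  | ite (b : Cond) (c d : Cmd)
  | loop (b : Cond) (c : Cmd)

/-- The memory: `nat a i` and `num a i` are the entries at position `i` of the array named `a`. -/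
structure Memory (K : Type) where
  nat : ℕ → ℕ → ℕ
  num : ℕ → ℕ → K

/-- The number of elementary operations in an expression. -/
def NExp.size : NExp → ℕ
  | .const _ => 1
  | .read _ i => i.size + 1
  | .add x y => x.size + y.size + 1
  | .sub x y => x.size + y.size + 1

/-- The number of elementary operations in an expression; an oracle query is one operation. -/
def KExp.size : KExp → ℕ
  | .zero => 1
  | .read _ i => i.size + 1
  | .add x y => x.size + y.size + 1
  | .sub x y => x.size + y.size + 1
  | .query j t => j.size + t.size + 1

/-- The number of elementary operations in a test. -/
def Cond.size : Cond → ℕ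
  | .natLe x y => x.size + y.size + 1
  | .numLe x y => x.size + y.size + 1
  | .neg b => b.size + 1
  | .and b b' => b.size + b'.size + 1

section Semantics

variable {K : Type} [CommRing K] [LinearOrder K] [IsStrictOrderedRing K]

/-- Value of an expression (the subtraction is the truncated one). -/
def NExp.eval (m : Memory K) : NExp → ℕ
  | .const c => c
  | .read a i => m.nat a (i.eval m)
  | .add x y => x.eval m + y.eval m
  | .sub x y => x.eval m - y.eval m

/-- Value of an expression, relative to an oracle `w`. -/
def KExp.eval (w : ℕ → K → K) (m : Memory K) : KExp → K
  | .zero => 0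
  | .read a i => m.num a (i.eval m)
  | .add x y => x.eval w m + y.eval w m
  | .sub x y => x.eval w m - y.eval w m
  | .query j t => w (j.eval m) (t.eval w m)

/-- Truth of a test, relative to an oracle `w`. -/
def Cond.Holds (w : ℕ → K → K) (m : Memory K) : Cond → Prop
  | .natLe x y => x.eval m ≤ y.eval m
  | .numLe x y => x.eval w m ≤ y.eval w m
  | .neg b => ¬ b.Holds w m
  | .and b b' => b.Holds w m ∧ b'.Holds w m

/-- Write `v` at position `i` of the array `a` of natural numbers. -/
def Memory.writeNat (m : Memory K) (a i v : ℕ) : Memory K :=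
  { m with nat := Function.update m.nat a (Function.update (m.nat a) i v) }

/-- Write `v` at position `i` of the array `a` of elements of `K`. -/
def Memory.writeNum (m : Memory K) (a i : ℕ) (v : K) : Memory K :=
  { m with num := Function.update m.num a (Function.update (m.num a) i v) }

/-- `Runs w c m t m'`: with oracle `w`, started in memory `m`, the program `c` halts after exactly
`t` elementary steps, in memory `m'`. -/
inductive Runs (w : ℕ → K → K) : Cmd → Memory K → ℕ → Memory K → Prop where
  | skip (m : Memory K) : Runs w .skip m 1 m
  | setNat (m : Memory K) (a : ℕ) (i x : NExp) :
      Runs w (.setNat a i x) m (i.size + x.size + 1) (m.writeNat a (i.eval m) (x.eval m))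
  | setNum (m : Memory K) (a : ℕ) (i : NExp) (x : KExp) :
      Runs w (.setNum a i x) m (i.size + x.size + 1) (m.writeNum a (i.eval m) (x.eval w m))
  | seq {c d : Cmd} {m m' m'' : Memory K} {t t' : ℕ} :
      Runs w c m t m' → Runs w d m' t' m'' → Runs w (.seq c d) m (t + t') m''
  | iteTrue {b : Cond} {c d : Cmd} {m m' : Memory K} {t : ℕ} :
      b.Holds w m → Runs w c m t m' → Runs w (.ite b c d) m (b.size + 1 + t) m'
  | iteFalse {b : Cond} {c d : Cmd} {m m' : Memory K} {t : ℕ} :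
      ¬ b.Holds w m → Runs w d m t m' → Runs w (.ite b c d) m (b.size + 1 + t) m'
  | loopTrue {b : Cond} {c : Cmd} {m m' m'' : Memory K} {t t' : ℕ} :
      b.Holds w m → Runs w c m t m' → Runs w (.loop b c) m' t' m'' →
      Runs w (.loop b c) m (b.size + 1 + t + t') m''
  | loopFalse {b : Cond} {c : Cmd} {m : Memory K} :
      ¬ b.Holds w m → Runs w (.loop b c) m (b.size + 1) m

/-- The oracle of an instance: query `(j, t)` is answered by `w j t`. -/
def Problem.oracle (I : Problem K) (j : ℕ) (t : K) : K :=
  if h : j < I.n then I.w ⟨j, h⟩ t else 0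

/-- A list of `n` elements of `K` as an array, filled up with zeros. -/
def toArray {n : ℕ} (f : Fin n → K) (i : ℕ) : K := if h : i < n then f ⟨i, h⟩ else 0

/-- The initial memory: the numbers `n` and `s` are in the natural array `0`, release dates,
processing times and rejection costs in the arrays `0`, `1`, `2` over `K`; all else is zero. The
cost functions are available through the oracle only. -/
def Problem.input (I : Problem K) : Memory K where
  nat a i := if a = 0 then (if i = 0 then I.n else if i = 1 then I.s else 0) else 0
  num a i :=
    if a = 0 then toArray I.r i
    else if a = 1 then toArray I.p i
    else if a = 2 then toArray I.e i
    else 0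

/-- The memory holds the schedule `S` as output: its number of pieces is at position `0` of the
natural array `1`; the jobs of the pieces are in the natural array `2`, their start and end times
in the arrays `3` and `4` over `K`. -/
def Memory.Outputs (m : Memory K) {n : ℕ} (S : Schedule K n) : Prop :=
  m.nat 1 0 = S.length ∧
  ∀ (i : ℕ) (h : i < S.length),
    m.nat 2 i = (S[i].job : ℕ) ∧ m.num 3 i = S[i].start ∧ m.num 4 i = S[i].finish

end Semantics

/-! ### Special objectives -/

section Objectives

variable {K : Type} [CommRing K] [LinearOrder K] [IsStrictOrderedRing K]

/-- Weighted flow time with rejection, for job weights `ω`. -/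
def weightedFlowTime (n s : ℕ) (r p e ω : Fin n → K) : Problem K where
  n := n
  s := s
  r := r
  p := p
  e := e
  w j t := ω j * (t - r j)

/-- Weighted tardiness with rejection, for job weights `ω` and due dates `d`. -/
def weightedTardiness (n s : ℕ) (r p e ω d : Fin n → K) : Problem K where
  n := n
  s := s
  r := r
  p := p
  e := e
  w j t := ω j * max 0 (t - d j)

/-- Weighted sum of completion times with rejection, for job weights `ω`. -/
def weightedCompletionTime (n s : ℕ) (r p e ω : Fin n → K) : Problem K where
  n := n
  s := s
  r := r
  p := p
  e := e
  w j t := ω j * t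

end Objectives

end RejSched

/-! Dominance. Every feasible schedule can be replaced by a nested one that is not more expensive:
an open job is interrupted only by complete subschedules, and the interval from the start of a job
to its end contains no idle time. In the preemptive case one removes the job that finishes last and
reinserts it with lowest priority (`Blocks.insert`). It then ends at `x + I.work X`, where `X` is
the set of jobs of its busy interval and all of them are released at or after `x`; counting the work
of `X` in the given schedule (`Problem.Feasible.hall`) shows that it is not later than before. This
gives `exists_blocks`; the non-preemptive case is the usual left shift, `exists_nest_nonpreemptive`.
In a nested schedule that starts at a release date, all interval ends have the form release date
plus total processing time of some scheduled jobs (`Nest.der`), so few points of time matter and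
nested schedules can be found by dynamic programming over pairs of such points. The only rules are
empty and idle intervals, concatenation, and enclosing an interval by one more job that fills its
gaps (`Der`).

Color coding. The dynamic program must not use a job twice, but cannot afford to remember sets of
jobs. For a fixed number `q` of scheduled jobs, the jobs receive colors below `q`, and each job has
a weight that combines a unit for counting, the power of two of its color, and a digit position for
its processing time. Only the total weight is stored. It determines the total processing time, and
if the color part of the total is the one expected, then at most `q` powers of two add up to `2 ^ q
- 1` modulo `2 ^ q`, which forces every color to occur exactly once (`eq_one_of_sum_two_pow`,
`nodup_of_target`). Table entries with repeated jobs may therefore exist; they are never selected.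
With `k` processing times among the colored jobs there are `rangeY q k` weights, `I.n * rangeY q k`
points of time, and derivations of height `8 * q` suffice, so that one run costs `n ^ 3` times a
factor that depends on `q` and `k` only (`run_time_le`, `runC_spec`).

Derandomization. The colorings to be tried come from two hash steps (`exists_colors`).
Multiplication modulo a prime of size at most `2 * n` maps the unknown set of `q` jobs injectively
to `2 * q * q` values for a suitable multiplier; trying all multipliers costs the fourth factor `n`.
Those values are colored level by level with geometrically shrinking bucket numbers
(`exists_peeling`, `exists_peelColor`). The data of this second step, logarithmically many
multipliers modulo a prime of order `q * q` and a set of active colors among `8 * q`, have only `2 ^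
O(q)` possibilities (`enum_bounds`). Single jobs are treated separately (`singlesC_spec`), because
for `s = 1` the bound `s ^ O(k)` leaves no room for a factor `2 ^ k`.

Programs are verified with time-bounded total correctness triples `Tri`, where a syntactic frame
rule (`Runs.same`) supplies everything that stays unchanged. The two variants of the problem share
all programs and proofs except for one test in the closing rule and the dominance argument. The
algorithm is analyzed in `mainC_spec` and its time in `mainTime_le`; the factor `log n` is slack. -/

set_option linter.unusedSectionVars false

namespace RejSched

/-! ### Program logic: frames, straight-line code, bounded loops -/

/-- Does the expression read the array `a`? -/
def NExp.reads : NExp → ℕ → Bool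
  | .const _, _ => false
  | .read b i, a => b == a || i.reads a
  | .add x y, a => x.reads a || y.reads a
  | .sub x y, a => x.reads a || y.reads a

/-- Does the program contain a write to the natural array `a`? -/
def Cmd.wN : Cmd → ℕ → Bool
  | .skip, _ => false
  | .setNat b _ _, a => b == a
  | .setNum _ _ _, _ => false
  | .seq c d, a => c.wN a || d.wN a
  | .ite _ c d, a => c.wN a || d.wN a
  | .loop _ c, a => c.wN a

/-- Does the program contain a write to the array `a` over `K`? -/
def Cmd.wK : Cmd → ℕ → Bool
  | .skip, _ => false
  | .setNat _ _ _, _ => false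
  | .setNum b _ _, a => b == a
  | .seq c d, a => c.wK a || d.wK a
  | .ite _ c d, a => c.wK a || d.wK a
  | .loop _ c, a => c.wK a

/-- Is the program free of loops? -/
def Cmd.loopFree : Cmd → Bool
  | .skip => true
  | .setNat _ _ _ => true
  | .setNum _ _ _ => true
  | .seq c d => c.loopFree && d.loopFree
  | .ite _ c d => c.loopFree && d.loopFree
  | .loop _ _ => false

/-- Bound on the number of steps of a loop-free program. -/
def Cmd.cost : Cmd → ℕ
  | .skip => 1
  | .setNat _ i x => i.size + x.size + 1
  | .setNum _ i x => i.size + x.size + 1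
  | .seq c d => c.cost + d.cost
  | .ite b c d => b.size + 1 + max c.cost d.cost
  | .loop _ _ => 0

/-- The register `a`: position `0` of the natural array `a`. -/
abbrev rd (a : ℕ) : NExp := .read a (.const 0)

/-- `for i < N do body`. -/
def forC (i : ℕ) (N : NExp) (body : Cmd) : Cmd :=
  .seq (.setNat i (.const 0) (.const 0))
    (.loop (.neg (.natLe N (rd i))) (.seq body (.setNat i (.const 0) (.add (rd i) (.const 1)))))

section Logic

variable {K : Type} [CommRing K] [LinearOrder K] [IsStrictOrderedRing K]

/-- The arrays that `c` does not write are the same in both memories. -/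
structure Same (c : Cmd) (m m' : Memory K) : Prop where
  nat : ∀ a, c.wN a = false → m'.nat a = m.nat a
  num : ∀ a, c.wK a = false → m'.num a = m.num a

theorem NExp.eval_congr (x : NExp) {m m' : Memory K}
    (h : ∀ a, x.reads a = true → m'.nat a = m.nat a) : x.eval m' = x.eval m := by
  induction x with
  | const c => rfl
  | read b i ih =>
    have h1 := h b (by simp [reads])
    have h2 := ih (fun a ha => h a (by simp [reads, ha]))
    simp [eval, h1, h2]
  | add x y ihx ihy =>
    simp [eval, ihx (fun a ha => h a (by simp [reads, ha])),
      ihy (fun a ha => h a (by simp [reads, ha]))]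
  | sub x y ihx ihy =>
    simp [eval, ihx (fun a ha => h a (by simp [reads, ha])),
      ihy (fun a ha => h a (by simp [reads, ha]))]

theorem Same.refl (c : Cmd) (m : Memory K) : Same c m m := ⟨fun _ _ => rfl, fun _ _ => rfl⟩

theorem Same.trans {c : Cmd} {m m' m'' : Memory K} (h : Same c m m') (h' : Same c m' m'') :
    Same c m m'' :=
  ⟨fun a ha => (h'.nat a ha).trans (h.nat a ha), fun a ha => (h'.num a ha).trans (h.num a ha)⟩

theorem Same.weaken {c d : Cmd} {m m' : Memory K} (h : Same c m m')
    (hN : ∀ a, d.wN a = false → c.wN a = false) (hK : ∀ a, d.wK a = false → c.wK a = false) :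
    Same d m m' :=
  ⟨fun a ha => h.nat a (hN a ha), fun a ha => h.num a (hK a ha)⟩

/-- The frame rule: the syntactic write sets over-approximate the effect of an execution. As `wN`
and `wK` are computable, later frame conditions are closed by `rfl` or `decide`. -/
theorem Runs.same {w : ℕ → K → K} {c : Cmd} {m m' : Memory K} {t : ℕ} (h : Runs w c m t m') :
    Same c m m' := by
  induction h with
  | skip m => exact Same.refl _ _
  | setNat m a i x =>
    refine ⟨fun b hb => ?_, fun b _ => rfl⟩
    simp only [Cmd.wN, beq_eq_false_iff_ne] at hb
    simp [Memory.writeNat, Function.update_of_ne hb.symm]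
  | setNum m a i x =>
    refine ⟨fun b _ => rfl, fun b hb => ?_⟩
    simp only [Cmd.wK, beq_eq_false_iff_ne] at hb
    simp [Memory.writeNum, Function.update_of_ne hb.symm]
  | seq _ _ ih1 ih2 =>
    exact (ih1.weaken (by simp +contextual [Cmd.wN]) (by simp +contextual [Cmd.wK])).trans
      (ih2.weaken (by simp +contextual [Cmd.wN]) (by simp +contextual [Cmd.wK]))
  | iteTrue _ _ ih =>
    exact ih.weaken (by simp +contextual [Cmd.wN]) (by simp +contextual [Cmd.wK])
  | iteFalse _ _ ih =>
    exact ih.weaken (by simp +contextual [Cmd.wN]) (by simp +contextual [Cmd.wK])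
  | loopTrue _ _ _ ih1 ih2 =>
    exact (ih1.weaken (by simp +contextual [Cmd.wN]) (by simp +contextual [Cmd.wK])).trans ih2
  | loopFalse _ => exact Same.refl _ _

/-- The program `c` halts from `m` within `T` steps in a memory that satisfies `Q`. -/
def Tri (w : ℕ → K → K) (c : Cmd) (m : Memory K) (T : ℕ) (Q : Memory K → Prop) : Prop :=
  ∃ t m', Runs w c m t m' ∧ t ≤ T ∧ Q m'

variable {w : ℕ → K → K} {c d : Cmd} {m : Memory K} {T T' : ℕ} {Q Q' : Memory K → Prop}

/-- The frame `Same c m m'` is handed to the proof of the new postcondition, so specifications have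
to mention only what a program changes. -/
theorem Tri.mono (h : Tri w c m T Q) (hT : T ≤ T') (hQ : ∀ m', Same c m m' → Q m' → Q' m') :
    Tri w c m T' Q' := by
  obtain ⟨t, m', hr, ht, hq⟩ := h
  exact ⟨t, m', hr, ht.trans hT, hQ m' hr.same hq⟩

theorem Tri.seq {T₁ T₂ : ℕ} (h : Tri w c m T₁ Q')
    (h' : ∀ m', Same c m m' → Q' m' → Tri w d m' T₂ Q) (hT : T₁ + T₂ ≤ T) :
    Tri w (.seq c d) m T Q := by
  obtain ⟨t, m', hr, ht, hq⟩ := h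
  obtain ⟨t', m'', hr', ht', hq'⟩ := h' m' hr.same hq
  exact ⟨_, m'', hr.seq hr', by omega, hq'⟩

theorem Tri.ite {b : Cond} {T₁ : ℕ} (h : b.Holds w m → Tri w c m T₁ Q)
    (h' : ¬ b.Holds w m → Tri w d m T₁ Q) (hT : b.size + 1 + T₁ ≤ T) :
    Tri w (.ite b c d) m T Q := by
  by_cases hb : b.Holds w m
  · obtain ⟨t, m', hr, ht, hq⟩ := h hb
    exact ⟨_, m', .iteTrue hb hr, by omega, hq⟩
  · obtain ⟨t, m', hr, ht, hq⟩ := h' hb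
    exact ⟨_, m', .iteFalse hb hr, by omega, hq⟩

open Classical in
/-- Effect of a loop-free program. -/
noncomputable def Cmd.exec (w : ℕ → K → K) : Cmd → Memory K → Memory K
  | .skip, m => m
  | .setNat a i x, m => m.writeNat a (i.eval m) (x.eval m)
  | .setNum a i x, m => m.writeNum a (i.eval m) (x.eval w m)
  | .seq c d, m => d.exec w (c.exec w m)
  | .ite b c d, m => if b.Holds w m then c.exec w m else d.exec w m
  | .loop _ _, m => m

theorem Cmd.exists_runs_exec (c : Cmd) (hc : c.loopFree = true) (m : Memory K) :
    ∃ t ≤ c.cost, Runs w c m t (c.exec w m) := by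
  induction c generalizing m with
  | skip => exact ⟨1, le_rfl, .skip m⟩
  | setNat a i x => exact ⟨_, le_rfl, .setNat m a i x⟩
  | setNum a i x => exact ⟨_, le_rfl, .setNum m a i x⟩
  | seq c d ihc ihd =>
    simp only [loopFree, Bool.and_eq_true] at hc
    obtain ⟨t, ht, h⟩ := ihc hc.1 m
    obtain ⟨t', ht', h'⟩ := ihd hc.2 (c.exec w m)
    exact ⟨_, add_le_add ht ht', h.seq h'⟩
  | ite b c d ihc ihd =>
    simp only [loopFree, Bool.and_eq_true] at hc
    by_cases hb : b.Holds w m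
    · obtain ⟨t, ht, h⟩ := ihc hc.1 m
      refine ⟨b.size + 1 + t, ?_, ?_⟩
      · simp only [cost]; omega
      · simpa only [exec, if_pos hb] using Runs.iteTrue hb h
    · obtain ⟨t, ht, h⟩ := ihd hc.2 m
      refine ⟨b.size + 1 + t, ?_, ?_⟩
      · simp only [cost]; omega
      · simpa only [exec, if_neg hb] using Runs.iteFalse hb h
  | loop b c => simp [loopFree] at hc

/-- Code without loops is verified by computing `Cmd.exec`; its time bound is a numeral or a simple
sum. -/
theorem Tri.line (hc : c.loopFree = true) (hT : c.cost ≤ T) (hQ : Q (c.exec w m)) :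
    Tri w c m T Q := by
  obtain ⟨t, ht, h⟩ := c.exists_runs_exec (w := w) hc m
  exact ⟨t, _, h, ht.trans hT, hQ⟩

/-- Bounded loop: the body neither writes the counter nor anything that the bound reads. -/
theorem Tri.forC {i n : ℕ} {N : NExp} {body : Cmd} (Inv : ℕ → Memory K → Prop)
    (hn : N.eval m = n) (hi : body.wN i = false) (hNi : N.reads i = false)
    (hN : ∀ a, N.reads a = true → body.wN a = false)
    (h0 : Inv 0 (m.writeNat i 0 0))
    (hbody : ∀ x < n, ∀ m₁, Same (forC i N body) m m₁ → m₁.nat i 0 = x → Inv x m₁ →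
      Tri w body m₁ T (fun m₂ => Inv (x + 1) (m₂.writeNat i 0 (x + 1))))
    (hT : (T + N.size + 12) * (n + 1) ≤ T')
    (hQ : ∀ m₁, Same (RejSched.forC i N body) m m₁ → Inv n m₁ → Q m₁) :
    Tri w (RejSched.forC i N body) m T' Q := by
  have hs0 : Same (RejSched.forC i N body) m (m.writeNat i 0 0) :=
    (Runs.setNat (w := w) m i (.const 0) (.const 0)).same.weaken
      (by simp +contextual [RejSched.forC, Cmd.wN]) (by simp [Cmd.wK])
  have hev : ∀ m₁, Same (RejSched.forC i N body) m m₁ → N.eval m₁ = n := by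
    intro m₁ hs
    rw [← hn]
    refine N.eval_congr (fun a ha => hs.nat a ?_)
    have h1 := hN a ha
    have h2 : i ≠ a := by rintro rfl; simp [hNi] at ha
    simp [RejSched.forC, Cmd.wN, h1, h2]
  -- Induction on the number `y` of remaining iterations, because `loopTrue` builds a run from its
  -- exit backwards.
  have key : ∀ y, y ≤ n → ∀ m₁, Same (RejSched.forC i N body) m m₁ → m₁.nat i 0 = n - y →
      Inv (n - y) m₁ →
      ∃ t m', Runs w (.loop (.neg (.natLe N (rd i))) (.seq body
        (.setNat i (.const 0) (.add (rd i) (.const 1))))) m₁ t m' ∧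
        t ≤ y * (T + N.size + 12) + N.size + 5 ∧ Same (RejSched.forC i N body) m m' ∧ Inv n m' := by
    intro y
    induction y with
    | zero =>
      intro _ m₁ hs hx hI
      refine ⟨_, m₁, .loopFalse ?_, ?_, hs, by simpa using hI⟩
      · simp [Cond.Holds, NExp.eval, hev m₁ hs, hx]
      · simp [Cond.size, NExp.size]
    | succ y ih =>
      intro hy m₁ hs hx hI
      obtain ⟨t, m₂, hr, ht, hI2⟩ := hbody (n - (y + 1)) (by omega) m₁ hs hx hI
      have hi2 : m₂.nat i 0 = n - (y + 1) := by rw [hr.same.nat i hi, hx]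
      have hx2 : n - (y + 1) + 1 = n - y := by omega
      have hr2 := Runs.setNat (w := w) m₂ i (.const 0) (.add (rd i) (.const 1))
      simp only [NExp.eval, hi2, hx2] at hr2
      rw [hx2] at hI2
      have hs3 := hs.trans ((hr.seq hr2).same.weaken (d := RejSched.forC i N body)
        (by simp +contextual [RejSched.forC, Cmd.wN]) (by simp +contextual [RejSched.forC, Cmd.wK]))
      obtain ⟨t', m', hr', ht', hs', hI'⟩ := ih (by omega) _ hs3 (by simp [Memory.writeNat]) hI2
      refine ⟨_, m', .loopTrue ?_ (hr.seq hr2) hr', ?_, hs', hI'⟩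
      · simp [Cond.Holds, NExp.eval, hev m₁ hs, hx]; omega
      -- One iteration costs `N.size + 5` for the test, at most `T` for the body and 6 for the
      -- increment.
      · simp only [Cond.size, NExp.size, Nat.succ_mul]; omega
  obtain ⟨t, m', hr, ht, hs, hI⟩ := key n le_rfl _ hs0 (by simp [Memory.writeNat]) (by simpa using h0)
  refine ⟨_, m', (Runs.setNat (w := w) m i (.const 0) (.const 0)).seq hr, le_trans ?_ hT, hQ m' hs hI⟩
  simp only [NExp.size]
  ring_nf at ht ⊢
  omega

end Logic

end RejSched

namespace RejSched

/-! ### Perfect hashing -/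

/-- The hash function `z ↦ ((a z) mod p) mod m`. -/
def hash (a p m z : ℕ) : ℕ := a * z % p % m

/-- For a colliding multiplier `a`, the difference `D a` of the two residues is a multiple of `m`,
nonzero, and at most `p - 1` in absolute value. It determines `a`, since `x - y` is invertible
modulo `p`. There are only `2 * ((p - 1) / m)` such multiples. -/
theorem card_hash_eq_le {p m x y : ℕ} (hp : p.Prime) (hm : 0 < m) (hx : x < p) (hy : y < p)
    (hxy : x ≠ y) :
    m * ((Finset.Icc 1 (p - 1)).filter (fun a => hash a p m x = hash a p m y)).card
      ≤ 2 * (p - 1) := by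
  have hp1 := hp.one_lt
  have := Fact.mk hp
  set F := (Finset.Icc 1 (p - 1)).filter (fun a => hash a p m x = hash a p m y) with hF
  let T : ℤ := (((p - 1) / m : ℕ) : ℤ)
  let D : ℕ → ℤ := fun a => ((a * x % p : ℕ) : ℤ) - ((a * y % p : ℕ) : ℤ)
  have hdvd : ∀ a ∈ F, (m : ℤ) ∣ D a := by
    intro a ha
    have h1 : a * x % p % m = a * y % p % m := (Finset.mem_filter.mp ha).2
    exact (Nat.modEq_iff_dvd (n := m) (a := a * y % p) (b := a * x % p)).mp h1.symm
  have hcast : ∀ a, ((D a : ℤ) : ZMod p) = (a : ZMod p) * ((x : ZMod p) - y) := by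
    intro a
    simp only [D, Int.cast_sub, Int.cast_natCast, ZMod.natCast_mod, Nat.cast_mul]
    ring
  have hne : (x : ZMod p) - y ≠ 0 := by
    rw [sub_ne_zero]
    intro h
    rw [ZMod.natCast_eq_natCast_iff'] at h
    rw [Nat.mod_eq_of_lt hx, Nat.mod_eq_of_lt hy] at h
    exact hxy h
  have hD0 : ∀ a ∈ F, D a ≠ 0 := by
    intro a ha h0
    have ha' := Finset.mem_Icc.mp (Finset.mem_filter.mp ha).1
    have h1 := hcast a
    rw [h0, Int.cast_zero] at h1
    have h2 : (a : ZMod p) = 0 := (mul_eq_zero.mp h1.symm).resolve_right hne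
    rw [ZMod.natCast_eq_zero_iff] at h2
    exact absurd (Nat.le_of_dvd (by omega) h2) (by omega)
  have hcard : F.card ≤ ((Finset.Icc (-T) T).erase 0).card := by
    refine Finset.card_le_card_of_injOn (fun a => D a / m) ?_ ?_
    · intro a ha
      have hd := hdvd a ha
      have h0 := hD0 a ha
      obtain ⟨q, hq⟩ := hd
      have hm' : (m : ℤ) ≠ 0 := by positivity
      have hq0 : q ≠ 0 := by rintro rfl; simp at hq; exact h0 hq
      have hq' : D a / m = q := by rw [hq, Int.mul_ediv_cancel_left _ hm']
      have hb1 : a * x % p < p := Nat.mod_lt _ (by omega)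
      have hb2 : a * y % p < p := Nat.mod_lt _ (by omega)
      have habs : |(m : ℤ) * q| ≤ ((p - 1 : ℕ) : ℤ) := by
        rw [← hq, abs_le]; simp only [D]; omega
      have hT : |q| ≤ T := by
        have h3 : m * q.natAbs ≤ p - 1 := by
          rw [abs_mul, Nat.abs_cast, Int.abs_eq_natAbs] at habs
          exact_mod_cast habs
        have h4 : q.natAbs ≤ (p - 1) / m := by
          rw [Nat.le_div_iff_mul_le hm, mul_comm]; exact h3
        rw [Int.abs_eq_natAbs]; exact Int.ofNat_le.mpr h4
      simp only [Finset.coe_erase, Set.mem_sdiff, Finset.mem_coe, Finset.mem_Icc, hq']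
      exact ⟨abs_le.mp hT, by simpa using hq0⟩
    · intro a ha b hb hab
      have ha' := Finset.mem_Icc.mp (Finset.mem_filter.mp ha).1
      have hb' := Finset.mem_Icc.mp (Finset.mem_filter.mp hb).1
      have hab : D a / m = D b / m := hab
      have hDab : D a = D b := by
        rw [← Int.ediv_mul_cancel (hdvd a ha), hab, Int.ediv_mul_cancel (hdvd b hb)]
      have h1 := hcast a
      rw [hDab, hcast b] at h1
      have h2 := mul_right_cancel₀ hne h1
      rw [ZMod.natCast_eq_natCast_iff'] at h2
      rw [Nat.mod_eq_of_lt (by omega), Nat.mod_eq_of_lt (by omega)] at h2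
      exact h2.symm
  have hT2 : ((Finset.Icc (-T) T).erase 0).card = 2 * ((p - 1) / m) := by
    rw [Finset.card_erase_of_mem (by simp [T]; positivity), Int.card_Icc]
    simp only [T]
    omega
  have h5 : m * ((p - 1) / m) ≤ p - 1 := Nat.mul_div_le _ _
  calc m * F.card ≤ m * (2 * ((p - 1) / m)) := by rw [← hT2]; gcongr
    _ = 2 * (m * ((p - 1) / m)) := by ring
    _ ≤ 2 * (p - 1) := by omega

/-- Some multiplier produces few collisions. -/
theorem exists_few_collisions {p m : ℕ} (hp : p.Prime) (hm : 0 < m) (S : Finset ℕ)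
    (hS : ∀ x ∈ S, x < p) :
    ∃ a, 1 ≤ a ∧ a < p ∧
      m * (S.offDiag.filter (fun z => hash a p m z.1 = hash a p m z.2)).card
        ≤ 2 * (S.card * S.card - S.card) := by
  have hp1 := hp.one_lt
  obtain ⟨a, ha, h⟩ := Finset.exists_le_of_sum_le (s := Finset.Icc 1 (p - 1))
    (f := fun a => m * (S.offDiag.filter (fun z => hash a p m z.1 = hash a p m z.2)).card)
    (g := fun _ => 2 * (S.card * S.card - S.card)) (by simp; omega) (by
      simp only [Finset.sum_const, Nat.card_Icc, smul_eq_mul, Finset.card_filter, Finset.mul_sum]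
      -- Averaging: exchange the sum over the multipliers with the sum over the ordered pairs, then
      -- bound each pair by `card_hash_eq_le`.
      rw [Finset.sum_comm]
      calc _ ≤ ∑ z ∈ S.offDiag, 2 * (p - 1) := by
            refine Finset.sum_le_sum (fun z hz => ?_)
            rw [Finset.mem_offDiag] at hz
            have := card_hash_eq_le hp hm (hS _ hz.1) (hS _ hz.2.1) hz.2.2
            rwa [Finset.card_filter, Finset.mul_sum] at this
        _ = (p - 1 + 1 - 1) * (2 * (S.card * S.card - S.card)) := by
            rw [Finset.sum_const, Finset.offDiag_card, smul_eq_mul, Nat.add_sub_cancel]; ring)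
  rw [Finset.mem_Icc] at ha
  exact ⟨a, by omega, by omega, h⟩

/-- With at least `2 * |S| ^ 2` buckets the averaged number of collisions is below one, hence zero.
-/
theorem exists_injOn_hash {p m : ℕ} (hp : p.Prime) (S : Finset ℕ)
    (hS : ∀ x ∈ S, x < p) (hm : 2 * (S.card * S.card) ≤ m) (hm0 : 0 < m) :
    ∃ a, a < p ∧ Set.InjOn (hash a p m) S := by
  obtain ⟨a, _, hap, h⟩ := exists_few_collisions hp hm0 S hS
  refine ⟨a, hap, fun x hx y hy hxy => ?_⟩
  by_contra hne
  have h1 : 0 < (S.offDiag.filter (fun z => hash a p m z.1 = hash a p m z.2)).card := by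
    refine Finset.card_pos.mpr ⟨(x, y), ?_⟩
    simp only [Finset.mem_filter, Finset.mem_offDiag]
    exact ⟨⟨hx, hy, hne⟩, hxy⟩
  have h2 : 0 < S.card := Finset.card_pos.mpr ⟨x, hx⟩
  have h3 : S.card ≤ S.card * S.card := Nat.le_mul_of_pos_left _ h2
  have := Nat.mul_le_mul_left m h1
  omega

/-- Number of buckets in level `i`. -/
def buckets (q i : ℕ) : ℕ := 4 * (q / 2 ^ i)

/-- The colors of the levels below `i` are `0, ..., offset q i - 1`. -/
def offset (q : ℕ) : ℕ → ℕ
  | 0 => 0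
  | i + 1 => offset q i + buckets q i

/-- The candidate color of `z` in level `i`. -/
def levelColor (q p : ℕ) (a : ℕ → ℕ) (i z : ℕ) : ℕ := offset q i + hash (a i) p (buckets q i) z

/-- The first active color of `z` in the levels below `i`. -/
def firstColor (q p : ℕ) (a : ℕ → ℕ) (A : ℕ → Prop) [DecidablePred A] : ℕ → ℕ → Option ℕ
  | 0, _ => none
  | i + 1, z =>
    match firstColor q p a A i z with
    | some c => some c
    | none => if A (levelColor q p a i z) then some (levelColor q p a i z) else none

theorem offset_mono (q : ℕ) : Monotone (offset q) :=
  monotone_nat_of_le_succ (fun i => by simp [offset])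

/-- Potential argument: level `i` consumes `4 * b` colors for `b = q / 2 ^ i`, and the reserve drops
from `8 * b` to `8 * (b / 2)`. So all levels together use at most `8 * q` colors. -/
theorem offset_add_le (q i : ℕ) : offset q i + 8 * (q / 2 ^ i) ≤ 8 * q := by
  induction i with
  | zero => simp [offset]
  | succ i ih =>
    have : q / 2 ^ (i + 1) = q / 2 ^ i / 2 := by rw [pow_succ, Nat.div_div_eq_div_mul]
    simp only [offset, buckets, this]
    omega

theorem levelColor_lt {q p i z : ℕ} {a : ℕ → ℕ} (h : 0 < q / 2 ^ i) :
    levelColor q p a i z < offset q (i + 1) := by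
  simp only [levelColor, offset, hash, buckets]
  have := Nat.mod_lt (a i * z % p) (show 0 < 4 * (q / 2 ^ i) by omega)
  omega

/-- Only multipliers and active colors of the levels already passed matter, so extending both by
another level does not disturb colors that are assigned. -/
theorem firstColor_congr {q p : ℕ} {a a' : ℕ → ℕ} {A A' : ℕ → Prop} [DecidablePred A]
    [DecidablePred A'] {i : ℕ} (z : ℕ) (hpos : ∀ j < i, 0 < q / 2 ^ j)
    (ha : ∀ j < i, a j = a' j) (hA : ∀ c < offset q i, A c ↔ A' c) :
    firstColor q p a A i z = firstColor q p a' A' i z := by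
  induction i with
  | zero => rfl
  | succ i ih =>
    have h1 : levelColor q p a i z = levelColor q p a' i z := by
      simp [levelColor, ha i (by omega)]
    have h2 := hA _ (levelColor_lt (p := p) (z := z) (a := a) (hpos i (by omega)))
    rw [firstColor, firstColor, ih (fun j hj => hpos j (by omega)) (fun j hj => ha j (by omega))
      (fun c hc => hA c (lt_of_lt_of_le hc (offset_mono q (Nat.le_succ i))))]
    rw [h1] at h2
    simp only [h1, h2]

/-- Level by level, at least half of the remaining elements are isolated. -/
theorem exists_peeling {q p : ℕ} (hp : p.Prime) (S : Finset ℕ) (hS : ∀ x ∈ S, x < p)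
    (hq : S.card ≤ q) (i : ℕ) (hpos : ∀ j < i, 0 < q / 2 ^ j) :
    ∃ (a : ℕ → ℕ) (A S' : Finset ℕ), (∀ j, a j < p) ∧ (∀ c ∈ A, c < offset q i) ∧ S' ⊆ S ∧
      S'.card ≤ q / 2 ^ i ∧ A.card = (S \ S').card ∧
      (∀ x ∈ S \ S', ∃ c ∈ A, firstColor q p a (· ∈ A) i x = some c) ∧
      (∀ x ∈ S \ S', ∀ y ∈ S \ S',
        firstColor q p a (· ∈ A) i x = firstColor q p a (· ∈ A) i y → x = y) ∧
      (∀ x ∈ S', firstColor q p a (· ∈ A) i x = none) := by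
  induction i with
  | zero =>
    exact ⟨fun _ => 0, ∅, S, fun _ => hp.pos, by simp, subset_rfl, by simpa using hq, by simp,
      by simp, by simp, fun x _ => rfl⟩
  | succ i ih =>
    obtain ⟨a, A, S', ha, hA, hS', hcard, hAcard, h1, h2, h3⟩ := ih (fun j hj => hpos j (by omega))
    have hb : 0 < q / 2 ^ i := hpos i (by omega)
    set b := q / 2 ^ i with hbdef
    obtain ⟨v, -, hvp, hv⟩ := exists_few_collisions (m := buckets q i) hp
      (by show 0 < 4 * b; omega) S' (fun x hx => hS x (hS' hx))
    set h := hash v p (buckets q i) with hh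
    set N := S'.filter (fun x => ∃ y ∈ S', y ≠ x ∧ h x = h y) with hN
    have hNsub : N ⊆ S' := Finset.filter_subset _ _
    have hNcard : N.card ≤ (S'.offDiag.filter (fun z => h z.1 = h z.2)).card := by
      refine (Finset.card_le_card (t := (S'.offDiag.filter (fun z => h z.1 = h z.2)).image Prod.fst)
        ?_).trans Finset.card_image_le
      intro x hx
      obtain ⟨hx1, y, hy, hyx, hxy⟩ := Finset.mem_filter.mp hx
      exact Finset.mem_image.mpr ⟨(x, y), by
        simp only [Finset.mem_filter, Finset.mem_offDiag]; exact ⟨⟨hx1, hy, hyx.symm⟩, hxy⟩, rfl⟩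
    -- Each element of `N` contributes an ordered colliding pair, so `4 * b * |N| ≤ 2 * |S'| * (|S'|
    -- - 1)`, and `|S'| ≤ b` leaves at most half of `S'` in `N`.
    have hN2 : N.card ≤ b / 2 := by
      have e1 : 4 * b * N.card ≤ 2 * (S'.card * S'.card - S'.card) :=
        (Nat.mul_le_mul_left _ hNcard).trans hv
      have e2 : S'.card * S'.card ≤ b * S'.card := Nat.mul_le_mul_right _ hcard
      have e3 : 2 * b * (2 * N.card) ≤ 2 * b * S'.card := by
        calc 2 * b * (2 * N.card) = 4 * b * N.card := by ring
          _ ≤ 2 * (S'.card * S'.card - S'.card) := e1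
          _ ≤ 2 * (b * S'.card) := by omega
          _ = 2 * b * S'.card := by ring
      have e4 : 2 * N.card ≤ S'.card := Nat.le_of_mul_le_mul_left e3 (by omega)
      omega
    have hiso : ∀ x ∈ S' \ N, ∀ y ∈ S', h x = h y → x = y := by
      intro x hx y hy hxy
      rw [Finset.mem_sdiff] at hx
      by_contra hne
      exact hx.2 (Finset.mem_filter.mpr ⟨hx.1, y, hy, Ne.symm hne, hxy⟩)
    set a' := Function.update a i v with ha'
    -- Only the buckets of isolated elements become active. A colliding element thus finds its
    -- bucket inactive and moves on to the next level.
    set I := (S' \ N).image (fun x => offset q i + h x) with hI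
    have hInot : ∀ c < offset q i, c ∉ I := by
      intro c hc hcI
      obtain ⟨x, _, rfl⟩ := Finset.mem_image.mp hcI
      omega
    have hlev : ∀ x, levelColor q p a' i x = offset q i + h x := by
      intro x; simp [levelColor, ha', hh]
    have hprev : ∀ x, firstColor q p a' (· ∈ A ∪ I) i x = firstColor q p a (· ∈ A) i x := by
      intro x
      refine firstColor_congr x (fun j hj => hpos j (by omega)) (fun j hj => ?_) (fun c hc => ?_)
      · simp [ha', Function.update_of_ne (show j ≠ i by omega)]
      · simp [hInot c hc]
    have hAlev : ∀ x, offset q i + h x ∈ A ∪ I ↔ offset q i + h x ∈ I := by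
      intro x
      rw [Finset.mem_union]
      refine ⟨fun hc => hc.resolve_left (fun hc => ?_), Or.inr⟩
      have := hA _ hc; omega
    have hmemI : ∀ x ∈ S', offset q i + h x ∈ I ↔ x ∈ S' \ N := by
      intro x hx
      refine ⟨fun hc => ?_, fun hc => Finset.mem_image_of_mem _ hc⟩
      obtain ⟨y, hy, hyx⟩ := Finset.mem_image.mp hc
      have := hiso y hy x hx (by omega)
      rwa [← this]
    have hold : ∀ x ∈ S \ S', firstColor q p a' (· ∈ A ∪ I) (i + 1) x
        = firstColor q p a (· ∈ A) i x := by
      intro x hx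
      obtain ⟨c, _, hc⟩ := h1 x hx
      simp only [firstColor, hprev, hc]
    have hnew : ∀ x ∈ S' \ N, firstColor q p a' (· ∈ A ∪ I) (i + 1) x
        = some (offset q i + h x) := by
      intro x hx
      have hx' := (Finset.mem_sdiff.mp hx).1
      simp only [firstColor, hprev, h3 x hx', hlev, hAlev, hmemI x hx', hx, if_true]
    have hsplit : S \ N = (S \ S') ∪ (S' \ N) := by
      ext x; simp only [Finset.mem_sdiff, Finset.mem_union]
      constructor
      · rintro ⟨hx, hxN⟩
        by_cases hx' : x ∈ S'
        · exact Or.inr ⟨hx', hxN⟩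
        · exact Or.inl ⟨hx, hx'⟩
      · rintro (⟨hx, hx'⟩ | ⟨hx, hxN⟩)
        · exact ⟨hx, fun hN => hx' (hNsub hN)⟩
        · exact ⟨hS' hx, hxN⟩
    have hdisj : Disjoint (S \ S') (S' \ N) := by
      rw [Finset.disjoint_left]
      intro x hx hx'
      exact (Finset.mem_sdiff.mp hx).2 (Finset.mem_sdiff.mp hx').1
    have hIcard : I.card = (S' \ N).card := by
      refine Finset.card_image_of_injOn (fun x hx y hy hxy => ?_)
      exact hiso x hx y (Finset.mem_sdiff.mp hy).1 (by simpa using hxy)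
    have hAI : Disjoint A I := by
      rw [Finset.disjoint_left]
      intro c hc hcI
      exact hInot c (hA c hc) hcI
    refine ⟨a', A ∪ I, N, ?_, ?_, hNsub.trans hS', ?_, ?_, ?_, ?_, ?_⟩
    · intro j
      by_cases hj : j = i
      · subst hj; simpa [ha'] using hvp
      · simpa [ha', Function.update_of_ne hj] using ha j
    · intro c hc
      rcases Finset.mem_union.mp hc with hc | hc
      · exact lt_of_lt_of_le (hA c hc) (offset_mono q (Nat.le_succ i))
      · obtain ⟨x, _, rfl⟩ := Finset.mem_image.mp hc
        rw [← hlev]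
        exact levelColor_lt hb
    · rw [pow_succ, ← Nat.div_div_eq_div_mul]; exact hN2
    · rw [Finset.card_union_of_disjoint hAI, hIcard, hAcard, hsplit,
        Finset.card_union_of_disjoint hdisj]
    · intro x hx
      rw [hsplit] at hx
      rcases Finset.mem_union.mp hx with hx | hx
      · obtain ⟨c, hc, hc'⟩ := h1 x hx
        exact ⟨c, Finset.mem_union_left _ hc, by rw [hold x hx, hc']⟩
      · exact ⟨_, Finset.mem_union_right _ (Finset.mem_image_of_mem _ hx), hnew x hx⟩
    -- Levels use disjoint ranges of colors, so an element colored earlier cannot meet one colored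
    -- now.
    · have hcross : ∀ x ∈ S \ S', ∀ y ∈ S' \ N, firstColor q p a (· ∈ A) i x
          ≠ some (offset q i + h y) := by
        intro x hx y hy heq
        obtain ⟨c, hc, hc'⟩ := h1 x hx
        rw [hc'] at heq
        have := hA c hc
        simp at heq
        omega
      intro x hx y hy hxy
      rw [hsplit] at hx hy
      rcases Finset.mem_union.mp hx with hx | hx <;> rcases Finset.mem_union.mp hy with hy | hy
      · rw [hold x hx, hold y hy] at hxy
        exact h2 x hx y hy hxy
      · rw [hold x hx, hnew y hy] at hxy
        exact absurd hxy (hcross x hx y hy)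
      · rw [hnew x hx, hold y hy] at hxy
        exact absurd hxy.symm (hcross y hy x hx)
      · rw [hnew x hx, hnew y hy] at hxy
        exact hiso x hx y (Finset.mem_sdiff.mp hy).1 (by simpa using hxy)
    · intro x hx
      have hx' := hNsub hx
      have : x ∉ S' \ N := fun h => (Finset.mem_sdiff.mp h).2 hx
      simp only [firstColor, hprev, h3 x hx', hlev, hAlev, hmemI x hx', this, if_false]

/-- Number of active colors below `c`. -/
def rank (A : ℕ → Prop) [DecidablePred A] (c : ℕ) : ℕ := ((Finset.range c).filter A).card

/-- The color of `z` after `i` levels; `q` means that there is none. -/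
def peelColor (q p : ℕ) (a : ℕ → ℕ) (A : ℕ → Prop) [DecidablePred A] : ℕ → ℕ → ℕ
  | 0, _ => q
  | i + 1, z =>
    if q ≤ peelColor q p a A i z ∧ A (levelColor q p a i z) then
      rank A (levelColor q p a i z) else peelColor q p a A i z

/-- The program has no option type: the value `q` encodes a missing color. This is unambiguous
because active colors have rank below `q`. -/
theorem peelColor_eq {q p : ℕ} {a : ℕ → ℕ} {A : ℕ → Prop} [DecidablePred A]
    (hA : ∀ c, A c → rank A c < q) (i z : ℕ) :
    (firstColor q p a A i z = none ∧ peelColor q p a A i z = q) ∨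
      ∃ c, firstColor q p a A i z = some c ∧ A c ∧ peelColor q p a A i z = rank A c := by
  induction i with
  | zero => exact Or.inl ⟨rfl, rfl⟩
  | succ i ih =>
    rcases ih with ⟨h1, h2⟩ | ⟨c, h1, h2, h3⟩
    · by_cases hl : A (levelColor q p a i z)
      · exact Or.inr ⟨_, by simp [firstColor, h1, hl], hl, by simp [peelColor, h2, hl]⟩
      · exact Or.inl ⟨by simp [firstColor, h1, hl], by simp [peelColor, h2, hl]⟩
    · have := hA c h2
      exact Or.inr ⟨c, by simp [firstColor, h1], h2, by simp [peelColor, h3, this.not_ge]⟩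

/-- Perfect hashing: some choice of the multipliers and of the active colors gives all elements
of `S` different colors below `q`. -/
theorem exists_peelColor {q p : ℕ} (hp : p.Prime) (S : Finset ℕ) (hS : ∀ x ∈ S, x < p)
    (hq : S.card ≤ q) (i : ℕ) (hpos : ∀ j < i, 0 < q / 2 ^ j) (hi : q / 2 ^ i = 0) :
    ∃ (a : ℕ → ℕ) (A : Finset ℕ), (∀ j, a j < p) ∧ (∀ c ∈ A, c < 8 * q) ∧
      (∀ x ∈ S, peelColor q p a (· ∈ A) i x < q) ∧
      Set.InjOn (peelColor q p a (· ∈ A) i) S := by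
  obtain ⟨a, A, S', ha, hA, hS', hcard, hAcard, h1, h2, h3⟩ := exists_peeling hp S hS hq i hpos
  have hS'0 : S' = ∅ := Finset.card_eq_zero.mp (by omega)
  subst hS'0
  simp only [Finset.sdiff_empty] at hAcard h1 h2
  -- There are exactly `|S| ≤ q` active colors, so passing to ranks compresses the range `8 * q` to
  -- `q` without losing injectivity.
  have hrank : ∀ c, c ∈ A → rank (· ∈ A) c < q := by
    intro c hc
    refine lt_of_lt_of_le (Finset.card_lt_card (t := A) ?_) (hAcard ▸ hq)
    refine ⟨fun x hx => (Finset.mem_filter.mp hx).2, fun h => ?_⟩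
    have := h hc
    simp at this
  have hrinj : ∀ c ∈ A, ∀ d ∈ A, c < d → rank (· ∈ A) c < rank (· ∈ A) d := by
    intro c hc d hd hcd
    refine Finset.card_lt_card ⟨fun x hx => ?_, fun h => ?_⟩
    · simp only [Finset.mem_filter, Finset.mem_range] at hx ⊢
      exact ⟨by omega, hx.2⟩
    · have := h (Finset.mem_filter.mpr ⟨Finset.mem_range.mpr hcd, hc⟩)
      simp at this
  have hval : ∀ x ∈ S, ∃ c ∈ A, firstColor q p a (· ∈ A) i x = some c ∧
      peelColor q p a (· ∈ A) i x = rank (· ∈ A) c := by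
    intro x hx
    obtain ⟨c, hc, hc'⟩ := h1 x hx
    rcases peelColor_eq (p := p) (a := a) (A := (· ∈ A)) hrank i x with ⟨h4, _⟩ | ⟨c', h4, h5, h6⟩
    · rw [hc'] at h4; cases h4
    · exact ⟨c', h5, h4, h6⟩
  refine ⟨a, A, ha, fun c hc => ?_, fun x hx => ?_, fun x hx y hy hxy => ?_⟩
  · have := hA c hc
    have := offset_add_le q i
    omega
  · obtain ⟨c, hc, _, h⟩ := hval x hx
    rw [h]; exact hrank c hc
  · obtain ⟨c, hc, hc', h⟩ := hval x hx
    obtain ⟨d, hd, hd', h'⟩ := hval y hy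
    rw [h, h'] at hxy
    have hcd : c = d := by
      rcases lt_trichotomy c d with hlt | heq | hlt
      · exact absurd hxy (hrinj c hc d hd hlt).ne
      · exact heq
      · exact absurd hxy (hrinj d hd c hc hlt).ne'
    exact h2 x hx y hy (by rw [hc', hd', hcd])

/-- Distinctness of colors can be read off from a sum of powers of two. -/
theorem eq_one_of_sum_two_pow (q : ℕ) (f : ℕ → ℕ)
    (hsum : (∑ c ∈ Finset.range q, f c * 2 ^ c) % 2 ^ q = 2 ^ q - 1)
    (hcard : ∑ c ∈ Finset.range q, f c ≤ q) : ∀ c < q, f c = 1 := by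
  induction q generalizing f with
  | zero => intro c hc; omega
  | succ q ih =>
    rw [Finset.sum_range_succ'] at hsum hcard
    simp only [pow_zero, mul_one, pow_succ'] at hsum
    have hre : ∑ c ∈ Finset.range q, f (c + 1) * (2 * 2 ^ c)
        = 2 * ∑ c ∈ Finset.range q, f (c + 1) * 2 ^ c := by
      rw [Finset.mul_sum]; exact Finset.sum_congr rfl (fun c _ => by ring)
    rw [hre] at hsum
    set s := ∑ c ∈ Finset.range q, f (c + 1) * 2 ^ c with hs
    have hpos : 0 < 2 ^ q := by positivity
    -- All low binary digits of the sum are one; the last of them comes from `f 0` alone.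
    have hodd : f 0 % 2 = 1 := by
      have h1 : (2 * s + f 0) % (2 * 2 ^ q) % 2 = (2 * s + f 0) % 2 :=
        Nat.mod_mul_right_mod _ _ _
      rw [hsum] at h1
      omega
    obtain ⟨u, hu⟩ : ∃ u, f 0 = 2 * u + 1 := ⟨f 0 / 2, by omega⟩
    have hsu : (s + u) % 2 ^ q = 2 ^ q - 1 := by
      have h1 : 2 * s + f 0 = 2 * (s + u) + 1 := by omega
      rw [h1] at hsum
      have h2 := Nat.div_add_mod (2 * (s + u) + 1) (2 * 2 ^ q)
      rw [hsum] at h2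
      have h3 : s + u = 2 ^ q * ((2 * (s + u) + 1) / (2 * 2 ^ q)) + (2 ^ q - 1) := by
        have : 2 * 2 ^ q * ((2 * (s + u) + 1) / (2 * 2 ^ q))
          = 2 * (2 ^ q * ((2 * (s + u) + 1) / (2 * 2 ^ q))) := by ring
        omega
      rw [h3, Nat.mul_add_mod, Nat.mod_eq_of_lt (by omega)]
    rcases Nat.eq_zero_or_pos q with rfl | hq
    · simp at hcard
      intro c hc
      have : c = 0 := by omega
      subst this; omega
    · obtain ⟨q, rfl⟩ : ∃ q', q = q' + 1 := ⟨q - 1, by omega⟩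
      -- Write `f 0 = 2 * u + 1` and carry `u` to the next digit. The carry halves the surplus, so
      -- the bound on the total survives for `f'`. By induction all `f' c` are one, and then their
      -- sum leaves room only for `u = 0`.
      set f' : ℕ → ℕ := fun c => f (c + 1) + if c = 0 then u else 0 with hf'
      have e1 : ∑ c ∈ Finset.range (q + 1), f' c * 2 ^ c = s + u := by
        rw [hs]
        simp only [hf', add_mul, Finset.sum_add_distrib]
        congr 1
        rw [Finset.sum_eq_single 0] <;> simp +contextual
      have e2 : ∑ c ∈ Finset.range (q + 1), f' c = (∑ c ∈ Finset.range (q + 1), f (c + 1)) + u := by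
        simp only [hf', Finset.sum_add_distrib]
        congr 1
        rw [Finset.sum_eq_single 0] <;> simp +contextual
      have h1 := ih f' (by rw [e1]; exact hsu) (by rw [e2]; omega)
      have e3 : ∑ c ∈ Finset.range (q + 1), f' c = q + 1 := by
        rw [Finset.sum_congr rfl (fun c hc => h1 c (Finset.mem_range.mp hc))]; simp
      have hu0 : u = 0 := by omega
      intro c hc
      rcases c with _ | c
      · omega
      · have := h1 c (by omega)
        simpa [hf', hu0] using this

end RejSched

namespace RejSched

section Theory

variable {K : Type} [CommRing K] [LinearOrder K] [IsStrictOrderedRing K]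

/-! ### Derivations: schedules composed of nested intervals -/

/-- Length of a piece. -/
def Piece.len {n : ℕ} (q : Piece K n) : K := q.finish - q.start

/-- The pieces of `L` follow each other in the interval from `lo` to `hi`. -/
def Chain {n : ℕ} : K → Schedule K n → K → Prop
  | lo, [], hi => lo ≤ hi
  | lo, q :: L, hi => lo ≤ q.start ∧ q.start < q.finish ∧ Chain q.finish L hi

/-- Fill the gaps of the chain `L` from `lo` to `hi` with job `j`. -/
def fill {n : ℕ} (j : Fin n) : K → Schedule K n → K → Schedule K n
  | lo, [], hi => if lo < hi then [⟨j, lo, hi⟩] else []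
  | lo, q :: L, hi =>
    if lo < q.start then ⟨j, lo, q.start⟩ :: q :: fill j q.finish L hi
    else q :: fill j q.finish L hi

/-- A table of times `T` and of total processing times `P`, weights of the jobs, the jobs that may
be used, and the indices of their release dates. -/
structure Grid (K : Type) (n : ℕ) where
  T : ℕ → K
  P : ℕ → K
  NT : ℕ
  Y : ℕ
  wt : Fin n → ℕ
  ok : Fin n → Prop
  anc : Fin n → ℕ

/-- `Der I mode G h τ₀ τ₁ y c L J`: in at most `h` steps one derives the schedule `L` of the jobs `J`
from time index `τ₀` to time index `τ₁`, with total weight `y` and at cost at most `c`. -/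
inductive Der (I : Problem K) (mode : Mode) (G : Grid K I.n) :
    ℕ → ℕ → ℕ → ℕ → K → Schedule K I.n → List (Fin I.n) → Prop where
  | nil (h τ : ℕ) : τ < G.NT → Der I mode G h τ τ 0 0 [] []
  | idle (h τ : ℕ) (b : Fin I.n) : τ < G.NT → G.T τ ≤ G.T (G.anc b) →
      Der I mode G h τ (G.anc b) 0 0 [] []
  | concat {h τ₀ τ₁ τ₂ y₁ y₂ : ℕ} {c₁ c₂ : K} {L₁ L₂ : Schedule K I.n} {J₁ J₂ : List (Fin I.n)} :
      Der I mode G h τ₀ τ₁ y₁ c₁ L₁ J₁ → Der I mode G h τ₁ τ₂ y₂ c₂ L₂ J₂ → y₁ + y₂ < G.Y →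
      Der I mode G (h + 1) τ₀ τ₂ (y₁ + y₂) (c₁ + c₂) (L₁ ++ L₂) (J₁ ++ J₂)
  -- The index of the end is obtained by adding weights to the index of the start. This index may
  -- leave the block of its release date, so the equation for the time is a tested condition and not
  -- a consequence. Without preemption the enclosed interval has to be empty.
  | close {h τ₀ τ₁ y : ℕ} {c : K} {L : Schedule K I.n} {J : List (Fin I.n)} (j : Fin I.n) :
      Der I mode G h τ₀ τ₁ y c L J → G.ok j → y + G.wt j < G.Y → τ₀ + (y + G.wt j) < G.NT →
      I.r j ≤ G.T τ₀ → G.T τ₁ ≤ G.T (τ₀ + (y + G.wt j)) →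
      G.T (τ₀ + (y + G.wt j)) = G.T τ₀ + G.P y + I.p j → (mode = .nonpreemptive → y = 0) →
      Der I mode G (h + 1) τ₀ (τ₀ + (y + G.wt j)) (y + G.wt j)
        (c + (I.w j (G.T (τ₀ + (y + G.wt j))) - I.e j))
        (fill j (G.T τ₀) L (G.T (τ₀ + (y + G.wt j)))) (j :: J)

theorem Der.succ {I : Problem K} {mode : Mode} {G : Grid K I.n} {h τ₀ τ₁ y : ℕ} {c : K}
    {L : Schedule K I.n} {J : List (Fin I.n)} (d : Der I mode G h τ₀ τ₁ y c L J) :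
    Der I mode G (h + 1) τ₀ τ₁ y c L J := by
  induction d with
  | nil h τ hτ => exact .nil _ _ hτ
  | idle h τ b hτ hT => exact .idle _ _ _ hτ hT
  | concat _ _ hy ih1 ih2 => exact .concat ih1 ih2 hy
  | close j _ h1 h2 h3 h4 h5 h6 h7 ih => exact .close j ih h1 h2 h3 h4 h5 h6 h7

theorem Der.mono {I : Problem K} {mode : Mode} {G : Grid K I.n} {h h' τ₀ τ₁ y : ℕ} {c : K}
    {L : Schedule K I.n} {J : List (Fin I.n)} (d : Der I mode G h τ₀ τ₁ y c L J) (hh : h ≤ h') :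
    Der I mode G h' τ₀ τ₁ y c L J := by
  induction hh with
  | refl => exact d
  | step _ ih => exact ih.succ

section Lists

variable {n : ℕ}

theorem Chain.le {lo hi : K} {L : Schedule K n} (h : Chain lo L hi) : lo ≤ hi := by
  induction L generalizing lo with
  | nil => exact h
  | cons q L ih => exact h.1.trans (h.2.1.le.trans (ih h.2.2))

theorem Chain.append {lo mid hi : K} {L₁ L₂ : Schedule K n} (h₁ : Chain lo L₁ mid)
    (h₂ : Chain mid L₂ hi) : Chain lo (L₁ ++ L₂) hi := by
  induction L₁ generalizing lo with
  | nil =>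
    cases L₂ with
    | nil => exact le_trans (show lo ≤ mid from h₁) (show mid ≤ hi from h₂)
    | cons q L => exact ⟨le_trans (show lo ≤ mid from h₁) h₂.1, h₂.2⟩
  | cons q L ih => exact ⟨h₁.1, h₁.2.1, ih h₁.2.2⟩

theorem Chain.mono_right {lo hi hi' : K} {L : Schedule K n} (h : Chain lo L hi) (hh : hi ≤ hi') :
    Chain lo L hi' := by
  induction L generalizing lo with
  | nil => exact le_trans (show lo ≤ hi from h) hh
  | cons q L ih => exact ⟨h.1, h.2.1, ih h.2.2⟩

theorem Chain.bounds {lo hi : K} {L : Schedule K n} (h : Chain lo L hi) :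
    ∀ q ∈ L, lo ≤ q.start ∧ q.start < q.finish ∧ q.finish ≤ hi := by
  induction L generalizing lo with
  | nil => simp
  | cons q L ih =>
    intro q' hq'
    rcases List.mem_cons.mp hq' with rfl | hq'
    · exact ⟨h.1, h.2.1, h.2.2.le⟩
    · obtain ⟨h1, h2, h3⟩ := ih h.2.2 q' hq'
      exact ⟨h.1.trans (h.2.1.le.trans h1), h2, h3⟩

theorem Chain.pairwise {lo hi : K} {L : Schedule K n} (h : Chain lo L hi) :
    L.Pairwise (fun q q' => q.finish ≤ q'.start ∨ q'.finish ≤ q.start) := by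
  induction L generalizing lo with
  | nil => exact List.Pairwise.nil
  | cons q L ih => exact List.Pairwise.cons (fun q' hq' => Or.inl (h.2.2.bounds q' hq').1) (ih h.2.2)

theorem Chain.fill {lo hi : K} {L : Schedule K n} (j : Fin n) (h : Chain lo L hi) :
    Chain lo (fill j lo L hi) hi := by
  induction L generalizing lo with
  | nil =>
    simp only [RejSched.fill]
    split_ifs with hlt
    · exact ⟨le_rfl, hlt, le_rfl⟩
    · exact h
  | cons q L ih =>
    simp only [RejSched.fill]
    split_ifs with hlt
    · exact ⟨le_rfl, hlt, le_rfl, h.2.1, ih h.2.2⟩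
    · exact ⟨h.1, h.2.1, ih h.2.2⟩

theorem length_fill_le (j : Fin n) (lo : K) (L : Schedule K n) (hi : K) :
    (fill j lo L hi).length ≤ 2 * L.length + 1 := by
  induction L generalizing lo with
  | nil => simp only [fill]; split_ifs <;> simp
  | cons q L ih =>
    have := ih q.finish
    simp only [fill]
    split_ifs <;> simp <;> omega

theorem mem_fill {j : Fin n} {lo hi : K} {L : Schedule K n} (h : Chain lo L hi) {q : Piece K n}
    (hq : q ∈ fill j lo L hi) : q ∈ L ∨ q.job = j ∧ lo ≤ q.start ∧ q.finish ≤ hi := by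
  induction L generalizing lo with
  | nil =>
    simp only [fill] at hq
    split_ifs at hq with hlt
    · simp only [List.mem_singleton] at hq
      subst hq; exact Or.inr ⟨rfl, le_rfl, le_rfl⟩
    · simp at hq
  | cons q' L ih =>
    have key : q ∈ fill j q'.finish L hi → q ∈ q' :: L ∨ q.job = j ∧ lo ≤ q.start ∧ q.finish ≤ hi := by
      intro hq
      rcases ih h.2.2 hq with h1 | ⟨h1, h2, h3⟩
      · exact Or.inl (List.mem_cons_of_mem _ h1)
      · exact Or.inr ⟨h1, h.1.trans (h.2.1.le.trans h2), h3⟩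
    simp only [fill] at hq
    split_ifs at hq with hlt
    · rcases List.mem_cons.mp hq with rfl | hq
      · exact Or.inr ⟨rfl, le_rfl, h.2.1.le.trans h.2.2.le⟩
      · rcases List.mem_cons.mp hq with rfl | hq
        · exact Or.inl (List.mem_cons_self ..)
        · exact key hq
    · rcases List.mem_cons.mp hq with rfl | hq
      · exact Or.inl (List.mem_cons_self ..)
      · exact key hq

theorem piecesOf_fill_of_ne {j j' : Fin n} (hj : j' ≠ j) (lo : K) (L : Schedule K n) (hi : K) :
    Schedule.piecesOf (fill j lo L hi) j' = Schedule.piecesOf L j' := by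
  induction L generalizing lo with
  | nil => simp only [fill]; split_ifs <;> simp [Schedule.piecesOf, hj.symm]
  | cons q L ih =>
    have := ih q.finish
    simp only [Schedule.piecesOf] at this
    simp only [fill]
    split_ifs <;> simp [Schedule.piecesOf, hj.symm, List.filter_cons, this]

theorem sum_len_fill {j : Fin n} {lo hi : K} {L : Schedule K n} (h : Chain lo L hi) :
    ((fill j lo L hi).map Piece.len).sum = hi - lo := by
  induction L generalizing lo with
  | nil =>
    have h : lo ≤ hi := h
    simp only [fill]
    split_ifs with hlt
    · simp [Piece.len]
    · simp [le_antisymm h (not_lt.mp hlt)]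
  | cons q L ih =>
    have := ih h.2.2
    simp only [fill]
    split_ifs with hlt
    · simp [this, Piece.len]
    · have : lo = q.start := le_antisymm h.1 (not_lt.mp hlt)
      simp [*, Piece.len]

/-- The added job receives precisely the time that the chain leaves free; with the equation in
`Der.close` this is its processing time. -/
theorem sum_len_piecesOf_fill {j : Fin n} {lo hi : K} {L : Schedule K n} (h : Chain lo L hi)
    (hj : ∀ q ∈ L, q.job ≠ j) :
    ((Schedule.piecesOf (fill j lo L hi) j).map Piece.len).sum
      = hi - lo - (L.map Piece.len).sum := by
  induction L generalizing lo with
  | nil =>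
    have h : lo ≤ hi := h
    simp only [fill]
    split_ifs with hlt
    · simp [Piece.len, Schedule.piecesOf]
    · simp [le_antisymm h (not_lt.mp hlt), Schedule.piecesOf]
  | cons q L ih =>
    have := ih h.2.2 (fun q' hq' => hj q' (List.mem_cons_of_mem _ hq'))
    have hq := hj q (List.mem_cons_self ..)
    simp only [Schedule.piecesOf] at this
    simp only [fill]
    split_ifs with hlt
    · simp [this, Piece.len, Schedule.piecesOf, hq]
      ring
    · have : lo = q.start := le_antisymm h.1 (not_lt.mp hlt)
      simp [*, Piece.len, Schedule.piecesOf]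
      ring

end Lists

variable {I : Problem K} {mode : Mode} {G : Grid K I.n}

/-- Total processing time. -/
def Problem.work (I : Problem K) (J : List (Fin I.n)) : K := (J.map I.p).sum

/-- The bound on the number of pieces is stated with `+ 1` to be stable under both rules: filling
yields at most `2 * L + 1` pieces, and `L₁ + L₂ + 1 ≤ (L₁ + 1) * (L₂ + 1)`. It controls the cost of
copying schedules. -/
theorem Der.basic {h τ₀ τ₁ y : ℕ} {c : K} {L : Schedule K I.n} {J : List (Fin I.n)}
    (hY : 0 < G.Y) (hanc : ∀ b, G.anc b < G.NT) (d : Der I mode G h τ₀ τ₁ y c L J) :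
    τ₀ < G.NT ∧ τ₁ < G.NT ∧ y < G.Y ∧ y = (J.map G.wt).sum ∧ (∀ j ∈ J, G.ok j) ∧
      L.length + 1 ≤ 2 ^ J.length := by
  induction d with
  | nil h τ hτ => exact ⟨hτ, hτ, hY, by simp⟩
  | idle h τ b hτ hT => exact ⟨hτ, hanc b, hY, by simp⟩
  | @concat h τ₀ τ₁ τ₂ y₁ y₂ c₁ c₂ L₁ L₂ J₁ J₂ _ _ hy ih1 ih2 =>
    refine ⟨ih1.1, ih2.2.1, hy, by simp [← ih1.2.2.2.1, ← ih2.2.2.2.1], ?_, ?_⟩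
    · intro j hj
      rcases List.mem_append.mp hj with hj | hj
      · exact ih1.2.2.2.2.1 j hj
      · exact ih2.2.2.2.2.1 j hj
    · have h1 := ih1.2.2.2.2.2
      have h2 := ih2.2.2.2.2.2
      simp only [List.length_append, pow_add]
      nlinarith
  | @close h τ₀ τ₁ y c L J j _ h1 h2 h3 h4 h5 h6 h7 ih =>
    refine ⟨ih.1, h3, h2, by simp [← ih.2.2.2.1, add_comm], ?_, ?_⟩
    · intro j' hj'
      rcases List.mem_cons.mp hj' with rfl | hj'
      · exact h1
      · exact ih.2.2.2.2.1 j' hj'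
    · have h1 := ih.2.2.2.2.2
      have h2 := length_fill_le j (G.T τ₀) L (G.T (τ₀ + (y + G.wt j)))
      simp only [List.length_cons, pow_succ]
      omega

/-- A derivation without repeated jobs is a schedule that is not more expensive. -/
theorem Der.sound (hY : 0 < G.Y) (hanc : ∀ b, G.anc b < G.NT)
    (hwt : ∀ j, G.ok j → 0 < G.wt j)
    (hP : ∀ J : List (Fin I.n), (∀ j ∈ J, G.ok j) → (J.map G.wt).sum < G.Y →
      G.P (J.map G.wt).sum = I.work J)
    {h τ₀ τ₁ y : ℕ} {c : K} {L : Schedule K I.n} {J : List (Fin I.n)}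
    (d : Der I mode G h τ₀ τ₁ y c L J) (hJ : J.Nodup) :
    Chain (G.T τ₀) L (G.T τ₁) ∧ (∀ q ∈ L, q.job ∈ J ∧ I.r q.job ≤ q.start) ∧
      (∀ j ∈ J, ((Schedule.piecesOf L j).map Piece.len).sum = I.p j) ∧
      (L.map Piece.len).sum = I.work J ∧
      (∃ D : Fin I.n → K, (∀ q ∈ L, q.finish ≤ D q.job) ∧ (∀ j ∈ J, I.r j ≤ D j) ∧
        c = (J.map (fun j => I.w j (D j) - I.e j)).sum) ∧
      (mode = .nonpreemptive → (L.map Piece.job).Nodup) := by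
  induction d with
  | nil h τ hτ => exact ⟨le_rfl, by simp, by simp, by simp [Problem.work], ⟨I.r, by simp⟩, by simp⟩
  | idle h τ b hτ hT =>
    exact ⟨hT, by simp, by simp, by simp [Problem.work], ⟨I.r, by simp⟩, by simp⟩
  | @concat h τ₀ τ₁ τ₂ y₁ y₂ c₁ c₂ L₁ L₂ J₁ J₂ d1 d2 hy ih1 ih2 =>
    rw [List.nodup_append'] at hJ
    obtain ⟨hJ1, hJ2, hdis⟩ := hJ
    obtain ⟨a1, a2, a3, a4, ⟨D1, a5, a6, a7⟩, a8⟩ := ih1 hJ1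
    obtain ⟨b1, b2, b3, b4, ⟨D2, b5, b6, b7⟩, b8⟩ := ih2 hJ2
    have hno1 : ∀ j ∈ J₁, Schedule.piecesOf L₂ j = [] := by
      intro j hj
      simp only [Schedule.piecesOf, List.filter_eq_nil_iff, decide_eq_true_eq]
      rintro q hq rfl
      exact hdis hj (b2 q hq).1
    have hno2 : ∀ j ∈ J₂, Schedule.piecesOf L₁ j = [] := by
      intro j hj
      simp only [Schedule.piecesOf, List.filter_eq_nil_iff, decide_eq_true_eq]
      rintro q hq rfl
      exact hdis (a2 q hq).1 hj
    have happ : ∀ j, Schedule.piecesOf (L₁ ++ L₂) j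
        = Schedule.piecesOf L₁ j ++ Schedule.piecesOf L₂ j := fun j => List.filter_append ..
    refine ⟨a1.append b1, ?_, ?_, ?_, ⟨fun j => if j ∈ J₁ then D1 j else D2 j, ?_, ?_, ?_⟩, ?_⟩
    · intro q hq
      rcases List.mem_append.mp hq with hq | hq
      · exact ⟨List.mem_append_left _ (a2 q hq).1, (a2 q hq).2⟩
      · exact ⟨List.mem_append_right _ (b2 q hq).1, (b2 q hq).2⟩
    · intro j hj
      rw [happ]
      rcases List.mem_append.mp hj with hj | hj
      · rw [hno1 j hj, List.append_nil, a3 j hj]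
      · rw [hno2 j hj, List.nil_append, b3 j hj]
    · simp [Problem.work] at a4 b4 ⊢
      rw [a4, b4]
    · intro q hq
      rcases List.mem_append.mp hq with hq | hq
      · simp only [(a2 q hq).1, if_true]; exact a5 q hq
      · have : q.job ∉ J₁ := fun h => hdis h (b2 q hq).1
        simp only [this, if_false]; exact b5 q hq
    · intro j hj
      by_cases hj1 : j ∈ J₁
      · simp only [hj1, if_true]; exact a6 j hj1
      · simp only [hj1, if_false]; exact b6 j ((List.mem_append.mp hj).resolve_left hj1)
    · rw [List.map_append, List.sum_append, a7, b7]
      congr 2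
      · exact List.map_congr_left (fun j hj => by simp [hj])
      · refine List.map_congr_left (fun j hj => ?_)
        have : j ∉ J₁ := fun h => hdis h hj
        simp [this]
    · intro hm
      rw [List.map_append, List.nodup_append']
      refine ⟨a8 hm, b8 hm, ?_⟩
      intro j hj hj'
      obtain ⟨q, hq, rfl⟩ := List.mem_map.mp hj
      obtain ⟨q', hq', he⟩ := List.mem_map.mp hj'
      exact hdis (a2 q hq).1 (he ▸ (b2 q' hq').1)
  | @close h τ₀ τ₁ y c L J j d h1 h2 h3 h4 h5 h6 h7 ih =>
    rw [List.nodup_cons] at hJ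
    obtain ⟨hjJ, hJ⟩ := hJ
    obtain ⟨a1, a2, a3, a4, ⟨D, a5, a6, a7⟩, a8⟩ := ih hJ
    obtain ⟨-, -, c1, c2, c3, -⟩ := d.basic hY hanc
    have hPy : G.P y = I.work J := by rw [c2]; exact hP J c3 (c2 ▸ c1)
    set τ' := τ₀ + (y + G.wt j) with hτ'
    have hch : Chain (G.T τ₀) L (G.T τ') := a1.mono_right h5
    have hjL : ∀ q ∈ L, q.job ≠ j := fun q hq he => hjJ (he ▸ (a2 q hq).1)
    -- The job is charged at the end of its interval, although it finishes earlier if inner pieces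
    -- occupy the end. Therefore `D` is only an upper bound on finishing times, and the cost an
    -- upper bound on the true one.
    refine ⟨hch.fill j, ?_, ?_, ?_, ⟨fun i => if i = j then G.T τ' else D i, ?_, ?_, ?_⟩, ?_⟩
    · intro q hq
      rcases mem_fill hch hq with hq | ⟨hq1, hq2, hq3⟩
      · exact ⟨List.mem_cons_of_mem _ (a2 q hq).1, (a2 q hq).2⟩
      · rw [hq1]; exact ⟨List.mem_cons_self .., h4.trans hq2⟩
    · intro i hi
      by_cases hij : i = j
      · subst hij
        rw [sum_len_piecesOf_fill hch hjL, a4, h6, hPy]; ring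
      · rw [piecesOf_fill_of_ne hij, a3 i ((List.mem_cons.mp hi).resolve_left hij)]
    · rw [sum_len_fill hch, h6, hPy]
      simp [Problem.work]; ring
    · intro q hq
      rcases mem_fill hch hq with hq | ⟨hq1, hq2, hq3⟩
      · simp only [hjL q hq, if_false]; exact a5 q hq
      · simp only [hq1, if_true]; exact hq3
    · intro i hi
      by_cases hij : i = j
      · subst hij; simp only [if_true]; exact h4.trans hch.le
      · simp only [hij, if_false]; exact a6 i ((List.mem_cons.mp hi).resolve_left hij)
    · rw [List.map_cons, List.sum_cons, a7, add_comm]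
      congr 1
      · simp
      congr 1
      refine List.map_congr_left (fun i hi => ?_)
      have : i ≠ j := fun he => hjJ (he ▸ hi)
      simp [this]
    · intro hm
      have hy := h7 hm
      -- Weight zero means no job at all since weights are positive; then the new job fills an empty
      -- chain and becomes one piece.
      have hJ0 : J = [] := by
        cases J with
        | nil => rfl
        | cons i J =>
          have := hwt i (c3 i (List.mem_cons_self ..))
          simp at c2
          omega
      have hL0 : L = [] := by
        cases L with
        | nil => rfl
        | cons q L =>
          have := (a2 q (List.mem_cons_self ..)).1
          simp [hJ0] at this
      subst hL0
      simp only [fill]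
      split_ifs <;> simp

/-- A derivation without repeated jobs yields a feasible schedule. -/
theorem Der.feasible (hI : I.Admissible) (hY : 0 < G.Y) (hanc : ∀ b, G.anc b < G.NT)
    (hwt : ∀ j, G.ok j → 0 < G.wt j)
    (hP : ∀ J : List (Fin I.n), (∀ j ∈ J, G.ok j) → (J.map G.wt).sum < G.Y →
      G.P (J.map G.wt).sum = I.work J)
    {h τ₀ τ₁ y : ℕ} {c : K} {L : Schedule K I.n} {J : List (Fin I.n)}
    (d : Der I mode G h τ₀ τ₁ y c L J) (hJ : J.Nodup) (hs : J.length ≤ I.s) :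
    I.Feasible mode L ∧ I.cost L ≤ c + ∑ j, I.e j := by
  obtain ⟨a1, a2, a3, a4, ⟨D, a5, a6, a7⟩, a8⟩ := d.sound hY hanc hwt hP hJ
  have hsched : L.scheduled = J.toFinset := by
    ext j
    simp only [Schedule.scheduled, List.mem_toFinset, List.mem_map]
    constructor
    · rintro ⟨q, hq, rfl⟩; exact (a2 q hq).1
    · intro hj
      by_contra hno
      have h0 : Schedule.piecesOf L j = [] := by
        simp only [Schedule.piecesOf, List.filter_eq_nil_iff, decide_eq_true_eq]
        intro q hq he
        exact hno ⟨q, hq, he⟩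
      have := a3 j hj
      rw [h0] at this
      exact absurd this (by simpa using (hI.1 j).ne)
  have hJcard : J.toFinset.card = J.length := List.toFinset_card_of_nodup hJ
  refine ⟨⟨fun q hq => ⟨(a2 q hq).2, (a1.bounds q hq).2.1⟩, a1.pairwise, ?_, ?_, ?_⟩, ?_⟩
  · intro j hj
    exact a3 j (by rw [hsched] at hj; simpa using hj)
  · rw [Schedule.rejected, Finset.card_sdiff_of_subset (Finset.subset_univ _), hsched, hJcard]
    simp; omega
  · cases mode with
    | preemptive => trivial
    | nonpreemptive => exact a8 rfl
  -- The place where monotonicity of the private costs makes charging at `D j` harmless; both times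
  -- are at least `I.r j`, where monotonicity holds.
  · have hcompl : ∀ j ∈ J, I.w j (I.completion L j) ≤ I.w j (D j) := by
      intro j hj
      have h1 : ∀ (l : List K) (x : K), x ≤ l.foldr max x := by
        intro l x
        induction l with
        | nil => exact le_rfl
        | cons y l ih => exact ih.trans (le_max_right _ _)
      have h2 : ∀ (l : List K) (x B : K), x ≤ B → (∀ y ∈ l, y ≤ B) → l.foldr max x ≤ B := by
        intro l x B hx hl
        induction l with
        | nil => exact hx
        | cons y l ih =>
          exact max_le (hl y (List.mem_cons_self ..))
            (ih (fun z hz => hl z (List.mem_cons_of_mem _ hz)))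
      refine hI.2 j (h1 _ _) (a6 j hj) (h2 _ _ _ (a6 j hj) ?_)
      intro y hy
      obtain ⟨q, hq, rfl⟩ := List.mem_map.mp hy
      simp only [Schedule.piecesOf, List.mem_filter, decide_eq_true_eq] at hq
      have := a5 q hq.1
      rwa [hq.2] at this
    have hrej : ∑ j ∈ L.rejected, I.e j = ∑ j, I.e j - ∑ j ∈ J.toFinset, I.e j := by
      rw [Schedule.rejected, hsched, Finset.sum_sdiff_eq_sub (Finset.subset_univ _)]
    have hc : c = ∑ j ∈ J.toFinset, (I.w j (D j) - I.e j) := by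
      rw [a7, List.sum_toFinset _ hJ]
    have hle : ∑ j ∈ J.toFinset, I.w j (I.completion L j) ≤ ∑ j ∈ J.toFinset, I.w j (D j) :=
      Finset.sum_le_sum (fun j hj => hcompl j (by simpa using hj))
    rw [Problem.cost, hrej, hsched, hc, Finset.sum_sub_distrib]
    linarith

end Theory

end RejSched

namespace RejSched

section Structure

variable {K : Type} [CommRing K] [LinearOrder K] [IsStrictOrderedRing K]
variable {I : Problem K} {mode : Mode}

/-! ### Every schedule is dominated by a derivation -/

/-- The combinatorial form of a derivation: `Nest I mode h t u J c` says that the jobs `J` can be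
processed between the times `t` and `u` at cost `c`. -/
inductive Nest (I : Problem K) (mode : Mode) : ℕ → K → K → List (Fin I.n) → K → Prop where
  | nil (t : K) : Nest I mode 0 t t [] 0
  | idle (t : K) (b : Fin I.n) : t ≤ I.r b → Nest I mode 0 t (I.r b) [] 0
  | append {h₁ h₂ : ℕ} {t u v : K} {J₁ J₂ : List (Fin I.n)} {c₁ c₂ : K} :
      Nest I mode h₁ t u J₁ c₁ → Nest I mode h₂ u v J₂ c₂ →
      Nest I mode (h₁ + h₂ + 1) t v (J₁ ++ J₂) (c₁ + c₂)
  | close {h : ℕ} {t u : K} {J : List (Fin I.n)} {c : K} (j : Fin I.n) :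
      Nest I mode h t u J c → I.r j ≤ t → u ≤ t + I.work J + I.p j →
      (mode = .nonpreemptive → J = []) →
      Nest I mode (h + 1) t (t + I.work J + I.p j) (j :: J)
        (c + (I.w j (t + I.work J + I.p j) - I.e j))

@[simp] theorem Problem.work_nil : I.work [] = 0 := rfl

@[simp] theorem Problem.work_cons (j : Fin I.n) (J : List (Fin I.n)) :
    I.work (j :: J) = I.p j + I.work J := by simp [Problem.work]

@[simp] theorem Problem.work_append (J J' : List (Fin I.n)) :
    I.work (J ++ J') = I.work J + I.work J' := by simp [Problem.work]

theorem Problem.work_nonneg (hI : I.Admissible) (J : List (Fin I.n)) : 0 ≤ I.work J :=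
  List.sum_nonneg (by
    intro x hx
    obtain ⟨j, _, rfl⟩ := List.mem_map.mp hx
    exact (hI.1 j).le)

/-- What the tables of a grid have to satisfy. -/
structure Grid.Good (G : Grid K I.n) : Prop where
  Y_pos : 0 < G.Y
  lt_NT : ∀ (b : Fin I.n) (y : ℕ), y < G.Y → G.anc b + y < G.NT
  T_eq : ∀ (b : Fin I.n) (y : ℕ), y < G.Y → G.T (G.anc b + y) = I.r b + G.P y
  P_eq : ∀ Z : List (Fin I.n), (∀ j ∈ Z, G.ok j) → (Z.map G.wt).sum < G.Y →
    G.P (Z.map G.wt).sum = I.work Z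

theorem Grid.Good.T_sum {G : Grid K I.n} (hG : G.Good) (b : Fin I.n)
    {Z : List (Fin I.n)} (hZ : ∀ j ∈ Z, G.ok j) (hq : (Z.map G.wt).sum < G.Y) :
    G.T (G.anc b + (Z.map G.wt).sum) = I.r b + I.work Z := by
  rw [hG.T_eq b _ hq, hG.P_eq Z hZ hq]

/-- Every time is represented as `I.r b + I.work Z`, with index `G.anc b` plus the weight of `Z`. An
idle interval restarts with a new `b` and empty `Z`. The weight of `Z` grows at most by the weight
of the jobs already processed, so indices stay inside the block of `b`. -/
theorem Nest.der {G : Grid K I.n} (hG : G.Good) {h : ℕ} {t u : K} {J : List (Fin I.n)}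
    {c : K} (d : Nest I mode h t u J c) :
    ∀ (b : Fin I.n) (Z : List (Fin I.n)), (∀ j ∈ Z, G.ok j) → (∀ j ∈ J, G.ok j) →
      (Z.map G.wt).sum + (J.map G.wt).sum < G.Y → t = I.r b + I.work Z →
      ∃ (b' : Fin I.n) (Z' : List (Fin I.n)) (L : Schedule K I.n), (∀ j ∈ Z', G.ok j) ∧
        (Z'.map G.wt).sum ≤ (Z.map G.wt).sum + (J.map G.wt).sum ∧ u = I.r b' + I.work Z' ∧
        Der I mode G h (G.anc b + (Z.map G.wt).sum) (G.anc b' + (Z'.map G.wt).sum)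
          (J.map G.wt).sum c L J := by
  induction d with
  | nil t =>
    intro b Z hZ _ hq ht
    exact ⟨b, Z, [], hZ, by simp, ht, .nil _ _ (hG.lt_NT b _ (by simpa using hq))⟩
  | idle t b' htb =>
    intro b Z hZ _ hq ht
    have hq' : (Z.map G.wt).sum < G.Y := by simpa using hq
    refine ⟨b', [], [], by simp, by simp, by simp, ?_⟩
    have h0 : G.T (G.anc b') = I.r b' := by
      simpa using hG.T_sum b' (Z := []) (by simp) hG.Y_pos
    exact .idle _ _ b' (hG.lt_NT b _ hq') (by rw [hG.T_sum b hZ hq', h0, ← ht]; exact htb)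
  | @append h₁ h₂ t u v J₁ J₂ c₁ c₂ _ _ ih1 ih2 =>
    intro b Z hZ hJ hq ht
    rw [List.map_append, List.sum_append] at hq
    obtain ⟨b1, Z1, L1, hZ1, hl1, hu1, d1⟩ := ih1 b Z hZ
      (fun j hj => hJ j (List.mem_append_left _ hj)) (by omega) ht
    obtain ⟨b2, Z2, L2, hZ2, hl2, hu2, d2⟩ := ih2 b1 Z1 hZ1
      (fun j hj => hJ j (List.mem_append_right _ hj)) (by omega) hu1
    refine ⟨b2, Z2, L1 ++ L2, hZ2, by rw [List.map_append, List.sum_append]; omega, hu2, ?_⟩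
    have hlt : (J₁.map G.wt).sum + (J₂.map G.wt).sum < G.Y := by omega
    rw [List.map_append, List.sum_append]
    exact .concat (d1.mono (Nat.le_add_right ..)) (d2.mono (Nat.le_add_left ..)) hlt
  | @close h t u J c j _ hr hu hm ih =>
    intro b Z hZ hJ hq ht
    rw [List.map_cons, List.sum_cons] at hq
    have hJ' : ∀ i ∈ J, G.ok i := fun i hi => hJ i (List.mem_cons_of_mem _ hi)
    obtain ⟨b1, Z1, L1, hZ1, hl1, hu1, d1⟩ := ih b Z hZ hJ' (by omega) ht
    -- The closed interval has no idle time, so its end is represented by the `b` of its start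
    -- together with `Z` and all jobs processed in the interval.
    have hZJ : ∀ i ∈ Z ++ (J ++ [j]), G.ok i := by
      intro i hi
      simp only [List.mem_append, List.mem_singleton] at hi
      rcases hi with hi | hi | rfl
      · exact hZ i hi
      · exact hJ' i hi
      · exact hJ i (List.mem_cons_self ..)
    have hsum : ((Z ++ (J ++ [j])).map G.wt).sum
        = (Z.map G.wt).sum + ((J.map G.wt).sum + G.wt j) := by simp
    have hwork : I.work (Z ++ (J ++ [j])) = I.work Z + (I.work J + I.p j) := by simp
    have hlt : ((Z ++ (J ++ [j])).map G.wt).sum < G.Y := by rw [hsum]; omega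
    have hT := hG.T_sum b hZJ hlt
    rw [hsum, ← add_assoc] at hT
    rw [hsum] at hlt
    have hT0 := hG.T_sum b hZ (by omega)
    have hT1 := hG.T_sum b1 hZ1 (by omega)
    have hP := hG.P_eq J hJ' (by omega)
    have hend : G.T (G.anc b + (Z.map G.wt).sum + ((J.map G.wt).sum + G.wt j))
        = t + I.work J + I.p j := by rw [hT, hwork, ht]; ring
    have hd := Der.close j d1 (hJ j (List.mem_cons_self ..)) (by omega)
      (by have := hG.lt_NT b _ hlt; omega) (by rw [hT0, ← ht]; exact hr)
      (by rw [hT1, hend, ← hu1]; exact hu) (by rw [hend, hT0, hP, ← ht])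
      (fun h => by rw [hm h]; rfl)
    rw [hend] at hd
    refine ⟨b, Z ++ (J ++ [j]), fill j (G.T (G.anc b + (Z.map G.wt).sum)) L1
      (t + I.work J + I.p j), hZJ, by rw [hsum, List.map_cons, List.sum_cons]; omega, by rw [hwork, ht]; ring, ?_⟩
    rw [hsum, List.map_cons, List.sum_cons, add_comm (G.wt j), ← add_assoc (G.anc b)]
    exact hd

/-- A sequence of busy intervals, each of which starts at the release date of a job and contains
only jobs that are released within it. -/
inductive Blocks (I : Problem K) (mode : Mode) : ℕ → K → List (Fin I.n) → K → Prop where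
  | nil (u : K) : Blocks I mode 0 u [] 0
  | cons {h h' : ℕ} {u : K} {J J' : List (Fin I.n)} {c c' : K} (b : Fin I.n) : u ≤ I.r b →
      Nest I mode h (I.r b) (I.r b + I.work J) J c → (∀ j ∈ J, I.r b ≤ I.r j) →
      Blocks I mode h' (I.r b + I.work J) J' c' →
      Blocks I mode (h + h' + 4) u (J ++ J') (c + c')

/-- The time before each block becomes an idle interval up to its release date. The surplus 4 per
block in `Blocks` more than pays for this and for two concatenations. -/
theorem Blocks.nest {h : ℕ} {u : K} {J : List (Fin I.n)} {c : K} (d : Blocks I mode h u J c) :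
    ∃ h' v, h' ≤ h ∧ Nest I mode h' u v J c := by
  induction d with
  | nil u => exact ⟨0, u, le_rfl, .nil u⟩
  | @cons h h' u J J' c c' b hu hn _ _ ih =>
    obtain ⟨h'', v, hle, hn'⟩ := ih
    have := (Nest.idle (mode := mode) u b hu).append (hn.append hn')
    simp only [List.nil_append, zero_add] at this
    refine ⟨_, v, ?_, this⟩
    omega

/-- An open job is interrupted by all blocks that start before its end. -/
theorem Blocks.absorb (hI : I.Admissible) {h₀ : ℕ} {u : K} {J₀ : List (Fin I.n)} {c₀ : K}
    (d : Blocks I mode h₀ u J₀ c₀) (t x : K) :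
    ∀ {hR : ℕ} {R : List (Fin I.n)} {cR : K}, Nest I mode hR t u R cR → t ≤ u →
      u ≤ t + I.work R + x → (∀ j ∈ R, t ≤ I.r j) →
      ∃ (h' h'' : ℕ) (R' J' : List (Fin I.n)) (c' c'' u' : K), Nest I mode h' t u' R' c' ∧
        u' ≤ t + I.work R' + x ∧ Blocks I mode h'' (t + I.work R' + x) J' c'' ∧
        (R' ++ J').Perm (R ++ J₀) ∧ c' + c'' = cR + c₀ ∧ h' + h'' ≤ hR + h₀ ∧
        ∀ j ∈ R', t ≤ I.r j := by
  induction d with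
  | nil u =>
    intro hR R cR hn _ hu hr
    exact ⟨hR, 0, R, [], cR, 0, u, hn, hu, .nil _, by simp, by simp, le_rfl, hr⟩
  | @cons h h' u J J' c c' b hub hb hbr hrest ih =>
    intro hR R cR hn htu hu hr
    -- Either the open job ends before the next block starts and nothing changes any more, or the
    -- block is swallowed and postpones the end of the open job by its work.
    rcases le_or_gt (t + I.work R + x) (I.r b) with hle | hlt
    · exact ⟨hR, _, R, J ++ J', cR, _, u, hn, hu, .cons b hle hb hbr hrest, List.Perm.refl _, rfl,
        le_rfl, hr⟩
    · have hn2 := (hn.append (Nest.idle u b hub)).append hb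
      rw [List.append_nil, add_zero, add_zero] at hn2
      have hw := I.work_nonneg hI J
      obtain ⟨a, a', R', J'', d1, d2, u', e1, e2, e3, e4, e5, e6, e7⟩ := ih hn2
        (by linarith) (by rw [Problem.work_append]; linarith) (by
          intro j hj
          rcases List.mem_append.mp hj with hj | hj
          · exact hr j hj
          · exact (htu.trans hub).trans (hbr j hj))
      refine ⟨a, a', R', J'', d1, d2, u', e1, e2, e3, ?_, ?_, by omega, e7⟩
      · rwa [List.append_assoc] at e4
      · rw [e5]; ring

/-- Insertion of the job that is completed last. -/
theorem Blocks.insert (hI : I.Admissible) (hm : mode = .preemptive) {h₀ : ℕ} {u : K}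
    {J₀ : List (Fin I.n)} {c₀ : K} (d : Blocks I mode h₀ u J₀ c₀) (j : Fin I.n) (hu : u ≤ I.r j) :
    ∃ (h : ℕ) (J X : List (Fin I.n)) (c D x : K), Blocks I mode h u J c ∧ J.Perm (j :: J₀) ∧
      h ≤ h₀ + 8 ∧ c = c₀ + (I.w j D - I.e j) ∧ I.r j ≤ D ∧ X.Subperm (j :: J₀) ∧ j ∈ X ∧
      (∀ i ∈ X, x ≤ I.r i) ∧ D = x + I.work X := by
  have hm' : mode ≠ .nonpreemptive := by rw [hm]; simp
  have hpj := hI.1 j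
  -- `X` and `x` certify that the end `D` of the inserted job is unavoidable: the jobs in `X`, among
  -- them `j`, are released at or after `x`, and together they need the time up to `D`. No job
  -- inserted earlier is moved.
  induction d with
  | nil u =>
    have h1 := Nest.close (mode := mode) j (Nest.nil (I.r j)) le_rfl
      (by simpa using hpj.le) (fun h => absurd h hm')
    simp only [Problem.work_nil, add_zero, zero_add] at h1
    have h2 := Blocks.cons (u := u) (J := [j]) (h' := 0) (J' := []) (c' := 0) j hu
      (by simpa using h1) (by simp) (.nil _)
    refine ⟨_, _, [j], _, I.r j + I.p j, I.r j, h2, by simp, by omega, by simp, by linarith,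
      List.Subperm.refl _, by simp, by simp, by simp⟩
  | @cons h h' u J J' c c' b hub hb hbr hrest ih =>
    have hw := I.work_nonneg hI J
    -- A block that ends before the release of `j` is left alone.
    rcases le_or_gt (I.r b + I.work J) (I.r j) with hle | hlt
    · obtain ⟨a, J₁, X, c₁, D, x, e1, e2, e3, e4, e5, e6, e7, e8, e9⟩ := ih hle
      refine ⟨_, J ++ J₁, X, c + c₁, D, x, .cons b hub hb hbr e1, ?_, by omega, by rw [e4]; ring,
        e5, ?_, e7, e8, e9⟩
      · exact (e2.append_left J).trans List.perm_middle
      · refine e6.trans (List.Sublist.subperm ?_)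
        exact List.Sublist.cons_cons j (List.sublist_append_right J J')
    · rcases le_or_gt (I.r b) (I.r j) with hle2 | hlt2
      -- Released inside a block, which has no idle time: `j` starts at the end of the block, is
      -- interrupted by the following blocks, and all of this merges into one block that starts at
      -- `I.r b`.
      · obtain ⟨a, a', R, J₁, d1, d2, u', e1, e2, e3, e4, e5, e6, e7⟩ := hrest.absorb hI
          (I.r b + I.work J) (I.p j) (Nest.nil _) le_rfl (by simpa using hpj.le) (by simp)
        have h1 := hb.append (Nest.close j e1 hlt.le e2 (fun h => absurd h hm'))
        have hD : I.r b + I.work J + I.work R + I.p j = I.r b + I.work (J ++ j :: R) := by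
          simp; ring
        have h2 : Blocks I mode _ u ((J ++ j :: R) ++ J₁) _ :=
          Blocks.cons b hub (by rw [hD] at h1; exact h1) (by
            intro i hi
            simp only [List.mem_append, List.mem_cons] at hi
            rcases hi with hi | rfl | hi
            · exact hbr i hi
            · exact hle2
            · have := e7 i hi; linarith) (by rw [← hD]; exact e3)
        have hperm : ((J ++ j :: R) ++ J₁).Perm (j :: (J ++ J')) := by
          rw [List.append_assoc]
          refine (List.perm_middle (l₁ := J) (a := j)).trans (List.Perm.cons j ?_)
          exact (by simpa using e4 : (R ++ J₁).Perm J').append_left J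
        refine ⟨_, _, J ++ j :: R, _, _, I.r b, h2, hperm, by omega, ?_, ?_, ?_, by simp, ?_, rfl⟩
        · linear_combination e5
        · have := I.work_nonneg hI R
          simp only [Problem.work_append, Problem.work_cons]; linarith
        · exact (List.sublist_append_left _ J₁).subperm.trans hperm.subperm
        · intro i hi
          simp only [List.mem_append, List.mem_cons] at hi
          rcases hi with hi | rfl | hi
          · exact hbr i hi
          · exact hle2
          · have := e7 i hi; linarith
      -- Released before the block: `j` opens a block of its own at `I.r j` and is interrupted by
      -- everything that starts before its end.
      · have hall : Blocks I mode _ (I.r j) (J ++ J') (c + c') := .cons b hlt2.le hb hbr hrest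
        obtain ⟨a, a', R, J₁, d1, d2, u', e1, e2, e3, e4, e5, e6, e7⟩ := hall.absorb hI
          (I.r j) (I.p j) (Nest.nil _) le_rfl (by simpa using hpj.le) (by simp)
        have h1 := Nest.close j e1 le_rfl e2 (fun h => absurd h hm')
        have hD : I.r j + I.work R + I.p j = I.r j + I.work (j :: R) := by
          simp; ring
        have h2 : Blocks I mode _ u ((j :: R) ++ J₁) _ :=
          Blocks.cons j hu (by rw [hD] at h1; exact h1) (by
            intro i hi
            rcases List.mem_cons.mp hi with rfl | hi
            · exact le_rfl
            · exact e7 i hi) (by rw [← hD]; exact e3)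
        have hperm : ((j :: R) ++ J₁).Perm (j :: (J ++ J')) :=
          List.Perm.cons j (by simpa using e4)
        refine ⟨_, _, j :: R, _, _, I.r j, h2, hperm, by omega, ?_, ?_, ?_, by simp, ?_, rfl⟩
        · linear_combination e5
        · have := I.work_nonneg hI R
          simp only [Problem.work_cons]; linarith
        · exact (List.sublist_append_left _ J₁).subperm.trans hperm.subperm
        · intro i hi
          rcases List.mem_cons.mp hi with rfl | hi
          · exact le_rfl
          · exact e7 i hi

/-- Induction that inserts the jobs in order of their completion times `C`. Of the given schedule
only the condition on sets `X` is kept: some job of `X` is completed after all work of `X` has been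
done from time `x` on. -/
theorem exists_blocks (hI : I.Admissible) (hm : mode = .preemptive) (C : Fin I.n → K) (u : K)
    (m : ℕ) : ∀ Z : Finset (Fin I.n), Z.card = m → (∀ j ∈ Z, u ≤ I.r j) →
    (∀ X ⊆ Z, X.Nonempty → ∀ x, (∀ j ∈ X, x ≤ I.r j) → ∃ j ∈ X, x + ∑ i ∈ X, I.p i ≤ C j) →
    ∃ (h : ℕ) (J : List (Fin I.n)) (c : K), Blocks I mode h u J c ∧ J.Nodup ∧ J.toFinset = Z ∧
      h ≤ 8 * m ∧ c ≤ ∑ j ∈ Z, (I.w j (C j) - I.e j) := by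
  induction m with
  | zero =>
    intro Z hZ _ _
    rw [Finset.card_eq_zero] at hZ
    subst hZ
    exact ⟨0, [], 0, .nil u, by simp, by simp, by simp, by simp⟩
  | succ m ih =>
    intro Z hZ hu hC
    obtain ⟨j, hjZ, hjmax⟩ := Z.exists_max_image C (Finset.card_pos.mp (by omega))
    obtain ⟨h, J, c, hB, hJ, hJZ, hh, hc⟩ := ih (Z.erase j)
      (by rw [Finset.card_erase_of_mem hjZ]; omega) (fun i hi => hu i (Finset.mem_of_mem_erase hi))
      (fun X hX => hC X (hX.trans (Finset.erase_subset j Z)))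
    obtain ⟨h', J', X, c', D, x, e1, e2, e3, e4, e5, e6, e7, e8, e9⟩ := hB.insert hI hm j (hu j hjZ)
    have hjJ : j ∉ J := by rw [← List.mem_toFinset, hJZ]; simp
    have hnd : (j :: J).Nodup := List.nodup_cons.mpr ⟨hjJ, hJ⟩
    have hset : (j :: J).toFinset = Z := by
      rw [List.toFinset_cons, hJZ, Finset.insert_erase hjZ]
    have hXnd : X.Nodup := by
      obtain ⟨l, hl1, hl2⟩ := e6
      exact (hl1.nodup_iff).mp (hl2.nodup hnd)
    have hXZ : X.toFinset ⊆ Z := by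
      intro i hi
      rw [← hset, List.mem_toFinset]
      exact e6.subset (List.mem_toFinset.mp hi)
    -- The certificate yields a job of `X` with `D ≤ C i`, and `j` has the largest completion time,
    -- hence `D ≤ C j`.
    obtain ⟨i, hi, hle⟩ := hC X.toFinset hXZ ⟨j, List.mem_toFinset.mpr e7⟩ x
      (fun i hi => e8 i (List.mem_toFinset.mp hi))
    have hDC : D ≤ C j := by
      rw [e9]
      refine le_trans (le_of_eq ?_) (hle.trans (hjmax i (hXZ hi)))
      rw [List.sum_toFinset _ hXnd]; rfl
    refine ⟨h', J', c', e1, e2.nodup_iff.mpr hnd, ?_, by omega, ?_⟩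
    · rw [List.toFinset_eq_of_perm _ _ e2, hset]
    · have hw := hI.2 j (Set.mem_Ici.mpr e5) (Set.mem_Ici.mpr (e5.trans hDC)) hDC
      rw [e4, ← Finset.sum_erase_add _ _ hjZ]
      linarith

/-- Disjoint intervals fit into the interval that contains them. -/
theorem sum_len_le {n : ℕ} (m : ℕ) : ∀ (L : Schedule K n) (x M : K), L.length = m → x ≤ M →
    L.Pairwise (fun q q' => q.finish ≤ q'.start ∨ q'.finish ≤ q.start) →
    (∀ q ∈ L, x ≤ q.start ∧ q.start < q.finish ∧ q.finish ≤ M) → (L.map Piece.len).sum ≤ M - x := by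
  classical
  induction m with
  | zero =>
    intro L x M hL hxM _ _
    rw [List.length_eq_zero_iff] at hL
    subst hL
    simpa using hxM
  | succ m ih =>
    intro L x M hL hxM hpw hb
    -- Remove the piece that ends last: the others are disjoint from it and cannot lie behind it, so
    -- they fit before its start.
    obtain ⟨q, hq, hmax⟩ := L.toFinset.exists_max_image Piece.finish (by
      cases L with
      | nil => simp at hL
      | cons q L => exact ⟨q, by simp⟩)
    rw [List.mem_toFinset] at hq
    have hperm := List.perm_cons_erase hq
    have hpw' : (q :: L.erase q).Pairwise
        (fun q q' => q.finish ≤ q'.start ∨ q'.finish ≤ q.start) :=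
      (hperm.pairwise_iff (fun h => h.symm)).mp hpw
    rw [List.pairwise_cons] at hpw'
    have hqb := hb q hq
    have h1 := ih (L.erase q) x q.start (by rw [List.length_erase_of_mem hq]; omega) hqb.1
      hpw'.2 (by
        intro q' hq'
        have hq'L := List.mem_of_mem_erase hq'
        have hb' := hb q' hq'L
        refine ⟨hb'.1, hb'.2.1, ?_⟩
        rcases hpw'.1 q' hq' with h | h
        · have := hmax q' (List.mem_toFinset.mpr hq'L)
          exact absurd (h.trans_lt hb'.2.1) (not_lt.mpr this)
        · exact h)
    rw [(hperm.map Piece.len).sum_eq, List.map_cons, List.sum_cons]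
    simp only [Piece.len] at h1 ⊢
    linarith

theorem finish_le_completion {S : Schedule K I.n} {q : Piece K I.n} (hq : q ∈ S) :
    q.finish ≤ I.completion S q.job := by
  have h : ∀ (l : List K) (x : K), ∀ y ∈ l, y ≤ l.foldr max x := by
    intro l x
    induction l with
    | nil => simp
    | cons z l ih =>
      intro y hy
      rcases List.mem_cons.mp hy with rfl | hy
      · exact le_max_left _ _
      · exact (ih y hy).trans (le_max_right _ _)
  exact h _ _ _ (List.mem_map_of_mem (by simp [Schedule.piecesOf, hq]))

theorem sum_len_of_jobs (S : Schedule K I.n) (X : Finset (Fin I.n)) :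
    ((S.filter (fun q => decide (q.job ∈ X))).map Piece.len).sum
      = ∑ j ∈ X, ((S.piecesOf j).map Piece.len).sum := by
  induction S with
  | nil => simp [Schedule.piecesOf]
  | cons q S ih =>
    simp only [Schedule.piecesOf] at ih ⊢
    by_cases hq : q.job ∈ X
    · simp only [List.filter_cons, hq, decide_true, if_true, List.map_cons, List.sum_cons, ih]
      rw [← Finset.sum_erase_add _ _ hq, ← Finset.sum_erase_add X _ hq]
      simp only [decide_true, if_true, List.map_cons, List.sum_cons]
      have h2 : ∑ x ∈ X.erase q.job, ((if decide (q.job = x) = true then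
          q :: List.filter (fun q => decide (q.job = x)) S
          else List.filter (fun q => decide (q.job = x)) S).map Piece.len).sum
          = ∑ x ∈ X.erase q.job, ((List.filter (fun q => decide (q.job = x)) S).map Piece.len).sum :=
        Finset.sum_congr rfl (fun j hj => by
          have : q.job ≠ j := (Finset.ne_of_mem_erase hj).symm
          simp [this])
      rw [h2]
      ring
    · simp only [List.filter_cons, hq, decide_false, Bool.false_eq_true, if_false, ih]
      refine Finset.sum_congr rfl (fun j hj => ?_)
      have : q.job ≠ j := fun h => hq (h ▸ hj)
      simp [this]

/-- All pieces of jobs of `X` are disjoint and lie between `x` and the latest completion time in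
`X`. -/
theorem Problem.Feasible.hall {S : Schedule K I.n} (hS : I.Feasible mode S) (X : Finset (Fin I.n))
    (hX : X ⊆ S.scheduled) (hX0 : X.Nonempty) (x : K) (hx : ∀ j ∈ X, x ≤ I.r j) :
    ∃ j ∈ X, x + ∑ i ∈ X, I.p i ≤ I.completion S j := by
  obtain ⟨j, hj, hmax⟩ := X.exists_max_image (I.completion S) hX0
  refine ⟨j, hj, ?_⟩
  have hb : ∀ q ∈ S.filter (fun q => decide (q.job ∈ X)),
      x ≤ q.start ∧ q.start < q.finish ∧ q.finish ≤ I.completion S j := by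
    intro q hq
    rw [List.mem_filter, decide_eq_true_eq] at hq
    have h1 := hS.1 q hq.1
    exact ⟨(hx _ hq.2).trans h1.1, h1.2, (finish_le_completion hq.1).trans (hmax _ hq.2)⟩
  have hjs := hX hj
  simp only [Schedule.scheduled, List.mem_toFinset, List.mem_map] at hjs
  obtain ⟨q, hq, hqj⟩ := hjs
  have h0 := hb q (by rw [List.mem_filter, decide_eq_true_eq, hqj]; exact ⟨hq, hj⟩)
  have h1 := sum_len_le _ (S.filter (fun q => decide (q.job ∈ X))) x (I.completion S j) rfl
    (h0.1.trans (h0.2.1.le.trans h0.2.2)) (hS.2.1.filter _) hb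
  have h2 : ∑ i ∈ X, ((S.piecesOf i).map Piece.len).sum = ∑ i ∈ X, I.p i :=
    Finset.sum_congr rfl (fun i hi => hS.2.2.1 i (hX hi))
  rw [sum_len_of_jobs, h2] at h1
  linarith

/-- Left shift in the order of completion. The last clause records that the shifted jobs end no
later than some completion time among them (or at `u`), which is what the next job needs in order to
start in time. -/
theorem exists_nest_nonpreemptive (hI : I.Admissible) (C : Fin I.n → K) (u : K)
    (m : ℕ) : ∀ Z : Finset (Fin I.n), Z.card = m → (∀ j ∈ Z, u ≤ I.r j ∧ I.r j + I.p j ≤ C j) →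
    (∀ i ∈ Z, ∀ j ∈ Z, i ≠ j → C i + I.p j ≤ C j ∨ C j + I.p i ≤ C i) →
    ∃ (h : ℕ) (J : List (Fin I.n)) (c E : K), Nest I mode h u E J c ∧ J.Nodup ∧ J.toFinset = Z ∧
      h ≤ 8 * m ∧ c ≤ ∑ j ∈ Z, (I.w j (C j) - I.e j) ∧ (E = u ∨ ∃ j ∈ Z, E ≤ C j) := by
  induction m with
  | zero =>
    intro Z hZ _ _
    rw [Finset.card_eq_zero] at hZ
    subst hZ
    exact ⟨0, [], 0, u, .nil u, by simp, by simp, by simp, by simp, Or.inl rfl⟩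
  | succ m ih =>
    intro Z hZ hu hC
    obtain ⟨j, hjZ, hjmax⟩ := Z.exists_max_image C (Finset.card_pos.mp (by omega))
    obtain ⟨h, J, c, E, hN, hJ, hJZ, hh, hc, hE⟩ := ih (Z.erase j)
      (by rw [Finset.card_erase_of_mem hjZ]; omega) (fun i hi => hu i (Finset.mem_of_mem_erase hi))
      (fun i hi i' hi' => hC i (Finset.mem_of_mem_erase hi) i' (Finset.mem_of_mem_erase hi'))
    have hjJ : j ∉ J := by rw [← List.mem_toFinset, hJZ]; simp
    have hpj := hI.1 j
    -- `S` is the later one of `E` and `I.r j`; an idle interval is needed only when it is the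
    -- release date.
    have key : ∃ S, E ≤ S ∧ I.r j ≤ S ∧ S + I.p j ≤ C j ∧ ∃ h₁, h₁ ≤ h + 1 ∧
        Nest I mode h₁ u S J c := by
      rcases le_or_gt E (I.r j) with hle | hlt
      · exact ⟨I.r j, hle, le_rfl, (hu j hjZ).2, h + 1, le_rfl, by
          simpa using hN.append (Nest.idle E j hle)⟩
      · refine ⟨E, le_rfl, hlt.le, ?_, h, by omega, hN⟩
        rcases hE with rfl | ⟨i, hi, hEi⟩
        · exact absurd (hu j hjZ).1 (not_le.mpr hlt)
        · have hij : i ≠ j := Finset.ne_of_mem_erase hi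
          have hiZ := Finset.mem_of_mem_erase hi
          rcases hC i hiZ j hjZ hij with h | h
          · linarith
          · have := hjmax i hiZ
            have := hI.1 i
            linarith
    obtain ⟨S, hES, hrS, hSC, h₁, hh₁, hN₁⟩ := key
    have h2 := hN₁.append (Nest.close j (Nest.nil S) hrS (by simpa using hpj.le) (fun _ => rfl))
    simp only [Problem.work_nil, add_zero, zero_add] at h2
    have hset : (J ++ [j]).toFinset = Z := by
      ext i
      have : i ∈ J ↔ i ∈ Z.erase j := by rw [← hJZ, List.mem_toFinset]
      simp only [List.mem_toFinset, List.mem_append, List.mem_singleton, this, Finset.mem_erase]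
      by_cases hij : i = j
      · subst hij; simp [hjZ]
      · simp [hij]
    refine ⟨_, _, _, _, h2, ?_, hset, by omega, ?_, Or.inr ⟨j, hjZ, hSC⟩⟩
    · rw [List.nodup_append']
      exact ⟨hJ, List.nodup_singleton j, by simpa using hjJ⟩
    · have hrD : I.r j ≤ S + I.p j := by linarith
      have hw := hI.2 j (Set.mem_Ici.mpr hrD) (Set.mem_Ici.mpr (hrD.trans hSC)) hSC
      rw [← Finset.sum_erase_add _ _ hjZ]
      linarith

theorem completion_nonpreemptive {S : Schedule K I.n} (hS : I.Feasible .nonpreemptive S)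
    {q : Piece K I.n} (hq : q ∈ S) :
    I.completion S q.job = q.finish ∧ q.finish - q.start = I.p q.job := by
  have hnd : (S.map Piece.job).Nodup := hS.2.2.2.2
  have hpieces : S.piecesOf q.job = [q] := by
    clear hS
    simp only [Schedule.piecesOf]
    induction S with
    | nil => simp at hq
    | cons q' S ih =>
      rw [List.map_cons, List.nodup_cons] at hnd
      rcases List.mem_cons.mp hq with rfl | hq
      · simp only [List.filter_cons, decide_true, if_true, List.cons.injEq, true_and,
          List.filter_eq_nil_iff, decide_eq_true_eq]
        intro q' hq' he
        exact hnd.1 (he ▸ List.mem_map_of_mem hq')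
      · have : q'.job ≠ q.job := fun he => hnd.1 (he ▸ List.mem_map_of_mem hq)
        simp only [List.filter_cons, this, decide_false, Bool.false_eq_true, if_false]
        exact ih hq hnd.2
  have h1 := hS.1 q hq
  have h2 := hS.2.2.1 q.job (by
    simp only [Schedule.scheduled, List.mem_toFinset]
    exact List.mem_map_of_mem hq)
  rw [hpieces] at h2
  refine ⟨?_, by simpa using h2⟩
  rw [Problem.completion, hpieces]
  simpa using h1.1.trans h1.2.le

/-- Every feasible schedule that is not empty is dominated by a nested schedule. -/
theorem Problem.Feasible.exists_nest (hI : I.Admissible) {S : Schedule K I.n}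
    (hS : I.Feasible mode S) (h0 : S.scheduled.Nonempty) :
    ∃ (h : ℕ) (b : Fin I.n) (v : K) (J : List (Fin I.n)) (c : K), Nest I mode h (I.r b) v J c ∧
      J.Nodup ∧ J.toFinset = S.scheduled ∧ h ≤ 8 * S.scheduled.card ∧
      c ≤ ∑ j ∈ S.scheduled, (I.w j (I.completion S j) - I.e j) := by
  obtain ⟨b, _, hb⟩ := S.scheduled.exists_min_image I.r h0
  cases mode with
  | preemptive =>
    obtain ⟨h, J, c, hB, hJ, hJS, hh, hc⟩ := exists_blocks hI rfl (I.completion S) (I.r b) _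
      S.scheduled rfl hb (fun X hX hX0 x hx => hS.hall X hX hX0 x hx)
    obtain ⟨h', v, hle, hN⟩ := hB.nest
    exact ⟨h', b, v, J, c, hN, hJ, hJS, hle.trans hh, hc⟩
  | nonpreemptive =>
    have hex : ∀ j ∈ S.scheduled, ∃ q ∈ S, q.job = j := by
      intro j hj
      simpa [Schedule.scheduled] using hj
    obtain ⟨h, J, c, E, hN, hJ, hJS, hh, hc, -⟩ := exists_nest_nonpreemptive
      (mode := .nonpreemptive) hI (I.completion S) (I.r b) _ S.scheduled rfl (by
        intro j hj
        obtain ⟨q, hq, rfl⟩ := hex j hj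
        obtain ⟨h1, h2⟩ := completion_nonpreemptive hS hq
        have := (hS.1 q hq).1
        exact ⟨hb _ hj, by rw [h1]; linarith⟩) (by
        intro i hi j hj hij
        obtain ⟨q, hq, rfl⟩ := hex i hi
        obtain ⟨q', hq', rfl⟩ := hex j hj
        obtain ⟨h1, h2⟩ := completion_nonpreemptive hS hq
        obtain ⟨h1', h2'⟩ := completion_nonpreemptive hS hq'
        have hne : q ≠ q' := fun h => hij (by rw [h])
        rw [h1, h1']
        have hsymm : Std.Symm (fun q q' : Piece K I.n => q.finish ≤ q'.start ∨ q'.finish ≤ q.start) :=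
          ⟨fun _ _ h => h.symm⟩
        rcases hS.2.1.forall hq hq' hne with h | h
        · left; linarith
        · right; linarith)
    exact ⟨h, b, E, J, c, hN, hJ, hJS, hh, hc⟩

/-- Measured against rejecting everything, the cost is a sum over the scheduled jobs; the dynamic
program works with these differences. -/
theorem cost_eq (I : Problem K) (S : Schedule K I.n) :
    I.cost S = ∑ j ∈ S.scheduled, (I.w j (I.completion S j) - I.e j) + ∑ j, I.e j := by
  rw [Problem.cost, Schedule.rejected, Finset.sum_sdiff_eq_sub (Finset.subset_univ _),
    Finset.sum_sub_distrib]
  ring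

end Structure

end RejSched

namespace RejSched

/-! ### Building blocks of programs -/

infixl:65 " +ₙ " => NExp.add
infixl:65 " -ₙ " => NExp.sub
infixl:65 " +ₖ " => KExp.add
infixl:65 " -ₖ " => KExp.sub
infixr:60 " ⨟ " => Cmd.seq

/-- The register `a` over `K`. -/
abbrev kr (a : ℕ) : KExp := .read a (.const 0)

/-- Assignment to a register. -/
abbrev setR (a : ℕ) (x : NExp) : Cmd := .setNat a (.const 0) x

/-- Assignment to a register over `K`. -/
abbrev setK (a : ℕ) (x : KExp) : Cmd := .setNum a (.const 0) x

/-- Conditional without alternative. -/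
abbrev ifC (b : Cond) (c : Cmd) : Cmd := .ite b c .skip

/-- `x < y` for natural numbers. -/
abbrev ltN (x y : NExp) : Cond := .natLe (x +ₙ .const 1) y

/-- `x < y` in `K`. -/
abbrev ltK (x y : KExp) : Cond := .neg (.numLe y x)

/-- Product of two numbers. -/
def mulC (o i : ℕ) (x y : NExp) : Cmd :=
  setR o (.const 0) ⨟ forC i x (setR o (rd o +ₙ y))

/-- Quotient and remainder. -/
def divModC (o r i : ℕ) (x b : NExp) : Cmd :=
  setR r x ⨟ setR o (.const 0) ⨟
    forC i x (ifC (.natLe b (rd r)) (setR r (rd r -ₙ b) ⨟ setR o (rd o +ₙ .const 1)))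

section Gadgets

variable {K : Type} [CommRing K] [LinearOrder K] [IsStrictOrderedRing K]
variable {w : ℕ → K → K} {m : Memory K}

theorem writeNat_nat (m : Memory K) (a i v b j : ℕ) :
    (m.writeNat a i v).nat b j = if b = a ∧ j = i then v else m.nat b j := by
  by_cases hb : b = a
  · subst hb; simp [Memory.writeNat, Function.update_apply]
  · simp [Memory.writeNat, hb]

@[simp] theorem writeNat_num (m : Memory K) (a i v : ℕ) : (m.writeNat a i v).num = m.num := rfl

@[simp] theorem writeNum_nat (m : Memory K) (a i : ℕ) (v : K) : (m.writeNum a i v).nat = m.nat := rfl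

theorem writeNum_num (m : Memory K) (a i : ℕ) (v : K) (b j : ℕ) :
    (m.writeNum a i v).num b j = if b = a ∧ j = i then v else m.num b j := by
  by_cases hb : b = a
  · subst hb; simp [Memory.writeNum, Function.update_apply]
  · simp [Memory.writeNum, hb]

theorem writeNat_nat_of_ne (m : Memory K) {a b : ℕ} (i v : ℕ) (h : b ≠ a) :
    (m.writeNat a i v).nat b = m.nat b := by simp [Memory.writeNat, Function.update_of_ne h]

theorem NExp.eval_write (x : NExp) {a : ℕ} (i v : ℕ) (h : x.reads a = false) :
    x.eval (m.writeNat a i v) = x.eval m :=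
  x.eval_congr (fun b hb => writeNat_nat_of_ne m i v (by rintro rfl; simp [h] at hb))

theorem Same.eval {c : Cmd} {m' : Memory K} (h : Same c m m') (x : NExp)
    (hx : ∀ a, x.reads a = true → c.wN a = false) : x.eval m' = x.eval m :=
  x.eval_congr (fun a ha => h.nat a (hx a ha))

/-- Repeated addition, so the time is linear in the first factor and independent of the second;
callers choose the small factor first. -/
theorem mulC_spec {o i : ℕ} {x y : NExp} {T : ℕ} (ho : o ≠ i) (hxo : x.reads o = false)
    (hxi : x.reads i = false) (hyo : y.reads o = false) (hyi : y.reads i = false)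
    (hT : (x.size + y.size + 20) * (x.eval m + 1) ≤ T) :
    Tri w (mulC o i x y) m T (fun m' => m'.nat o 0 = x.eval m * y.eval m) := by
  refine Tri.seq (T₁ := 3) (T₂ := (y.size + 5 + x.size + 12) * (x.eval m + 1))
    (Q' := fun m' => m' = m.writeNat o 0 0) (Tri.line rfl (by simp [Cmd.cost, NExp.size]) rfl) ?_
    (le_trans ?_ hT)
  · rintro m' - rfl
    refine Tri.forC (n := x.eval m) (T := y.size + 5)
      (fun t m' => m'.nat o 0 = t * y.eval m) (x.eval_write _ _ hxo) ?_ hxi ?_ ?_ ?_ le_rfl ?_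
    · simp [Cmd.wN, ho]
    · intro a ha
      simp only [Cmd.wN, beq_eq_false_iff_ne]
      rintro rfl; simp [hxo] at ha
    · simp [writeNat_nat, ho]
    · intro t _ m₁ hs _ hI
      refine Tri.line rfl (by simp [Cmd.cost, NExp.size]; omega) ?_
      have hy : y.eval m₁ = y.eval m := by
        refine (hs.eval y (fun a ha => ?_)).trans (y.eval_write _ _ hyo)
        have h1 : o ≠ a := by rintro rfl; simp [hyo] at ha
        have h2 : i ≠ a := by rintro rfl; simp [hyi] at ha
        simp [forC, Cmd.wN, h1, h2]
      simp [Cmd.exec, NExp.eval, writeNat_nat, ho, hI, hy]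
      ring
    · intro m₁ _ h; exact h
  · have : (x.size + y.size + 20) * (x.eval m + 1)
      = (y.size + 5 + x.size + 12) * (x.eval m + 1) + 3 * (x.eval m + 1) := by ring
    omega

theorem divModC_spec {o r i : ℕ} {x b : NExp} {T : ℕ} (hor : o ≠ r) (hoi : o ≠ i) (hri : r ≠ i)
    (hxo : x.reads o = false) (hxr : x.reads r = false) (hxi : x.reads i = false)
    (hbo : b.reads o = false) (hbr : b.reads r = false) (hbi : b.reads i = false)
    (hb : 0 < b.eval m) (hT : (2 * x.size + 2 * b.size + 40) * (x.eval m + 1) ≤ T) :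
    Tri w (divModC o r i x b) m T
      (fun m' => m'.nat o 0 = x.eval m / b.eval m ∧ m'.nat r 0 = x.eval m % b.eval m) := by
  refine Tri.seq (T₁ := x.size + 2) (T₂ := (2 * b.size + 20 + x.size + 12) * (x.eval m + 1) + 3)
    (Q' := fun m' => m' = m.writeNat r 0 (x.eval m))
    (Tri.line rfl (by simp [Cmd.cost, NExp.size]; omega) rfl) ?_ (le_trans ?_ hT)
  · rintro m' - rfl
    refine Tri.seq (T₁ := 3) (T₂ := (2 * b.size + 20 + x.size + 12) * (x.eval m + 1))
      (Q' := fun m' => m' = (m.writeNat r 0 (x.eval m)).writeNat o 0 0)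
      (Tri.line rfl (by simp [Cmd.cost, NExp.size]) rfl) ?_ (by omega)
    rintro m' - rfl
    -- Repeated subtraction over a fixed number of iterations. If every iteration subtracted, the
    -- quotient would be at least `x`, so the remainder would be 0 because the divisor is positive;
    -- thus the remainder is small in either case.
    refine Tri.forC (n := x.eval m) (T := 2 * b.size + 20)
      (fun t m' => m'.nat r 0 + b.eval m * m'.nat o 0 = x.eval m ∧
        (m'.nat r 0 < b.eval m ∨ t ≤ m'.nat o 0)) ?_ ?_ hxi ?_ ?_ ?_ le_rfl ?_
    · rw [x.eval_write _ _ hxo, x.eval_write _ _ hxr]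
    · simp [Cmd.wN, hoi, hri]
    · intro a ha
      have h1 : o ≠ a := by rintro rfl; simp [hxo] at ha
      have h2 : r ≠ a := by rintro rfl; simp [hxr] at ha
      simp [Cmd.wN, h1, h2]
    · simp [writeNat_nat, hoi, hri, hor.symm]
    · intro t _ m₁ hs _ hI
      have hbe : b.eval m₁ = b.eval m := by
        refine (hs.eval b (fun a ha => ?_)).trans ?_
        · have h1 : o ≠ a := by rintro rfl; simp [hbo] at ha
          have h2 : r ≠ a := by rintro rfl; simp [hbr] at ha
          have h3 : i ≠ a := by rintro rfl; simp [hbi] at ha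
          simp [forC, Cmd.wN, h1, h2, h3]
        · rw [b.eval_write _ _ hbo, b.eval_write _ _ hbr]
      refine Tri.line rfl (by simp [Cmd.cost, NExp.size, Cond.size]; omega) ?_
      obtain ⟨h1, h2⟩ := hI
      simp only [Cmd.exec, Cond.Holds, NExp.eval, hbe]
      split_ifs with hle
      · simp only [writeNat_nat, hoi, hri, hor, hor.symm, if_false, and_true,
          if_true]
        refine ⟨?_, ?_⟩
        · rw [mul_add, mul_one]; omega
        · omega
      · simp only [writeNat_nat, hoi, hri, false_and, if_false]
        exact ⟨h1, Or.inl (by omega)⟩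
    · rintro m₁ _ ⟨h1, h2⟩
      have hlt : m₁.nat r 0 < b.eval m := by
        rcases h2 with h2 | h2
        · exact h2
        · have := Nat.mul_le_mul hb h2
          by_contra hge
          omega
      rw [← h1]
      constructor
      · rw [Nat.add_mul_div_left _ _ hb, Nat.div_eq_of_lt hlt, zero_add]
      · rw [Nat.add_mul_mod_self_left, Nat.mod_eq_of_lt hlt]
  · have : (2 * x.size + 2 * b.size + 40) * (x.eval m + 1)
      = (2 * b.size + 20 + x.size + 12) * (x.eval m + 1) + (x.size + 8) * (x.eval m + 1) := by ring
    have h2 : x.size + 8 ≤ (x.size + 8) * (x.eval m + 1) := Nat.le_mul_of_pos_right _ (by omega)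
    omega

/-- Agreement on given arrays. -/
structure Agree (A B : List ℕ) (m m' : Memory K) : Prop where
  nat : ∀ a ∈ A, m'.nat a = m.nat a
  num : ∀ b ∈ B, m'.num b = m.num b

theorem Agree.refl {A B : List ℕ} (m : Memory K) : Agree A B m m :=
  ⟨fun _ _ => rfl, fun _ _ => rfl⟩

theorem Agree.trans {A B : List ℕ} {m₁ m₂ m₃ : Memory K} (h : Agree A B m₁ m₂)
    (h' : Agree A B m₂ m₃) : Agree A B m₁ m₃ :=
  ⟨fun a ha => (h'.nat a ha).trans (h.nat a ha), fun a ha => (h'.num a ha).trans (h.num a ha)⟩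

theorem Agree.sub {A B A' B' : List ℕ} {m₁ m₂ : Memory K} (h : Agree A B m₁ m₂)
    (hA : A' ⊆ A) (hB : B' ⊆ B) : Agree A' B' m₁ m₂ :=
  ⟨fun a ha => h.nat a (hA ha), fun a ha => h.num a (hB ha)⟩

theorem Same.agree {A B : List ℕ} {c : Cmd} {m' : Memory K} (h : Same c m m')
    (hA : ∀ a ∈ A, c.wN a = false) (hB : ∀ b ∈ B, c.wK b = false) : Agree A B m m' :=
  ⟨fun a ha => h.nat a (hA a ha), fun a ha => h.num a (hB a ha)⟩

theorem Agree.writeNat {A B : List ℕ} (m : Memory K) {i : ℕ} (j v : ℕ) (hi : i ∉ A) :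
    Agree A B m (m.writeNat i j v) :=
  ⟨fun a ha => writeNat_nat_of_ne m j v (by rintro rfl; exact hi ha), fun _ _ => rfl⟩

/-- Bounded loop whose iterations establish persistent facts. -/
theorem Tri.forAll {i n T T' : ℕ} {N : NExp} {body : Cmd} (Inv : Memory K → Prop)
    (Mono : Memory K → Memory K → Prop) (Done : ℕ → Memory K → Prop)
    (hn : N.eval m = n) (hi : body.wN i = false) (hNi : N.reads i = false)
    (hN : ∀ a, N.reads a = true → body.wN a = false)
    (hinv : ∀ m v, Inv m → Inv (m.writeNat i 0 v)) (hmono : ∀ m v, Mono m (m.writeNat i 0 v))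
    (htrans : ∀ m₁ m₂ m₃, Mono m₁ m₂ → Mono m₂ m₃ → Mono m₁ m₃)
    (hdone : ∀ x m₁ m₂, Mono m₁ m₂ → Done x m₁ → Done x m₂) (h0 : Inv m)
    (hbody : ∀ x < n, ∀ m₁, Same (RejSched.forC i N body) m m₁ → m₁.nat i 0 = x → Inv m₁ →
      Mono m m₁ → Tri w body m₁ T (fun m₂ => Inv m₂ ∧ Mono m₁ m₂ ∧ Done x m₂))
    (hT : (T + N.size + 12) * (n + 1) ≤ T') :
    Tri w (RejSched.forC i N body) m T' (fun m' => Inv m' ∧ Mono m m' ∧ ∀ x < n, Done x m') := by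
  refine Tri.forC (T := T) (fun t m' => Inv m' ∧ Mono m m' ∧ ∀ x < t, Done x m') hn hi hNi hN
    ⟨hinv _ _ h0, hmono _ _, by simp⟩ ?_ hT (fun m₁ _ h => h)
  rintro x hx m₁ hs hxi ⟨h1, h2, h3⟩
  refine (hbody x hx m₁ hs hxi h1 h2).mono le_rfl ?_
  rintro m₂ _ ⟨h4, h5, h6⟩
  refine ⟨hinv _ _ h4, htrans _ _ _ h2 (htrans _ _ _ h5 (hmono _ _)), fun y hy => ?_⟩
  rcases Nat.lt_succ_iff_lt_or_eq.mp hy with hy | rfl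
  · exact hdone _ _ _ (htrans _ _ _ h5 (hmono _ _)) (h3 y hy)
  · exact hdone _ _ _ (hmono _ _) h6

end Gadgets

/-! ### The dynamic program for one coloring -/

/-- Strides of the processing times of the colored jobs; total processing times of the vectors. -/
def typesC : Cmd :=
  -- Array 6 holds the colors; a color of at least `rd 4` excludes the job. Vectors of
  -- multiplicities of processing times are coded in base `rd 4 + 1`: array 7 holds the place value
  -- of each colored job, register 8 the number of codes, and array 5 over `K` the total processing
  -- time of each code.
  setR 8 (.const 1) ⨟ setK 5 .zero ⨟
  forC 25 (rd 0) (ifC (ltN (.read 6 (rd 25)) (rd 4))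
    (setR 26 (.const 0) ⨟
     forC 27 (rd 25) (ifC (.and (ltN (.read 6 (rd 27)) (rd 4))
        (.and (.numLe (.read 1 (rd 27)) (.read 1 (rd 25)))
          (.numLe (.read 1 (rd 25)) (.read 1 (rd 27)))))
        (.setNat 7 (rd 25) (.read 7 (rd 27)) ⨟ setR 26 (.const 1))) ⨟
     ifC (.natLe (rd 26) (.const 0))
       (.setNat 7 (rd 25) (rd 8) ⨟ mulC 28 29 (rd 4 +ₙ .const 1) (rd 8) ⨟
        forC 30 (rd 28 -ₙ rd 8)
          (.setNum 5 (rd 8 +ₙ rd 30) (.read 5 (rd 30) +ₖ .read 1 (rd 25))) ⨟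
        setR 8 (rd 28))))

/-- Weights of the jobs and the size of the range of weights. -/
def weightsC : Cmd :=
  setR 9 (rd 8) ⨟
  -- Array 9 holds `2 ^ i * V` with `V` the number of codes. A job with color `c` gets weight `(2 ^
  -- q + 2 ^ c) * V` plus its place value: one unit of counting, its color bit, its processing time.
  -- Color bits may carry into the count; this is resolved only when an entry is selected.
  forC 31 (rd 4) (.setNat 9 (rd 31 +ₙ .const 1) (.read 9 (rd 31) +ₙ .read 9 (rd 31))) ⨟
  forC 32 (rd 0) (.setNat 10 (rd 32)
    (.read 9 (rd 4) +ₙ .read 9 (.read 6 (rd 32)) +ₙ .read 7 (rd 32))) ⨟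
  mulC 11 33 (rd 4 +ₙ .const 1) (.read 9 (rd 4)) ⨟
  forC 34 (rd 11 -ₙ rd 8) (.setNum 5 (rd 8 +ₙ rd 34) (.read 5 (rd 34)))

/-- Address tables and the table of times. -/
def timesC : Cmd :=
  -- Arrays 13 and 14 hold the multiples of the two table strides, so later address computations
  -- need additions only. The point of time with index `b * Y + y` is release date `b` plus
  -- processing time of weight `y`.
  mulC 12 35 (rd 0) (rd 11) ⨟
  setR 13 (.const 0) ⨟
  forC 36 (rd 12) (.setNat 13 (rd 36 +ₙ .const 1) (.read 13 (rd 36) +ₙ rd 11)) ⨟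
  setR 14 (.const 0) ⨟
  forC 37 (rd 12) (.setNat 14 (rd 37 +ₙ .const 1) (.read 14 (rd 37) +ₙ .read 13 (rd 12))) ⨟
  forC 38 (rd 0) (forC 39 (rd 11)
    (.setNum 6 (.read 13 (rd 38) +ₙ rd 39) (.read 0 (rd 38) +ₖ .read 5 (rd 39))))

/-- The address of an entry of the table. -/
abbrev kapE (x y v : NExp) : NExp := .read 14 x +ₙ .read 13 y +ₙ v

/-- Enter the empty schedule from `x` to `y`. -/
def emptyC (x y : NExp) : Cmd :=
  setR 43 (kapE x y (.const 0)) ⨟ .setNat 15 (rd 43) (.const 1) ⨟ .setNat 16 (rd 43) (.const 0) ⨟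
    .setNat 17 (rd 43) (.const 0) ⨟ .setNum 7 (rd 43) .zero

/-- Initial table. -/
def initC : Cmd :=
  forC 40 (.read 14 (rd 12)) (.setNat 15 (rd 40) (.const 0)) ⨟
  forC 41 (rd 12) (emptyC (rd 41) (rd 41) ⨟
    forC 42 (rd 0) (ifC (.numLe (.read 6 (rd 41)) (.read 6 (.read 13 (rd 42))))
      (emptyC (rd 41) (.read 13 (rd 42)))))

/-- Enter the candidate at the top of the heap if it is better. -/
def relaxC : Cmd :=
  -- The heap of schedules only grows: a candidate is written beyond its end and accepted by moving
  -- the end. A candidate that is not accepted is overwritten by the next one.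
  ifC (.neg (.and (.natLe (.const 1) (.read 15 (rd 46))) (.numLe (.read 7 (rd 46)) (kr 11))))
    (.setNat 15 (rd 46) (.const 1) ⨟ .setNum 7 (rd 46) (kr 11) ⨟ .setNat 16 (rd 46) (rd 18) ⨟
      .setNat 17 (rd 46) (rd 47) ⨟ setR 18 (rd 18 +ₙ rd 47))

/-- Write a cell of the heap. -/
def cellC (a j : NExp) (x y : KExp) : Cmd := .setNat 19 a j ⨟ .setNum 8 a x ⨟ .setNum 9 a y

/-- Copy a part of the heap. -/
def copyC (i : ℕ) (src dst len : NExp) : Cmd :=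
  forC i len (cellC (dst +ₙ rd i) (.read 19 (src +ₙ rd i)) (.read 8 (src +ₙ rd i))
    (.read 9 (src +ₙ rd i)))

/-- Concatenation of two entries. -/
def concatC : Cmd :=
  setR 45 (kapE (rd 50) (rd 52) (rd 53)) ⨟
  ifC (.and (.natLe (.const 1) (.read 15 (rd 45))) (ltN (rd 51 +ₙ rd 53) (rd 11)))
    (setR 46 (kapE (rd 49) (rd 52) (rd 51 +ₙ rd 53)) ⨟
     copyC 55 (.read 16 (rd 44)) (rd 18) (.read 17 (rd 44)) ⨟
     copyC 56 (.read 16 (rd 45)) (rd 18 +ₙ .read 17 (rd 44)) (.read 17 (rd 45)) ⨟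
     setR 47 (.read 17 (rd 44) +ₙ .read 17 (rd 45)) ⨟
     setK 11 (.read 7 (rd 44) +ₖ .read 7 (rd 45)) ⨟ relaxC)

/-- Emit a piece. -/
def emitC (j : NExp) (x y : KExp) : Cmd :=
  cellC (rd 18 +ₙ rd 47) j x y ⨟ setR 47 (rd 47 +ₙ .const 1)

/-- The test of the mode. -/
def modeCond : Mode → Cond
  | .preemptive => .natLe (.const 0) (.const 0)
  | .nonpreemptive => .natLe (rd 51) (.const 0)

/-- One more piece of the open job (before the piece at `src`), then the piece at `src`. -/
def fillStepC : Cmd :=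
  setR 68 (.read 16 (rd 44) +ₙ rd 57) ⨟
  ifC (ltK (kr 12) (.read 8 (rd 68))) (emitC (rd 54) (kr 12) (.read 8 (rd 68))) ⨟
  emitC (.read 19 (rd 68)) (.read 8 (rd 68)) (.read 9 (rd 68)) ⨟
  setK 12 (.read 9 (rd 68))

/-- The condition for closing an entry. -/
def closeCond (mode : Mode) : Cond :=
  .and (ltN (.read 6 (rd 54)) (rd 4)) (.and (ltN (rd 59) (rd 11)) (.and (ltN (rd 58) (rd 12))
    (.and (.numLe (.read 0 (rd 54)) (.read 6 (rd 49)))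
    (.and (.numLe (.read 6 (rd 50)) (.read 6 (rd 58)))
    (.and (.numLe (.read 6 (rd 58)) (.read 6 (rd 49) +ₖ .read 5 (rd 51) +ₖ .read 1 (rd 54)))
    (.and (.numLe (.read 6 (rd 49) +ₖ .read 5 (rd 51) +ₖ .read 1 (rd 54)) (.read 6 (rd 58)))
      (modeCond mode)))))))

/-- Addition of a job that fills the gaps of an entry. -/
def closeC (mode : Mode) : Cmd :=
  setR 59 (rd 51 +ₙ .read 10 (rd 54)) ⨟ setR 58 (rd 49 +ₙ rd 59) ⨟
  ifC (closeCond mode)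
    (setR 46 (kapE (rd 49) (rd 58) (rd 59)) ⨟ setR 47 (.const 0) ⨟ setK 12 (.read 6 (rd 49)) ⨟
     forC 57 (.read 17 (rd 44)) fillStepC ⨟
     ifC (ltK (kr 12) (.read 6 (rd 58))) (emitC (rd 54) (kr 12) (.read 6 (rd 58))) ⨟
     setK 11 (.read 7 (rd 44) +ₖ (.query (rd 54) (.read 6 (rd 58)) -ₖ .read 2 (rd 54))) ⨟ relaxC)

/-- One round. -/
def roundC (mode : Mode) : Cmd :=
  forC 49 (rd 12) (forC 50 (rd 12) (forC 51 (rd 11)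
    (setR 44 (kapE (rd 49) (rd 50) (rd 51)) ⨟
     ifC (.natLe (.const 1) (.read 15 (rd 44)))
       (forC 52 (rd 12) (forC 53 (rd 11) concatC) ⨟ forC 54 (rd 0) (closeC mode)))))

/-- All rounds. -/
def roundsC (mode : Mode) : Cmd :=
  -- Three doublings give the `8 * q` rounds that the height of the derivations requires.
  setR 60 (rd 4 +ₙ rd 4) ⨟ setR 60 (rd 60 +ₙ rd 60) ⨟ setR 60 (rd 60 +ₙ rd 60) ⨟
  forC 48 (rd 60) (roundC mode)

/-- Look for an entry that uses every color once and is better than the best schedule so far. -/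
def selectC : Cmd :=
  -- The smallest admissible weight: `q` units of counting and all color bits. Adding any code below
  -- `rd 8` covers all possible multiplicities of processing times.
  mulC 65 66 (rd 4) (.read 9 (rd 4)) ⨟ setR 65 (rd 65 +ₙ .read 9 (rd 4) -ₙ rd 8) ⨟
  forC 61 (rd 0) (forC 62 (rd 12) (forC 63 (rd 8)
    (setR 64 (kapE (.read 13 (rd 61)) (rd 62) (rd 65 +ₙ rd 63)) ⨟
     ifC (.and (.natLe (.const 1) (.read 15 (rd 64))) (ltK (.read 7 (rd 64)) (kr 10)))
       (setK 10 (.read 7 (rd 64)) ⨟ setR 20 (.read 16 (rd 64)) ⨟ setR 21 (.read 17 (rd 64))))))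

/-- The dynamic program. -/
def runC (mode : Mode) : Cmd :=
  typesC ⨟ weightsC ⨟ timesC ⨟ initC ⨟ roundsC mode ⨟ selectC

end RejSched

namespace RejSched

section Dynamic

variable {K : Type} [CommRing K] [LinearOrder K] [IsStrictOrderedRing K]
variable {w : ℕ → K → K} {I : Problem K} {mode : Mode}

/-! ### Correctness of the rounds -/

/-- Arrays that are fixed during the rounds. -/
def fixN : List ℕ := [0, 4, 6, 8, 9, 10, 11, 12, 13, 14]
/-- Arrays over `K` that are fixed during the rounds. -/
def fixK : List ℕ := [0, 1, 2, 5, 6]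
/-- Arrays on which the state of the dynamic program depends. -/
def coreN : List ℕ := [0, 4, 6, 8, 9, 10, 11, 12, 13, 14, 15, 16, 17, 18, 19, 20, 21]
/-- Arrays over `K` on which the state of the dynamic program depends. -/
def coreK : List ℕ := [0, 1, 2, 5, 6, 7, 8, 9, 10]

/-- The grid stored in the memory. -/
def gridOf (n : ℕ) (m : Memory K) : Grid K n where
  T := m.num 6
  P := m.num 5
  NT := m.nat 12 0
  Y := m.nat 11 0
  wt j := m.nat 10 j
  ok j := m.nat 6 j < m.nat 4 0
  anc b := b * m.nat 11 0

theorem gridOf_congr {m m' : Memory K} (h : Agree fixN fixK m m') (n : ℕ) :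
    gridOf n m' = gridOf n m := by
  simp [gridOf, h.nat 4 (by simp [fixN]), h.nat 6 (by simp [fixN]), h.nat 10 (by simp [fixN]),
    h.nat 11 (by simp [fixN]), h.nat 12 (by simp [fixN]), h.num 5 (by simp [fixK]),
    h.num 6 (by simp [fixK])]

/-- A cell of the heap. -/
def cell (m : Memory K) (x : ℕ) : ℕ × K × K := (m.nat 19 x, m.num 8 x, m.num 9 x)

/-- The contents of a cell that represents a piece. -/
def Piece.toCell {n : ℕ} (q : Piece K n) : ℕ × K × K := (q.job, q.start, q.finish)

/-- The list `L` is stored at position `a` of the heap. -/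
def Slice {n : ℕ} (m : Memory K) (a : ℕ) (L : Schedule K n) : Prop :=
  ∀ (i : ℕ) (h : i < L.length), cell m (a + i) = L[i].toCell

theorem Slice.congr {n : ℕ} {m m' : Memory K} {a : ℕ} {L : Schedule K n} (h : Slice m a L)
    (hc : ∀ x, a ≤ x → x < a + L.length → cell m' x = cell m x) : Slice m' a L := by
  intro i hi
  rw [hc _ (by omega) (by omega), h i hi]

theorem Slice.append {n : ℕ} {m : Memory K} {a : ℕ} {L L' : Schedule K n} (h : Slice m a L)
    (h' : Slice m (a + L.length) L') : Slice m a (L ++ L') := by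
  intro i hi
  rw [List.length_append] at hi
  by_cases hlt : i < L.length
  · rw [List.getElem_append_left hlt]; exact h i hlt
  · rw [List.getElem_append_right (by omega), ← h' (i - L.length) (by omega)]
    congr 1; omega

/-- Address of an entry of the table. -/
def kap (m : Memory K) (τ₀ τ₁ y : ℕ) : ℕ :=
  τ₀ * (m.nat 12 0 * m.nat 11 0) + τ₁ * m.nat 11 0 + y

theorem kap_inj {m : Memory K} {τ₀ τ₁ y τ₀' τ₁' y' : ℕ} (h1 : τ₁ < m.nat 12 0) (hy : y < m.nat 11 0)
    (h1' : τ₁' < m.nat 12 0) (hy' : y' < m.nat 11 0)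
    (h : kap m τ₀ τ₁ y = kap m τ₀' τ₁' y') : τ₀ = τ₀' ∧ τ₁ = τ₁' ∧ y = y' := by
  have key : ∀ {B a b c d : ℕ}, b < B → d < B → a * B + b = c * B + d → a = c ∧ b = d := by
    intro B a b c d hb hd he
    have hB : 0 < B := by omega
    have h1 : (a * B + b) / B = a := by
      rw [mul_comm, Nat.mul_add_div hB, Nat.div_eq_of_lt hb, add_zero]
    have h2 : (c * B + d) / B = c := by
      rw [mul_comm, Nat.mul_add_div hB, Nat.div_eq_of_lt hd, add_zero]
    have : a = c := by rw [← h1, he, h2]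
    subst this
    exact ⟨rfl, by omega⟩
  simp only [kap] at h
  rw [← mul_assoc, ← add_mul, ← mul_assoc, ← add_mul] at h
  obtain ⟨h2, h3⟩ := key hy hy' h
  obtain ⟨h4, h5⟩ := key h1 h1' h2
  exact ⟨h4, h5, h3⟩

/-- The tables that describe the instance and the coloring. -/
structure Env (I : Problem K) (m : Memory K) : Prop where
  n_eq : m.nat 0 0 = I.n
  r_eq : ∀ j : Fin I.n, m.num 0 j = I.r j
  p_eq : ∀ j : Fin I.n, m.num 1 j = I.p j
  e_eq : ∀ j : Fin I.n, m.num 2 j = I.e j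
  R1 : ∀ τ ≤ m.nat 12 0, m.nat 13 τ = τ * m.nat 11 0
  R2 : ∀ τ ≤ m.nat 12 0, m.nat 14 τ = τ * (m.nat 12 0 * m.nat 11 0)
  NT_eq : m.nat 12 0 = I.n * m.nat 11 0
  Y_pos : 0 < m.nat 11 0

theorem Env.congr {m m' : Memory K} (h : Agree fixN fixK m m') (hE : Env I m) : Env I m' := by
  obtain ⟨h1, h2, h3, h4, h5, h6, h7, h8⟩ := hE
  have e0 := h.nat 0 (by simp [fixN])
  have e11 := h.nat 11 (by simp [fixN])
  have e12 := h.nat 12 (by simp [fixN])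
  have e13 := h.nat 13 (by simp [fixN])
  have e14 := h.nat 14 (by simp [fixN])
  have k0 := h.num 0 (by simp [fixK])
  have k1 := h.num 1 (by simp [fixK])
  have k2 := h.num 2 (by simp [fixK])
  constructor <;> simp only [e0, e11, e12, e13, e14, k0, k1, k2] <;> assumption

theorem Env.anc_lt {m : Memory K} (hE : Env I m) (b : Fin I.n) : (gridOf I.n m).anc b < (gridOf I.n m).NT := by
  simp only [gridOf, hE.NT_eq]
  exact Nat.mul_lt_mul_of_pos_right b.2 hE.Y_pos

/-- The state of the dynamic program: all entries of the table are derivable. -/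
structure Dyn (I : Problem K) (mode : Mode) (m : Memory K) : Prop where
  env : Env I m
  sound : ∀ τ₀ τ₁ y, τ₀ < m.nat 12 0 → τ₁ < m.nat 12 0 → y < m.nat 11 0 →
    m.nat 15 (kap m τ₀ τ₁ y) ≠ 0 →
    ∃ (h : ℕ) (L : Schedule K I.n) (J : List (Fin I.n)),
      Der I mode (gridOf I.n m) h τ₀ τ₁ y (m.num 7 (kap m τ₀ τ₁ y)) L J ∧
      Slice m (m.nat 16 (kap m τ₀ τ₁ y)) L ∧ m.nat 17 (kap m τ₀ τ₁ y) = L.length ∧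
      m.nat 16 (kap m τ₀ τ₁ y) + L.length ≤ m.nat 18 0

theorem fix_of_core {m m' : Memory K} (h : Agree coreN coreK m m') : Agree fixN fixK m m' :=
  h.sub (by simp [fixN, coreN]) (by simp [fixK, coreK])

theorem kap_congr {m m' : Memory K} (h : Agree fixN fixK m m') : kap m' = kap m := by
  funext a b c
  simp [kap, h.nat 12 (by simp [fixN]), h.nat 11 (by simp [fixN])]

theorem Dyn.congr {m m' : Memory K} (h : Agree coreN coreK m m') (hD : Dyn I mode m) :
    Dyn I mode m' := by
  refine ⟨hD.env.congr (fix_of_core h), ?_⟩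
  have hs := hD.sound
  have e11 := h.nat 11 (by simp [coreN])
  have e12 := h.nat 12 (by simp [coreN])
  have e15 := h.nat 15 (by simp [coreN])
  have e16 := h.nat 16 (by simp [coreN])
  have e17 := h.nat 17 (by simp [coreN])
  have e18 := h.nat 18 (by simp [coreN])
  have e19 := h.nat 19 (by simp [coreN])
  have k7 := h.num 7 (by simp [coreK])
  have k8 := h.num 8 (by simp [coreK])
  have k9 := h.num 9 (by simp [coreK])
  simp only [kap_congr (fix_of_core h), gridOf_congr (fix_of_core h), e11, e12, e15, e16, e17, e18,
    k7, Slice, cell, e19, k8, k9]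
  exact hs

/-- Progress of the dynamic program. -/
structure Mono (m m' : Memory K) : Prop where
  fix : Agree fixN fixK m m'
  best : Agree [20, 21] [10] m m'
  hp : m.nat 18 0 ≤ m'.nat 18 0
  heap : ∀ x < m.nat 18 0, cell m' x = cell m x
  tab : ∀ κ, m.nat 15 κ ≠ 0 → m'.nat 15 κ ≠ 0 ∧ m'.num 7 κ ≤ m.num 7 κ

theorem Mono.of_core {m m' : Memory K} (h : Agree coreN coreK m m') : Mono m m' where
  fix := fix_of_core h
  best := h.sub (by simp [coreN]) (by simp [coreK])
  hp := by rw [h.nat 18 (by simp [coreN])]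
  heap x _ := by
    simp [cell, h.nat 19 (by simp [coreN]), h.num 8 (by simp [coreK]), h.num 9 (by simp [coreK])]
  tab κ hκ := by
    rw [h.nat 15 (by simp [coreN]), h.num 7 (by simp [coreK])]; exact ⟨hκ, le_rfl⟩

theorem Mono.trans {m₁ m₂ m₃ : Memory K} (h : Mono m₁ m₂) (h' : Mono m₂ m₃) : Mono m₁ m₃ where
  fix := h.fix.trans h'.fix
  best := h.best.trans h'.best
  hp := h.hp.trans h'.hp
  heap x hx := (h'.heap x (lt_of_lt_of_le hx h.hp)).trans (h.heap x hx)
  tab κ hκ := by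
    obtain ⟨h1, h2⟩ := h.tab κ hκ
    obtain ⟨h3, h4⟩ := h'.tab κ h1
    exact ⟨h3, h4.trans h2⟩

/-- The table has an entry of cost at most `c`. -/
def Has (m : Memory K) (κ : ℕ) (c : K) : Prop := m.nat 15 κ ≠ 0 ∧ m.num 7 κ ≤ c

theorem Has.mono {m m' : Memory K} {κ : ℕ} {c : K} (hM : Mono m m') (h : Has m κ c) : Has m' κ c :=
  ⟨(hM.tab κ h.1).1, (hM.tab κ h.1).2.trans h.2⟩

/-- Agreement on everything but the free part of the heap and scratch registers. -/
structure HeapStep (m m' : Memory K) : Prop where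
  core : Agree [0, 4, 6, 8, 9, 10, 11, 12, 13, 14, 15, 16, 17, 18, 20, 21] [0, 1, 2, 5, 6, 7, 10] m m'
  heap : ∀ x < m.nat 18 0, cell m' x = cell m x

theorem HeapStep.dyn {m m' : Memory K} (h : HeapStep m m') (hD : Dyn I mode m) : Dyn I mode m' := by
  have hf : Agree fixN fixK m m' := h.core.sub (by simp [fixN]) (by simp [fixK])
  refine ⟨hD.env.congr hf, ?_⟩
  have hs := hD.sound
  simp only [kap_congr hf, gridOf_congr hf, h.core.nat 11 (by simp), h.core.nat 12 (by simp),
    h.core.nat 15 (by simp), h.core.nat 16 (by simp), h.core.nat 17 (by simp),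
    h.core.nat 18 (by simp), h.core.num 7 (by simp)]
  intro τ₀ τ₁ y h0 h1 hy hT
  obtain ⟨h', L, J, a1, a2, a3, a4⟩ := hs τ₀ τ₁ y h0 h1 hy hT
  exact ⟨h', L, J, a1, a2.congr (fun x _ hx => h.heap x (by omega)), a3, a4⟩

theorem HeapStep.mono {m m' : Memory K} (h : HeapStep m m') : Mono m m' where
  fix := h.core.sub (by simp [fixN]) (by simp [fixK])
  best := h.core.sub (by simp) (by simp)
  hp := by rw [h.core.nat 18 (by simp)]
  heap := h.heap
  tab κ hκ := by rw [h.core.nat 15 (by simp), h.core.num 7 (by simp)]; exact ⟨hκ, le_rfl⟩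

theorem HeapStep.trans {m₁ m₂ m₃ : Memory K} (h : HeapStep m₁ m₂) (h' : HeapStep m₂ m₃) :
    HeapStep m₁ m₃ where
  core := h.core.trans h'.core
  heap x hx := (h'.heap x (by rw [h.core.nat 18 (by simp)]; exact hx)).trans (h.heap x hx)

theorem HeapStep.of_same {c : Cmd} {m m' : Memory K} (h : Same c m m')
    (hN : ∀ a ∈ coreN, c.wN a = false) (hK : ∀ a ∈ coreK, c.wK a = false) : HeapStep m m' := by
  have hA : Agree coreN coreK m m' := h.agree hN hK
  refine ⟨hA.sub (by simp [coreN]) (by simp [coreK]), fun x _ => ?_⟩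
  simp [cell, hA.nat 19 (by simp [coreN]), hA.num 8 (by simp [coreK]), hA.num 9 (by simp [coreK])]

/-- The candidate has to be derivable and to lie at the end of the heap. Whether it is accepted or
not, afterwards the entry costs at most as much as the candidate, and no entry has become worse. -/
theorem relaxC_spec {m : Memory K} (hD : Dyn I mode m) {h τ₀ τ₁ y : ℕ} {L : Schedule K I.n}
    {J : List (Fin I.n)} (d : Der I mode (gridOf I.n m) h τ₀ τ₁ y (m.num 11 0) L J)
    (hk : m.nat 46 0 = kap m τ₀ τ₁ y) (hS : Slice m (m.nat 18 0) L) (hl : m.nat 47 0 = L.length) :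
    Tri w relaxC m 100 (fun m' => Dyn I mode m' ∧ Mono m m' ∧
      Has m' (kap m τ₀ τ₁ y) (m.num 11 0)) := by
  obtain ⟨hτ₀, hτ₁, hy, -⟩ := d.basic hD.env.Y_pos hD.env.anc_lt
  refine Tri.line rfl (by decide) ?_
  simp only [relaxC, Cmd.exec]
  split_ifs with hc
  swap
  · simp only [Cond.Holds, NExp.eval, KExp.eval, not_not] at hc
    rw [hk] at hc
    exact ⟨hD, Mono.of_core (Agree.refl m), by have := hc.1; omega, hc.2⟩
  set κ := kap m τ₀ τ₁ y with hκ
  simp only [Cond.Holds, NExp.eval, KExp.eval, hk] at hc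
  simp only [NExp.eval, KExp.eval, writeNat_nat, writeNat_num, writeNum_nat, hk, hl]
  norm_num
  set m' : Memory K := (((((m.writeNat 15 κ 1).writeNum 7 κ (m.num 11 0)).writeNat 16 κ
    (m.nat 18 0)).writeNat 17 κ L.length).writeNat 18 0 (m.nat 18 0 + L.length)) with hm'
  have hfix : Agree fixN fixK m m' := by
    constructor
    · intro a ha
      simp only [fixN, List.mem_cons, List.not_mem_nil, or_false] at ha
      funext j
      rcases ha with rfl | rfl | rfl | rfl | rfl | rfl | rfl | rfl | rfl | rfl <;>
        simp [hm', writeNat_nat]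
    · intro a ha
      simp only [fixK, List.mem_cons, List.not_mem_nil, or_false] at ha
      funext j
      rcases ha with rfl | rfl | rfl | rfl | rfl <;> simp [hm', writeNum_num]
  have e15 : ∀ x, m'.nat 15 x = if x = κ then 1 else m.nat 15 x := by
    intro x; simp [hm', writeNat_nat]
  have e16 : ∀ x, m'.nat 16 x = if x = κ then m.nat 18 0 else m.nat 16 x := by
    intro x; simp [hm', writeNat_nat]
  have e17 : ∀ x, m'.nat 17 x = if x = κ then L.length else m.nat 17 x := by
    intro x; simp [hm', writeNat_nat]
  have e18 : m'.nat 18 0 = m.nat 18 0 + L.length := by simp [hm', writeNat_nat]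
  have k7 : ∀ x, m'.num 7 x = if x = κ then m.num 11 0 else m.num 7 x := by
    intro x; simp [hm', writeNum_num]
  have hcell : ∀ x, cell m' x = cell m x := by
    intro x; simp [hm', cell, writeNat_nat, writeNum_num]
  refine ⟨⟨hD.env.congr hfix, ?_⟩, ⟨hfix, ?_, by omega, fun x _ => hcell x, ?_⟩, ?_⟩
  · rw [gridOf_congr hfix, kap_congr hfix, hfix.nat 12 (by simp [fixN]), hfix.nat 11 (by simp [fixN])]
    intro τ₀' τ₁' y' h0' h1' hy' hT
    rw [e15] at hT
    rw [e16, e17, k7, e18]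
    by_cases hκ' : kap m τ₀' τ₁' y' = κ
    · obtain ⟨rfl, rfl, rfl⟩ := kap_inj h1' hy' hτ₁ hy hκ'
      simp only [hκ, if_true]
      exact ⟨h, L, J, d, hS.congr (fun x _ _ => hcell x), rfl, le_rfl⟩
    · simp only [hκ', if_false] at hT ⊢
      obtain ⟨h', L', J', a1, a2, a3, a4⟩ := hD.sound τ₀' τ₁' y' h0' h1' hy' hT
      exact ⟨h', L', J', a1, a2.congr (fun x _ _ => hcell x), a3, by omega⟩
  · constructor
    · intro a ha
      simp only [List.mem_cons, List.not_mem_nil, or_false] at ha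
      funext j
      rcases ha with rfl | rfl <;> simp [hm', writeNat_nat]
    · intro a ha
      simp only [List.mem_cons, List.not_mem_nil, or_false] at ha
      funext j
      subst ha; simp [hm', writeNum_num]
  · intro x hx
    rw [e15, k7]
    by_cases hxκ : x = κ
    · subst hxκ
      simp only [if_true]
      refine ⟨one_ne_zero, ?_⟩
      by_contra hlt
      exact hc ⟨by omega, (not_le.mp hlt).le⟩
    · simp only [hxκ, if_false]
      exact ⟨hx, le_rfl⟩
  · exact ⟨by rw [e15]; simp, by rw [k7]; simp⟩

/-- A cell is written by three successive assignments, so the later expressions must not depend on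
the earlier writes; `hx` and `hy` demand this. -/
theorem cell_cellC (m : Memory K) {a j : NExp} {x y : KExp} {A : ℕ} (hA : a.eval m = A)
    (ha19 : a.reads 19 = false)
    (hx : ∀ v, x.eval w (m.writeNat 19 A v) = x.eval w m)
    (hy : ∀ v u, y.eval w ((m.writeNat 19 A v).writeNum 8 A u) = y.eval w m) (z : ℕ) :
    cell ((cellC a j x y).exec w m) z
      = if z = A then (j.eval m, x.eval w m, y.eval w m) else cell m z := by
  have h1 : ∀ v, a.eval (m.writeNat 19 A v) = A := by
    intro v; rw [a.eval_write _ _ ha19, hA]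
  have h2 : ∀ v u, a.eval ((m.writeNat 19 A v).writeNum 8 A u) = A := by
    intro v u
    rw [a.eval_congr (m := m.writeNat 19 A v) (by simp), h1]
  simp only [cellC, Cmd.exec, hA, h1, h2, hx, hy]
  by_cases hz : z = A
  · subst hz
    simp [cell, writeNat_nat, writeNum_num]
  · simp [cell, writeNat_nat, writeNum_num, hz]

/-- Copying within the heap. -/
theorem copyC_spec {m : Memory K} {i n s d T : ℕ} {src dst len : NExp} (hn : len.eval m = n)
    (hs : src.eval m = s) (hd : dst.eval m = d) (hi : i ≠ 19)
    (hlen : ∀ a, len.reads a = true → a ≠ 19 ∧ a ≠ i)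
    (hsrc : ∀ a, src.reads a = true → a ≠ 19 ∧ a ≠ i)
    (hdst : ∀ a, dst.reads a = true → a ≠ 19 ∧ a ≠ i) (hle : s + n ≤ d)
    (hT : (3 * src.size + 3 * dst.size + len.size + 60) * (n + 1) ≤ T) :
    Tri w (copyC i src dst len) m T (fun m' =>
      (∀ x < n, cell m' (d + x) = cell m (s + x)) ∧ ∀ z < d, cell m' z = cell m z) := by
  have hev : ∀ (x : NExp), (∀ a, x.reads a = true → a ≠ 19 ∧ a ≠ i) → ∀ m₁,
      Same (copyC i src dst len) m m₁ → x.eval m₁ = x.eval m := by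
    intro x hx m₁ h
    refine h.eval x (fun a ha => ?_)
    have := hx a ha
    simp [copyC, forC, cellC, Cmd.wN, this.1.symm, this.2.symm]
  have hr19 : ∀ (x : NExp), (∀ a, x.reads a = true → a ≠ 19 ∧ a ≠ i) →
      x.reads 19 = false := by
    intro x hx
    by_contra h
    exact (hx 19 (by simpa using h)).1 rfl
  have hri : ∀ (x : NExp), (∀ a, x.reads a = true → a ≠ 19 ∧ a ≠ i) →
      x.reads i = false := by
    intro x hx
    by_contra h
    exact (hx i (by simpa using h)).2 rfl
  refine Tri.forC (n := n) (T := 3 * src.size + 3 * dst.size + 40)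
    (fun t m' => (∀ x < t, cell m' (d + x) = cell m (s + x)) ∧ ∀ z < d, cell m' z = cell m z)
    hn ?_ (hri _ hlen) ?_ ?_ ?_ (le_trans ?_ hT) (fun _ _ h => h)
  · simp [cellC, Cmd.wN, hi.symm]
  · intro a ha
    simp [cellC, Cmd.wN, (hlen a ha).1.symm]
  · refine ⟨by simp, fun z _ => ?_⟩
    simp [cell, writeNat_nat, hi.symm]
  · rintro t ht m₁ hsame hti ⟨h1, h2⟩
    refine Tri.line rfl (by simp [cellC, Cmd.cost, NExp.size, KExp.size]; omega) ?_
    have es := hev src hsrc m₁ hsame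
    have ed := hev dst hdst m₁ hsame
    have hS : (src +ₙ rd i).eval m₁ = s + t := by simp [NExp.eval, es, hs, hti]
    have hDst : (dst +ₙ rd i).eval m₁ = d + t := by simp [NExp.eval, ed, hd, hti]
    have hSr : (src +ₙ rd i).reads 19 = false := by simp [NExp.reads, hr19 src hsrc, hi]
    have hSw : ∀ v, (src +ₙ rd i).eval (m₁.writeNat 19 (d + t) v) = s + t := by
      intro v; rw [NExp.eval_write _ _ _ hSr, hS]
    have hSw2 : ∀ v u, (src +ₙ rd i).eval ((m₁.writeNat 19 (d + t) v).writeNum 8 (d + t) u) = s + t := by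
      intro v u
      rw [NExp.eval_congr (m := m₁.writeNat 19 (d + t) v) _ (by simp), hSw]
    have hcell := cell_cellC (w := w) m₁ (a := dst +ₙ rd i) (j := .read 19 (src +ₙ rd i))
      (x := .read 8 (src +ₙ rd i)) (y := .read 9 (src +ₙ rd i)) hDst
      (by simp [NExp.reads, hr19 dst hdst, hi])
      (by intro v; simp only [KExp.eval, hSw, hS, writeNat_num])
      (by intro v u; simp only [KExp.eval, hSw2, hS, writeNat_num, writeNum_num]; simp)
    simp only [NExp.eval.eq_2, KExp.eval, hS] at hcell
    have hcw : ∀ (m₂ : Memory K) v z, cell (m₂.writeNat i 0 v) z = cell m₂ z := by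
      intro m₂ v z
      simp [cell, writeNat_nat, hi.symm]
    simp only [hcw, hcell]
    refine ⟨fun x hx => ?_, fun z hz => ?_⟩
    · by_cases hxt : x = t
      · subst hxt
        -- The source lies entirely below the destination, so what is read has not been overwritten.
        rw [if_pos rfl, ← h2 (s + x) (by omega)]
        rfl
      · rw [if_neg (by omega)]
        exact h1 x (by omega)
    · rw [if_neg (by omega)]
      exact h2 z hz
  · exact Nat.mul_le_mul_right _ (by omega)

end Dynamic

end RejSched

/-! ### Concatenating two table entries and closing an entry by a job -/

namespace RejSched

section Dynamic

variable {K : Type} [CommRing K] [LinearOrder K] [IsStrictOrderedRing K]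
variable {w : ℕ → K → K} {I : Problem K} {mode : Mode}

theorem Tri.step {c d : Cmd} {m : Memory K} {T T₂ : ℕ} {Q : Memory K → Prop}
    (hc : c.loopFree = true)
    (h : ∀ m', Same c m m' → m' = c.exec w m → Tri w d m' T₂ Q) (hT : c.cost + T₂ ≤ T) :
    Tri w (.seq c d) m T Q :=
  Tri.seq (Q' := fun m' => m' = c.exec w m) (Tri.line hc le_rfl rfl) h hT

/-- Both schedules are copied to the end of the heap, which keeps every stored schedule contiguous.
The conclusion is phrased for all upper bounds `c₁`, `c₂` of the entries, because entries may
improve between the moment a bound is known and the moment the rule is applied. -/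
theorem concatC_spec {m : Memory K} {B τ₀ τ₁ τ₂ y₁ y₂ : ℕ} (hD : Dyn I mode m)
    (hB : ∀ h τ₀ τ₁ y c (L : Schedule K I.n) J, Der I mode (gridOf I.n m) h τ₀ τ₁ y c L J →
      L.length ≤ B)
    (h49 : m.nat 49 0 = τ₀) (h50 : m.nat 50 0 = τ₁) (h51 : m.nat 51 0 = y₁)
    (h52 : m.nat 52 0 = τ₂) (h53 : m.nat 53 0 = y₂) (h44 : m.nat 44 0 = kap m τ₀ τ₁ y₁)
    (hτ₀ : τ₀ < m.nat 12 0) (hτ₁ : τ₁ < m.nat 12 0) (hτ₂ : τ₂ < m.nat 12 0)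
    (hy₁ : y₁ < m.nat 11 0) (hy₂ : y₂ < m.nat 11 0) (hT₁ : m.nat 15 (kap m τ₀ τ₁ y₁) ≠ 0) :
    Tri w concatC m (500 * (B + 1)) (fun m' => Dyn I mode m' ∧ Mono m m' ∧
      ∀ c₁ c₂, Has m (kap m τ₀ τ₁ y₁) c₁ → Has m (kap m τ₁ τ₂ y₂) c₂ → y₁ + y₂ < m.nat 11 0 →
        Has m' (kap m τ₀ τ₂ (y₁ + y₂)) (c₁ + c₂)) := by
  have hE := hD.env
  set κ₁ := kap m τ₀ τ₁ y₁ with hκ₁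
  set κ₂ := kap m τ₁ τ₂ y₂ with hκ₂
  set κ₃ := kap m τ₀ τ₂ (y₁ + y₂) with hκ₃
  refine Tri.step rfl (T₂ := 480 * (B + 1)) ?_ (by
    have : (setR 45 (kapE (rd 50) (rd 52) (rd 53))).cost ≤ 16 := by decide
    omega)
  intro m₁ hs₁ he₁
  have hH₁ : HeapStep m m₁ := .of_same hs₁ (by decide) (by decide)
  have h45 : m₁.nat 45 0 = κ₂ := by
    rw [he₁]
    simp [Cmd.exec, NExp.eval, writeNat_nat, h50, h52, h53, hE.R1 τ₂ hτ₂.le, hE.R2 τ₁ hτ₁.le, hκ₂,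
      kap]
  have e15 := hH₁.core.nat 15 (by simp)
  have e11 := hH₁.core.nat 11 (by simp)
  have r51 := hs₁.nat 51 rfl
  have r53 := hs₁.nat 53 rfl
  refine Tri.ite (T₁ := 460 * (B + 1)) ?_ ?_ ?_
  rotate_left
  · intro hc
    refine Tri.line rfl (by simp [Cmd.cost]; omega) ?_
    refine ⟨hH₁.dyn hD, hH₁.mono, fun c₁ c₂ h1 h2 hy => absurd ⟨?_, ?_⟩ hc⟩
    · have := h2.1
      simp only [Cond.Holds, NExp.eval, h45, e15]
      omega
    · simp only [Cond.Holds, NExp.eval, r51, r53, h51, h53, e11]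
      omega
  · simp only [Cond.size, NExp.size]; omega
  intro hc
  simp only [Cond.Holds, NExp.eval, h45, e15, r51, r53, h51, h53, e11] at hc
  have hy : y₁ + y₂ < m.nat 11 0 := by omega
  obtain ⟨d1, L₁, J₁, a1, a2, a3, a4⟩ := hD.sound τ₀ τ₁ y₁ hτ₀ hτ₁ hy₁ hT₁
  obtain ⟨d2, L₂, J₂, b1, b2, b3, b4⟩ := hD.sound τ₁ τ₂ y₂ hτ₁ hτ₂ hy₂ (by
    rw [← hκ₂]; omega)
  rw [← hκ₁] at a2 a3 a4
  rw [← hκ₂] at b2 b3 b4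
  have hd := (a1.mono (le_max_left d1 d2)).concat (b1.mono (le_max_right d1 d2)) hy
  refine Tri.step rfl (T₂ := 440 * (B + 1)) ?_ (by
    have : (setR 46 (kapE (rd 49) (rd 52) (rd 51 +ₙ rd 53))).cost ≤ 18 := by decide
    omega)
  intro m₂ hs₂ he₂
  have hH₂ : HeapStep m m₂ := hH₁.trans (.of_same hs₂ (by decide) (by decide))
  have h46 : m₂.nat 46 0 = κ₃ := by
    rw [he₂]
    simp [Cmd.exec, NExp.eval, writeNat_nat, hs₁.nat 49 rfl, hs₁.nat 52 rfl, hs₁.nat 51 rfl,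
      hs₁.nat 53 rfl, h49, h51, h52, h53, hs₁.nat 13 rfl, hs₁.nat 14 rfl, hE.R1 τ₂ hτ₂.le,
      hE.R2 τ₀ hτ₀.le, hκ₃, kap]
  have r44 : m₂.nat 44 0 = κ₁ := by rw [hs₂.nat 44 rfl, hs₁.nat 44 rfl, h44]
  have r45 : m₂.nat 45 0 = κ₂ := by rw [hs₂.nat 45 rfl, h45]
  have hl1 := hB _ _ _ _ _ _ _ a1
  have hl2 := hB _ _ _ _ _ _ _ b1
  refine Tri.seq (T₁ := 150 * (B + 1)) (T₂ := 290 * (B + 1))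
    (copyC_spec (n := L₁.length) (s := m.nat 16 κ₁) (d := m.nat 18 0)
      (by simp only [NExp.eval, r44, hH₂.core.nat 17 (by simp), a3])
      (by simp only [NExp.eval, r44, hH₂.core.nat 16 (by simp)])
      (by simp only [NExp.eval, hH₂.core.nat 18 (by simp)]) (by decide)
      (by intro a ha; simp [NExp.reads] at ha; omega)
      (by intro a ha; simp [NExp.reads] at ha; omega)
      (by intro a ha; simp [NExp.reads] at ha; omega) a4
      (by simp only [NExp.size]; exact Nat.mul_le_mul (by omega) (by omega))) ?_ (by omega)
  rintro m₃ hs₃ ⟨c1, c2⟩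
  have hH₃' : HeapStep m₂ m₃ := ⟨hs₃.agree (by decide) (by decide), fun x hx => c2 x (by
    rwa [hH₂.core.nat 18 (by simp)] at hx)⟩
  have hH₃ := hH₂.trans hH₃'
  have r44' : m₃.nat 44 0 = κ₁ := by rw [hs₃.nat 44 rfl, r44]
  have r45' : m₃.nat 45 0 = κ₂ := by rw [hs₃.nat 45 rfl, r45]
  refine Tri.seq (T₁ := 150 * (B + 1)) (T₂ := 140 * (B + 1))
    (copyC_spec (n := L₂.length) (s := m.nat 16 κ₂) (d := m.nat 18 0 + L₁.length)
      (by simp only [NExp.eval, r45', hH₃.core.nat 17 (by simp), b3])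
      (by simp only [NExp.eval, r45', hH₃.core.nat 16 (by simp)])
      (by simp only [NExp.eval, hH₃.core.nat 18 (by simp), r44', hH₃.core.nat 17 (by simp), a3])
      (by decide)
      (by intro a ha; simp [NExp.reads] at ha; omega)
      (by intro a ha; simp [NExp.reads] at ha; omega)
      (by intro a ha; simp [NExp.reads] at ha; omega) (by omega)
      (by simp only [NExp.size]; exact Nat.mul_le_mul (by omega) (by omega))) ?_ (by omega)
  rintro m₄ hs₄ ⟨c3, c4⟩
  have hH₄ : HeapStep m m₄ := hH₃.trans ⟨hs₄.agree (by decide) (by decide), fun x hx => c4 x (by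
    rw [hH₃.core.nat 18 (by simp)] at hx; omega)⟩
  have hS1 : Slice m₄ (m.nat 18 0) L₁ := by
    intro i hi
    rw [c4 _ (by omega), c1 i hi, hH₂.heap _ (by omega), a2 i hi]
  have hS2 : Slice m₄ (m.nat 18 0 + L₁.length) L₂ := by
    intro i hi
    rw [c3 i hi, hH₃.heap _ (by omega), b2 i hi]
  refine Tri.step rfl (T₂ := 125 * (B + 1)) ?_ (by
    have : (setR 47 (.read 17 (rd 44) +ₙ .read 17 (rd 45))).cost ≤ 13 := by decide
    omega)
  intro m₅ hs₅ he₅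
  have r44'' : m₄.nat 44 0 = κ₁ := by rw [hs₄.nat 44 rfl, r44']
  have r45'' : m₄.nat 45 0 = κ₂ := by rw [hs₄.nat 45 rfl, r45']
  have h47 : m₅.nat 47 0 = (L₁ ++ L₂).length := by
    rw [he₅]
    simp [Cmd.exec, NExp.eval, writeNat_nat, r44'', r45'', hH₄.core.nat 17 (by simp), a3, b3]
  refine Tri.step rfl (T₂ := 100) ?_ (by
    have : (setK 11 (.read 7 (rd 44) +ₖ .read 7 (rd 45))).cost ≤ 13 := by decide
    omega)
  intro m₆ hs₆ he₆
  have hH₆' : HeapStep m₄ m₆ := HeapStep.trans (.of_same hs₅ (by decide) (by decide))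
    (.of_same hs₆ (by decide) (by decide))
  have hH₆ := hH₄.trans hH₆'
  have k11 : m₆.num 11 0 = m.num 7 κ₁ + m.num 7 κ₂ := by
    rw [he₆]
    simp [Cmd.exec, KExp.eval, NExp.eval, writeNum_num, hs₅.nat 44 rfl, hs₅.nat 45 rfl, r44'', r45'',
      hs₅.num 7 rfl, hH₄.core.num 7 (by simp)]
  have h18 : m₆.nat 18 0 = m.nat 18 0 := by rw [hH₆.core.nat 18 (by simp)]
  have hcell : ∀ x, cell m₆ x = cell m₄ x := by
    intro x
    simp [cell, hs₆.nat 19 rfl, hs₅.nat 19 rfl, hs₆.num 8 rfl, hs₅.num 8 rfl, hs₆.num 9 rfl,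
      hs₅.num 9 rfl]
  have hkap := kap_congr hH₆.mono.fix
  have hD₆ := hH₆.dyn hD
  have hrel := relaxC_spec (w := w) (m := m₆) hD₆ (h := max d1 d2 + 1) (τ₀ := τ₀) (τ₁ := τ₂)
    (y := y₁ + y₂) (L := L₁ ++ L₂) (J := J₁ ++ J₂)
    (by rw [gridOf_congr hH₆.mono.fix, k11]; exact hd)
    (by rw [hs₆.nat 46 rfl, hs₅.nat 46 rfl, hs₄.nat 46 rfl, hs₃.nat 46 rfl, h46, hkap])
    (by
      rw [h18]
      exact (hS1.append hS2).congr (fun x _ _ => hcell x))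
    (by rw [hs₆.nat 47 rfl, h47])
  refine hrel.mono le_rfl ?_
  rintro m' _ ⟨f1, f2, f3⟩
  refine ⟨f1, hH₆.mono.trans f2, fun c₁ c₂ h1 h2 _ => ⟨?_, ?_⟩⟩
  · rw [hkap] at f3; exact f3.1
  · rw [hkap] at f3
    exact f3.2.trans (by rw [k11]; exact add_le_add h1.2 h2.2)

/-- The piece of job `j` that fills a gap. -/
def gap {n : ℕ} (j : Fin n) (lo hi : K) : Schedule K n := if lo < hi then [⟨j, lo, hi⟩] else []

theorem gap_pos {n : ℕ} (j : Fin n) {lo hi : K} (h : lo < hi) : gap j lo hi = [⟨j, lo, hi⟩] :=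
  if_pos h

theorem gap_neg {n : ℕ} (j : Fin n) {lo hi : K} (h : ¬ lo < hi) : gap j lo hi = [] :=
  if_neg h

/-- The pieces emitted before the end of a chain is reached. -/
def fillPre {n : ℕ} (j : Fin n) : K → Schedule K n → Schedule K n
  | _, [] => []
  | lo, q :: L =>
    gap j lo q.start ++ q :: fillPre j q.finish L

/-- The end of a chain. -/
def chainEnd {n : ℕ} : K → Schedule K n → K
  | lo, [] => lo
  | _, q :: L => chainEnd q.finish L

/-- The program emits pieces from left to right, so the final gap, known only after the loop, is
split off. -/
theorem fill_eq {n : ℕ} (j : Fin n) (lo : K) (L : Schedule K n) (hi : K) :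
    fill j lo L hi = fillPre j lo L ++
      gap j (chainEnd lo L) hi := by
  induction L generalizing lo with
  | nil => rfl
  | cons q L ih =>
    by_cases h : lo < q.start
    · simp [fill, fillPre, chainEnd, ih, h, gap_pos j h]
    · simp [fill, fillPre, chainEnd, ih, h, gap_neg j h]

/-- Recursion at the right end, in the order in which the loop consumes the chain. -/
theorem fillPre_concat {n : ℕ} (j : Fin n) (lo : K) (L : Schedule K n) (q : Piece K n) :
    fillPre j lo (L ++ [q]) = fillPre j lo L ++
      (gap j (chainEnd lo L) q.start ++ [q]) := by
  induction L generalizing lo with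
  | nil => simp [fillPre, chainEnd]
  | cons q' L ih =>
    simp [fillPre, chainEnd, ih]

theorem chainEnd_concat {n : ℕ} (lo : K) (L : Schedule K n) (q : Piece K n) :
    chainEnd lo (L ++ [q]) = q.finish := by
  induction L generalizing lo with
  | nil => rfl
  | cons q' L ih => exact ih _

theorem Slice.concat {n : ℕ} {m m' : Memory K} {a : ℕ} {L : Schedule K n} {q : Piece K n}
    (h : Slice m a L)
    (hc : ∀ z, cell m' z = if z = a + L.length then q.toCell else cell m z) :
    Slice m' a (L ++ [q]) := by
  refine Slice.append (h.congr fun x _ hx => by rw [hc, if_neg (by omega)]) ?_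
  intro i hi
  have : i = 0 := by simpa using hi
  subst this
  rw [hc]; simp

theorem emitC_spec {m : Memory K} {j : NExp} {x y : KExp} {T : ℕ}
    (hx : ∀ v, x.eval w (m.writeNat 19 (m.nat 18 0 + m.nat 47 0) v) = x.eval w m)
    (hy : ∀ v u, y.eval w ((m.writeNat 19 (m.nat 18 0 + m.nat 47 0) v).writeNum 8
      (m.nat 18 0 + m.nat 47 0) u) = y.eval w m)
    (hT : j.size + x.size + y.size + 30 ≤ T) :
    Tri w (emitC j x y) m T (fun m' => m'.nat 47 0 = m.nat 47 0 + 1 ∧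
      ∀ z, cell m' z = if z = m.nat 18 0 + m.nat 47 0 then (j.eval m, x.eval w m, y.eval w m)
        else cell m z) := by
  refine Tri.line rfl (le_trans ?_ hT) ?_
  · simp [emitC, cellC, Cmd.cost, NExp.size]; omega
  have hc := cell_cellC (w := w) m (a := rd 18 +ₙ rd 47) (j := j) (x := x) (y := y) rfl rfl hx hy
  have hs : Same (cellC (rd 18 +ₙ rd 47) j x y) m ((cellC (rd 18 +ₙ rd 47) j x y).exec w m) := by
    obtain ⟨t, _, hr⟩ := (cellC (rd 18 +ₙ rd 47) j x y).exists_runs_exec (w := w) rfl m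
    exact hr.same
  constructor
  · simp only [emitC, Cmd.exec.eq_4, Cmd.exec.eq_2, NExp.eval]
    rw [writeNat_nat, if_pos ⟨rfl, rfl⟩, hs.nat 47 rfl]
  · intro z
    refine Eq.trans ?_ (hc z)
    simp [emitC, Cmd.exec, cell, writeNat_nat]

/-- The condition under which an entry can be closed by job `j`. -/
def CloseOK (I : Problem K) (mode : Mode) (G : Grid K I.n) (τ₀ τ₁ y : ℕ) (j : Fin I.n) : Prop :=
  G.ok j ∧ y + G.wt j < G.Y ∧ τ₀ + (y + G.wt j) < G.NT ∧ I.r j ≤ G.T τ₀ ∧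
    G.T τ₁ ≤ G.T (τ₀ + (y + G.wt j)) ∧ G.T (τ₀ + (y + G.wt j)) = G.T τ₀ + G.P y + I.p j ∧
    (mode = .nonpreemptive → y = 0)

/-- Equality of times is tested by two comparisons; apart from this the test is the list of premises
of `Der.close`. -/
theorem closeCond_iff {m : Memory K} (hE : Env I m) {τ₀ τ₁ y : ℕ} {j : Fin I.n}
    (h49 : m.nat 49 0 = τ₀) (h50 : m.nat 50 0 = τ₁) (h51 : m.nat 51 0 = y) (h54 : m.nat 54 0 = j)
    (h59 : m.nat 59 0 = y + m.nat 10 j) (h58 : m.nat 58 0 = τ₀ + (y + m.nat 10 j)) :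
    (closeCond mode).Holds w m ↔ CloseOK I mode (gridOf I.n m) τ₀ τ₁ y j := by
  have hm : (modeCond mode).Holds w m ↔ (mode = .nonpreemptive → y = 0) := by
    cases mode <;> simp [modeCond, Cond.Holds, NExp.eval, h51]
  simp only [closeCond, Cond.Holds, NExp.eval, KExp.eval, h49, h50, h51, h54, h58, h59, hm, CloseOK,
    gridOf, hE.r_eq, hE.p_eq, Nat.add_one_le_iff]
  constructor
  · rintro ⟨h1, h2, h3, h4, h5, h6, h7, h8⟩
    exact ⟨h1, h2, h3, h4, h5, le_antisymm h6 h7, h8⟩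
  · rintro ⟨h1, h2, h3, h4, h5, h6, h8⟩
    exact ⟨h1, h2, h3, h4, h5, h6.le, h6.ge, h8⟩

/-- The loop that fills the gaps. -/
theorem fillLoop_spec {m : Memory K} {κ : ℕ} {L : Schedule K I.n} {j : Fin I.n} {lo : K} {B : ℕ}
    (h44 : m.nat 44 0 = κ) (h54 : m.nat 54 0 = j) (h47 : m.nat 47 0 = 0) (h12 : m.num 12 0 = lo)
    (hS : Slice m (m.nat 16 κ) L) (hl : m.nat 17 κ = L.length)
    (hle : m.nat 16 κ + L.length ≤ m.nat 18 0) (hB : L.length ≤ B) :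
    Tri w (forC 57 (.read 17 (rd 44)) fillStepC) m (200 * (B + 1)) (fun m' =>
      HeapStep m m' ∧ m'.nat 47 0 = (fillPre j lo L).length ∧ m'.num 12 0 = chainEnd lo L ∧
        Slice m' (m.nat 18 0) (fillPre j lo L)) := by
  refine Tri.forC (n := L.length) (T := 150)
    (fun t m' => HeapStep m m' ∧ m'.nat 47 0 = (fillPre j lo (L.take t)).length ∧
      m'.num 12 0 = chainEnd lo (L.take t) ∧ Slice m' (m.nat 18 0) (fillPre j lo (L.take t)))
    (by simp only [NExp.eval, h44, hl]) rfl rfl ?_ ?_ ?_ ?_ ?_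
  · intro a ha
    simp [NExp.reads] at ha
    rcases ha with rfl | rfl <;> rfl
  · refine ⟨⟨Agree.writeNat m 0 0 (by simp), fun x _ => by simp [cell, writeNat_nat]⟩, ?_, ?_, ?_⟩
    · simp [writeNat_nat, h47, fillPre]
    · simp [h12, chainEnd]
    · simp [fillPre, Slice]
  · rintro t ht m₁ hs hti ⟨h1, h2, h3, h4⟩
    set q := L[t] with hq
    have htake : L.take (t + 1) = L.take t ++ [q] := List.take_succ_eq_append_getElem ht
    set F := fillPre j lo (L.take t) with hF
    set cur := chainEnd lo (L.take t) with hcur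
    set src := m.nat 16 κ + t with hsrc
    have hlt : src < m.nat 18 0 := by omega
    refine Tri.step rfl (T₂ := 140) ?_ (by
      have : (setR 68 (.read 16 (rd 44) +ₙ rd 57)).cost ≤ 10 := by decide
      omega)
    intro m₂ hs₂ he₂
    have h68 : m₂.nat 68 0 = src := by
      rw [he₂]
      simp [Cmd.exec, NExp.eval, writeNat_nat, hs.nat 44 rfl, h44, h1.core.nat 16 (by simp), hti,
        hsrc]
    have hH₂ : HeapStep m₁ m₂ := .of_same hs₂ (by decide) (by decide)
    have hcell₂ : ∀ z, cell m₂ z = cell m₁ z := by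
      intro z; simp [cell, hs₂.nat 19 rfl, hs₂.num 8 rfl, hs₂.num 9 rfl]
    have e47 : m₂.nat 47 0 = F.length := by rw [hs₂.nat 47 rfl, h2]
    have e12 : m₂.num 12 0 = cur := by rw [hs₂.num 12 rfl, h3]
    have e54 : m₂.nat 54 0 = j := by rw [hs₂.nat 54 rfl, hs.nat 54 rfl, h54]
    have e18 : m₂.nat 18 0 = m.nat 18 0 := by
      rw [hH₂.core.nat 18 (by simp), h1.core.nat 18 (by simp)]
    have hqc : cell m₂ src = q.toCell := by
      rw [hcell₂, h1.heap src hlt, hsrc, hS t ht]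
    have hst : m₂.num 8 src = q.start := congrArg (fun p => p.2.1) hqc
    set F' := F ++ gap j cur q.start with hF'
    refine Tri.seq (T₁ := 60) (T₂ := 80) (Q' := fun m₃ => m₃.nat 47 0 = F'.length ∧
      Slice m₃ (m.nat 18 0) F' ∧ ∀ z < m.nat 18 0, cell m₃ z = cell m₂ z) ?_ ?_ (by norm_num)
    · refine Tri.ite (T₁ := 50) ?_ ?_ (by decide)
      · intro hc
        simp only [Cond.Holds, KExp.eval, NExp.eval, h68, hst, e12, not_le] at hc
        have hF'' : F' = F ++ [⟨j, cur, q.start⟩] := by rw [hF', gap_pos j hc]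
        refine (emitC_spec (T := 50) ?_ ?_ (by decide)).mono le_rfl ?_
        · intro v; simp [KExp.eval, NExp.eval]
        · intro v u
          rw [e18, e47]
          simp only [KExp.eval, NExp.eval, writeNum_nat, writeNum_num, writeNat_num]
          rw [writeNat_nat_of_ne _ _ _ (by decide), h68, if_neg (by omega)]
        · rintro m₃ _ ⟨g1, g2⟩
          rw [e47, e18] at g2
          simp only [NExp.eval, KExp.eval, e54, e12, h68, hst] at g2
          rw [hF'']
          refine ⟨by rw [g1, e47]; simp, ?_, fun z hz => by rw [g2, if_neg (by omega)]⟩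
          exact Slice.concat (h4.congr fun x _ _ => hcell₂ x) g2
      · intro hc
        simp only [Cond.Holds, KExp.eval, NExp.eval, h68, hst, e12] at hc
        have hF'' : F' = F := by rw [hF', gap_neg j (fun h => hc (not_le.mpr h)), List.append_nil]
        rw [hF'']
        exact Tri.line rfl (by decide) ⟨e47, h4.congr fun x _ _ => hcell₂ x, fun z _ => rfl⟩
    rintro m₃ hs₃ ⟨g1, g2, g3⟩
    have e68 : m₃.nat 68 0 = src := by rw [hs₃.nat 68 rfl, h68]
    have e18' : m₃.nat 18 0 = m.nat 18 0 := by rw [hs₃.nat 18 rfl, e18]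
    have hqc' : cell m₃ src = q.toCell := by rw [g3 src hlt, hqc]
    have q1 : m₃.nat 19 src = q.job := congrArg (fun p => p.1) hqc'
    have q2 : m₃.num 8 src = q.start := congrArg (fun p => p.2.1) hqc'
    have q3 : m₃.num 9 src = q.finish := congrArg (fun p => p.2.2) hqc'
    refine Tri.seq (T₁ := 60) (T₂ := 20) (Q' := fun m₄ => m₄.nat 47 0 = (F' ++ [q]).length ∧
      Slice m₄ (m.nat 18 0) (F' ++ [q]) ∧ ∀ z < m.nat 18 0, cell m₄ z = cell m₂ z) ?_ ?_ (by norm_num)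
    · refine (emitC_spec (T := 60) ?_ ?_ (by decide)).mono le_rfl ?_
      · intro v
        simp only [KExp.eval, NExp.eval, writeNat_num]
        rw [writeNat_nat_of_ne _ _ _ (by decide)]
      · intro v u
        simp only [KExp.eval, NExp.eval, writeNum_nat, writeNum_num, writeNat_num]
        rw [writeNat_nat_of_ne _ _ _ (by decide)]
        simp
      · rintro m₄ _ ⟨g4, g5⟩
        rw [g1, e18'] at g5
        simp only [NExp.eval, KExp.eval, e68, q1, q2, q3] at g5
        exact ⟨by rw [g4, g1]; simp, Slice.concat g2 g5,
          fun z hz => by rw [g5, if_neg (by omega), g3 z hz]⟩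
    rintro m₄ hs₄ ⟨g4, g5, g6⟩
    refine Tri.line rfl (by decide) ?_
    have e68' : m₄.nat 68 0 = src := by rw [hs₄.nat 68 rfl, e68]
    have q3' : m₄.num 9 src = q.finish := by
      have : cell m₄ src = q.toCell := by rw [g6 src hlt, hqc]
      exact congrArg (fun p => p.2.2) this
    have hpre : fillPre j lo (L.take (t + 1)) = F' ++ [q] := by
      rw [htake, fillPre_concat, hF', List.append_assoc]
    have hend : chainEnd lo (L.take (t + 1)) = q.finish := by rw [htake, chainEnd_concat]
    rw [hpre, hend]
    set m₅ := ((setK 12 (.read 9 (rd 68))).exec w m₄).writeNat 57 0 (t + 1) with hm₅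
    have hcell₅ : ∀ z, cell m₅ z = cell m₄ z := by
      intro z; simp [hm₅, Cmd.exec, cell, writeNat_nat, writeNum_num]
    have hA : Agree [0, 4, 6, 8, 9, 10, 11, 12, 13, 14, 15, 16, 17, 18, 20, 21]
        [0, 1, 2, 5, 6, 7, 10] m₄ m₅ := by
      constructor
      · intro a ha
        exact writeNat_nat_of_ne _ _ _ (by rintro rfl; simp at ha)
      · intro a ha
        funext z
        have : a ≠ 12 := by rintro rfl; simp at ha
        simp [hm₅, Cmd.exec, writeNum_num, this]
    refine ⟨⟨(h1.core.trans hH₂.core).trans (((hs₃.agree (by decide) (by decide)).trans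
      (hs₄.agree (by decide) (by decide))).trans hA), fun z hz => ?_⟩, ?_, ?_,
      g5.congr fun z _ _ => hcell₅ z⟩
    · rw [hcell₅, g6 z hz, hcell₂, h1.heap z hz]
    · simp [hm₅, Cmd.exec, writeNat_nat, g4]
    · simp [hm₅, Cmd.exec, KExp.eval, NExp.eval, writeNum_num, e68', q3']
  · simp only [NExp.size]; exact Nat.mul_le_mul (by omega) (by omega)
  · rintro m₁ _ h
    simpa using h

/-- The schedule produced by the loop and the final gap is `fill`, so soundness of the new entry is
one application of `Der.close`. Costs are differences to rejection, whence one oracle query and one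
subtraction. -/
theorem closeC_spec {m : Memory K} {B τ₀ τ₁ y : ℕ} {j : Fin I.n} (hD : Dyn I mode m)
    (hB : ∀ h τ₀ τ₁ y c (L : Schedule K I.n) J, Der I mode (gridOf I.n m) h τ₀ τ₁ y c L J →
      L.length ≤ B)
    (h49 : m.nat 49 0 = τ₀) (h50 : m.nat 50 0 = τ₁) (h51 : m.nat 51 0 = y)
    (h54 : m.nat 54 0 = j) (h44 : m.nat 44 0 = kap m τ₀ τ₁ y)
    (hτ₀ : τ₀ < m.nat 12 0) (hτ₁ : τ₁ < m.nat 12 0)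
    (hy : y < m.nat 11 0) (hT₁ : m.nat 15 (kap m τ₀ τ₁ y) ≠ 0) :
    Tri I.oracle (closeC mode) m (700 * (B + 1)) (fun m' => Dyn I mode m' ∧ Mono m m' ∧
      ∀ c, Has m (kap m τ₀ τ₁ y) c → CloseOK I mode (gridOf I.n m) τ₀ τ₁ y j →
        Has m' (kap m τ₀ (τ₀ + (y + m.nat 10 j)) (y + m.nat 10 j))
          (c + (I.w j (m.num 6 (τ₀ + (y + m.nat 10 j))) - I.e j))) := by
  have hE := hD.env
  set κ₁ := kap m τ₀ τ₁ y with hκ₁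
  refine Tri.step rfl (T₂ := 680 * (B + 1)) ?_ (by
    have : (setR 59 (rd 51 +ₙ .read 10 (rd 54))).cost ≤ 12 := by decide
    omega)
  intro m₁ hs₁ he₁
  have h59 : m₁.nat 59 0 = y + m.nat 10 j := by
    rw [he₁]; simp [Cmd.exec, NExp.eval, writeNat_nat, h51, h54]
  refine Tri.step rfl (T₂ := 670 * (B + 1)) ?_ (by
    have : (setR 58 (rd 49 +ₙ rd 59)).cost ≤ 9 := by decide
    omega)
  intro m₂ hs₂ he₂
  have h58 : m₂.nat 58 0 = τ₀ + (y + m.nat 10 j) := by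
    rw [he₂]; simp [Cmd.exec, NExp.eval, writeNat_nat, hs₁.nat 49 rfl, h49, h59]
  have hH₂ : HeapStep m m₂ := HeapStep.trans (.of_same hs₁ (by decide) (by decide))
    (.of_same hs₂ (by decide) (by decide))
  have hD₂ := hH₂.dyn hD
  have hG₂ := gridOf_congr hH₂.mono.fix I.n
  set y' := y + m.nat 10 j with hy'
  set τ' := τ₀ + y' with hτ'
  have hiff := closeCond_iff (w := I.oracle) (mode := mode) hD₂.env (τ₀ := τ₀) (τ₁ := τ₁) (y := y) (j := j)
    (by rw [hs₂.nat 49 rfl, hs₁.nat 49 rfl, h49]) (by rw [hs₂.nat 50 rfl, hs₁.nat 50 rfl, h50])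
    (by rw [hs₂.nat 51 rfl, hs₁.nat 51 rfl, h51]) (by rw [hs₂.nat 54 rfl, hs₁.nat 54 rfl, h54])
    (by rw [hs₂.nat 59 rfl, h59, hH₂.core.nat 10 (by simp)])
    (by rw [h58, hH₂.core.nat 10 (by simp)])
  rw [hG₂] at hiff
  refine Tri.ite (T₁ := 500 * (B + 1)) ?_ ?_ (by
    have : (closeCond mode).size ≤ 160 := by cases mode <;> decide
    omega)
  rotate_left
  · intro hc
    refine Tri.line rfl (by simp [Cmd.cost]; omega) ⟨hD₂, hH₂.mono, fun c _ h2 => ?_⟩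
    exact absurd (hiff.mpr h2) hc
  intro hc
  have hok := hiff.mp hc
  obtain ⟨o1, o2, o3, o4, o5, o6, o7⟩ := hok
  simp only [gridOf] at o1 o2 o3 o4 o5 o6
  obtain ⟨d1, L, J, a1, a2, a3, a4⟩ := hD.sound τ₀ τ₁ y hτ₀ hτ₁ hy hT₁
  rw [← hκ₁] at a2 a3 a4
  have hd := Der.close j a1 o1 o2 o3 o4 o5 o6 o7
  have hl := hB _ _ _ _ _ _ _ a1
  refine Tri.step rfl (T₂ := 480 * (B + 1)) ?_ (by
    have : (setR 46 (kapE (rd 49) (rd 58) (rd 59))).cost ≤ 16 := by decide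
    omega)
  intro m₃ hs₃ he₃
  have h46 : m₃.nat 46 0 = kap m τ₀ τ' y' := by
    rw [he₃]
    simp [Cmd.exec, NExp.eval, writeNat_nat, hs₂.nat 49 rfl, hs₁.nat 49 rfl, h49, h58,
      hs₂.nat 59 rfl, h59, hH₂.core.nat 13 (by simp), hH₂.core.nat 14 (by simp),
      hE.R1 τ' (le_of_lt o3), hE.R2 τ₀ hτ₀.le, kap]
  refine Tri.step rfl (T₂ := 470 * (B + 1)) ?_ (by
    have : (setR 47 (.const 0)).cost ≤ 7 := by decide
    omega)
  intro m₄ hs₄ he₄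
  have h47 : m₄.nat 47 0 = 0 := by
    rw [he₄]; simp [Cmd.exec, NExp.eval, writeNat_nat]
  refine Tri.step rfl (T₂ := 460 * (B + 1)) ?_ (by
    have : (setK 12 (.read 6 (rd 49))).cost ≤ 9 := by decide
    omega)
  intro m₅ hs₅ he₅
  have hH₅ : HeapStep m m₅ := hH₂.trans (HeapStep.trans (.of_same hs₃ (by decide) (by decide))
    (HeapStep.trans (.of_same hs₄ (by decide) (by decide)) (.of_same hs₅ (by decide) (by decide))))
  have k12 : m₅.num 12 0 = m.num 6 τ₀ := by
    rw [he₅]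
    simp [Cmd.exec, KExp.eval, NExp.eval, writeNum_num, hs₄.nat 49 rfl, hs₃.nat 49 rfl,
      hs₂.nat 49 rfl, hs₁.nat 49 rfl, h49, hs₄.num 6 rfl, hs₃.num 6 rfl, hs₂.num 6 rfl,
      hs₁.num 6 rfl]
  have hreg₅ : ∀ a ∈ [44, 54, 58], m₅.nat a = m₂.nat a := by
    intro a ha
    simp at ha
    rcases ha with rfl | rfl | rfl
    · rw [hs₅.nat 44 rfl, hs₄.nat 44 rfl, hs₃.nat 44 rfl]
    · rw [hs₅.nat 54 rfl, hs₄.nat 54 rfl, hs₃.nat 54 rfl]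
    · rw [hs₅.nat 58 rfl, hs₄.nat 58 rfl, hs₃.nat 58 rfl]
  have r44 : m₅.nat 44 0 = κ₁ := by
    rw [hreg₅ 44 (by simp), hs₂.nat 44 rfl, hs₁.nat 44 rfl, h44]
  have r54 : m₅.nat 54 0 = j := by
    rw [hreg₅ 54 (by simp), hs₂.nat 54 rfl, hs₁.nat 54 rfl, h54]
  have r58 : m₅.nat 58 0 = τ' := by rw [hreg₅ 58 (by simp), h58]
  have r18 : m₅.nat 18 0 = m.nat 18 0 := by rw [hH₅.core.nat 18 (by simp)]
  refine Tri.seq (T₁ := 200 * (B + 1)) (T₂ := 260 * (B + 1))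
    (fillLoop_spec (L := L) (B := B) r44 r54
      (by rw [hs₅.nat 47 rfl, h47]) k12
      (by
        rw [hH₅.core.nat 16 (by simp)]
        exact a2.congr fun x _ hx => hH₅.heap x (by omega))
      (by rw [hH₅.core.nat 17 (by simp), a3])
      (by rw [hH₅.core.nat 16 (by simp), r18]; exact a4) hl) ?_ (by omega)
  rintro m₆ hs₆ ⟨b1, b2, b3, b4⟩
  rw [r18] at b4
  have hH₆ := hH₅.trans b1
  have s58 : m₆.nat 58 0 = τ' := by rw [hs₆.nat 58 rfl, r58]
  have s54 : m₆.nat 54 0 = j := by rw [hs₆.nat 54 rfl, r54]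
  have s18 : m₆.nat 18 0 = m.nat 18 0 := by rw [hH₆.core.nat 18 (by simp)]
  have s6 : m₆.num 6 = m.num 6 := hH₆.core.num 6 (by simp)
  set F := fill j (m.num 6 τ₀) L (m.num 6 τ') with hF
  refine Tri.seq (T₁ := 60) (T₂ := 150) (Q' := fun m₇ => m₇.nat 47 0 = F.length ∧
      Slice m₇ (m.nat 18 0) F ∧ ∀ z < m.nat 18 0, cell m₇ z = cell m₆ z) ?_ ?_ (by omega)
  · refine Tri.ite (T₁ := 50) ?_ ?_ (by decide)
    · intro hc
      simp only [Cond.Holds, KExp.eval, NExp.eval, s58, s6, b3, not_le] at hc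
      have hF' : F = fillPre j (m.num 6 τ₀) L ++ [⟨j, chainEnd (m.num 6 τ₀) L, m.num 6 τ'⟩] := by
        rw [hF, fill_eq, gap_pos j hc]
      refine (emitC_spec (T := 50) ?_ ?_ (by decide)).mono le_rfl ?_
      · intro v; simp [KExp.eval, NExp.eval]
      · intro v u
        simp only [KExp.eval, NExp.eval, writeNum_nat, writeNum_num, writeNat_num]
        rw [writeNat_nat_of_ne _ _ _ (by decide)]
        simp
      · rintro m₇ _ ⟨g1, g2⟩
        rw [b2, s18] at g2
        simp only [NExp.eval, KExp.eval, s54, b3, s58, s6] at g2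
        rw [hF']
        exact ⟨by rw [g1, b2]; simp, Slice.concat b4 g2, fun z hz => by rw [g2, if_neg (by omega)]⟩
    · intro hc
      simp only [Cond.Holds, KExp.eval, NExp.eval, s58, s6, b3] at hc
      have hF' : F = fillPre j (m.num 6 τ₀) L := by
        rw [hF, fill_eq, gap_neg j (fun h => hc (not_le.mpr h)), List.append_nil]
      rw [hF']
      exact Tri.line rfl (by decide) ⟨b2, b4, fun z _ => rfl⟩
  rintro m₇ hs₇ ⟨c1, c2, c3⟩
  refine Tri.step rfl (T₂ := 100) ?_ (by decide)
  intro m₈ hs₈ he₈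
  have hH₈ : HeapStep m m₈ := (hH₆.trans ⟨hs₇.agree (by decide) (by decide), fun z hz => c3 z (by
    rwa [s18] at hz)⟩).trans (.of_same hs₈ (by decide) (by decide))
  have hcell₈ : ∀ z, cell m₈ z = cell m₇ z := by
    intro z; simp [cell, hs₈.nat 19 rfl, hs₈.num 8 rfl, hs₈.num 9 rfl]
  have k11 : m₈.num 11 0 = m.num 7 κ₁ + (I.w j (m.num 6 τ') - I.e j) := by
    have e7 : m₇.num 7 = m.num 7 := by rw [hs₇.num 7 rfl, hH₆.core.num 7 (by simp)]
    have e6 : m₇.num 6 = m.num 6 := by rw [hs₇.num 6 rfl, s6]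
    have e2 : m₇.num 2 = m.num 2 := by rw [hs₇.num 2 rfl, hH₆.core.num 2 (by simp)]
    have e44 : m₇.nat 44 0 = κ₁ := by rw [hs₇.nat 44 rfl, hs₆.nat 44 rfl, r44]
    have e54 : m₇.nat 54 0 = j := by rw [hs₇.nat 54 rfl, s54]
    have e58 : m₇.nat 58 0 = τ' := by rw [hs₇.nat 58 rfl, s58]
    rw [he₈]
    simp [Cmd.exec, KExp.eval, NExp.eval, writeNum_num, e7, e6, e2, e44, e54, e58, hE.e_eq,
      Problem.oracle]
  have hkap := kap_congr hH₈.mono.fix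
  have hrel := relaxC_spec (w := I.oracle) (m := m₈) (hH₈.dyn hD) (h := d1 + 1) (τ₀ := τ₀) (τ₁ := τ')
    (y := y') (L := F) (J := j :: J)
    (by rw [gridOf_congr hH₈.mono.fix, k11]; exact hd)
    (by rw [hs₈.nat 46 rfl, hs₇.nat 46 rfl, hs₆.nat 46 rfl, hs₅.nat 46 rfl, hs₄.nat 46 rfl, h46, hkap])
    (by
      rw [hH₈.core.nat 18 (by simp)]
      exact c2.congr (fun x _ _ => hcell₈ x))
    (by rw [hs₈.nat 47 rfl, c1])
  refine hrel.mono le_rfl ?_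
  rintro m' _ ⟨f1, f2, f3⟩
  rw [hkap] at f3
  exact ⟨f1, hH₈.mono.trans f2, fun c h1 _ => ⟨f3.1, f3.2.trans (by
    rw [k11]; exact add_le_add h1.2 le_rfl)⟩⟩

end Dynamic

end RejSched

/-! ### One round and the iteration of rounds -/

namespace RejSched

section Dynamic

variable {K : Type} [CommRing K] [LinearOrder K] [IsStrictOrderedRing K]
variable {w : ℕ → K → K} {I : Problem K} {mode : Mode}

/-- Derivable schedules have at most `B` pieces. -/
def LenBound (I : Problem K) (mode : Mode) (B : ℕ) (m : Memory K) : Prop :=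
  ∀ h τ₀ τ₁ y c (L : Schedule K I.n) J, Der I mode (gridOf I.n m) h τ₀ τ₁ y c L J → L.length ≤ B

theorem LenBound.congr {B : ℕ} {m m' : Memory K} (h : Agree fixN fixK m m')
    (hB : LenBound I mode B m) : LenBound I mode B m' := by
  unfold LenBound; rw [gridOf_congr h]; exact hB

/-- The dynamic program with a bound on the sizes of schedules. -/
def DynB (I : Problem K) (mode : Mode) (B : ℕ) (m : Memory K) : Prop :=
  Dyn I mode m ∧ LenBound I mode B m

theorem DynB.write {B : ℕ} {m : Memory K} {i : ℕ} (hi : i ∉ coreN) (v : ℕ) (h : DynB I mode B m) :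
    DynB I mode B (m.writeNat i 0 v) :=
  ⟨h.1.congr (Agree.writeNat m 0 v hi), h.2.congr (fix_of_core (Agree.writeNat m 0 v hi))⟩

theorem Mono.write (m : Memory K) {i : ℕ} (hi : i ∉ coreN) (v : ℕ) : Mono m (m.writeNat i 0 v) :=
  Mono.of_core (Agree.writeNat m 0 v hi)

theorem Mono.nat {m m' : Memory K} (h : Mono m m') {a : ℕ} (ha : a ∈ fixN) : m'.nat a = m.nat a :=
  h.fix.nat a ha

theorem Mono.num {m m' : Memory K} (h : Mono m m') {a : ℕ} (ha : a ∈ fixK) : m'.num a = m.num a :=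
  h.fix.num a ha

theorem concatLoop_spec {m : Memory K} {B τ₀ τ₁ y₁ : ℕ} (hD : DynB I mode B m)
    (h49 : m.nat 49 0 = τ₀) (h50 : m.nat 50 0 = τ₁) (h51 : m.nat 51 0 = y₁)
    (h44 : m.nat 44 0 = kap m τ₀ τ₁ y₁) (hτ₀ : τ₀ < m.nat 12 0) (hτ₁ : τ₁ < m.nat 12 0)
    (hy₁ : y₁ < m.nat 11 0) (hT₁ : m.nat 15 (kap m τ₀ τ₁ y₁) ≠ 0) :
    Tri w (forC 52 (rd 12) (forC 53 (rd 11) concatC)) m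
      (700 * (B + 1) * (m.nat 11 0 + 1) * (m.nat 12 0 + 1)) (fun m' => DynB I mode B m' ∧ Mono m m' ∧
      ∀ τ₂ < m.nat 12 0, ∀ y₂ < m.nat 11 0, ∀ c₁ c₂, Has m (kap m τ₀ τ₁ y₁) c₁ →
        Has m (kap m τ₁ τ₂ y₂) c₂ → y₁ + y₂ < m.nat 11 0 →
        Has m' (kap m τ₀ τ₂ (y₁ + y₂)) (c₁ + c₂)) := by
  refine Tri.forAll (n := m.nat 12 0) (T := 600 * (B + 1) * (m.nat 11 0 + 1)) (DynB I mode B) Mono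
    (fun τ₂ m' => ∀ y₂ < m.nat 11 0, ∀ c₁ c₂, Has m (kap m τ₀ τ₁ y₁) c₁ →
        Has m (kap m τ₁ τ₂ y₂) c₂ → y₁ + y₂ < m.nat 11 0 →
        Has m' (kap m τ₀ τ₂ (y₁ + y₂)) (c₁ + c₂)) rfl rfl rfl ?_
    (fun m v h => h.write (by decide) v) (fun m v => Mono.write m (by decide) v)
    (fun _ _ _ h h' => h.trans h')
    (fun x m₁ m₂ h hd y₂ hy c₁ c₂ h1 h2 h3 => (hd y₂ hy c₁ c₂ h1 h2 h3).mono h) hD ?_ ?_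
  · intro a ha
    simp [NExp.reads] at ha
    subst ha; rfl
  · intro τ₂ hτ₂ m₁ hs h52 hD₁ hM
    have e11 : m₁.nat 11 = m.nat 11 := hM.nat (by decide)
    refine Tri.forAll (n := m.nat 11 0) (T := 500 * (B + 1)) (DynB I mode B) Mono
      (fun y₂ m' => ∀ c₁ c₂, Has m (kap m τ₀ τ₁ y₁) c₁ →
        Has m (kap m τ₁ τ₂ y₂) c₂ → y₁ + y₂ < m.nat 11 0 →
        Has m' (kap m τ₀ τ₂ (y₁ + y₂)) (c₁ + c₂)) (by simp only [NExp.eval, e11]) rfl rfl ?_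
      (fun m v h => h.write (by decide) v) (fun m v => Mono.write m (by decide) v)
      (fun _ _ _ h h' => h.trans h')
      (fun x m₁ m₂ h hd c₁ c₂ h1 h2 h3 => (hd c₁ c₂ h1 h2 h3).mono h) hD₁ ?_ ?_
    · intro a ha
      simp [NExp.reads] at ha
      subst ha; rfl
    · intro y₂ hy₂ m₂ hs₂ h53 hD₂ hM₂
      have hM' := hM.trans hM₂
      have hk : kap m₂ = kap m := kap_congr hM'.fix
      have f11 : m₂.nat 11 = m.nat 11 := hM'.nat (by decide)
      have f12 : m₂.nat 12 = m.nat 12 := hM'.nat (by decide)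
      refine (concatC_spec (w := w) (m := m₂) (B := B) (τ₀ := τ₀) (τ₁ := τ₁) (τ₂ := τ₂) (y₁ := y₁)
        (y₂ := y₂) hD₂.1 hD₂.2 ?_ ?_ ?_ ?_ h53 ?_ ?_ ?_ ?_ ?_ ?_ ?_).mono le_rfl ?_
      · rw [hs₂.nat 49 rfl, hs.nat 49 rfl, h49]
      · rw [hs₂.nat 50 rfl, hs.nat 50 rfl, h50]
      · rw [hs₂.nat 51 rfl, hs.nat 51 rfl, h51]
      · rw [hs₂.nat 52 rfl, h52]
      · rw [hs₂.nat 44 rfl, hs.nat 44 rfl, h44, hk]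
      · rwa [f12]
      · rwa [f12]
      · rwa [f12]
      · rwa [f11]
      · rwa [f11]
      · rw [hk]; exact (hM'.tab _ hT₁).1
      · rintro m₃ _ ⟨g1, g2, g3⟩
        rw [hk, f11] at g3
        exact ⟨⟨g1, hD₂.2.congr g2.fix⟩, g2, fun c₁ c₂ h1 h2 h3 =>
          g3 c₁ c₂ (h1.mono hM') (h2.mono hM') h3⟩
    · simp only [NExp.size]
      refine Nat.mul_le_mul (by omega) le_rfl
  · simp only [NExp.size]
    refine Nat.mul_le_mul ?_ le_rfl
    have : 1 * 1 ≤ (B + 1) * (m.nat 11 0 + 1) := Nat.mul_le_mul (by omega) (by omega)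
    rw [mul_assoc, mul_assoc]; omega

theorem closeLoop_spec {m : Memory K} {B τ₀ τ₁ y : ℕ} (hD : DynB I mode B m)
    (h49 : m.nat 49 0 = τ₀) (h50 : m.nat 50 0 = τ₁) (h51 : m.nat 51 0 = y)
    (h44 : m.nat 44 0 = kap m τ₀ τ₁ y) (hτ₀ : τ₀ < m.nat 12 0) (hτ₁ : τ₁ < m.nat 12 0)
    (hy : y < m.nat 11 0) (hT₁ : m.nat 15 (kap m τ₀ τ₁ y) ≠ 0) :
    Tri I.oracle (forC 54 (rd 0) (closeC mode)) m (800 * (B + 1) * (I.n + 1)) (fun m' =>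
      DynB I mode B m' ∧ Mono m m' ∧ ∀ (j : Fin I.n) c, Has m (kap m τ₀ τ₁ y) c →
        CloseOK I mode (gridOf I.n m) τ₀ τ₁ y j →
        Has m' (kap m τ₀ (τ₀ + (y + m.nat 10 j)) (y + m.nat 10 j))
          (c + (I.w j (m.num 6 (τ₀ + (y + m.nat 10 j))) - I.e j))) := by
  refine (Tri.forAll (n := I.n) (T := 700 * (B + 1)) (DynB I mode B) Mono
    (fun x m' => ∀ (j : Fin I.n) c, (j : ℕ) = x → Has m (kap m τ₀ τ₁ y) c →
        CloseOK I mode (gridOf I.n m) τ₀ τ₁ y j →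
        Has m' (kap m τ₀ (τ₀ + (y + m.nat 10 j)) (y + m.nat 10 j))
          (c + (I.w j (m.num 6 (τ₀ + (y + m.nat 10 j))) - I.e j))) (by exact hD.1.env.n_eq)
    (by cases mode <;> rfl) rfl ?_
    (fun m v h => h.write (by decide) v) (fun m v => Mono.write m (by decide) v)
    (fun _ _ _ h h' => h.trans h')
    (fun x m₁ m₂ h hd j c h1 h2 h3 => (hd j c h1 h2 h3).mono h) hD ?_ ?_).mono le_rfl ?_
  · intro a ha
    simp [NExp.reads] at ha
    subst ha; cases mode <;> rfl
  · intro x hx m₂ hs₂ h54 hD₂ hM'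
    have hk : kap m₂ = kap m := kap_congr hM'.fix
    have f11 : m₂.nat 11 = m.nat 11 := hM'.nat (by decide)
    have f12 : m₂.nat 12 = m.nat 12 := hM'.nat (by decide)
    have f10 : m₂.nat 10 = m.nat 10 := hM'.nat (by decide)
    have f6 : m₂.num 6 = m.num 6 := hM'.num (by decide)
    have hg := gridOf_congr hM'.fix I.n
    refine (closeC_spec (m := m₂) (B := B) (τ₀ := τ₀) (τ₁ := τ₁) (y := y) (j := ⟨x, hx⟩)
      hD₂.1 hD₂.2 ?_ ?_ ?_ h54 ?_ ?_ ?_ ?_ ?_).mono le_rfl ?_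
    · rw [hs₂.nat 49 (by cases mode <;> rfl), h49]
    · rw [hs₂.nat 50 (by cases mode <;> rfl), h50]
    · rw [hs₂.nat 51 (by cases mode <;> rfl), h51]
    · rw [hs₂.nat 44 (by cases mode <;> rfl), h44, hk]
    · rwa [f12]
    · rwa [f12]
    · rwa [f11]
    · rw [hk]; exact (hM'.tab _ hT₁).1
    · rintro m₃ _ ⟨g1, g2, g3⟩
      rw [hk, f10, f6, hg] at g3
      refine ⟨⟨g1, hD₂.2.congr g2.fix⟩, g2, ?_⟩
      rintro j c rfl h2 h3
      exact g3 c (h2.mono hM') h3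
  · simp only [NExp.size]
    refine Nat.mul_le_mul (by omega) le_rfl
  · rintro m' _ ⟨h1, h2, h3⟩
    exact ⟨h1, h2, fun j c h4 h5 => h3 j j.2 j c rfl h4 h5⟩

/-- All rules whose first premise is the entry `(τ₀, τ₁, y)` of `m` have been applied in `m'`. -/
def RulesDone (I : Problem K) (mode : Mode) (m : Memory K) (τ₀ τ₁ y : ℕ) (m' : Memory K) : Prop :=
  (∀ τ₂ < m.nat 12 0, ∀ y₂ < m.nat 11 0, ∀ c₁ c₂, Has m (kap m τ₀ τ₁ y) c₁ →
      Has m (kap m τ₁ τ₂ y₂) c₂ → y + y₂ < m.nat 11 0 → Has m' (kap m τ₀ τ₂ (y + y₂)) (c₁ + c₂)) ∧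
  ∀ (j : Fin I.n) c, Has m (kap m τ₀ τ₁ y) c → CloseOK I mode (gridOf I.n m) τ₀ τ₁ y j →
      Has m' (kap m τ₀ (τ₀ + (y + m.nat 10 j)) (y + m.nat 10 j))
        (c + (I.w j (m.num 6 (τ₀ + (y + m.nat 10 j))) - I.e j))

theorem RulesDone.mono {m m' m'' : Memory K} {τ₀ τ₁ y : ℕ} (h : RulesDone I mode m τ₀ τ₁ y m')
    (hM : Mono m' m'') : RulesDone I mode m τ₀ τ₁ y m'' :=
  ⟨fun τ₂ h1 y₂ h2 c₁ c₂ h3 h4 h5 => (h.1 τ₂ h1 y₂ h2 c₁ c₂ h3 h4 h5).mono hM,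
    fun j c h1 h2 => (h.2 j c h1 h2).mono hM⟩

/-- The table changes during a round, but entries only improve. So a rule applied in a later memory
also serves the premises that held when the round began. -/
theorem RulesDone.of_later {m₀ m m' : Memory K} {τ₀ τ₁ y : ℕ} (h : RulesDone I mode m τ₀ τ₁ y m')
    (hM : Mono m₀ m) : RulesDone I mode m₀ τ₀ τ₁ y m' := by
  have hk : kap m = kap m₀ := kap_congr hM.fix
  have f11 : m.nat 11 = m₀.nat 11 := hM.nat (by decide)
  have f12 : m.nat 12 = m₀.nat 12 := hM.nat (by decide)
  have f10 : m.nat 10 = m₀.nat 10 := hM.nat (by decide)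
  have f6 : m.num 6 = m₀.num 6 := hM.num (by decide)
  have hg := gridOf_congr hM.fix I.n
  obtain ⟨h1, h2⟩ := h
  rw [f11, f12, hk] at h1
  rw [hk, f10, f6, hg] at h2
  exact ⟨fun τ₂ a1 y₂ a2 c₁ c₂ a3 a4 a5 => h1 τ₂ a1 y₂ a2 c₁ c₂ (a3.mono hM) (a4.mono hM) a5,
    fun j c a1 a2 => h2 j c (a1.mono hM) a2⟩

/-- The part of a round that belongs to one entry. -/
abbrev entryC (mode : Mode) : Cmd :=
  setR 44 (kapE (rd 49) (rd 50) (rd 51)) ⨟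
     ifC (.natLe (.const 1) (.read 15 (rd 44)))
       (forC 52 (rd 12) (forC 53 (rd 11) concatC) ⨟ forC 54 (rd 0) (closeC mode))

theorem entryC_spec {m : Memory K} {B τ₀ τ₁ y : ℕ} (hD : DynB I mode B m)
    (h49 : m.nat 49 0 = τ₀) (h50 : m.nat 50 0 = τ₁) (h51 : m.nat 51 0 = y)
    (hτ₀ : τ₀ < m.nat 12 0) (hτ₁ : τ₁ < m.nat 12 0) (hy : y < m.nat 11 0) :
    Tri I.oracle (entryC mode) m (1600 * (B + 1) * (m.nat 11 0 + 1) * (m.nat 12 0 + 1)) (fun m' =>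
      DynB I mode B m' ∧ Mono m m' ∧ RulesDone I mode m τ₀ τ₁ y m') := by
  have hE := hD.1.env
  set C := (B + 1) * ((m.nat 11 0 + 1) * (m.nat 12 0 + 1)) with hC
  have hC1 : 1 ≤ C := Nat.mul_pos (by omega) (Nat.mul_pos (by omega) (by omega))
  have hnC : (B + 1) * (I.n + 1) ≤ C := by
    refine Nat.mul_le_mul le_rfl ?_
    have : I.n ≤ m.nat 12 0 := by
      rw [hE.NT_eq]; exact Nat.le_mul_of_pos_right _ hE.Y_pos
    calc I.n + 1 ≤ 1 * (m.nat 12 0 + 1) := by omega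
      _ ≤ _ := Nat.mul_le_mul (by omega) le_rfl
  refine Tri.step rfl (T₂ := 1580 * C) ?_ (by
    have : (setR 44 (kapE (rd 49) (rd 50) (rd 51))).cost ≤ 16 := by decide
    rw [mul_assoc, mul_assoc, ← hC]
    omega)
  intro m₁ hs₁ he₁
  have h44 : m₁.nat 44 0 = kap m τ₀ τ₁ y := by
    rw [he₁]
    simp [Cmd.exec, NExp.eval, writeNat_nat, h49, h50, h51, hE.R1 τ₁ hτ₁.le, hE.R2 τ₀ hτ₀.le, kap]
  have hH₁ : HeapStep m m₁ := .of_same hs₁ (by decide) (by decide)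
  have hM₁ := hH₁.mono
  have hk : kap m₁ = kap m := kap_congr hM₁.fix
  have f11 : m₁.nat 11 = m.nat 11 := hM₁.nat (by decide)
  have f12 : m₁.nat 12 = m.nat 12 := hM₁.nat (by decide)
  have e15 : m₁.nat 15 = m.nat 15 := hH₁.core.nat 15 (by simp)
  have hD₁ : DynB I mode B m₁ := ⟨hH₁.dyn hD.1, hD.2.congr hM₁.fix⟩
  refine Tri.ite (T₁ := 1570 * C) ?_ ?_ (by
    have : (Cond.natLe (.const 1) (.read 15 (rd 44))).size ≤ 8 := by decide
    omega)
  rotate_left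
  · intro hc
    simp only [Cond.Holds, NExp.eval, h44, e15] at hc
    refine Tri.line rfl (by simp [Cmd.cost]; omega) ⟨hD₁, hM₁, ?_, ?_⟩
    · intro τ₂ _ y₂ _ c₁ c₂ h
      have := h.1
      omega
    · intro j c h
      have := h.1
      omega
  intro hc
  simp only [Cond.Holds, NExp.eval, h44, e15] at hc
  have hT : m.nat 15 (kap m τ₀ τ₁ y) ≠ 0 := by omega
  refine Tri.seq (T₁ := 700 * C) (T₂ := 800 * C) ((concatLoop_spec (m := m₁) (B := B) (τ₀ := τ₀)
    (τ₁ := τ₁) (y₁ := y) hD₁ (by rw [hs₁.nat 49 rfl, h49]) (by rw [hs₁.nat 50 rfl, h50])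
    (by rw [hs₁.nat 51 rfl, h51]) (by rw [h44, hk]) (by rwa [f12]) (by rwa [f12]) (by rwa [f11])
    (by rw [hk, e15]; exact hT)).mono ?_ (fun m' hs' h => h)) ?_ (by omega)
  · rw [f11, f12, mul_assoc, mul_assoc, ← hC]
  rintro m₂ hs₂ ⟨hD₂, hM₂, hc2⟩
  have hM₂' := hM₁.trans hM₂
  have hk₂ : kap m₂ = kap m := kap_congr hM₂'.fix
  refine (closeLoop_spec (m := m₂) (B := B) (τ₀ := τ₀)
    (τ₁ := τ₁) (y := y) hD₂ (by rw [hs₂.nat 49 rfl, hs₁.nat 49 rfl, h49])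
    (by rw [hs₂.nat 50 rfl, hs₁.nat 50 rfl, h50])
    (by rw [hs₂.nat 51 rfl, hs₁.nat 51 rfl, h51]) (by rw [hs₂.nat 44 rfl, h44, hk₂])
    (by rwa [hM₂'.nat (by decide)]) (by rwa [hM₂'.nat (by decide)]) (by rwa [hM₂'.nat (by decide)])
    (by rw [hk₂]; exact (hM₂'.tab _ hT).1)).mono ?_ ?_
  · rw [mul_assoc]; omega
  rintro m₃ hs₃ ⟨hD₃, hM₃, hc3⟩
  refine ⟨hD₃, hM₂'.trans hM₃, ?_, ?_⟩
  · intro τ₂ h1 y₂ h2 c₁ c₂ h3 h4 h5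
    rw [hk, f11, f12] at hc2
    exact (hc2 τ₂ h1 y₂ h2 c₁ c₂ (h3.mono hM₁) (h4.mono hM₁) h5).mono hM₃
  · intro j c h1 h2
    rw [hk₂, hM₂'.nat (a := 10) (by decide), hM₂'.num (a := 6) (by decide),
      gridOf_congr hM₂'.fix] at hc3
    exact hc3 j c (h1.mono hM₂') h2

theorem roundC_spec {m : Memory K} {B : ℕ} (hD : DynB I mode B m) :
    Tri I.oracle (roundC mode) m
      (1900 * (B + 1) * (m.nat 11 0 + 1) ^ 2 * (m.nat 12 0 + 1) ^ 3) (fun m' =>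
      DynB I mode B m' ∧ Mono m m' ∧ ∀ τ₀ < m.nat 12 0, ∀ τ₁ < m.nat 12 0, ∀ y < m.nat 11 0,
        RulesDone I mode m τ₀ τ₁ y m') := by
  set C := 100 * (B + 1) * (m.nat 11 0 + 1) * (m.nat 12 0 + 1) with hC
  have hC1 : 100 ≤ C := by
    have : 1 ≤ (B + 1) * ((m.nat 11 0 + 1) * (m.nat 12 0 + 1)) :=
      Nat.mul_pos (by omega) (Nat.mul_pos (by omega) (by omega))
    rw [hC, mul_assoc, mul_assoc]; omega
  have hY1 : 1 ≤ m.nat 11 0 + 1 := by omega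
  have hN1 : 1 ≤ m.nat 12 0 + 1 := by omega
  refine Tri.forAll (n := m.nat 12 0) (T := 18 * C * (m.nat 11 0 + 1) * (m.nat 12 0 + 1))
    (DynB I mode B) Mono
    (fun τ₀ m' => ∀ τ₁ < m.nat 12 0, ∀ y < m.nat 11 0, RulesDone I mode m τ₀ τ₁ y m') rfl
    (by cases mode <;> rfl) rfl ?_
    (fun m v h => h.write (by decide) v) (fun m v => Mono.write m (by decide) v)
    (fun _ _ _ h h' => h.trans h') (fun x m₁ m₂ h hd τ₁ h1 y h2 => (hd τ₁ h1 y h2).mono h) hD ?_ ?_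
  · intro a ha
    simp [NExp.reads] at ha
    subst ha; cases mode <;> rfl
  · intro τ₀ hτ₀ m₁ hs₁ h49 hD₁ hM₁
    have f12 : m₁.nat 12 = m.nat 12 := hM₁.nat (by decide)
    refine Tri.forAll (n := m.nat 12 0) (T := 17 * C * (m.nat 11 0 + 1))
      (DynB I mode B) Mono
      (fun τ₁ m' => ∀ y < m.nat 11 0, RulesDone I mode m τ₀ τ₁ y m') (by simp only [NExp.eval, f12])
      (by cases mode <;> rfl) rfl ?_
      (fun m v h => h.write (by decide) v) (fun m v => Mono.write m (by decide) v)
      (fun _ _ _ h h' => h.trans h') (fun x m₁ m₂ h hd y h2 => (hd y h2).mono h) hD₁ ?_ ?_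
    · intro a ha
      simp [NExp.reads] at ha
      subst ha; cases mode <;> rfl
    · intro τ₁ hτ₁ m₂ hs₂ h50 hD₂ hM₂
      have g11 : m₂.nat 11 = m.nat 11 := (hM₁.trans hM₂).nat (by decide)
      refine Tri.forAll (n := m.nat 11 0) (T := 16 * C)
        (DynB I mode B) Mono
        (fun y m' => RulesDone I mode m τ₀ τ₁ y m') (by simp only [NExp.eval, g11])
        (by cases mode <;> rfl) rfl ?_
        (fun m v h => h.write (by decide) v) (fun m v => Mono.write m (by decide) v)
        (fun _ _ _ h h' => h.trans h') (fun x m₁ m₂ h hd => hd.mono h) hD₂ ?_ ?_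
      · intro a ha
        simp [NExp.reads] at ha
        subst ha; cases mode <;> rfl
      · intro y hy m₃ hs₃ h51 hD₃ hM₃
        have hM := (hM₁.trans hM₂).trans hM₃
        have l11 : m₃.nat 11 = m.nat 11 := hM.nat (by decide)
        have l12 : m₃.nat 12 = m.nat 12 := hM.nat (by decide)
        refine (entryC_spec (B := B) (τ₀ := τ₀) (τ₁ := τ₁) (y := y) hD₃ ?_ ?_ h51 ?_ ?_ ?_).mono ?_ ?_
        · rw [hs₃.nat 49 (by cases mode <;> rfl), hs₂.nat 49 (by cases mode <;> rfl), h49]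
        · rw [hs₃.nat 50 (by cases mode <;> rfl), h50]
        · rwa [l12]
        · rwa [l12]
        · rwa [l11]
        · rw [l11, l12, hC]; apply le_of_eq; ring
        · rintro m' _ ⟨a1, a2, a3⟩
          exact ⟨a1, a2, a3.of_later hM⟩
      · simp only [NExp.size]
        exact Nat.mul_le_mul (by omega) le_rfl
    · simp only [NExp.size]
      refine Nat.mul_le_mul ?_ le_rfl
      nlinarith
  · simp only [NExp.size]
    have h1 : 1 ≤ (m.nat 11 0 + 1) * (m.nat 12 0 + 1) := Nat.mul_pos hY1 hN1
    have h2 : 18 * C * (m.nat 11 0 + 1) * (m.nat 12 0 + 1) + (1 + 1) + 12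
        ≤ 19 * C * (m.nat 11 0 + 1) * (m.nat 12 0 + 1) := by
      rw [mul_assoc, mul_assoc (19 * C)]
      nlinarith
    refine (Nat.mul_le_mul h2 le_rfl).trans (le_of_eq ?_)
    rw [hC]; ring

/-- Everything derivable in `h` steps has been found. -/
def Found (I : Problem K) (mode : Mode) (h : ℕ) (m m' : Memory K) : Prop :=
  ∀ τ₀ τ₁ y c (L : Schedule K I.n) J, Der I mode (gridOf I.n m) h τ₀ τ₁ y c L J →
    Has m' (kap m τ₀ τ₁ y) c

/-- The last rule of a derivation of height `h + 1` has premises of height `h`, which are in the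
table before the round; the empty schedules have been there from the beginning. -/
theorem Found.round {m m' m'' : Memory K} {h : ℕ} (hE : Env I m) (hM : Mono m m') (hM' : Mono m' m'')
    (hF : Found I mode h m m')
    (hR : ∀ τ₀ < m'.nat 12 0, ∀ τ₁ < m'.nat 12 0, ∀ y < m'.nat 11 0,
      RulesDone I mode m' τ₀ τ₁ y m'') : Found I mode (h + 1) m m'' := by
  have hk : kap m' = kap m := kap_congr hM.fix
  have f11 : m'.nat 11 = m.nat 11 := hM.nat (by decide)
  have f12 : m'.nat 12 = m.nat 12 := hM.nat (by decide)
  have f10 : m'.nat 10 = m.nat 10 := hM.nat (by decide)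
  have f6 : m'.num 6 = m.num 6 := hM.num (by decide)
  have hg := gridOf_congr hM.fix I.n
  intro τ₀ τ₁ y c L J d
  generalize hh : h + 1 = h' at d
  cases d with
  | nil h₁ τ hτ => exact (hF _ _ _ _ _ _ (.nil _ _ hτ)).mono hM'
  | idle h₁ τ b hτ hT => exact (hF _ _ _ _ _ _ (.idle _ _ _ hτ hT)).mono hM'
  | @concat h₁ τ₀ τ₁ τ₂ y₁ y₂ c₁ c₂ L₁ L₂ J₁ J₂ d₁ d₂ hy =>
    obtain rfl : h = h₁ := by omega
    obtain ⟨a1, a2, a3, -⟩ := d₁.basic hE.Y_pos hE.anc_lt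
    obtain ⟨b1, b2, b3, -⟩ := d₂.basic hE.Y_pos hE.anc_lt
    simp only [gridOf] at a1 a2 a3 b1 b2 b3 hy
    have := (hR τ₀ (by rwa [f12]) τ₁ (by rwa [f12]) y₁ (by rwa [f11])).1 _ (by rwa [f12]) y₂
      (by rwa [f11]) c₁ c₂
    rw [hk, f11] at this
    exact this (hF _ _ _ _ _ _ d₁) (hF _ _ _ _ _ _ d₂) hy
  | @close h₁ τ₀ τ₁ y c L J j d₁ h1 h2 h3 h4 h5 h6 h7 =>
    obtain rfl : h = h₁ := by omega
    obtain ⟨a1, a2, a3, -⟩ := d₁.basic hE.Y_pos hE.anc_lt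
    simp only [gridOf] at a1 a2 a3
    have := (hR τ₀ (by rwa [f12]) τ₁ (by rwa [f12]) y (by rwa [f11])).2 j c
    rw [hk, f10, f6, hg] at this
    exact this (hF _ _ _ _ _ _ d₁) ⟨h1, h2, h3, h4, h5, h6, h7⟩

theorem roundsC_spec {m : Memory K} {B q : ℕ} (hD : DynB I mode B m) (hq : m.nat 4 0 = q)
    (hF : Found I mode 0 m m) :
    Tri I.oracle (roundsC mode) m
      (2000 * (B + 1) * (m.nat 11 0 + 1) ^ 2 * (m.nat 12 0 + 1) ^ 3 * (8 * q + 2)) (fun m' =>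
      Dyn I mode m' ∧ Mono m m' ∧ Found I mode (8 * q) m m') := by
  set C := (B + 1) * (m.nat 11 0 + 1) ^ 2 * (m.nat 12 0 + 1) ^ 3 with hC
  have hC1 : 1 ≤ C := Nat.mul_pos (Nat.mul_pos (by omega) (by positivity)) (by positivity)
  have hCe : 2000 * (B + 1) * (m.nat 11 0 + 1) ^ 2 * (m.nat 12 0 + 1) ^ 3 * (8 * q + 2)
      = (2000 * C) * (8 * q + 1) + 2000 * C := by rw [hC]; ring
  have hgo : ∀ m₁, DynB I mode B m₁ → Mono m m₁ → m₁.nat 60 0 = 8 * q →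
      Tri I.oracle (forC 48 (rd 60) (roundC mode)) m₁ ((2000 * C) * (8 * q + 1)) (fun m' =>
        Dyn I mode m' ∧ Mono m m' ∧ Found I mode (8 * q) m m') := by
    intro m₁ hD₁ hM₁ h60
    refine Tri.forC (n := 8 * q) (T := 1900 * C)
      (fun t m' => DynB I mode B m' ∧ Mono m m' ∧ Found I mode t m m') h60 (by cases mode <;> rfl) rfl
      ?_ ?_ ?_ ?_ ?_
    · intro a ha
      simp [NExp.reads] at ha
      subst ha; cases mode <;> rfl
    · have hM := hM₁.trans (Mono.write m₁ (i := 48) (by decide) 0)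
      exact ⟨hD₁.write (by decide) 0, hM, fun τ₀ τ₁ y c L J d => (hF τ₀ τ₁ y c L J d).mono hM⟩
    · rintro t ht m₂ - - ⟨hD₂, hM₂, hF₂⟩
      refine (roundC_spec hD₂).mono ?_ ?_
      · rw [hM₂.nat (a := 11) (by decide), hM₂.nat (a := 12) (by decide), hC]
        apply le_of_eq; ring
      · rintro m₃ _ ⟨a1, a2, a3⟩
        have hw := Mono.write m₃ (i := 48) (by decide) (t + 1)
        refine ⟨a1.write (by decide) _, (hM₂.trans a2).trans hw, ?_⟩
        intro τ₀ τ₁ y c L J d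
        exact (Found.round hD.1.env hM₂ a2 hF₂ a3 τ₀ τ₁ y c L J d).mono hw
    · simp only [NExp.size]
      exact Nat.mul_le_mul (by omega) le_rfl
    · rintro m₂ - ⟨a1, a2, a3⟩
      exact ⟨a1.1, a2, a3⟩
  rw [hCe]
  refine Tri.step rfl (T₂ := (2000 * C) * (8 * q + 1) + 1980 * C) ?_ (by
    have : (setR 60 (rd 4 +ₙ rd 4)).cost ≤ 20 := by decide
    omega)
  intro m₁ hs₁ he₁
  refine Tri.step rfl (T₂ := (2000 * C) * (8 * q + 1) + 1960 * C) ?_ (by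
    have : (setR 60 (rd 60 +ₙ rd 60)).cost ≤ 20 := by decide
    omega)
  intro m₂ hs₂ he₂
  refine Tri.step rfl (T₂ := (2000 * C) * (8 * q + 1)) ?_ (by
    have : (setR 60 (rd 60 +ₙ rd 60)).cost ≤ 20 := by decide
    omega)
  intro m₃ hs₃ he₃
  have hH : HeapStep m m₃ := HeapStep.trans (.of_same hs₁ (by decide) (by decide))
    (HeapStep.trans (.of_same hs₂ (by decide) (by decide)) (.of_same hs₃ (by decide) (by decide)))
  refine hgo m₃ ⟨hH.dyn hD.1, hD.2.congr hH.mono.fix⟩ hH.mono ?_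
  have h1 : m₁.nat 60 0 = q + q := by
    rw [he₁]; simp [Cmd.exec, NExp.eval, writeNat_nat, hq]
  have h2 : m₂.nat 60 0 = (q + q) + (q + q) := by
    rw [he₂]; simp [Cmd.exec, NExp.eval, writeNat_nat, h1]
  rw [he₃]; simp [Cmd.exec, NExp.eval, writeNat_nat, h2]; omega

end Dynamic

end RejSched

/-! ### Codes for multisets of processing times -/

namespace RejSched

section Tables

variable {K : Type} [CommRing K] [LinearOrder K] [IsStrictOrderedRing K]
variable {w : ℕ → K → K} {I : Problem K}

theorem sum_map_split {α M : Type*} [DecidableEq α] [AddCommMonoid M] (f : α → M) (x : α)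
    (J : List α) :
    (J.map f).sum = ((J.filter (fun j => j ≠ x)).map f).sum + J.count x • f x := by
  induction J with
  | nil => simp
  | cons a J ih =>
    by_cases h : a = x
    · subst h
      simp [ih, succ_nsmul, add_comm, add_assoc]
    · simp [ih, h, add_assoc]

theorem length_split {α : Type*} [DecidableEq α] (x : α) (J : List α) :
    J.length = (J.filter (fun j => j ≠ x)).length + J.count x := by
  have := sum_map_split (fun _ : α => 1) x J
  simpa using this

/-- The number of different processing times of the colored jobs below `x`. -/
def numTypes (I : Problem K) (col : ℕ → ℕ) (q x : ℕ) : ℕ :=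
  ((Finset.univ.filter (fun j : Fin I.n => (j : ℕ) < x ∧ col j < q)).image I.p).card

theorem numTypes_mono (I : Problem K) (col : ℕ → ℕ) (q : ℕ) {x y : ℕ} (h : x ≤ y) :
    numTypes I col q x ≤ numTypes I col q y := by
  refine Finset.card_le_card (Finset.image_subset_image fun j hj => ?_)
  simp only [Finset.mem_filter, Finset.mem_univ, true_and] at hj ⊢
  exact ⟨by omega, hj.2⟩

theorem filter_succ (I : Problem K) {col : ℕ → ℕ} {q x : ℕ} (hx : x < I.n) (hc : col x < q) :
    (Finset.univ.filter (fun j : Fin I.n => (j : ℕ) < x + 1 ∧ col j < q))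
      = insert ⟨x, hx⟩ (Finset.univ.filter (fun j : Fin I.n => (j : ℕ) < x ∧ col j < q)) := by
  ext j
  simp only [Finset.mem_filter, Finset.mem_univ, true_and, Finset.mem_insert, Fin.ext_iff]
  constructor
  · rintro ⟨h1, h2⟩
    by_cases h : (j : ℕ) = x
    · exact Or.inl h
    · exact Or.inr ⟨by omega, h2⟩
  · rintro (h | ⟨h1, h2⟩)
    · exact ⟨by omega, by rw [h]; exact hc⟩
    · exact ⟨by omega, h2⟩

theorem numTypes_succ_skip (I : Problem K) {col : ℕ → ℕ} {q x : ℕ} (hc : ¬ col x < q) :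
    numTypes I col q (x + 1) = numTypes I col q x := by
  unfold numTypes
  congr 2
  ext j
  simp only [Finset.mem_filter, Finset.mem_univ, true_and]
  constructor
  · rintro ⟨h1, h2⟩
    refine ⟨lt_of_le_of_ne (by omega) ?_, h2⟩
    intro h; rw [h] at h2; exact hc h2
  · rintro ⟨h1, h2⟩; exact ⟨by omega, h2⟩

theorem numTypes_succ_old (I : Problem K) {col : ℕ → ℕ} {q x : ℕ} (hx : x < I.n) (hc : col x < q)
    (i : Fin I.n) (hi : (i : ℕ) < x) (hci : col i < q) (hp : I.p i = I.p ⟨x, hx⟩) :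
    numTypes I col q (x + 1) = numTypes I col q x := by
  unfold numTypes
  rw [filter_succ I hx hc, Finset.image_insert, Finset.card_insert_of_mem]
  rw [← hp]
  exact Finset.mem_image_of_mem _ (by simp [hi, hci])

theorem numTypes_succ_new (I : Problem K) {col : ℕ → ℕ} {q x : ℕ} (hx : x < I.n) (hc : col x < q)
    (h : ∀ i : Fin I.n, (i : ℕ) < x → col i < q → I.p i ≠ I.p ⟨x, hx⟩) :
    numTypes I col q (x + 1) = numTypes I col q x + 1 := by
  unfold numTypes
  rw [filter_succ I hx hc, Finset.image_insert, Finset.card_insert_of_notMem]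
  intro hm
  obtain ⟨i, hi, he⟩ := Finset.mem_image.mp hm
  simp only [Finset.mem_filter, Finset.mem_univ, true_and] at hi
  exact h i hi.1 hi.2 he

/-- The sums of strides of at most `q` jobs. -/
structure TypeInv (I : Problem K) (q x : ℕ) (m : Memory K) : Prop where
  V_eq : m.nat 8 0 = (q + 1) ^ numTypes I (m.nat 6) q x
  sum : ∀ J : List (Fin I.n), (∀ j ∈ J, (j : ℕ) < x ∧ m.nat 6 j < q) → J.length ≤ q →
    (J.map (fun j : Fin I.n => m.nat 7 j)).sum < m.nat 8 0 ∧
      m.num 5 (J.map (fun j : Fin I.n => m.nat 7 j)).sum = I.work J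

theorem TypeInv.congr {q x : ℕ} {m m' : Memory K} (h : TypeInv I q x m) (h6 : m'.nat 6 = m.nat 6)
    (h7 : m'.nat 7 = m.nat 7) (h8 : m'.nat 8 = m.nat 8) (h5 : m'.num 5 = m.num 5) :
    TypeInv I q x m' := by
  obtain ⟨h1, h2⟩ := h
  constructor
  · rw [h8, h6, h1]
  · rw [h6, h7, h8, h5]; exact h2

/-- A repeated processing time shares the place value of an earlier job `i`. Replacing `x` by `i` in
a list changes neither the code nor the work. -/
theorem TypeInv.old {q x : ℕ} {m m' : Memory K} (h : TypeInv I q x m) (hx : x < I.n)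
    (hc : m.nat 6 x < q) (i : Fin I.n) (hi : (i : ℕ) < x) (hci : m.nat 6 i < q)
    (hp : I.p i = I.p ⟨x, hx⟩) (h6 : m'.nat 6 = m.nat 6) (h8 : m'.nat 8 = m.nat 8)
    (h5 : m'.num 5 = m.num 5) (h7 : ∀ y < x, m'.nat 7 y = m.nat 7 y)
    (h7x : m'.nat 7 x = m.nat 7 i) : TypeInv I q (x + 1) m' := by
  constructor
  · rw [h8, h6, numTypes_succ_old I hx hc i hi hci hp, h.V_eq]
  · intro J hJ hl
    rw [h6] at hJ
    let g : Fin I.n → Fin I.n := fun j => if (j : ℕ) = x then i else j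
    have h1 : ∀ j ∈ J, m'.nat 7 j = m.nat 7 (g j) := by
      intro j hj
      by_cases hjx : (j : ℕ) = x
      · simp only [g, hjx, if_true, h7x]
      · simp only [g, hjx, if_false]
        exact h7 _ (by have := (hJ j hj).1; omega)
    have h2 : ∀ j ∈ J, I.p j = I.p (g j) := by
      intro j hj
      by_cases hjx : (j : ℕ) = x
      · simp only [g, hjx, if_true, hp]
        congr 1; exact Fin.ext hjx
      · simp only [g, hjx, if_false]
    have h3 := h.sum (J.map g) (by
      intro j hj
      obtain ⟨j', hj', rfl⟩ := List.mem_map.mp hj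
      have := hJ j' hj'
      by_cases hjx : (j' : ℕ) = x
      · simp only [g, hjx, if_true]; exact ⟨hi, hci⟩
      · simp only [g, hjx, if_false]; exact ⟨by omega, this.2⟩) (by simpa using hl)
    rw [List.map_map] at h3
    have h4 : J.map (fun j : Fin I.n => m'.nat 7 j) = J.map ((fun j : Fin I.n => m.nat 7 j) ∘ g) :=
      List.map_congr_left fun j hj => h1 j hj
    have h5' : I.work J = I.work (J.map g) := by
      unfold Problem.work
      rw [List.map_map]
      exact congrArg List.sum (List.map_congr_left fun j hj => h2 j hj)
    rw [h8, h5, h4, h5']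
    exact h3

/-- A new processing time opens a new digit with place value `V`, the current number of codes. At
most `q` jobs occur, so base `q + 1` avoids carries, and the table consists of translates of its
first `V` entries. -/
theorem TypeInv.new {q x : ℕ} {m m' : Memory K} (h : TypeInv I q x m) (hx : x < I.n)
    (hc : m.nat 6 x < q)
    (hno : ∀ i : Fin I.n, (i : ℕ) < x → m.nat 6 i < q → I.p i ≠ I.p ⟨x, hx⟩)
    (h6 : m'.nat 6 = m.nat 6) (h8 : m'.nat 8 0 = (q + 1) * m.nat 8 0)
    (h5 : ∀ y < m.nat 8 0, m'.num 5 y = m.num 5 y)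
    (h5' : ∀ y < q * m.nat 8 0, m'.num 5 (m.nat 8 0 + y) = m'.num 5 y + I.p ⟨x, hx⟩)
    (h7 : ∀ y < x, m'.nat 7 y = m.nat 7 y) (h7x : m'.nat 7 x = m.nat 8 0) :
    TypeInv I q (x + 1) m' := by
  constructor
  · rw [h8, h6, numTypes_succ_new I hx hc hno, h.V_eq, pow_succ]; ring
  · intro J hJ hl
    rw [h6] at hJ
    set V := m.nat 8 0 with hV
    set x' : Fin I.n := ⟨x, hx⟩ with hx'
    set J' := J.filter (fun j => j ≠ x') with hJ'
    set c := J.count x' with hcdef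
    have hlen : J.length = J'.length + c := length_split x' J
    have hmem : ∀ j ∈ J', (j : ℕ) < x ∧ m.nat 6 j < q := by
      intro j hj
      simp only [hJ', List.mem_filter, decide_eq_true_eq] at hj
      have h1 := hJ j hj.1
      have h2 : (j : ℕ) ≠ x := fun h => hj.2 (Fin.ext h)
      exact ⟨by omega, h1.2⟩
    obtain ⟨h1, h2⟩ := h.sum J' hmem (by omega)
    have hs : (J.map (fun j : Fin I.n => m'.nat 7 j)).sum
        = (J'.map (fun j : Fin I.n => m.nat 7 j)).sum + c * V := by
      rw [sum_map_split _ x' J, ← hJ', ← hcdef, hx', h7x, smul_eq_mul]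
      congr 2
      exact List.map_congr_left fun j hj => h7 j (hmem j hj).1
    have hw : I.work J = I.work J' + c • I.p x' := sum_map_split _ x' J
    set s := (J'.map (fun j : Fin I.n => m.nat 7 j)).sum with hsdef
    -- The copies of the new job are added one at a time, each by one shift of length `V`.
    have key : ∀ d ≤ q, m'.num 5 (s + d * V) = I.work J' + d • I.p x' := by
      intro d
      induction d with
      | zero => intro _; simp [h5 s h1, h2]
      | succ d ih =>
        intro hd
        have e : s + (d + 1) * V = V + (s + d * V) := by ring
        rw [e, h5' _ ?_, ih (by omega), succ_nsmul, add_assoc]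
        calc s + d * V < V + d * V := by omega
          _ = (d + 1) * V := by ring
          _ ≤ q * V := Nat.mul_le_mul hd le_rfl
    rw [hs, h8, hw]
    refine ⟨?_, key c (by omega)⟩
    calc s + c * V < V + c * V := by omega
      _ = (c + 1) * V := by ring
      _ ≤ (q + 1) * V := Nat.mul_le_mul (by omega) le_rfl

/-- Treatment of one job by `typesC`. -/
abbrev typeStepC : Cmd := ifC (ltN (.read 6 (rd 25)) (rd 4))
    (setR 26 (.const 0) ⨟
     forC 27 (rd 25) (ifC (.and (ltN (.read 6 (rd 27)) (rd 4))
        (.and (.numLe (.read 1 (rd 27)) (.read 1 (rd 25)))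
          (.numLe (.read 1 (rd 25)) (.read 1 (rd 27)))))
        (.setNat 7 (rd 25) (.read 7 (rd 27)) ⨟ setR 26 (.const 1))) ⨟
     ifC (.natLe (rd 26) (.const 0))
       (.setNat 7 (rd 25) (rd 8) ⨟ mulC 28 29 (rd 4 +ₙ .const 1) (rd 8) ⨟
        forC 30 (rd 28 -ₙ rd 8)
          (.setNum 5 (rd 8 +ₙ rd 30) (.read 5 (rd 30) +ₖ .read 1 (rd 25))) ⨟
        setR 8 (rd 28)))

theorem typeStepC_spec {m : Memory K} {q x U : ℕ} (hx : x < I.n) (h25 : m.nat 25 0 = x)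
    (h4 : m.nat 4 0 = q) (hp : ∀ j : Fin I.n, m.num 1 j = I.p j) (hT : TypeInv I q x m)
    (hU : (q + 1) ^ numTypes I (m.nat 6) q I.n ≤ U) :
    Tri w typeStepC m (300 * (I.n + q + U + 1)) (TypeInv I q (x + 1)) := by
  refine Tri.ite (T₁ := 280 * (I.n + q + U + 1)) ?_ ?_ (by
    have : (ltN (.read 6 (rd 25)) (rd 4)).size ≤ 10 := by decide
    omega)
  rotate_left
  · intro hc
    simp only [Cond.Holds, NExp.eval, h25, h4] at hc
    have hc' : ¬ m.nat 6 x < q := by omega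
    refine Tri.line rfl (by simp [Cmd.cost]; omega) ⟨?_, ?_⟩
    · simp only [Cmd.exec]; rw [numTypes_succ_skip I hc', hT.V_eq]
    · intro J hJ hl
      refine hT.sum J (fun j hj => ?_) hl
      obtain ⟨h1, h2⟩ := hJ j hj
      simp only [Cmd.exec] at h2
      refine ⟨lt_of_le_of_ne (by omega) (fun h => ?_), h2⟩
      rw [h] at h2; exact hc' h2
  intro hc
  simp only [Cond.Holds, NExp.eval, h25, h4] at hc
  have hc : m.nat 6 x < q := by omega
  refine Tri.step rfl (T₂ := 270 * (I.n + q + U + 1)) ?_ (by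
    have : (setR 26 (.const 0)).cost ≤ 10 := by decide
    omega)
  intro m₁ hs₁ he₁
  have h26 : m₁.nat 26 0 = 0 := by rw [he₁]; simp [Cmd.exec, NExp.eval, writeNat_nat]
  refine Tri.seq (T₁ := 70 * (I.n + 1)) (T₂ := 200 * (I.n + q + U + 1)) (Q' := fun m₂ =>
    (∀ y < x, m₂.nat 7 y = m.nat 7 y) ∧
    ((m₂.nat 26 0 = 0 ∧ ∀ i : Fin I.n, (i : ℕ) < x → m.nat 6 i < q → I.p i ≠ I.p ⟨x, hx⟩) ∨
     (m₂.nat 26 0 = 1 ∧ ∃ i : Fin I.n, (i : ℕ) < x ∧ m.nat 6 i < q ∧ I.p i = I.p ⟨x, hx⟩ ∧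
        m₂.nat 7 x = m.nat 7 i))) ?_ ?_ (by omega)
  · refine Tri.forC (n := x) (T := 50) (fun t m₂ => (∀ y < x, m₂.nat 7 y = m.nat 7 y) ∧
      ((m₂.nat 26 0 = 0 ∧ ∀ i : Fin I.n, (i : ℕ) < t → m.nat 6 i < q → I.p i ≠ I.p ⟨x, hx⟩) ∨
       (m₂.nat 26 0 = 1 ∧ ∃ i : Fin I.n, (i : ℕ) < t ∧ m.nat 6 i < q ∧ I.p i = I.p ⟨x, hx⟩ ∧
        m₂.nat 7 x = m.nat 7 i))) (by simp only [NExp.eval, hs₁.nat 25 rfl, h25]) rfl rfl ?_ ?_ ?_ ?_ ?_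
    · intro a ha
      simp [NExp.reads] at ha
      subst ha; rfl
    · refine ⟨fun y _ => by rw [writeNat_nat_of_ne _ _ _ (by decide), hs₁.nat 7 rfl], Or.inl ⟨?_, ?_⟩⟩
      · rw [writeNat_nat_of_ne _ _ _ (by decide), h26]
      · intro i hi; omega
    · rintro t ht m₂ hs₂ h27 ⟨g1, g2⟩
      have e25 : m₂.nat 25 0 = x := by rw [hs₂.nat 25 rfl, hs₁.nat 25 rfl, h25]
      have e4 : m₂.nat 4 0 = q := by rw [hs₂.nat 4 rfl, hs₁.nat 4 rfl, h4]
      have e6 : m₂.nat 6 = m.nat 6 := by rw [hs₂.nat 6 rfl, hs₁.nat 6 rfl]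
      have e1 : m₂.num 1 = m.num 1 := by rw [hs₂.num 1 rfl, hs₁.num 1 rfl]
      have ht' : t < I.n := by omega
      refine Tri.line rfl (by decide) ?_
      have p1 : m.num 1 t = I.p ⟨t, ht'⟩ := hp ⟨t, ht'⟩
      have p2 : m.num 1 x = I.p ⟨x, hx⟩ := hp ⟨x, hx⟩
      simp only [Cmd.exec, Cond.Holds, NExp.eval, KExp.eval, h27, e25, e4, e6, e1, p1, p2]
      split_ifs with hif
      · obtain ⟨f1, f2, f3⟩ := hif
        refine ⟨?_, Or.inr ⟨?_, ⟨t, ht'⟩, by simp, f1, le_antisymm f2 f3, ?_⟩⟩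
        · intro y hy
          simp only [writeNat_nat]
          have : y ≠ x := by omega
          simp [this, g1 y hy]
        · simp [writeNat_nat]
        · simp [writeNat_nat, g1 t ht]
      · refine ⟨fun y hy => by rw [writeNat_nat_of_ne _ _ _ (by decide), g1 y hy], ?_⟩
        rw [writeNat_nat_of_ne _ _ _ (by decide), writeNat_nat_of_ne _ _ _ (by decide)]
        rcases g2 with ⟨f1, f2⟩ | ⟨f1, i, f2, f3⟩
        · refine Or.inl ⟨f1, fun i hi hci hpi => ?_⟩
          by_cases hit : (i : ℕ) = t
          · have : i = ⟨t, ht'⟩ := Fin.ext hit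
            subst this
            exact hif ⟨hci, hpi.le, hpi.ge⟩
          · exact f2 i (by omega) hci hpi
        · exact Or.inr ⟨f1, i, by omega, f3⟩
    · simp only [NExp.size]
      exact Nat.mul_le_mul (by omega) (by omega)
    · rintro m₂ _ h; exact h
  rintro m₂ hs₂ ⟨g1, g2⟩
  have e25 : m₂.nat 25 0 = x := by rw [hs₂.nat 25 rfl, hs₁.nat 25 rfl, h25]
  have e4 : m₂.nat 4 0 = q := by rw [hs₂.nat 4 rfl, hs₁.nat 4 rfl, h4]
  have e6 : m₂.nat 6 = m.nat 6 := by rw [hs₂.nat 6 rfl, hs₁.nat 6 rfl]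
  have e8 : m₂.nat 8 = m.nat 8 := by rw [hs₂.nat 8 rfl, hs₁.nat 8 rfl]
  have e1 : m₂.num 1 = m.num 1 := by rw [hs₂.num 1 rfl, hs₁.num 1 rfl]
  have e5 : m₂.num 5 = m.num 5 := by rw [hs₂.num 5 rfl, hs₁.num 5 rfl]
  refine Tri.ite (T₁ := 190 * (I.n + q + U + 1)) ?_ ?_ (by
    have : (Cond.natLe (rd 26) (.const 0)).size ≤ 8 := by decide
    omega)
  rotate_left
  · intro hc2
    simp only [Cond.Holds, NExp.eval] at hc2
    rcases g2 with ⟨f1, -⟩ | ⟨f1, i, f2, f3, f4, f5⟩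
    · omega
    exact Tri.line rfl (by simp [Cmd.cost]; omega) (hT.old hx hc i f2 f3 f4 e6 e8 e5 g1 f5)
  intro hc2
  simp only [Cond.Holds, NExp.eval] at hc2
  rcases g2 with ⟨f1, hno⟩ | ⟨f1, -⟩
  swap
  · omega
  set V := m.nat 8 0 with hV
  have hVpos : 0 < V := by rw [hV, hT.V_eq]; positivity
  -- `U` bounds the number of codes after the last job. This number only grows, so `U` also bounds
  -- the size of the table reached in the present step.
  have hVU : (q + 1) * V ≤ U := by
    refine le_trans (le_of_eq ?_) ((Nat.pow_le_pow_right (by omega)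
      (numTypes_mono I (m.nat 6) q (show x + 1 ≤ I.n from hx))).trans hU)
    rw [numTypes_succ_new I hx hc hno, hV, hT.V_eq, pow_succ]; ring
  have hVU' : q * V + V ≤ U := by rw [← Nat.succ_mul]; exact hVU
  refine Tri.step rfl (T₂ := 180 * (I.n + q + U + 1)) ?_ (by
    have : (Cmd.setNat 7 (rd 25) (rd 8)).cost ≤ 10 := by decide
    omega)
  intro m₃ hs₃ he₃
  have e7 : ∀ y, m₃.nat 7 y = if y = x then V else m₂.nat 7 y := by
    intro y; rw [he₃]; simp [Cmd.exec, NExp.eval, writeNat_nat, e25, e8, hV]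
  have a8 : m₃.nat 8 = m.nat 8 := by rw [hs₃.nat 8 rfl, e8]
  have a4 : m₃.nat 4 0 = q := by rw [hs₃.nat 4 rfl, e4]
  refine Tri.seq (T₁ := 30 * (q + 2)) (T₂ := 120 * (I.n + q + U + 1))
    ((mulC_spec (by decide) rfl rfl rfl rfl le_rfl).mono ?_ (fun _ _ h => h)) ?_ (by omega)
  · simp only [NExp.size, NExp.eval, a4]
    exact Nat.mul_le_mul (by omega) (by omega)
  rintro m₄ hs₄ h28
  simp only [NExp.eval, a4, a8] at h28
  rw [← hV] at h28
  have b8 : m₄.nat 8 = m.nat 8 := by rw [hs₄.nat 8 rfl, a8]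
  have b25 : m₄.nat 25 0 = x := by rw [hs₄.nat 25 rfl, hs₃.nat 25 rfl, e25]
  have b1 : m₄.num 1 = m.num 1 := by rw [hs₄.num 1 rfl, hs₃.num 1 rfl, e1]
  have b5 : m₄.num 5 = m.num 5 := by rw [hs₄.num 5 rfl, hs₃.num 5 rfl, e5]
  refine Tri.seq (T₁ := 60 * (U + 1)) (T₂ := 20) (Q' := fun m₅ =>
    (∀ y < V, m₅.num 5 y = m.num 5 y) ∧
    ∀ y < q * V, m₅.num 5 (V + y) = m₅.num 5 y + I.p ⟨x, hx⟩) ?_ ?_ (by omega)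
  · refine Tri.forC (n := q * V) (T := 30) (fun t m₅ => (∀ y < V, m₅.num 5 y = m.num 5 y) ∧
      ∀ y < t, m₅.num 5 (V + y) = m₅.num 5 y + I.p ⟨x, hx⟩) ?_ rfl rfl ?_ ?_ ?_ ?_ ?_
    · simp only [NExp.eval, h28, b8, ← hV]
      rw [Nat.succ_mul]; omega
    · intro a ha
      simp [NExp.reads] at ha
      rcases ha with rfl | rfl <;> rfl
    · exact ⟨fun y _ => by rw [writeNat_num, b5], fun y hy => by omega⟩
    · rintro t ht m₅ hs₅ h30 ⟨k1, k2⟩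
      refine Tri.line rfl (by decide) ?_
      have c8 : m₅.nat 8 0 = V := by rw [hs₅.nat 8 rfl, b8]
      have c25 : m₅.nat 25 0 = x := by rw [hs₅.nat 25 rfl, b25]
      have c1 : m₅.num 1 x = I.p ⟨x, hx⟩ := by rw [hs₅.num 1 rfl, b1]; exact hp ⟨x, hx⟩
      simp only [Cmd.exec, NExp.eval, KExp.eval, c8, c25, h30, c1, writeNat_num, writeNum_num,
        true_and]
      constructor
      · intro y hy
        rw [if_neg (by omega), k1 y hy]
      · intro y hy
        rw [if_neg (show ¬ y = V + t by omega)]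
        by_cases hyt : y = t
        · rw [if_pos (by omega), hyt]
        · rw [if_neg (by omega), k2 y (by omega)]
    · simp only [NExp.size]
      exact Nat.mul_le_mul (by omega) (by omega)
    · rintro m₅ _ h; exact h
  rintro m₅ hs₅ ⟨k1, k2⟩
  refine Tri.line rfl (by decide) (hT.new hx hc hno ?_ ?_ ?_ ?_ ?_ ?_)
  · rw [← e6]; simp only [Cmd.exec, NExp.eval]
    rw [writeNat_nat_of_ne _ _ _ (by decide), hs₅.nat 6 rfl, hs₄.nat 6 rfl, hs₃.nat 6 rfl]
  · simp only [Cmd.exec, NExp.eval, writeNat_nat, hs₅.nat 28 rfl, h28]; simp [hV]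
  · exact k1
  · exact k2
  · intro y hy
    simp only [Cmd.exec, NExp.eval]
    rw [writeNat_nat_of_ne _ _ _ (by decide), hs₅.nat 7 rfl, hs₄.nat 7 rfl, e7, if_neg (by omega),
      g1 y hy]
  · simp only [Cmd.exec, NExp.eval]
    rw [writeNat_nat_of_ne _ _ _ (by decide), hs₅.nat 7 rfl, hs₄.nat 7 rfl, e7, if_pos rfl]

theorem typesC_spec {m : Memory K} {q U : ℕ} (h0 : m.nat 0 0 = I.n)
    (h4 : m.nat 4 0 = q) (hp : ∀ j : Fin I.n, m.num 1 j = I.p j)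
    (hU : (q + 1) ^ numTypes I (m.nat 6) q I.n ≤ U) :
    Tri w typesC m (400 * (I.n + q + U + 1) * (I.n + 1)) (TypeInv I q I.n) := by
  have hC : I.n + q + U + 1 ≤ (I.n + q + U + 1) * (I.n + 1) := Nat.le_mul_of_pos_right _ (by omega)
  refine Tri.step rfl (T₂ := 390 * (I.n + q + U + 1) * (I.n + 1)) ?_ (by
    have : (setR 8 (.const 1)).cost ≤ 10 := by decide
    rw [mul_assoc, mul_assoc]
    omega)
  intro m₁ hs₁ he₁
  refine Tri.step rfl (T₂ := 380 * (I.n + q + U + 1) * (I.n + 1)) ?_ (by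
    have : (setK 5 .zero).cost ≤ 10 := by decide
    rw [mul_assoc, mul_assoc]
    omega)
  intro m₂ hs₂ he₂
  have e6 : m₂.nat 6 = m.nat 6 := by rw [hs₂.nat 6 rfl, hs₁.nat 6 rfl]
  have e8 : m₂.nat 8 0 = 1 := by
    rw [hs₂.nat 8 rfl, he₁]; simp [Cmd.exec, NExp.eval, writeNat_nat]
  have e5 : m₂.num 5 0 = 0 := by
    rw [he₂]; simp [Cmd.exec, NExp.eval, KExp.eval, writeNum_num]
  refine Tri.forC (n := I.n) (T := 300 * (I.n + q + U + 1)) (TypeInv I q) ?_ rfl rfl ?_ ?_ ?_ ?_ ?_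
  · simp only [NExp.eval, hs₂.nat 0 rfl, hs₁.nat 0 rfl, h0]
  · intro a ha
    simp [NExp.reads] at ha
    subst ha; rfl
  · refine TypeInv.congr (m := m₂) ⟨?_, ?_⟩ ?_ ?_ ?_ ?_
    · rw [e8]; simp [numTypes]
    · intro J hJ _
      have : J = [] := by
        cases J with
        | nil => rfl
        | cons j J => exact absurd (hJ j (by simp)).1 (by omega)
      subst this
      simp [e8, e5]
    all_goals rfl
  · intro x hx m₃ hs₃ h25 hI
    refine (typeStepC_spec hx h25 (by rw [hs₃.nat 4 rfl, hs₂.nat 4 rfl, hs₁.nat 4 rfl, h4])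
      (by intro j; rw [hs₃.num 1 rfl, hs₂.num 1 rfl, hs₁.num 1 rfl, hp]) hI
      (by rw [hs₃.nat 6 rfl, e6]; exact hU)).mono le_rfl ?_
    intro m₄ _ hI'
    exact hI'.congr (writeNat_nat_of_ne _ _ _ (by decide)) (writeNat_nat_of_ne _ _ _ (by decide))
      (writeNat_nat_of_ne _ _ _ (by decide)) rfl
  · simp only [NExp.size]
    exact Nat.mul_le_mul (by omega) le_rfl
  · intro m' _ h; exact h

end Tables

end RejSched

/-! ### Weights, addresses and points of time -/

namespace RejSched

section Tables

variable {K : Type} [CommRing K] [LinearOrder K] [IsStrictOrderedRing K]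
variable {w : ℕ → K → K} {I : Problem K}

/-- The weights of the colored jobs and the table of processing times. -/
structure WeightInv (I : Problem K) (q : ℕ) (m : Memory K) : Prop where
  V_eq : m.nat 8 0 = (q + 1) ^ numTypes I (m.nat 6) q I.n
  pw : m.nat 9 q = 2 ^ q * m.nat 8 0
  Y_eq : m.nat 11 0 = (q + 1) * (2 ^ q * m.nat 8 0)
  wt : ∀ J : List (Fin I.n), (∀ j ∈ J, m.nat 6 j < q) → (J.map (fun j : Fin I.n => m.nat 10 j)).sum
    = (J.length * 2 ^ q + (J.map (fun j : Fin I.n => 2 ^ m.nat 6 j)).sum) * m.nat 8 0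
      + (J.map (fun j : Fin I.n => m.nat 7 j)).sum
  str : ∀ J : List (Fin I.n), (∀ j ∈ J, m.nat 6 j < q) → J.length ≤ q →
    (J.map (fun j : Fin I.n => m.nat 7 j)).sum < m.nat 8 0
  P_eq : ∀ J : List (Fin I.n), (∀ j ∈ J, m.nat 6 j < q) → J.length ≤ q →
    (J.map (fun j : Fin I.n => m.nat 10 j)).sum < m.nat 11 0 →
    m.num 5 (J.map (fun j : Fin I.n => m.nat 10 j)).sum = I.work J

theorem WeightInv.V_pos {q : ℕ} {m : Memory K} (h : WeightInv I q m) : 0 < m.nat 8 0 := by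
  rw [h.V_eq]; positivity

theorem WeightInv.Y_pos {q : ℕ} {m : Memory K} (h : WeightInv I q m) : 0 < m.nat 11 0 := by
  rw [h.Y_eq]; have := h.V_pos; positivity

/-- Each colored job weighs at least `2 ^ q * V`, and the range of weights ends at `(q + 1) * 2 ^ q
* V`. -/
theorem WeightInv.length_le {q : ℕ} {m : Memory K} (h : WeightInv I q m) {J : List (Fin I.n)}
    (hJ : ∀ j ∈ J, m.nat 6 j < q)
    (hY : (J.map (fun j : Fin I.n => m.nat 10 j)).sum < m.nat 11 0) : J.length ≤ q := by
  rw [h.wt J hJ, h.Y_eq] at hY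
  have h1 : J.length * (2 ^ q * m.nat 8 0) < (q + 1) * (2 ^ q * m.nat 8 0) := by
    refine lt_of_le_of_lt ?_ hY
    rw [add_mul, mul_assoc]; omega
  have := Nat.lt_of_mul_lt_mul_right h1
  omega

theorem weightsC_spec {m : Memory K} {q : ℕ} (h0 : m.nat 0 0 = I.n) (h4 : m.nat 4 0 = q)
    (hT : TypeInv I q I.n m) :
    Tri w weightsC m (300 * (I.n + (q + 1) * (2 ^ q * m.nat 8 0) + 1)) (WeightInv I q) := by
  set V := m.nat 8 0 with hV
  set Y := (q + 1) * (2 ^ q * V) with hY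
  have hVpos : 0 < V := by rw [hV, hT.V_eq]; positivity
  have hpos : 0 < 2 ^ q * V := by positivity
  have hqY : q + 1 ≤ Y := Nat.le_mul_of_pos_right _ hpos
  have hVY : V ≤ Y := by
    calc V ≤ 2 ^ q * V := Nat.le_mul_of_pos_left _ (by positivity)
      _ ≤ Y := Nat.le_mul_of_pos_left _ (by omega)
  refine Tri.step rfl (T₂ := 280 * (I.n + Y + 1)) ?_ (by
    have : (setR 9 (rd 8)).cost ≤ 10 := by decide
    omega)
  intro m₁ hs₁ he₁
  have e9 : m₁.nat 9 0 = V := by rw [he₁]; simp [Cmd.exec, NExp.eval, writeNat_nat, hV]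
  refine Tri.seq (T₁ := 60 * (q + 1)) (T₂ := 220 * (I.n + Y + 1)) (Q' := fun m₂ =>
    ∀ i ≤ q, m₂.nat 9 i = 2 ^ i * V) ?_ ?_ (by omega)
  · refine Tri.forC (n := q) (T := 40) (fun t m₂ => ∀ i ≤ t, m₂.nat 9 i = 2 ^ i * V)
      (by simp only [NExp.eval, hs₁.nat 4 rfl, h4]) rfl rfl ?_ ?_ ?_ ?_ ?_
    · intro a ha
      simp [NExp.reads] at ha
      subst ha; rfl
    · intro i hi
      obtain rfl : i = 0 := by omega
      rw [writeNat_nat_of_ne _ _ _ (by decide), e9]; simp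
    · rintro t ht m₂ hs₂ h31 hI
      refine Tri.line rfl (by decide) ?_
      intro i hi
      simp only [Cmd.exec, NExp.eval, h31, writeNat_nat, true_and]
      rw [if_neg (by simp)]
      by_cases hit : i = t + 1
      · rw [if_pos hit, hI t le_rfl, hit, pow_succ]; ring
      · rw [if_neg hit, hI i (by omega)]
    · simp only [NExp.size]
      exact Nat.mul_le_mul (by omega) le_rfl
    · intro m₂ _ h; exact h
  intro m₂ hs₂ hpw
  refine Tri.seq (T₁ := 60 * (I.n + 1)) (T₂ := 150 * (Y + 1)) (Q' := fun m₃ =>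
    ∀ j < I.n, m₃.nat 10 j = m₂.nat 9 q + m₂.nat 9 (m.nat 6 j) + m.nat 7 j) ?_ ?_ (by omega)
  · refine Tri.forC (n := I.n) (T := 40) (fun t m₃ => ∀ j < t, m₃.nat 10 j =
        m₂.nat 9 q + m₂.nat 9 (m.nat 6 j) + m.nat 7 j)
      (by simp only [NExp.eval, hs₂.nat 0 rfl, hs₁.nat 0 rfl, h0]) rfl rfl ?_ ?_ ?_ ?_ ?_
    · intro a ha
      simp [NExp.reads] at ha
      subst ha; rfl
    · intro i hi; omega
    · rintro t ht m₃ hs₃ h32 hI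
      refine Tri.line rfl (by decide) ?_
      intro i hi
      simp only [Cmd.exec, NExp.eval, h32, writeNat_nat, true_and, hs₃.nat 9 rfl, hs₃.nat 4 rfl,
        hs₂.nat 4 rfl, hs₁.nat 4 rfl, h4, hs₃.nat 6 rfl, hs₂.nat 6 rfl, hs₁.nat 6 rfl,
        hs₃.nat 7 rfl, hs₂.nat 7 rfl, hs₁.nat 7 rfl]
      rw [if_neg (by simp)]
      by_cases hit : i = t
      · rw [if_pos hit, hit]
      · rw [if_neg hit, hI i (by omega)]
    · simp only [NExp.size]
      exact Nat.mul_le_mul (by omega) le_rfl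
    · intro m₂ _ h; exact h
  intro m₃ hs₃ hwt
  have e4 : m₃.nat 4 0 = q := by rw [hs₃.nat 4 rfl, hs₂.nat 4 rfl, hs₁.nat 4 rfl, h4]
  have e9' : m₃.nat 9 = m₂.nat 9 := hs₃.nat 9 rfl
  refine Tri.seq (T₁ := 60 * (q + 1)) (T₂ := 90 * (Y + 1)) ((mulC_spec (by decide) rfl rfl rfl rfl
    (by simp only [NExp.eval, e4]; exact le_rfl)).mono ?_ (fun _ _ h => h)) ?_ (by omega)
  · simp only [NExp.size]; omega
  intro m₄ hs₄ hYm
  simp only [NExp.eval, e4, e9', hpw q le_rfl] at hYm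
  rw [← hY] at hYm
  have e8 : m₄.nat 8 = m.nat 8 := by
    rw [hs₄.nat 8 rfl, hs₃.nat 8 rfl, hs₂.nat 8 rfl, hs₁.nat 8 rfl]
  have e5 : m₄.num 5 = m.num 5 := by
    rw [hs₄.num 5 rfl, hs₃.num 5 rfl, hs₂.num 5 rfl, hs₁.num 5 rfl]
  refine Tri.forC (n := Y - V) (T := 40) (fun t m₅ => (∀ y < V, m₅.num 5 y = m.num 5 y) ∧
      ∀ y < t, m₅.num 5 (V + y) = m₅.num 5 y) (by simp only [NExp.eval, hYm, e8, ← hV]) rfl rfl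
      ?_ ?_ ?_ ?_ ?_
  · intro a ha
    simp [NExp.reads] at ha
    rcases ha with rfl | rfl <;> rfl
  · exact ⟨fun y _ => by rw [writeNat_num, e5], fun y hy => by omega⟩
  · rintro t ht m₅ hs₅ h34 ⟨k1, k2⟩
    refine Tri.line rfl (by decide) ?_
    have c8 : m₅.nat 8 0 = V := by rw [hs₅.nat 8 rfl, e8]
    simp only [Cmd.exec, NExp.eval, KExp.eval, c8, h34, writeNat_num, writeNum_num, true_and]
    constructor
    · intro y hy
      rw [if_neg (by omega), k1 y hy]
    · intro y hy
      rw [if_neg (show ¬ y = V + t by omega)]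
      by_cases hyt : y = t
      · rw [if_pos (by omega), hyt]
      · rw [if_neg (by omega), k2 y (by omega)]
  · simp only [NExp.size]
    exact Nat.mul_le_mul (by omega) (by omega)
  rintro m₅ hs₅ ⟨k1, k2⟩
  have f6 : m₅.nat 6 = m.nat 6 := by
    rw [hs₅.nat 6 rfl, hs₄.nat 6 rfl, hs₃.nat 6 rfl, hs₂.nat 6 rfl, hs₁.nat 6 rfl]
  have f7 : m₅.nat 7 = m.nat 7 := by
    rw [hs₅.nat 7 rfl, hs₄.nat 7 rfl, hs₃.nat 7 rfl, hs₂.nat 7 rfl, hs₁.nat 7 rfl]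
  have f8 : m₅.nat 8 = m.nat 8 := by rw [hs₅.nat 8 rfl, e8]
  have f10 : m₅.nat 10 = m₃.nat 10 := by rw [hs₅.nat 10 rfl, hs₄.nat 10 rfl]
  have f11 : m₅.nat 11 0 = Y := by rw [hs₅.nat 11 rfl, hYm]
  have f9 : m₅.nat 9 q = 2 ^ q * V := by rw [hs₅.nat 9 rfl, hs₄.nat 9 rfl, e9', hpw q le_rfl]
  -- The table of processing times is continued with period `V`: the part of a weight that describes
  -- count and colors does not influence the processing time.
  have hper : ∀ c s, s < V → c * V + s < Y → m₅.num 5 (c * V + s) = m.num 5 s := by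
    intro c
    induction c with
    | zero => intro s hs _; rw [zero_mul, zero_add, k1 s hs]
    | succ c ih =>
      intro s hs hlt
      have e : (c + 1) * V + s = V + (c * V + s) := by ring
      rw [e] at hlt ⊢
      rw [k2 _ (by omega), ih s hs (by omega)]
  have hsum : ∀ J : List (Fin I.n), (∀ j ∈ J, m.nat 6 j < q) →
      (J.map (fun j : Fin I.n => m₃.nat 10 j)).sum
      = (J.length * 2 ^ q + (J.map (fun j : Fin I.n => 2 ^ m.nat 6 j)).sum) * V
        + (J.map (fun j : Fin I.n => m.nat 7 j)).sum := by
    intro J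
    induction J with
    | nil => simp
    | cons j J ih =>
      intro hJ
      simp only [List.map_cons, List.sum_cons, List.length_cons, ih (fun i hi => hJ i (by simp [hi])),
        hwt j j.2, hpw q le_rfl, hpw _ (hJ j (by simp)).le]
      ring
  have hT' := hT.sum
  refine ⟨by rw [f8, f6, hT.V_eq], by rw [f9, f8], by rw [f11, f8], ?_, ?_, ?_⟩
  · rw [f6, f7, f8, f10]; exact hsum
  · rw [f6, f7, f8]
    intro J hJ hl
    exact (hT.sum J (fun j hj => ⟨j.2, hJ j hj⟩) hl).1
  · rw [f6, f10, f11]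
    intro J hJ hl hlt
    obtain ⟨h1, h2⟩ := hT.sum J (fun j hj => ⟨j.2, hJ j hj⟩) hl
    rw [hsum J hJ] at hlt ⊢
    rw [hper _ _ h1 hlt, h2]

/-- The tables of addresses and times. -/
structure TimeInv (I : Problem K) (m : Memory K) : Prop where
  NT_eq : m.nat 12 0 = I.n * m.nat 11 0
  R1 : ∀ τ ≤ m.nat 12 0, m.nat 13 τ = τ * m.nat 11 0
  R2 : ∀ τ ≤ m.nat 12 0, m.nat 14 τ = τ * (m.nat 12 0 * m.nat 11 0)
  T_eq : ∀ b < I.n, ∀ y < m.nat 11 0, m.num 6 (b * m.nat 11 0 + y) = m.num 0 b + m.num 5 y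

theorem timesC_spec {m : Memory K} {Y : ℕ} (h0 : m.nat 0 0 = I.n) (h11 : m.nat 11 0 = Y)
    (hY : 0 < Y) :
    Tri w timesC m (400 * (I.n + 1) * (Y + 1)) (TimeInv I) := by
  set N := I.n * Y with hN
  have hC : (I.n + 1) * (Y + 1) = N + I.n + Y + 1 := by rw [hN]; ring
  rw [mul_assoc, hC]
  refine Tri.seq (T₁ := 24 * (I.n + 1)) (T₂ := 370 * (N + I.n + Y + 1)) (mulC_spec (by decide)
    rfl rfl rfl rfl (by simp only [NExp.eval, NExp.size, h0]; exact le_rfl)) ?_ (by omega)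
  intro m₁ hs₁ h12
  simp only [NExp.eval, h0, h11, ← hN] at h12
  have a11 : m₁.nat 11 0 = Y := by rw [hs₁.nat 11 rfl, h11]
  refine Tri.step rfl (T₂ := 360 * (N + I.n + Y + 1)) ?_ (by
    have : (setR 13 (.const 0)).cost ≤ 10 := by decide
    omega)
  intro m₂ hs₂ he₂
  have e13 : m₂.nat 13 0 = 0 := by rw [he₂]; simp [Cmd.exec, NExp.eval, writeNat_nat]
  refine Tri.seq (T₁ := 60 * (N + 1)) (T₂ := 300 * (N + I.n + Y + 1)) (Q' := fun m₃ =>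
    ∀ i ≤ N, m₃.nat 13 i = i * Y) ?_ ?_ (by omega)
  · refine Tri.forC (n := N) (T := 40) (fun t m₃ => ∀ i ≤ t, m₃.nat 13 i = i * Y)
      (by simp only [NExp.eval, hs₂.nat 12 rfl, h12]) rfl rfl ?_ ?_ ?_ ?_ ?_
    · intro a ha
      simp [NExp.reads] at ha
      subst ha; rfl
    · intro i hi
      obtain rfl : i = 0 := by omega
      rw [writeNat_nat_of_ne _ _ _ (by decide), e13]; simp
    · rintro t ht m₃ hs₃ h36 hI
      refine Tri.line rfl (by decide) ?_
      intro i hi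
      simp only [Cmd.exec, NExp.eval, h36, writeNat_nat, true_and, hs₃.nat 11 rfl, hs₂.nat 11 rfl,
        a11]
      rw [if_neg (by simp)]
      by_cases hit : i = t + 1
      · rw [if_pos hit, hI t le_rfl, hit]; ring
      · rw [if_neg hit, hI i (by omega)]
    · simp only [NExp.size]
      exact Nat.mul_le_mul (by omega) le_rfl
    · intro m₂ _ h; exact h
  intro m₃ hs₃ hR1
  refine Tri.step rfl (T₂ := 290 * (N + I.n + Y + 1)) ?_ (by
    have : (setR 14 (.const 0)).cost ≤ 10 := by decide
    omega)
  intro m₄ hs₄ he₄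
  have e14 : m₄.nat 14 0 = 0 := by rw [he₄]; simp [Cmd.exec, NExp.eval, writeNat_nat]
  have b12 : m₄.nat 12 0 = N := by rw [hs₄.nat 12 rfl, hs₃.nat 12 rfl, hs₂.nat 12 rfl, h12]
  have b13 : m₄.nat 13 = m₃.nat 13 := hs₄.nat 13 rfl
  have b11 : m₄.nat 11 0 = Y := by rw [hs₄.nat 11 rfl, hs₃.nat 11 rfl, hs₂.nat 11 rfl, a11]
  have b0 : m₄.nat 0 0 = I.n := by
    rw [hs₄.nat 0 rfl, hs₃.nat 0 rfl, hs₂.nat 0 rfl, hs₁.nat 0 rfl, h0]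
  refine Tri.seq (T₁ := 60 * (N + 1)) (T₂ := 230 * (N + I.n + Y + 1)) (Q' := fun m₅ =>
    ∀ i ≤ N, m₅.nat 14 i = i * (N * Y)) ?_ ?_ (by omega)
  · refine Tri.forC (n := N) (T := 40) (fun t m₅ => ∀ i ≤ t, m₅.nat 14 i = i * (N * Y))
      (by simp only [NExp.eval, b12]) rfl rfl ?_ ?_ ?_ ?_ ?_
    · intro a ha
      simp [NExp.reads] at ha
      subst ha; rfl
    · intro i hi
      obtain rfl : i = 0 := by omega
      rw [writeNat_nat_of_ne _ _ _ (by decide), e14]; simp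
    · rintro t ht m₅ hs₅ h37 hI
      refine Tri.line rfl (by decide) ?_
      intro i hi
      simp only [Cmd.exec, NExp.eval, h37, writeNat_nat, true_and, hs₅.nat 12 rfl, b12,
        hs₅.nat 13 rfl, b13, hR1 N le_rfl]
      rw [if_neg (by simp)]
      by_cases hit : i = t + 1
      · rw [if_pos hit, hI t le_rfl, hit]; ring
      · rw [if_neg hit, hI i (by omega)]
    · simp only [NExp.size]
      exact Nat.mul_le_mul (by omega) le_rfl
    · intro m₂ _ h; exact h
  intro m₅ hs₅ hR2
  have c11 : m₅.nat 11 0 = Y := by rw [hs₅.nat 11 rfl, b11]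
  have c12 : m₅.nat 12 0 = N := by rw [hs₅.nat 12 rfl, b12]
  have c13 : m₅.nat 13 = m₃.nat 13 := by rw [hs₅.nat 13 rfl, b13]
  have c0 : m₅.nat 0 0 = I.n := by rw [hs₅.nat 0 rfl, b0]
  have hbN : ∀ b < I.n, b ≤ N := by
    intro b hb
    calc b ≤ I.n * 1 := by omega
      _ ≤ N := Nat.mul_le_mul le_rfl hY
  refine Tri.forC (n := I.n) (T := 60 * (Y + 1)) (fun t m' => ∀ b < t, ∀ y < Y,
      m'.num 6 (b * Y + y) = m₅.num 0 b + m₅.num 5 y)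
    (by simp only [NExp.eval, c0]) rfl rfl ?_ ?_ ?_ ?_ ?_
  · intro a ha
    simp [NExp.reads] at ha
    subst ha; rfl
  · intro b hb; omega
  · rintro b hb m₆ hs₆ h38 hI
    refine Tri.forC (n := Y) (T := 40) (fun t m' => (∀ b' < b, ∀ y < Y,
        m'.num 6 (b' * Y + y) = m₅.num 0 b' + m₅.num 5 y) ∧ ∀ y < t,
        m'.num 6 (b * Y + y) = m₅.num 0 b + m₅.num 5 y)
      (by simp only [NExp.eval, hs₆.nat 11 rfl, c11]) rfl rfl ?_ ?_ ?_ ?_ ?_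
    · intro a ha
      simp [NExp.reads] at ha
      subst ha; rfl
    · exact ⟨fun b' h y h' => hI b' h y h', fun y hy => by omega⟩
    · rintro t ht m₇ hs₇ h39 ⟨k1, k2⟩
      refine Tri.line rfl (by decide) ?_
      simp only [Cmd.exec, NExp.eval, KExp.eval, writeNat_num, writeNum_num, true_and,
        hs₇.nat 38 rfl, h38, h39, hs₇.nat 13 rfl, hs₆.nat 13 rfl, c13, hR1 b (hbN b hb),
        hs₇.num 0 rfl, hs₆.num 0 rfl, hs₇.num 5 rfl, hs₆.num 5 rfl]
      constructor
      · intro b' hb' y hy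
        -- Different release dates occupy disjoint blocks of length `Y`, so earlier blocks are not
        -- overwritten.
        rw [if_neg ?_, k1 b' hb' y hy]
        have : (b' + 1) * Y ≤ b * Y := Nat.mul_le_mul hb' le_rfl
        rw [add_mul, one_mul] at this
        omega
      · intro y hy
        by_cases hyt : y = t
        · rw [if_pos (by omega), hyt]
        · rw [if_neg (by omega), k2 y (by omega)]
    · simp only [NExp.size]
      exact Nat.mul_le_mul (by omega) le_rfl
    · rintro m₇ - ⟨k1, k2⟩ b' hb' y hy
      by_cases h : b' = b
      · rw [h]; exact k2 y hy
      · exact k1 b' (by omega) y hy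
  · simp only [NExp.size]
    have : (60 * (Y + 1) + (1 + 1) + 12) * (I.n + 1) ≤ (80 * (Y + 1)) * (I.n + 1) :=
      Nat.mul_le_mul (by omega) le_rfl
    refine this.trans ?_
    rw [mul_assoc, mul_comm (Y + 1), hC]; omega
  · intro m₆ hs₆ hI
    have d11 : m₆.nat 11 0 = Y := by rw [hs₆.nat 11 rfl, c11]
    have d12 : m₆.nat 12 0 = N := by rw [hs₆.nat 12 rfl, c12]
    have d13 : m₆.nat 13 = m₃.nat 13 := by rw [hs₆.nat 13 rfl, c13]
    refine ⟨by rw [d12, d11], ?_, ?_, ?_⟩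
    · rw [d12, d13, d11]; exact hR1
    · rw [d12, hs₆.nat 14 rfl, d11]; exact hR2
    · rw [d11, hs₆.num 0 rfl, hs₆.num 5 rfl]; exact hI

end Tables

end RejSched

/-! ### The initial table -/

namespace RejSched

section Init

variable {K : Type} [CommRing K] [LinearOrder K] [IsStrictOrderedRing K]
variable {w : ℕ → K → K} {I : Problem K} {mode : Mode}

/-- The table contains empty schedules only. -/
structure InitInv (I : Problem K) (mode : Mode) (m : Memory K) : Prop where
  env : Env I m
  entry : ∀ τ₀ τ₁ y, τ₀ < m.nat 12 0 → τ₁ < m.nat 12 0 → y < m.nat 11 0 →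
    m.nat 15 (kap m τ₀ τ₁ y) ≠ 0 → Der I mode (gridOf I.n m) 0 τ₀ τ₁ y 0 [] [] ∧
      m.num 7 (kap m τ₀ τ₁ y) = 0 ∧ m.nat 16 (kap m τ₀ τ₁ y) = 0 ∧ m.nat 17 (kap m τ₀ τ₁ y) = 0

/-- Progress while the table is filled. -/
structure InitMono (m m' : Memory K) : Prop where
  fix : Agree fixN fixK m m'
  tab : ∀ κ, m.nat 15 κ ≠ 0 → m'.nat 15 κ ≠ 0

theorem InitMono.trans {m₁ m₂ m₃ : Memory K} (h : InitMono m₁ m₂) (h' : InitMono m₂ m₃) :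
    InitMono m₁ m₃ :=
  ⟨h.fix.trans h'.fix, fun κ hκ => h'.tab κ (h.tab κ hκ)⟩

theorem InitMono.write (m : Memory K) {i : ℕ} (hi : i ∉ coreN) (v : ℕ) :
    InitMono m (m.writeNat i 0 v) := by
  refine ⟨fix_of_core (Agree.writeNat m 0 v hi), fun κ hκ => ?_⟩
  rw [writeNat_nat_of_ne m 0 v (by rintro rfl; simp [coreN] at hi)]; exact hκ

theorem InitInv.congr {m m' : Memory K} (h : Agree coreN coreK m m') (hI : InitInv I mode m) :
    InitInv I mode m' := by
  refine ⟨hI.env.congr (fix_of_core h), ?_⟩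
  have := hI.entry
  simp only [kap_congr (fix_of_core h), gridOf_congr (fix_of_core h), h.nat 11 (by simp [coreN]),
    h.nat 12 (by simp [coreN]), h.nat 15 (by simp [coreN]), h.nat 16 (by simp [coreN]),
    h.nat 17 (by simp [coreN]), h.num 7 (by simp [coreK])]
  exact this

theorem emptyC_spec {m : Memory K} {x y : NExp} {τ τ' : ℕ} (hI : InitInv I mode m)
    (hx : x.eval m = τ) (hy : y.eval m = τ') (hτ : τ < m.nat 12 0) (hτ' : τ' < m.nat 12 0)
    (hd : Der I mode (gridOf I.n m) 0 τ τ' 0 0 [] []) (hs : x.size + y.size ≤ 20) :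
    Tri w (emptyC x y) m 80 (fun m' => InitInv I mode m' ∧ InitMono m m' ∧
      m'.nat 15 (kap m τ τ' 0) ≠ 0) := by
  have hE := hI.env
  refine Tri.line rfl (by simp [emptyC, Cmd.cost, NExp.size, KExp.size]; omega) ?_
  set κ := kap m τ τ' 0 with hκ
  have hκe : m.nat 14 τ + m.nat 13 τ' + 0 = κ := by rw [hE.R1 τ' hτ'.le, hE.R2 τ hτ.le, hκ, kap]
  simp only [emptyC, Cmd.exec, NExp.eval, KExp.eval, hx, hy, hκe, writeNat_nat, writeNum_nat,
    true_and, if_true, Nat.reduceEqDiff, if_false, false_and]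
  set m' : Memory K := ((((m.writeNat 43 0 κ).writeNat 15 κ 1).writeNat 16 κ 0).writeNat 17 κ
    0).writeNum 7 κ 0 with hm'
  have hfix : Agree fixN fixK m m' := by
    constructor
    · intro a ha
      simp only [fixN, List.mem_cons, List.not_mem_nil, or_false] at ha
      funext j
      rcases ha with rfl | rfl | rfl | rfl | rfl | rfl | rfl | rfl | rfl | rfl <;>
        simp [hm', writeNat_nat]
    · intro a ha
      simp only [fixK, List.mem_cons, List.not_mem_nil, or_false] at ha
      funext j
      rcases ha with rfl | rfl | rfl | rfl | rfl <;> simp [hm', writeNum_num]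
  have e15 : ∀ x, m'.nat 15 x = if x = κ then 1 else m.nat 15 x := by
    intro x; simp [hm', writeNat_nat]
  have e16 : ∀ x, m'.nat 16 x = if x = κ then 0 else m.nat 16 x := by
    intro x; simp [hm', writeNat_nat]
  have e17 : ∀ x, m'.nat 17 x = if x = κ then 0 else m.nat 17 x := by
    intro x; simp [hm', writeNat_nat]
  have k7 : ∀ x, m'.num 7 x = if x = κ then 0 else m.num 7 x := by
    intro x; simp [hm', writeNum_num]
  refine ⟨⟨hE.congr hfix, ?_⟩, ⟨hfix, ?_⟩, ?_⟩
  · rw [gridOf_congr hfix, kap_congr hfix, hfix.nat 12 (by simp [fixN]), hfix.nat 11 (by simp [fixN])]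
    intro τ₀ τ₁ y' h0 h1 hy' hT
    rw [e15] at hT
    rw [e16, e17, k7]
    by_cases hκ' : kap m τ₀ τ₁ y' = κ
    · obtain ⟨rfl, rfl, rfl⟩ := kap_inj h1 hy' hτ' hE.Y_pos hκ'
      simp only [hκ', if_true, and_self, and_true]
      exact hd
    · simp only [hκ', if_false] at hT ⊢
      exact hI.entry τ₀ τ₁ y' h0 h1 hy' hT
  · intro x hx
    rw [e15]
    split_ifs
    · exact one_ne_zero
    · exact hx
  · simp

/-- Derivations of height 0 are exactly the empty and the idle intervals, and these are enumerated
here; this is the base case for the rounds. -/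
theorem initC_spec {m : Memory K} {B : ℕ} (hE : Env I m) (hB : LenBound I mode B m) :
    Tri w initC m (400 * (m.nat 12 0 + 1) ^ 2 * (m.nat 11 0 + 1)) (fun m' =>
      DynB I mode B m' ∧ Found I mode 0 m' m') := by
  set N := m.nat 12 0 with hN
  set Y := m.nat 11 0 with hY
  have hnN : I.n ≤ N := by
    rw [hN, hE.NT_eq]; exact Nat.le_mul_of_pos_right _ hE.Y_pos
  have hC : N * (N * Y) + 1 ≤ (N + 1) ^ 2 * (Y + 1) := by ring_nf; omega
  have hC2 : (N + 1) * (I.n + 1) ≤ (N + 1) ^ 2 * (Y + 1) := by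
    rw [pow_two]
    calc (N + 1) * (I.n + 1) ≤ (N + 1) * (N + 1) * 1 := by
          rw [mul_one]; exact Nat.mul_le_mul le_rfl (by omega)
      _ ≤ _ := Nat.mul_le_mul le_rfl (by omega)
  rw [mul_assoc]
  -- The table is reused by all runs, so the flags of old entries must be cleared; the other fields
  -- count only under a set flag. The heap is not reset, because the best schedule so far lives
  -- there.
  refine Tri.seq (T₁ := 60 * (N * (N * Y) + 1)) (T₂ := 320 * ((N + 1) * (I.n + 1)))
    (Q' := fun m₁ => ∀ κ < N * (N * Y), m₁.nat 15 κ = 0) ?_ ?_ (by omega)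
  · refine Tri.forC (n := N * (N * Y)) (T := 40) (fun t m₁ => ∀ κ < t, m₁.nat 15 κ = 0)
      (by simp only [NExp.eval]; exact hE.R2 N le_rfl) rfl rfl ?_ ?_ ?_ ?_ ?_
    · intro a ha
      simp [NExp.reads] at ha
      rcases ha with rfl | rfl <;> rfl
    · intro i hi; omega
    · rintro t ht m₁ hs₁ h40 hI
      refine Tri.line rfl (by decide) ?_
      intro i hi
      simp only [Cmd.exec, NExp.eval, h40, writeNat_nat, true_and]
      rw [if_neg (by simp)]
      by_cases hit : i = t
      · rw [if_pos hit]
      · rw [if_neg hit, hI i (by omega)]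
    · simp only [NExp.size]
      exact Nat.mul_le_mul (by omega) le_rfl
    · intro m₂ _ h; exact h
  intro m₁ hs₁ hzero
  have hfix₁ : Agree fixN fixK m m₁ := hs₁.agree (by decide) (by decide)
  have hE₁ := hE.congr hfix₁
  have f12 : m₁.nat 12 0 = N := by rw [hs₁.nat 12 rfl]
  have f11 : m₁.nat 11 0 = Y := by rw [hs₁.nat 11 rfl]
  have hI₁ : InitInv I mode m₁ := by
    refine ⟨hE₁, fun τ₀ τ₁ y h0 h1 hy hT => absurd (hzero _ ?_) hT⟩
    rw [f12] at h0 h1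
    rw [f11] at hy
    rw [kap, f12, f11]
    calc τ₀ * (N * Y) + τ₁ * Y + y < τ₀ * (N * Y) + (τ₁ * Y + Y) := by omega
      _ = τ₀ * (N * Y) + (τ₁ + 1) * Y := by ring
      _ ≤ τ₀ * (N * Y) + N * Y := Nat.add_le_add_left (Nat.mul_le_mul h1 le_rfl) _
      _ = (τ₀ + 1) * (N * Y) := by ring
      _ ≤ N * (N * Y) := Nat.mul_le_mul h0 le_rfl
  refine (Tri.forAll (n := N) (T := 260 * (I.n + 1)) (InitInv I mode) InitMono
    (fun τ m' => m'.nat 15 (kap m₁ τ τ 0) ≠ 0 ∧ ∀ b < I.n, m₁.num 6 τ ≤ m₁.num 6 (b * Y) →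
      m'.nat 15 (kap m₁ τ (b * Y) 0) ≠ 0) (by simp only [NExp.eval, f12]) rfl rfl ?_
    (fun m v h => h.congr (Agree.writeNat m 0 v (by decide)))
    (fun m v => InitMono.write m (by decide) v)
    (fun _ _ _ h h' => h.trans h')
    (fun x m₁ m₂ h hd => ⟨h.tab _ hd.1, fun b hb h' => h.tab _ (hd.2 b hb h')⟩) hI₁ ?_ ?_).mono
    le_rfl ?_
  · intro a ha
    simp [NExp.reads] at ha
    subst ha; rfl
  · intro τ hτ m₂ hs₂ h41 hI₂ hM₂
    have hk := kap_congr hM₂.fix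
    have g12 : m₂.nat 12 = m₁.nat 12 := hM₂.fix.nat 12 (by decide)
    have g11 : m₂.nat 11 = m₁.nat 11 := hM₂.fix.nat 11 (by decide)
    refine Tri.seq (T₁ := 80) (T₂ := 180 * (I.n + 1)) (emptyC_spec (τ := τ) (τ' := τ) hI₂ h41 h41
      (by rwa [g12, f12]) (by rwa [g12, f12]) (.nil _ _ (by simp only [gridOf]; rwa [g12, f12]))
      (by decide)) ?_ (by omega)
    rintro m₃ hs₃ ⟨hI₃, hM₃, hF₃⟩
    rw [hk] at hF₃
    have hM₃' := hM₂.trans hM₃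
    refine (Tri.forAll (n := I.n) (T := 150) (InitInv I mode) InitMono
      (fun b m' => m₁.num 6 τ ≤ m₁.num 6 (b * Y) → m'.nat 15 (kap m₁ τ (b * Y) 0) ≠ 0)
      (by simp only [NExp.eval]; exact hI₃.env.n_eq) rfl rfl ?_
      (fun m v h => h.congr (Agree.writeNat m 0 v (by decide)))
      (fun m v => InitMono.write m (by decide) v)
      (fun _ _ _ h h' => h.trans h')
      (fun x m₁ m₂ h hd h' => h.tab _ (hd h')) hI₃ ?_ ?_).mono le_rfl ?_
    · intro a ha
      simp [NExp.reads] at ha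
      subst ha; rfl
    · intro b hb m₄ hs₄ h42 hI₄ hM₄
      have hM := hM₃'.trans hM₄
      have hk₄ := kap_congr hM.fix
      have l12 : m₄.nat 12 0 = N := by rw [hM.fix.nat 12 (by decide), f12]
      have l11 : m₄.nat 11 0 = Y := by rw [hM.fix.nat 11 (by decide), f11]
      have l6 : m₄.num 6 = m₁.num 6 := hM.fix.num 6 (by decide)
      have l41 : m₄.nat 41 0 = τ := by rw [hs₄.nat 41 rfl, hs₃.nat 41 rfl, h41]
      have hbN : b < N := by omega
      have l13 : m₄.nat 13 b = b * Y := by rw [hI₄.env.R1 b (by rw [l12]; omega), l11]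
      have hbY : b * Y < N := by
        have := hI₄.env.anc_lt ⟨b, hb⟩
        simp only [gridOf] at this
        rwa [l11, l12] at this
      refine Tri.ite (T₁ := 80) ?_ ?_ (by decide)
      · intro hc
        simp only [Cond.Holds, NExp.eval, KExp.eval, l41, h42, l13] at hc
        refine (emptyC_spec (x := rd 41) (y := .read 13 (rd 42)) (τ := τ) (τ' := b * Y) hI₄ l41 (by simp only [NExp.eval, h42, l13])
          (by rwa [l12]) (by rwa [l12]) ?_ (by decide)).mono le_rfl ?_
        · have := Der.idle (I := I) (mode := mode) (G := gridOf I.n m₄) 0 τ ⟨b, hb⟩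
            (by simp only [gridOf]; rwa [l12]) (by simp only [gridOf]; rw [l11]; exact hc)
          simp only [gridOf] at this ⊢
          rw [l11] at this ⊢
          exact this
        · rintro m₅ _ ⟨a1, a2, a3⟩
          rw [hk₄] at a3
          exact ⟨a1, a2, fun _ => a3⟩
      · intro hc
        simp only [Cond.Holds, NExp.eval, KExp.eval, l41, h42, l13, l6] at hc
        exact Tri.line rfl (by decide) ⟨hI₄, ⟨Agree.refl _, fun _ h => h⟩, fun h => absurd h hc⟩
    · simp only [NExp.size]
      exact Nat.mul_le_mul (by omega) le_rfl
    · rintro m₄ - ⟨a1, a2, a3⟩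
      exact ⟨a1, hM₃.trans a2, a2.tab _ hF₃, a3⟩
  · simp only [NExp.size]
    calc (260 * (I.n + 1) + (1 + 1) + 12) * (N + 1) ≤ (320 * (I.n + 1)) * (N + 1) :=
          Nat.mul_le_mul (by omega) le_rfl
      _ = _ := by ring
  · rintro m' _ ⟨hI', hM', hall⟩
    have hfix := hfix₁.trans hM'.fix
    have hk := kap_congr hM'.fix
    have l12 : m'.nat 12 0 = N := by rw [hM'.fix.nat 12 (by decide), f12]
    have l11 : m'.nat 11 0 = Y := by rw [hM'.fix.nat 11 (by decide), f11]
    have l6 : m'.num 6 = m₁.num 6 := hM'.fix.num 6 (by decide)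
    refine ⟨⟨⟨hI'.env, ?_⟩, hB.congr hfix⟩, ?_⟩
    · intro τ₀ τ₁ y h0 h1 hy hT
      obtain ⟨a1, a2, a3, a4⟩ := hI'.entry τ₀ τ₁ y h0 h1 hy hT
      refine ⟨0, [], [], by rw [a2]; exact a1, fun i hi => absurd hi (by simp), a4, by simp [a3]⟩
    · have key : ∀ τ₀ τ₁ c, m'.nat 15 (kap m₁ τ₀ τ₁ 0) ≠ 0 → τ₀ < N → τ₁ < N → c = 0 →
          Has m' (kap m' τ₀ τ₁ 0) c := by
        intro τ₀ τ₁ c hF h0 h1 hc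
        rw [← hk] at hF
        refine ⟨hF, ?_⟩
        rw [(hI'.entry τ₀ τ₁ 0 (by rwa [l12]) (by rwa [l12]) hI'.env.Y_pos hF).2.1, hc]
      intro τ₀ τ₁ y c L J d
      generalize hh : 0 = h at d
      cases d with
      | nil _ τ hτ =>
        simp only [gridOf, l12] at hτ
        exact key _ _ _ (hall _ hτ).1 hτ hτ rfl
      | idle _ τ b hτ hT =>
        have hb := hI'.env.anc_lt b
        simp only [gridOf, l12, l11, l6] at hτ hT hb ⊢
        exact key _ _ _ ((hall _ hτ).2 b b.2 hT) hτ hb rfl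
      | concat => omega
      | close => omega

end Init

end RejSched

/-! ### Weights that certify distinct colors, and the selection of the best entry -/

namespace RejSched

section Run

variable {K : Type} [CommRing K] [LinearOrder K] [IsStrictOrderedRing K]
variable {w : ℕ → K → K} {I : Problem K} {mode : Mode}

/-- The memory holds the instance. -/
structure Inst (I : Problem K) (m : Memory K) : Prop where
  n_eq : m.nat 0 0 = I.n
  r_eq : ∀ j : Fin I.n, m.num 0 j = I.r j
  p_eq : ∀ j : Fin I.n, m.num 1 j = I.p j
  e_eq : ∀ j : Fin I.n, m.num 2 j = I.e j

theorem Inst.congr {m m' : Memory K} (h : Inst I m) (h0 : m'.nat 0 = m.nat 0)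
    (k0 : m'.num 0 = m.num 0) (k1 : m'.num 1 = m.num 1) (k2 : m'.num 2 = m.num 2) : Inst I m' :=
  ⟨by rw [h0, h.n_eq], by rw [k0]; exact h.r_eq, by rw [k1]; exact h.p_eq, by rw [k2]; exact h.e_eq⟩

theorem Env.of_inv {q : ℕ} {m : Memory K} (hI : Inst I m) (hW : WeightInv I q m)
    (hT : TimeInv I m) : Env I m :=
  ⟨hI.n_eq, hI.r_eq, hI.p_eq, hI.e_eq, hT.R1, hT.R2, hT.NT_eq, hW.Y_pos⟩

theorem good_of_inv {q : ℕ} {m : Memory K} (hI : Inst I m) (h4 : m.nat 4 0 = q)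
    (hW : WeightInv I q m) (hT : TimeInv I m) : (gridOf I.n m).Good := by
  constructor
  · exact hW.Y_pos
  · intro b y hy
    simp only [gridOf] at hy ⊢
    rw [hT.NT_eq]
    calc b * m.nat 11 0 + y < b * m.nat 11 0 + m.nat 11 0 := by omega
      _ = (b + 1) * m.nat 11 0 := by ring
      _ ≤ _ := Nat.mul_le_mul b.2 le_rfl
  · intro b y hy
    simp only [gridOf] at hy ⊢
    rw [hT.T_eq b b.2 y hy, hI.r_eq]
  · intro Z hZ hlt
    simp only [gridOf, h4] at hZ hlt ⊢
    exact hW.P_eq Z hZ (hW.length_le hZ hlt) hlt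

theorem sum_map_eq_sum_count (f : ℕ → ℕ) {q : ℕ} (l : List ℕ) (hl : ∀ c ∈ l, c < q) :
    (l.map f).sum = ∑ c ∈ Finset.range q, l.count c * f c := by
  induction l with
  | nil => simp
  | cons a l ih =>
    have ha : a < q := hl a (by simp)
    simp only [List.map_cons, List.sum_cons, ih (fun c hc => hl c (by simp [hc])), List.count_cons,
      add_mul, Finset.sum_add_distrib, beq_iff_eq, ite_mul, one_mul, zero_mul]
    rw [Finset.sum_ite_eq]
    simp [ha, add_comm]

/-- The least weight that all colors together can have. -/
def target (q V : ℕ) : ℕ := q * (2 ^ q * V) + 2 ^ q * V - V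

theorem target_eq (q V : ℕ) : target q V = (q * 2 ^ q + (2 ^ q - 1)) * V := by
  obtain ⟨d, hd⟩ : ∃ d, 2 ^ q = d + 1 := ⟨2 ^ q - 1, by have : 0 < 2 ^ q := by positivity
                                                        omega⟩
  rw [target, hd, Nat.add_sub_cancel]
  have : q * ((d + 1) * V) + (d + 1) * V = (q * (d + 1) + d) * V + V := by ring
  rw [this, Nat.add_sub_cancel]

theorem target_add_le (q V : ℕ) : target q V + V ≤ (q + 1) * (2 ^ q * V) := by
  have h : V ≤ 2 ^ q * V := Nat.le_mul_of_pos_left _ (by positivity)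
  rw [target, add_mul, one_mul]; omega

/-- Division by `V` removes the code of the processing times and reduction modulo `2 ^ q` removes
the count. What remains is that the color bits sum to `2 ^ q - 1` modulo `2 ^ q`; with at most `q`
jobs every color occurs once, so no job is repeated. -/
theorem nodup_of_target {q v : ℕ} {m : Memory K} (hW : WeightInv I q m) {J : List (Fin I.n)}
    (hJ : ∀ j ∈ J, m.nat 6 j < q) (hv : v < m.nat 8 0)
    (hs : (J.map (fun j : Fin I.n => m.nat 10 j)).sum = target q (m.nat 8 0) + v) :
    J.Nodup ∧ J.length ≤ q := by
  have hV := hW.V_pos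
  have hl : J.length ≤ q := by
    refine hW.length_le hJ ?_
    rw [hs, hW.Y_eq]
    have := target_add_le q (m.nat 8 0)
    omega
  refine ⟨?_, hl⟩
  have hstr := hW.str J hJ hl
  rw [hW.wt J hJ, target_eq] at hs
  -- Both codes are smaller than `V`, so the quotients agree.
  have hdiv := congrArg (· / m.nat 8 0) hs
  rw [mul_comm _ (m.nat 8 0), mul_comm _ (m.nat 8 0), Nat.mul_add_div hV, Nat.mul_add_div hV,
    Nat.div_eq_of_lt hstr, Nat.div_eq_of_lt hv, add_zero, add_zero] at hdiv
  have hmod := congrArg (· % 2 ^ q) hdiv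
  have hpos : 0 < 2 ^ q := by positivity
  rw [mul_comm J.length, mul_comm q, Nat.mul_add_mod_self_left, Nat.mul_add_mod_self_left,
    Nat.mod_eq_of_lt (by omega : 2 ^ q - 1 < 2 ^ q)] at hmod
  set l := J.map (fun j : Fin I.n => m.nat 6 j) with hldef
  have hlq : ∀ c ∈ l, c < q := by
    intro c hc
    obtain ⟨j, hj, rfl⟩ := List.mem_map.mp hc
    exact hJ j hj
  have h1 : (J.map (fun j : Fin I.n => 2 ^ m.nat 6 j)).sum = (l.map (fun c => 2 ^ c)).sum := by
    rw [hldef, List.map_map]; rfl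
  rw [h1, sum_map_eq_sum_count (fun c => 2 ^ c) l hlq] at hmod
  have h2 : ∑ c ∈ Finset.range q, l.count c = J.length := by
    have := sum_map_eq_sum_count (fun _ => 1) l hlq
    simpa [hldef, Function.comp_def] using this.symm
  have h3 := eq_one_of_sum_two_pow q (fun c => l.count c) hmod (by rw [h2]; exact hl)
  have h4 : l.Nodup := by
    rw [List.nodup_iff_count_le_one]
    intro c
    by_cases hc : c < q
    · exact (h3 c hc).le
    · rw [List.count_eq_zero_of_not_mem (fun h => hc (hlq c h))]; exact Nat.zero_le _
  exact List.Nodup.of_map _ h4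

/-- Soundness of selection: the weight alone guarantees that a stored schedule is feasible, for an
arbitrary coloring. -/
theorem Der.feasible_of_target (hA : I.Admissible) {q v : ℕ} {m : Memory K} (hE : Env I m)
    (h4 : m.nat 4 0 = q) (hW : WeightInv I q m) (hG : (gridOf I.n m).Good) (hqs : q ≤ I.s)
    (hv : v < m.nat 8 0) {h τ₀ τ₁ : ℕ} {c : K} {L : Schedule K I.n} {J : List (Fin I.n)}
    (d : Der I mode (gridOf I.n m) h τ₀ τ₁ (target q (m.nat 8 0) + v) c L J) :
    I.Feasible mode L ∧ I.cost L ≤ c + ∑ j, I.e j ∧ L.length ≤ 2 ^ I.s := by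
  obtain ⟨-, -, -, hy, hok, hlen⟩ := d.basic hE.Y_pos hE.anc_lt
  simp only [gridOf, h4] at hy hok
  obtain ⟨h1, h2⟩ := nodup_of_target hW hok hv hy.symm
  suffices h : I.Feasible mode L ∧ I.cost L ≤ c + ∑ j, I.e j by
    have := Nat.pow_le_pow_right (show 0 < 2 by omega) (h2.trans hqs)
    exact ⟨h.1, h.2, by omega⟩
  refine d.feasible hA hE.Y_pos hE.anc_lt ?_ ?_ h1 (h2.trans hqs)
  · intro j hj
    simp only [gridOf, h4] at hj ⊢
    have h := hW.wt [j] (by simpa using hj)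
    simp only [List.map_cons, List.map_nil, List.sum_cons, List.sum_nil, add_zero,
      List.length_singleton, one_mul] at h
    have hV := hW.V_pos
    have : 0 < (2 ^ q + 2 ^ m.nat 6 j) * m.nat 8 0 := by positivity
    omega
  · intro J hJ hlt
    exact hG.P_eq J hJ hlt

/-- Completeness for a coloring that is injective on the scheduled jobs: `q` jobs then use each
color once, their bits sum to `2 ^ q - 1` exactly, and the nested schedule that dominates `S` has a
weight in the selected range. -/
theorem exists_der_of_feasible (hA : I.Admissible) {q : ℕ} {m : Memory K} (hE : Env I m)
    (h4 : m.nat 4 0 = q) (hW : WeightInv I q m) (hG : (gridOf I.n m).Good) (hq : 0 < q)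
    {S : Schedule K I.n} (hS : I.Feasible mode S) (hcard : S.scheduled.card = q)
    (hcol : ∀ j ∈ S.scheduled, m.nat 6 j < q)
    (hinj : Set.InjOn (fun j : Fin I.n => m.nat 6 j) S.scheduled) :
    ∃ (h : ℕ) (b : Fin I.n) (τ₁ v : ℕ) (c : K) (L : Schedule K I.n) (J : List (Fin I.n)),
      h ≤ 8 * q ∧ v < m.nat 8 0 ∧ τ₁ < m.nat 12 0 ∧
      c ≤ ∑ j ∈ S.scheduled, (I.w j (I.completion S j) - I.e j) ∧
      Der I mode (gridOf I.n m) h (b * m.nat 11 0) τ₁ (target q (m.nat 8 0) + v) c L J := by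
  obtain ⟨h, b, u, J, c, hN, hJ, hJS, hh, hc⟩ := hS.exists_nest hA
    (Finset.card_pos.mp (by omega))
  have hmem : ∀ j, j ∈ J ↔ j ∈ S.scheduled := by
    intro j; rw [← hJS, List.mem_toFinset]
  have hJq : ∀ j ∈ J, m.nat 6 j < q := fun j hj => hcol j ((hmem j).mp hj)
  have hlen : J.length = q := by
    rw [← hcard, ← hJS, List.toFinset_card_of_nodup hJ]
  set l := J.map (fun j : Fin I.n => m.nat 6 j) with hldef
  have hlq : ∀ c ∈ l, c < q := by
    intro c hc
    obtain ⟨j, hj, rfl⟩ := List.mem_map.mp hc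
    exact hJq j hj
  have hlnd : l.Nodup := by
    refine List.Nodup.map_on ?_ hJ
    intro x hx y hy hxy
    exact hinj (Finset.mem_coe.mpr ((hmem x).mp hx)) (Finset.mem_coe.mpr ((hmem y).mp hy)) hxy
  have hlr : l.toFinset = Finset.range q := by
    refine Finset.eq_of_subset_of_card_le ?_ ?_
    · intro c hc; exact Finset.mem_range.mpr (hlq c (List.mem_toFinset.mp hc))
    · rw [List.toFinset_card_of_nodup hlnd, hldef, List.length_map, hlen, Finset.card_range]
  have hsum : (J.map (fun j : Fin I.n => 2 ^ m.nat 6 j)).sum = 2 ^ q - 1 := by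
    have h1 : (J.map (fun j : Fin I.n => 2 ^ m.nat 6 j)).sum = (l.map (fun c => 2 ^ c)).sum := by
      rw [hldef, List.map_map]; rfl
    rw [h1, ← List.sum_toFinset _ hlnd, hlr, Nat.geomSum_eq le_rfl]
    simp
  have hwt := hW.wt J hJq
  have hstr := hW.str J hJq hlen.le
  rw [hsum, hlen, ← target_eq] at hwt
  have hlt : (J.map (fun j : Fin I.n => m.nat 10 j)).sum < m.nat 11 0 := by
    rw [hwt, hW.Y_eq]
    have := target_add_le q (m.nat 8 0)
    omega
  -- The nested schedule begins at a release date, so it starts with empty `Z`, that is, at the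
  -- first index of the block of `b`.
  obtain ⟨b', Z', L, -, -, -, d⟩ := hN.der hG b [] (by simp)
    (by simp only [gridOf, h4]; exact hJq) (by simpa [gridOf] using hlt) (by simp)
  have hb := d.basic hE.Y_pos hE.anc_lt
  refine ⟨h, b, _, _, c, L, J, by omega, hstr, hb.2.1, hc, ?_⟩
  have e : (J.map (gridOf I.n m).wt).sum = (J.map (fun j : Fin I.n => m.nat 10 j)).sum := rfl
  rw [e, hwt] at d
  simpa [gridOf] using d

/-- The best schedule so far. -/
def BestOK (I : Problem K) (mode : Mode) (m : Memory K) : Prop :=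
  ∃ L : Schedule K I.n, Slice m (m.nat 20 0) L ∧ m.nat 21 0 = L.length ∧
    m.nat 20 0 + L.length ≤ m.nat 18 0 ∧ I.Feasible mode L ∧ I.cost L ≤ m.num 10 0 + ∑ j, I.e j ∧ L.length ≤ 2 ^ I.s

theorem BestOK.mono {m m' : Memory K} (h : BestOK I mode m) (hb : Agree [20, 21] [10] m m')
    (hp : m.nat 18 0 ≤ m'.nat 18 0) (hc : ∀ x < m.nat 18 0, cell m' x = cell m x) :
    BestOK I mode m' := by
  obtain ⟨L, h1, h2, h3, h4, h5⟩ := h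
  refine ⟨L, ?_, ?_, ?_, h4, ?_⟩
  · rw [hb.nat 20 (by simp)]
    exact h1.congr fun x _ hx => hc x (by omega)
  · rw [hb.nat 21 (by simp), h2]
  · rw [hb.nat 20 (by simp)]; omega
  · rw [hb.num 10 (by simp)]; exact h5

theorem BestOK.congr {m m' : Memory K} (h : BestOK I mode m)
    (ha : Agree [18, 19, 20, 21] [8, 9, 10] m m') : BestOK I mode m' :=
  h.mono (ha.sub (by simp) (by simp)) (by rw [ha.nat 18 (by simp)])
    (fun x _ => by simp [cell, ha.nat 19 (by simp), ha.num 8 (by simp), ha.num 9 (by simp)])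

/-- Only the first index of each block is tried as a start, together with all ends and all codes;
every nonempty schedule is dominated by one that starts at a release date. -/
theorem selectC_spec {m : Memory K} {q : ℕ} (hD : Dyn I mode m) (h4 : m.nat 4 0 = q)
    (hpw : m.nat 9 q = 2 ^ q * m.nat 8 0) (hYt : target q (m.nat 8 0) + m.nat 8 0 ≤ m.nat 11 0)
    (hfeas : ∀ h τ₀ τ₁ v c (L : Schedule K I.n) J, v < m.nat 8 0 →
      Der I mode (gridOf I.n m) h τ₀ τ₁ (target q (m.nat 8 0) + v) c L J →
      I.Feasible mode L ∧ I.cost L ≤ c + ∑ j, I.e j ∧ L.length ≤ 2 ^ I.s)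
    (hb : BestOK I mode m) :
    Tri w selectC m (60 * (q + 1) + 200 * (m.nat 8 0 + 1) * (m.nat 12 0 + 1) * (I.n + 1)) (fun m' =>
      BestOK I mode m' ∧ m'.num 10 0 ≤ m.num 10 0 ∧
      ∀ b < I.n, ∀ τ₁ < m.nat 12 0, ∀ v < m.nat 8 0, ∀ c,
        Has m (kap m (b * m.nat 11 0) τ₁ (target q (m.nat 8 0) + v)) c → m'.num 10 0 ≤ c) := by
  have hE := hD.env
  set V := m.nat 8 0 with hV
  set N := m.nat 12 0 with hN
  set Y := m.nat 11 0 with hY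
  set X := 200 * (V + 1) * (N + 1) * (I.n + 1) with hX
  refine Tri.seq (T₁ := 30 * (q + 1)) (T₂ := 30 * (q + 1) + X) ((mulC_spec (by decide) rfl rfl rfl rfl
    le_rfl).mono ?_ (fun _ _ h => h)) ?_ (by omega)
  · simp only [NExp.eval, NExp.size, h4]; exact Nat.mul_le_mul (by omega) le_rfl
  intro m₁ hs₁ h65
  simp only [NExp.eval, h4, hpw] at h65
  refine Tri.step rfl (T₂ := X) ?_ (by
    have : (setR 65 (rd 65 +ₙ .read 9 (rd 4) -ₙ rd 8)).cost ≤ 20 := by decide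
    omega)
  intro m₂ hs₂ he₂
  have h65' : m₂.nat 65 0 = target q V := by
    rw [he₂]
    simp [Cmd.exec, NExp.eval, writeNat_nat, h65, hs₁.nat 4 rfl, h4, hs₁.nat 9 rfl, hpw,
      hs₁.nat 8 rfl, target, hV]
  have hs : Agree [0, 4, 8, 11, 12, 13, 14, 15, 16, 17, 18, 19, 20, 21] [7, 8, 9, 10] m m₂ :=
    Agree.trans (hs₁.agree (by decide) (by decide)) (hs₂.agree (by decide) (by decide))
  have hb₂ : BestOK I mode m₂ := hb.congr (hs.sub (by simp) (by simp))
  have hstab : ∀ (i : ℕ), i ∉ [18, 19, 20, 21] → ∀ (m : Memory K) v, BestOK I mode m →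
      BestOK I mode (m.writeNat i 0 v) := fun i hi m v h => h.congr (Agree.writeNat m 0 v hi)
  have hNn : ∀ b < I.n, b ≤ N := by
    intro b hb
    rw [hN, hE.NT_eq]
    exact hb.le.trans (Nat.le_mul_of_pos_right _ hE.Y_pos)
  have k10 : m₂.num 10 0 = m.num 10 0 := by rw [hs.num 10 (by simp)]
  refine (Tri.forAll (n := I.n) (T := 180 * (V + 1) * (N + 1)) (BestOK I mode)
    (fun m m' => m'.num 10 0 ≤ m.num 10 0)
    (fun b m' => ∀ τ₁ < N, ∀ v < V, ∀ c, Has m (kap m (b * Y) τ₁ (target q V + v)) c →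
      m'.num 10 0 ≤ c)
    (by simp only [NExp.eval]; rw [hs.nat 0 (by simp)]; exact hE.n_eq) rfl rfl ?_
    (hstab 61 (by decide)) (fun m v => le_rfl) (fun _ _ _ h h' => h'.trans h)
    (fun x m₁ m₂ h hd τ₁ h1 v h2 c h3 => h.trans (hd τ₁ h1 v h2 c h3)) hb₂ ?_ ?_).mono le_rfl ?_
  · intro a ha
    simp [NExp.reads] at ha
    subst ha; rfl
  · intro b hbn m₃ hs₃ h61 hb₃ _
    refine Tri.forAll (n := N) (T := 160 * (V + 1)) (BestOK I mode)
      (fun m m' => m'.num 10 0 ≤ m.num 10 0)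
      (fun τ₁ m' => ∀ v < V, ∀ c, Has m (kap m (b * Y) τ₁ (target q V + v)) c → m'.num 10 0 ≤ c)
      (by simp only [NExp.eval, hs₃.nat 12 rfl]; rw [hs.nat 12 (by simp)]) rfl rfl ?_
      (hstab 62 (by decide)) (fun m v => le_rfl) (fun _ _ _ h h' => h'.trans h)
      (fun x m₁ m₂ h hd v h2 c h3 => h.trans (hd v h2 c h3)) hb₃ ?_ ?_
    · intro a ha
      simp [NExp.reads] at ha
      subst ha; rfl
    · intro τ₁ hτ₁ m₄ hs₄ h62 hb₄ _
      refine Tri.forAll (n := V) (T := 140) (BestOK I mode)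
        (fun m m' => m'.num 10 0 ≤ m.num 10 0)
        (fun v m' => ∀ c, Has m (kap m (b * Y) τ₁ (target q V + v)) c → m'.num 10 0 ≤ c)
        (by simp only [NExp.eval, hs₄.nat 8 rfl, hs₃.nat 8 rfl]; rw [hs.nat 8 (by simp)]) rfl rfl ?_
        (hstab 63 (by decide)) (fun m v => le_rfl) (fun _ _ _ h h' => h'.trans h)
        (fun x m₁ m₂ h hd c h3 => h.trans (hd c h3)) hb₄ ?_ ?_
      · intro a ha
        simp [NExp.reads] at ha
        subst ha; rfl
      · intro v hv m₅ hs₅ h63 hb₅ _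
        set κ := kap m (b * Y) τ₁ (target q V + v) with hκ
        have hA : Agree [8, 11, 12, 13, 14, 15, 16, 17, 18, 19] [7, 8, 9] m m₅ :=
          (hs.sub (by simp) (by simp)).trans ((hs₃.agree (by decide) (by decide)).trans
            ((hs₄.agree (by decide) (by decide)).trans (hs₅.agree (by decide) (by decide))))
        have hbY : b * Y < N := by
          have := hE.anc_lt ⟨b, hbn⟩
          simpa [gridOf] using this
        refine Tri.step rfl (T₂ := 100) ?_ (by decide)
        intro m₆ hs₆ he₆
        have h64 : m₆.nat 64 0 = κ := by
          rw [he₆]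
          simp only [Cmd.exec, NExp.eval, writeNat_nat, true_and, if_true]
          rw [hA.nat 13 (by simp), hA.nat 14 (by simp), hs₅.nat 61 rfl, hs₄.nat 61 rfl, h61,
            hs₅.nat 62 rfl, h62, h63, hs₅.nat 65 rfl, hs₄.nat 65 rfl, hs₃.nat 65 rfl, h65',
            hE.R1 b (hNn b hbn), hE.R1 τ₁ hτ₁.le, hE.R2 _ hbY.le, hκ, kap]
        have hA₆ : Agree [8, 11, 12, 13, 14, 15, 16, 17, 18, 19] [7, 8, 9] m m₆ :=
          hA.trans (hs₆.agree (by decide) (by decide))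
        have e10 : m₆.num 10 = m₅.num 10 := hs₆.num 10 rfl
        refine Tri.line rfl (by decide) ?_
        simp only [Cmd.exec, Cond.Holds, NExp.eval, KExp.eval, h64]
        rw [hA₆.nat 15 (by simp), hA₆.num 7 (by simp)]
        split_ifs with hc
        all_goals rw [e10] at hc
        · obtain ⟨c1, c2⟩ := hc
          rw [not_le] at c2
          refine ⟨?_, ?_, ?_⟩
          · obtain ⟨h, L, J, a1, a2, a3, a4⟩ := hD.sound (b * Y) τ₁ (target q V + v) hbY hτ₁
              (by omega) (by rw [← hκ]; omega)
            rw [← hκ] at a1 a2 a3 a4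
            obtain ⟨f1, f2⟩ := hfeas _ _ _ _ _ _ _ hv a1
            refine ⟨L, ?_, ?_, ?_, f1, ?_⟩
            · simp only [writeNat_nat, writeNum_nat, Nat.reduceEqDiff, false_and, if_false,
                and_self, if_true, h64]
              rw [hA₆.nat 16 (by simp)]
              refine a2.congr fun x _ _ => ?_
              simp [cell, writeNat_nat, writeNum_num, hA₆.nat 19 (by simp), hA₆.num 8 (by simp),
                hA₆.num 9 (by simp)]
            · simp [writeNat_nat, h64, a3, hA₆.nat 17 (by simp)]
            · simp [writeNat_nat, h64, hA₆.nat 18 (by simp), hA₆.nat 16 (by simp)]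
              exact a4
            · simpa [writeNum_num] using f2
          · simpa [writeNum_num] using c2.le
          · intro c hh
            simpa [writeNum_num] using hh.2
        · refine ⟨hb₅.congr (hs₆.agree (by decide) (by decide)), by rw [e10], fun c hh => ?_⟩
          rw [e10]
          by_contra hlt
          rw [not_le] at hlt
          exact hc ⟨by have := hh.1; omega, fun h => absurd (h.trans hh.2) (not_le.mpr hlt)⟩
      · simp only [NExp.size]
        exact Nat.mul_le_mul (by omega) le_rfl
    · simp only [NExp.size]
      exact Nat.mul_le_mul (by omega) le_rfl
  · simp only [NExp.size]
    refine Nat.mul_le_mul ?_ le_rfl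
    have : 1 ≤ (V + 1) * (N + 1) := Nat.mul_pos (by omega) (by omega)
    rw [mul_assoc, mul_assoc]; omega
  · rintro m' _ ⟨a1, a2, a3⟩
    exact ⟨a1, a2.trans k10.le, a3⟩

end Run

end RejSched

/-! ### A complete run for one coloring -/

namespace RejSched

section Run

variable {K : Type} [CommRing K] [LinearOrder K] [IsStrictOrderedRing K]
variable {w : ℕ → K → K} {I : Problem K} {mode : Mode}

/-- The size of the range of weights. -/
def rangeY (q k : ℕ) : ℕ := (q + 1) * (2 ^ q * (q + 1) ^ k)

/-- The rounds dominate. With `N = n * Y` points of time, the table loops cost `N ^ 3 * Y ^ 2`, and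
the number of rounds and the length of schedules are each of order at most `Y`. -/
theorem run_time_le {n q k : ℕ} (hn : 0 < n) :
    400 * (n + q + (q + 1) ^ k + 1) * (n + 1) + 300 * (n + rangeY q k + 1)
      + 400 * (n + 1) * (rangeY q k + 1)
      + 400 * (n * rangeY q k + 1) ^ 2 * (rangeY q k + 1)
      + 2000 * (2 ^ q + 1) * (rangeY q k + 1) ^ 2 * (n * rangeY q k + 1) ^ 3 * (8 * q + 2)
      + (60 * (q + 1) + 200 * ((q + 1) ^ k + 1) * (n * rangeY q k + 1) * (n + 1))
      ≤ 4000000 * (n ^ 3 * rangeY q k ^ 7) := by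
  set Y := rangeY q k with hY
  have hpow : 0 < 2 ^ q := by positivity
  have hV : 0 < (q + 1) ^ k := by positivity
  have hqY : q + 1 ≤ Y := Nat.le_mul_of_pos_right _ (by positivity)
  have hVY : (q + 1) ^ k ≤ Y := by
    calc (q + 1) ^ k ≤ 2 ^ q * (q + 1) ^ k := Nat.le_mul_of_pos_left _ hpow
      _ ≤ Y := Nat.le_mul_of_pos_left _ (by omega)
  have hBY : 2 ^ q ≤ Y := by
    calc 2 ^ q ≤ 2 ^ q * (q + 1) ^ k := Nat.le_mul_of_pos_right _ hV
      _ ≤ Y := Nat.le_mul_of_pos_left _ (by omega)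
  have hY1 : 1 ≤ Y := by omega
  have hnY1 : 1 ≤ n * Y := Nat.mul_pos hn hY1
  have hnY : n ≤ n * Y := Nat.le_mul_of_pos_right _ hY1
  have hYn : Y ≤ n * Y := Nat.le_mul_of_pos_left _ hn
  set X := n ^ 3 * Y ^ 7 with hX
  have key : ∀ a b, a ≤ 3 → b ≤ 7 → n ^ a * Y ^ b ≤ X := fun a b ha hb =>
    Nat.mul_le_mul (Nat.pow_le_pow_right hn ha) (Nat.pow_le_pow_right hY1 hb)
  have t1 : 400 * (n + q + (q + 1) ^ k + 1) * (n + 1) ≤ 3200 * X := by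
    calc 400 * (n + q + (q + 1) ^ k + 1) * (n + 1) ≤ 400 * (4 * (n * Y)) * (2 * n) :=
          Nat.mul_le_mul (Nat.mul_le_mul le_rfl (by omega)) (by omega)
      _ = 3200 * (n ^ 2 * Y ^ 1) := by ring
      _ ≤ _ := Nat.mul_le_mul le_rfl (key 2 1 (by omega) (by omega))
  have t2 : 300 * (n + Y + 1) ≤ 900 * X := by
    calc 300 * (n + Y + 1) ≤ 300 * (3 * (n * Y)) := Nat.mul_le_mul le_rfl (by omega)
      _ = 900 * (n ^ 1 * Y ^ 1) := by ring
      _ ≤ _ := Nat.mul_le_mul le_rfl (key 1 1 (by omega) (by omega))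
  have t3 : 400 * (n + 1) * (Y + 1) ≤ 1600 * X := by
    calc 400 * (n + 1) * (Y + 1) ≤ 400 * (2 * n) * (2 * Y) :=
          Nat.mul_le_mul (Nat.mul_le_mul le_rfl (by omega)) (by omega)
      _ = 1600 * (n ^ 1 * Y ^ 1) := by ring
      _ ≤ _ := Nat.mul_le_mul le_rfl (key 1 1 (by omega) (by omega))
  have t4 : 400 * (n * Y + 1) ^ 2 * (Y + 1) ≤ 3200 * X := by
    calc 400 * (n * Y + 1) ^ 2 * (Y + 1) ≤ 400 * (2 * (n * Y)) ^ 2 * (2 * Y) :=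
          Nat.mul_le_mul (Nat.mul_le_mul le_rfl (Nat.pow_le_pow_left (by omega) 2)) (by omega)
      _ = 3200 * (n ^ 2 * Y ^ 3) := by ring
      _ ≤ _ := Nat.mul_le_mul le_rfl (key 2 3 (by omega) (by omega))
  have t5 : 2000 * (2 ^ q + 1) * (Y + 1) ^ 2 * (n * Y + 1) ^ 3 * (8 * q + 2) ≤ 1280000 * X := by
    calc 2000 * (2 ^ q + 1) * (Y + 1) ^ 2 * (n * Y + 1) ^ 3 * (8 * q + 2)
        ≤ 2000 * (2 * Y) * (2 * Y) ^ 2 * (2 * (n * Y)) ^ 3 * (10 * Y) :=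
          Nat.mul_le_mul (Nat.mul_le_mul (Nat.mul_le_mul (Nat.mul_le_mul le_rfl (by omega))
            (Nat.pow_le_pow_left (by omega) 2)) (Nat.pow_le_pow_left (by omega) 3)) (by omega)
      _ = 1280000 * (n ^ 3 * Y ^ 7) := by ring
      _ ≤ _ := le_rfl
  have t6 : 60 * (q + 1) ≤ 60 * X := by
    calc 60 * (q + 1) ≤ 60 * Y := Nat.mul_le_mul le_rfl hqY
      _ = 60 * (n ^ 0 * Y ^ 1) := by ring
      _ ≤ _ := Nat.mul_le_mul le_rfl (key 0 1 (by omega) (by omega))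
  have t7 : 200 * ((q + 1) ^ k + 1) * (n * Y + 1) * (n + 1) ≤ 1600 * X := by
    calc 200 * ((q + 1) ^ k + 1) * (n * Y + 1) * (n + 1) ≤ 200 * (2 * Y) * (2 * (n * Y)) * (2 * n) :=
          Nat.mul_le_mul (Nat.mul_le_mul (Nat.mul_le_mul le_rfl (by omega)) (by omega)) (by omega)
      _ = 1600 * (n ^ 2 * Y ^ 2) := by ring
      _ ≤ _ := Nat.mul_le_mul le_rfl (key 2 2 (by omega) (by omega))
  omega

/-- A run with a useless coloring does no harm: feasibility of the best schedule never depends on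
the coloring. Only the comparison with `S` requires that the coloring separates the jobs of `S`. -/
theorem runC_spec (hA : I.Admissible) (hn : 0 < I.n) {m : Memory K} {q : ℕ} (hI : Inst I m)
    (h4 : m.nat 4 0 = q) (hqs : q ≤ I.s) (hb : BestOK I mode m) :
    Tri I.oracle (runC mode) m
      (4000000 * (I.n ^ 3 * rangeY q (numTypes I (m.nat 6) q I.n) ^ 7)) (fun m' =>
      BestOK I mode m' ∧ m'.num 10 0 ≤ m.num 10 0 ∧ ∀ S : Schedule K I.n, I.Feasible mode S →
        0 < q → S.scheduled.card = q → (∀ j ∈ S.scheduled, m.nat 6 j < q) →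
        Set.InjOn (fun j : Fin I.n => m.nat 6 j) S.scheduled →
        m'.num 10 0 ≤ ∑ j ∈ S.scheduled, (I.w j (I.completion S j) - I.e j)) := by
  set k := numTypes I (m.nat 6) q I.n with hk
  set V := (q + 1) ^ k with hV
  set Y := rangeY q k with hY
  have hYV : Y = (q + 1) * (2 ^ q * V) := rfl
  have htime := run_time_le (q := q) (k := k) hn
  rw [← hV, ← hY] at htime
  set N := I.n * Y with hN
  set T5 := 2000 * (2 ^ q + 1) * (Y + 1) ^ 2 * (N + 1) ^ 3 * (8 * q + 2) with hT5
  set T6 := 60 * (q + 1) + 200 * (V + 1) * (N + 1) * (I.n + 1) with hT6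
  set T4 := 400 * (N + 1) ^ 2 * (Y + 1) with hT4
  set T3 := 400 * (I.n + 1) * (Y + 1) with hT3
  refine Tri.seq (T₁ := 400 * (I.n + q + V + 1) * (I.n + 1))
    (T₂ := 300 * (I.n + Y + 1) + (T3 + (T4 + (T5 + T6))))
    (typesC_spec hI.n_eq h4 hI.p_eq le_rfl) ?_ (by omega)
  intro m₁ hs₁ hT₁
  have h6₁ : m₁.nat 6 = m.nat 6 := hs₁.nat 6 rfl
  have h8₁ : m₁.nat 8 0 = V := by rw [hT₁.V_eq, h6₁]
  have hI₁ : Inst I m₁ := hI.congr (hs₁.nat 0 rfl) (hs₁.num 0 rfl) (hs₁.num 1 rfl) (hs₁.num 2 rfl)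
  have h4₁ : m₁.nat 4 0 = q := by rw [hs₁.nat 4 rfl, h4]
  refine Tri.seq (T₁ := 300 * (I.n + Y + 1)) (T₂ := T3 + (T4 + (T5 + T6)))
    ((weightsC_spec hI₁.n_eq h4₁ hT₁).mono (by rw [h8₁, ← hYV]) (fun _ _ h => h)) ?_ le_rfl
  intro m₂ hs₂ hW₂
  have h6₂ : m₂.nat 6 = m.nat 6 := by rw [hs₂.nat 6 rfl, h6₁]
  have h8₂ : m₂.nat 8 0 = V := by rw [hs₂.nat 8 rfl, h8₁]
  have h11₂ : m₂.nat 11 0 = Y := by rw [hW₂.Y_eq, h8₂, hYV]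
  have hI₂ : Inst I m₂ :=
    hI₁.congr (hs₂.nat 0 rfl) (hs₂.num 0 rfl) (hs₂.num 1 rfl) (hs₂.num 2 rfl)
  refine Tri.seq (T₁ := T3) (T₂ := T4 + (T5 + T6)) (timesC_spec hI₂.n_eq h11₂ (by
    rw [← h11₂]; exact hW₂.Y_pos)) ?_ le_rfl
  intro m₃ hs₃ hT₃
  have hI₃ : Inst I m₃ :=
    hI₂.congr (hs₃.nat 0 rfl) (hs₃.num 0 rfl) (hs₃.num 1 rfl) (hs₃.num 2 rfl)
  have e4 : m₃.nat 4 0 = q := by rw [hs₃.nat 4 rfl, hs₂.nat 4 rfl, h4₁]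
  have e6 : m₃.nat 6 = m.nat 6 := by rw [hs₃.nat 6 rfl, h6₂]
  have e8 : m₃.nat 8 0 = V := by rw [hs₃.nat 8 rfl, h8₂]
  have e11 : m₃.nat 11 0 = Y := by rw [hs₃.nat 11 rfl, h11₂]
  have e12 : m₃.nat 12 0 = N := by rw [hT₃.NT_eq, e11]
  have hW₃ : WeightInv I q m₃ := by
    obtain ⟨a1, a2, a3, a4, a5, a6⟩ := hW₂
    constructor <;> simp only [hs₃.nat 6 rfl, hs₃.nat 7 rfl, hs₃.nat 8 rfl, hs₃.nat 9 rfl,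
      hs₃.nat 10 rfl, hs₃.nat 11 rfl, hs₃.num 5 rfl] <;> assumption
  have hE₃ := Env.of_inv hI₃ hW₃ hT₃
  have hG₃ := good_of_inv hI₃ e4 hW₃ hT₃
  have hB₃ : LenBound I mode (2 ^ q) m₃ := by
    intro h τ₀ τ₁ y c L J d
    obtain ⟨-, -, hy, hyJ, hok, hl⟩ := d.basic hE₃.Y_pos hE₃.anc_lt
    simp only [gridOf, e4] at hy hyJ hok
    have hlen := hW₃.length_le hok (by rw [← hyJ]; exact hy)
    have := Nat.pow_le_pow_right (show 0 < 2 by omega) hlen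
    omega
  refine Tri.seq (T₁ := T4) (T₂ := T5 + T6) ((initC_spec hE₃ hB₃).mono (by rw [e12, e11])
    (fun _ _ h => h)) ?_ le_rfl
  rintro m₄ hs₄ ⟨hD₄, hF₄⟩
  have hfix₄ : Agree fixN fixK m₃ m₄ := hs₄.agree (by decide) (by decide)
  have g11 : m₄.nat 11 0 = Y := by rw [hs₄.nat 11 rfl, e11]
  have g12 : m₄.nat 12 0 = N := by rw [hs₄.nat 12 rfl, e12]
  refine Tri.seq (T₁ := T5) (T₂ := T6) ((roundsC_spec hD₄ (by rw [hs₄.nat 4 rfl, e4]) hF₄).mono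
    (by rw [g11, g12]) (fun _ _ h => h)) ?_ le_rfl
  rintro m₅ hs₅ ⟨hD₅, hM₅, hF₅⟩
  have hfix₅ : Agree fixN fixK m₃ m₅ := hfix₄.trans hM₅.fix
  have l4 : m₅.nat 4 0 = q := by rw [hfix₅.nat 4 (by decide), e4]
  have l6 : m₅.nat 6 = m.nat 6 := by rw [hfix₅.nat 6 (by decide), e6]
  have l8 : m₅.nat 8 0 = V := by rw [hfix₅.nat 8 (by decide), e8]
  have l11 : m₅.nat 11 0 = Y := by rw [hfix₅.nat 11 (by decide), e11]
  have l12 : m₅.nat 12 0 = N := by rw [hfix₅.nat 12 (by decide), e12]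
  have hg := gridOf_congr hfix₅ I.n
  have hA4 : Agree [18, 19, 20, 21] [8, 9, 10] m m₄ :=
    (hs₁.agree (by decide) (by decide)).trans ((hs₂.agree (by decide) (by decide)).trans
      ((hs₃.agree (by decide) (by decide)).trans (hs₄.agree (by decide) (by decide))))
  have hb₅ : BestOK I mode m₅ := (hb.congr hA4).mono hM₅.best hM₅.hp hM₅.heap
  have k10 : m₅.num 10 0 = m.num 10 0 := by
    rw [hM₅.best.num 10 (by simp), hA4.num 10 (by simp)]
  refine (selectC_spec hD₅ l4 (by
    rw [l8, hfix₅.nat 9 (by decide), hW₃.pw, e8]) (by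
      rw [l8, l11, hYV]; exact target_add_le q V) ?_ hb₅).mono (by rw [l8, l12]) ?_
  · intro h τ₀ τ₁ v c L J hv d
    rw [l8, hg, ← e8] at d
    exact d.feasible_of_target hA hE₃ e4 hW₃ hG₃ hqs (by rw [e8, ← l8]; exact hv)
  · rintro m₆ - ⟨c1, c2, c3⟩
    refine ⟨c1, c2.trans k10.le, ?_⟩
    intro S hS hq hcard hcol hinj
    obtain ⟨h, b, τ₁, v, c, L, J, d1, d2, d3, d4, d5⟩ := exists_der_of_feasible (mode := mode) hA hE₃
      e4 hW₃ hG₃ hq hS hcard (by rw [e6]; exact hcol) (by rw [e6]; exact hinj)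
    refine le_trans ?_ d4
    have hg₄ := gridOf_congr hfix₄ I.n
    have hkk : kap m₅ = kap m₄ := kap_congr hM₅.fix
    have hh := hF₅ _ _ _ _ L J (by rw [hg₄]; exact d5.mono d1)
    refine c3 b b.2 τ₁ (by rw [l12, ← e12]; exact d3) v (by rw [l8, ← e8]; exact d2) c ?_
    rw [hkk, l11, l8, ← e11, ← e8]
    exact hh

end Run

end RejSched

namespace RejSched

/-! ### Arithmetic gadgets for the enumeration of colorings -/

/-- `num 145` becomes the hash value. -/
def hashC (a p m z : NExp) : Cmd :=
  mulC 140 141 a z ⨟ divModC 142 143 141 (rd 140) p ⨟ divModC 144 145 141 (rd 143) m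

/-- The expression does not read any of the given arrays. -/
def NExp.avoids (x : NExp) (A : List ℕ) : Bool := A.all (fun a => !x.reads a)

/-- Digits of `g` in base `b`. -/
def digitsC (arr : ℕ) (g b N : NExp) : Cmd :=
  setR 123 g ⨟ forC 124 N (divModC 126 127 128 (rd 123) b ⨟
    .setNat arr (rd 124) (rd 127) ⨟ setR 123 (rd 126))

/-- Power. -/
def powC (o : ℕ) (x N : NExp) : Cmd :=
  setR o (.const 1) ⨟ forC 106 N (mulC 107 108 x (rd o) ⨟ setR o (rd 107))

/-- A prime between `rd 82` and its double. -/
def primeC : Cmd :=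
  setR 89 (.const 0) ⨟
  forC 83 (rd 82 +ₙ rd 82 +ₙ .const 1) (setR 84 (.const 1) ⨟
    ifC (.natLe (rd 83) (.const 1)) (setR 84 (.const 0)) ⨟
    ifC (ltN (rd 83) (rd 82)) (setR 84 (.const 0)) ⨟
    forC 85 (rd 83) (ifC (.natLe (.const 2) (rd 85))
      (divModC 86 87 88 (rd 83) (rd 85) ⨟ ifC (.natLe (rd 87) (.const 0)) (setR 84 (.const 0)))) ⨟
    ifC (.natLe (.const 1) (rd 84)) (setR 89 (rd 83)))

/-- The levels of the coloring: their number and their buckets. -/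
def levelsC : Cmd :=
  setR 97 (rd 4) ⨟ setR 98 (.const 0) ⨟ setR 104 (.const 0) ⨟
  forC 99 (rd 4 +ₙ .const 1)
    (ifC (.natLe (.const 1) (rd 97)) (setR 98 (rd 99 +ₙ .const 1)) ⨟
     .setNat 103 (rd 99) (rd 97 +ₙ rd 97 +ₙ rd 97 +ₙ rd 97) ⨟
     .setNat 104 (rd 99 +ₙ .const 1) (.read 104 (rd 99) +ₙ .read 103 (rd 99)) ⨟
     divModC 100 101 102 (rd 97) (.const 2) ⨟ setR 97 (rd 100))

section Gadgets

variable {K : Type} [CommRing K] [LinearOrder K] [IsStrictOrderedRing K]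
variable {w : ℕ → K → K} {m : Memory K}

theorem NExp.avoids_iff {x : NExp} {A : List ℕ} (h : x.avoids A = true) {a : ℕ} (ha : a ∈ A) :
    x.reads a = false := by
  simp only [avoids, List.all_eq_true] at h
  simpa using h a ha

theorem Same.eval_avoids {c : Cmd} {m' : Memory K} (h : Same c m m') {x : NExp} {A : List ℕ}
    (hx : x.avoids A = true) (hc : ∀ a, c.wN a = true → a ∈ A) : x.eval m' = x.eval m := by
  refine h.eval x (fun a ha => ?_)
  by_contra hw
  rw [x.avoids_iff hx (hc a (by simpa using hw))] at ha
  cases ha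

/-- The time is quadratic because the product, of size up to `b * b`, is reduced by repeated
subtraction. -/
theorem hashC_spec {a p q z : NExp} {A P Q Z b : ℕ} (ha : a.eval m = A) (hp : p.eval m = P)
    (hq : q.eval m = Q) (hz : z.eval m = Z)
    (ha' : a.avoids [140, 141, 142, 143, 144, 145] = true)
    (hp' : p.avoids [140, 141, 142, 143, 144, 145] = true)
    (hq' : q.avoids [140, 141, 142, 143, 144, 145] = true)
    (hz' : z.avoids [140, 141, 142, 143, 144, 145] = true)
    (hs : a.size + p.size + q.size + z.size ≤ 30) (hP : 0 < P) (hQ : 0 < Q)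
    (hAb : A ≤ b) (hPb : P ≤ b) (hZb : Z ≤ b) :
    Tri w (hashC a p q z) m (400 * (b + 1) ^ 2) (fun m' => m'.nat 145 0 = hash A P Q Z) := by
  have hc1 : ∀ c, (mulC 140 141 a z).wN c = true → c ∈ [140, 141, 142, 143, 144, 145] := by
    intro c hc; simp [mulC, forC, Cmd.wN] at hc; simp; omega
  have hc2 : ∀ c, (divModC 142 143 141 (rd 140) p).wN c = true →
      c ∈ [140, 141, 142, 143, 144, 145] := by
    intro c hc; simp [divModC, forC, Cmd.wN] at hc; simp; omega
  have hAZ : A * Z ≤ b * b := Nat.mul_le_mul hAb hZb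
  have e1 : 50 * (b + 1) ≤ 50 * (b + 1) ^ 2 := by
    rw [pow_two]; exact Nat.mul_le_mul le_rfl (Nat.le_mul_of_pos_left _ (by omega))
  have e2 : 104 * (b * b + 1) ≤ 104 * (b + 1) ^ 2 := by
    refine Nat.mul_le_mul le_rfl ?_
    rw [pow_two]; nlinarith
  refine Tri.seq (T₁ := 50 * (b + 1)) (T₂ := 104 * (b * b + 1) + 104 * (b + 1))
    ((mulC_spec (by decide) (a.avoids_iff ha' (by simp)) (a.avoids_iff ha' (by simp))
      (z.avoids_iff hz' (by simp)) (z.avoids_iff hz' (by simp)) le_rfl).mono ?_ (fun _ _ h => h)) ?_ ?_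
  · rw [ha]; exact Nat.mul_le_mul (by omega) (by omega)
  · intro m₁ hs₁ h140
    rw [ha, hz] at h140
    have p1 : p.eval m₁ = P := by rw [hs₁.eval_avoids hp' hc1, hp]
    have q1 : q.eval m₁ = Q := by rw [hs₁.eval_avoids hq' hc1, hq]
    refine Tri.seq (T₁ := 104 * (b * b + 1)) (T₂ := 104 * (b + 1))
      ((divModC_spec (by decide) (by decide) (by decide) rfl rfl rfl (p.avoids_iff hp' (by simp))
        (p.avoids_iff hp' (by simp)) (p.avoids_iff hp' (by simp)) (by rw [p1]; exact hP)
        le_rfl).mono ?_ (fun _ _ h => h)) ?_ le_rfl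
    · simp only [NExp.eval, NExp.size, h140]
      exact Nat.mul_le_mul (by omega) (by omega)
    · rintro m₂ hs₂ ⟨-, h143⟩
      have q2 : q.eval m₂ = Q := by rw [hs₂.eval_avoids hq' hc2, q1]
      simp only [NExp.eval, h140, p1] at h143
      have : A * Z % P < P := Nat.mod_lt _ hP
      refine (divModC_spec (by decide) (by decide) (by decide) rfl rfl rfl (q.avoids_iff hq' (by simp))
        (q.avoids_iff hq' (by simp)) (q.avoids_iff hq' (by simp)) (by rw [q2]; exact hQ)
        le_rfl).mono ?_ ?_
      · simp only [NExp.eval, NExp.size, h143]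
        exact Nat.mul_le_mul (by omega) (by omega)
      · rintro m₃ - ⟨-, h145⟩
        simp only [NExp.eval, h143, q2] at h145
        exact h145
  · omega

/-- Tabulation of a function. -/
theorem Tri.tabulate {i arr n T T' : ℕ} {N x : NExp} {body : Cmd} (f : ℕ → ℕ)
    (hn : N.eval m = n) (hi : body.wN i = false) (ha : body.wN arr = false) (hia : arr ≠ i)
    (hNi : N.reads i = false) (hNa : N.reads arr = false)
    (hN : ∀ a, N.reads a = true → body.wN a = false)
    (hbody : ∀ t < n, ∀ m₁, Same (RejSched.forC i N (body ⨟ .setNat arr (rd i) x)) m m₁ →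
      m₁.nat i 0 = t → Tri w body m₁ T (fun m₂ => x.eval m₂ = f t))
    (hT : (T + x.size + N.size + 20) * (n + 1) ≤ T') :
    Tri w (RejSched.forC i N (body ⨟ .setNat arr (rd i) x)) m T' (fun m' => ∀ t < n,
      m'.nat arr t = f t) := by
  refine Tri.forC (n := n) (T := T + x.size + 5) (fun t m' => ∀ j < t, m'.nat arr j = f j) hn ?_ hNi
    ?_ (by intro j hj; omega) ?_ (le_trans ?_ hT) (fun _ _ h => h)
  · simp [Cmd.wN, hi, hia]
  · intro a ha'
    have : arr ≠ a := by rintro rfl; simp [hNa] at ha'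
    simp [Cmd.wN, hN a ha', this]
  · intro t ht m₁ hs hit hI
    refine Tri.seq (T₁ := T) (T₂ := x.size + 5) (hbody t ht m₁ hs hit) ?_ (by omega)
    intro m₂ hs₂ hx
    refine Tri.line rfl (by simp [Cmd.cost, NExp.size]; omega) ?_
    have e : m₂.nat i 0 = t := by rw [hs₂.nat i hi, hit]
    intro j hj
    rw [writeNat_nat_of_ne _ _ _ hia]
    simp only [Cmd.exec, NExp.eval, e, hx, writeNat_nat, true_and]
    split_ifs with h
    · rw [h]
    · rw [hs₂.nat arr ha]; exact hI j (by omega)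
  · exact Nat.mul_le_mul (by omega) le_rfl

theorem digitsC_spec {arr : ℕ} {g b N : NExp} {G B n : ℕ} (hg : g.eval m = G) (hb : b.eval m = B)
    (hn : N.eval m = n) (harr : arr ∉ [123, 124, 126, 127, 128])
    (hb' : b.avoids [arr, 123, 124, 126, 127, 128] = true)
    (hN' : N.avoids [arr, 123, 124, 126, 127, 128] = true)
    (hs : g.size + b.size + N.size ≤ 20) (hB : 0 < B) :
    Tri w (digitsC arr g b N) m (200 * (G + 1) * (n + 2)) (fun m' => ∀ i < n,
      m'.nat arr i = G / B ^ i % B) := by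
  simp only [List.mem_cons, List.not_mem_nil, or_false, not_or] at harr
  have hev : ∀ x : NExp, x.avoids [arr, 123, 124, 126, 127, 128] = true → ∀ m₁,
      Same (digitsC arr g b N) m m₁ → x.eval m₁ = x.eval m := by
    intro x hx m₁ h
    refine h.eval_avoids hx ?_
    intro a ha
    simp [digitsC, divModC, forC, Cmd.wN] at ha
    simp; omega
  refine Tri.step rfl (T₂ := 170 * (G + 1) * (n + 1)) ?_ ?_
  rotate_left
  · have : (setR 123 g).cost ≤ 22 := by simp [Cmd.cost, NExp.size]; omega
    have h1 : 22 ≤ 22 * ((G + 1) * (n + 1)) :=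
      Nat.le_mul_of_pos_right _ (Nat.mul_pos (by omega) (by omega))
    have h2 : 200 * (G + 1) * (n + 2) = 170 * (G + 1) * (n + 1) + 30 * ((G + 1) * (n + 1))
      + 200 * (G + 1) := by ring
    omega
  intro m₁ hs₁ he₁
  have hs₁' : Same (digitsC arr g b N) m m₁ :=
    hs₁.weaken (by simp +contextual [digitsC, Cmd.wN]) (by simp +contextual [digitsC, Cmd.wK])
  have h123 : m₁.nat 123 0 = G := by rw [he₁]; simp [Cmd.exec, NExp.eval, writeNat_nat, hg]
  refine Tri.forC (n := n) (T := 130 * (G + 1)) (fun t m' => m'.nat 123 0 = G / B ^ t ∧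
    ∀ i < t, m'.nat arr i = G / B ^ i % B) (by rw [hev N hN' m₁ hs₁', hn]) ?_
    (N.avoids_iff hN' (by simp)) ?_ ?_ ?_ ?_ (fun _ _ h => h.2)
  · simp [divModC, forC, Cmd.wN]; omega
  · intro a ha
    by_contra hw
    simp [divModC, forC, Cmd.wN] at hw
    have := N.avoids_iff hN' (a := a) (by simp; omega)
    simp [this] at ha
  · refine ⟨?_, fun i hi => by omega⟩
    rw [writeNat_nat_of_ne _ _ _ (by decide), h123]; simp
  · rintro t ht m₂ hs₂ h124 ⟨k1, k2⟩
    have b2 : b.eval m₂ = B := by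
      rw [hev b hb' m₂ (hs₁'.trans (hs₂.weaken ?_ ?_)), hb]
      · intro a; simp +contextual [digitsC, Cmd.wN]
      · intro a; simp +contextual [digitsC, Cmd.wK]
    have hle : G / B ^ t ≤ G := Nat.div_le_self _ _
    refine Tri.seq (T₁ := 100 * (G + 1)) (T₂ := 30) ((divModC_spec (by decide) (by decide) (by decide)
      rfl rfl rfl (b.avoids_iff hb' (by simp)) (b.avoids_iff hb' (by simp))
      (b.avoids_iff hb' (by simp)) (by rw [b2]; exact hB) le_rfl).mono ?_ (fun _ _ h => h)) ?_ (by omega)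
    · simp only [NExp.eval, NExp.size, k1]
      exact Nat.mul_le_mul (by omega) (by omega)
    · rintro m₃ hs₃ ⟨h126, h127⟩
      simp only [NExp.eval, k1, b2] at h126 h127
      have e124 : m₃.nat 124 0 = t := by rw [hs₃.nat 124 rfl, h124]
      have harr3 : m₃.nat arr = m₂.nat arr := by
        refine hs₃.nat arr ?_
        simp [divModC, forC, Cmd.wN]; omega
      refine Tri.line rfl (by simp [Cmd.cost, NExp.size]) ⟨?_, ?_⟩
      · simp [Cmd.exec, NExp.eval, writeNat_nat, show (126 : ℕ) ≠ arr by omega, h126, pow_succ,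
          Nat.div_div_eq_div_mul]
      · intro i hi
        rw [writeNat_nat_of_ne _ _ _ harr.2.1]
        simp only [Cmd.exec, NExp.eval]
        rw [writeNat_nat_of_ne _ _ _ harr.1]
        simp only [writeNat_nat, e124, h127, true_and, harr3]
        split_ifs with h
        · rw [h]
        · exact k2 i (by omega)
  · have h1 : N.size ≤ 20 := by omega
    refine Nat.mul_le_mul (by omega) le_rfl

/-- The base is the first factor of each product, so a multiplication costs `X` steps however large
the power has become. -/
theorem powC_spec {o : ℕ} {x N : NExp} {X n : ℕ} (hx : x.eval m = X) (hn : N.eval m = n)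
    (ho : o ∉ [106, 107, 108]) (hx' : x.avoids [o, 106, 107, 108] = true)
    (hN' : N.avoids [o, 106, 107, 108] = true) (hs : x.size + N.size ≤ 10) :
    Tri w (powC o x N) m (100 * (X + 1) * (n + 2)) (fun m' => m'.nat o 0 = X ^ n) := by
  simp only [List.mem_cons, List.not_mem_nil, or_false, not_or] at ho
  have hev : ∀ y : NExp, y.avoids [o, 106, 107, 108] = true → ∀ m₁,
      Same (powC o x N) m m₁ → y.eval m₁ = y.eval m := by
    intro y hy m₁ h
    refine h.eval_avoids hy ?_
    intro a ha
    simp [powC, mulC, forC, Cmd.wN] at ha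
    simp; omega
  refine Tri.step rfl (T₂ := 100 * (X + 1) * (n + 1)) ?_ ?_
  rotate_left
  · have : (setR o (.const 1)).cost ≤ 3 := by simp [Cmd.cost, NExp.size]
    have h2 : 100 * (X + 1) * (n + 2) = 100 * (X + 1) * (n + 1) + 100 * (X + 1) := by ring
    omega
  intro m₁ hs₁ he₁
  have hs₁' : Same (powC o x N) m m₁ :=
    hs₁.weaken (by simp +contextual [powC, Cmd.wN]) (by simp +contextual [powC, Cmd.wK])
  have h1 : m₁.nat o 0 = 1 := by rw [he₁]; simp [Cmd.exec, NExp.eval, writeNat_nat]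
  refine Tri.forC (n := n) (T := 40 * (X + 1)) (fun t m' => m'.nat o 0 = X ^ t)
    (by rw [hev N hN' m₁ hs₁', hn]) ?_ (N.avoids_iff hN' (by simp)) ?_ ?_ ?_ ?_ (fun _ _ h => h)
  · simp [mulC, forC, Cmd.wN]; omega
  · intro a ha
    by_contra hw
    simp [mulC, forC, Cmd.wN] at hw
    have := N.avoids_iff hN' (a := a) (by simp; omega)
    simp [this] at ha
  · rw [writeNat_nat_of_ne _ _ _ (by omega), h1]; simp
  · rintro t ht m₂ hs₂ h106 hI
    have x2 : x.eval m₂ = X := by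
      rw [hev x hx' m₂ (hs₁'.trans (hs₂.weaken ?_ ?_)), hx]
      · intro a; simp +contextual [powC, Cmd.wN]
      · intro a; simp +contextual [powC, Cmd.wK]
    refine Tri.seq (T₁ := 32 * (X + 1)) (T₂ := 8 * (X + 1)) ((mulC_spec (by decide)
      (x.avoids_iff hx' (by simp)) (x.avoids_iff hx' (by simp)) (by simp [NExp.reads]; omega)
      (by simp [NExp.reads]; omega) le_rfl).mono ?_ (fun _ _ h => h)) ?_ (by omega)
    · simp only [NExp.size, x2]; exact Nat.mul_le_mul (by omega) le_rfl
    · intro m₃ hs₃ h107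
      simp only [NExp.eval, x2, hI] at h107
      refine Tri.line rfl ?_ ?_
      · have : (setR o (rd 107)).cost ≤ 4 := by simp [Cmd.cost, NExp.size]
        omega
      · simp [Cmd.exec, NExp.eval, writeNat_nat, h107, ho.1, pow_succ, mul_comm]
  · refine Nat.mul_le_mul (by omega) le_rfl

/-- Trial division of all candidates up to `2 * B`, keeping the last prime that is found; register
89 is 0 as long as there is none. -/
theorem primeC_spec {B : ℕ} (h82 : m.nat 82 0 = B) (hB : 0 < B) :
    Tri w primeC m (2000 * (B + 1) ^ 3) (fun m' => (m'.nat 89 0).Prime ∧ B ≤ m'.nat 89 0 ∧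
      m'.nat 89 0 ≤ 2 * B) := by
  have hpos : 1 ≤ (B + 1) ^ 3 := Nat.one_le_pow _ _ (by omega)
  refine Tri.step rfl (T₂ := 1900 * (B + 1) ^ 3) ?_ (by
    have : (setR 89 (.const 0)).cost ≤ 10 := by decide
    omega)
  intro m₁ hs₁ he₁
  have a82 : m₁.nat 82 0 = B := by rw [hs₁.nat 82 rfl, h82]
  have a89 : m₁.nat 89 0 = 0 := by rw [he₁]; simp [Cmd.exec, NExp.eval, writeNat_nat]
  refine Tri.forC (n := 2 * B + 1) (T := 800 * (B + 1) ^ 2) (fun t m' =>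
    ((m'.nat 89 0 = 0 ∧ ∀ c < t, B ≤ c → ¬ c.Prime) ∨
      ((m'.nat 89 0).Prime ∧ B ≤ m'.nat 89 0 ∧ m'.nat 89 0 ≤ 2 * B)))
    (by simp only [NExp.eval, a82]; omega) rfl rfl ?_ ?_ ?_ ?_ ?_
  · intro a ha
    simp [NExp.reads] at ha
    subst ha; rfl
  · exact Or.inl ⟨by rw [writeNat_nat_of_ne _ _ _ (by decide), a89], fun c hc => by omega⟩
  · rintro t ht m₂ hs₂ h83 hI
    have b82 : m₂.nat 82 0 = B := by rw [hs₂.nat 82 rfl, a82]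
    have hsq : (B + 1) * 1 ≤ (B + 1) ^ 2 := by rw [pow_two]; exact Nat.mul_le_mul le_rfl (by omega)
    refine Tri.step rfl (T₂ := 800 * (B + 1) ^ 2 - 3) ?_ (by
      have : (setR 84 (.const 1)).cost ≤ 3 := by decide
      omega)
    intro m₃ hs₃ he₃
    have c83 : m₃.nat 83 0 = t := by rw [hs₃.nat 83 rfl, h83]
    have c82 : m₃.nat 82 0 = B := by rw [hs₃.nat 82 rfl, b82]
    have c84 : m₃.nat 84 0 = 1 := by rw [he₃]; simp [Cmd.exec, NExp.eval, writeNat_nat]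
    refine Tri.seq (T₁ := 12) (T₂ := 800 * (B + 1) ^ 2 - 15) (Q' := fun m' =>
      m'.nat 84 0 = if t ≤ 1 then 0 else 1) (Tri.line rfl (by decide) ?_) ?_ (by omega)
    · simp only [Cmd.exec, Cond.Holds, NExp.eval, c83]
      split_ifs <;> simp [writeNat_nat, c84]
    intro m₄ hs₄ d84
    have d83 : m₄.nat 83 0 = t := by rw [hs₄.nat 83 rfl, c83]
    have d82 : m₄.nat 82 0 = B := by rw [hs₄.nat 82 rfl, c82]
    refine Tri.seq (T₁ := 15) (T₂ := 800 * (B + 1) ^ 2 - 30) (Q' := fun m' =>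
      m'.nat 84 0 = if t ≤ 1 ∨ t < B then 0 else 1) (Tri.line rfl (by decide) ?_) ?_ (by omega)
    · simp only [Cmd.exec, Cond.Holds, NExp.eval, d83, d82]
      by_cases h1 : t < B
      · rw [if_pos (by omega), if_pos (Or.inr h1)]; simp [writeNat_nat]
      · rw [if_neg (by omega), d84]
        by_cases h2 : t ≤ 1
        · rw [if_pos h2, if_pos (Or.inl h2)]
        · rw [if_neg h2, if_neg (by omega)]
    intro m₅ hs₅ e84
    have e83 : m₅.nat 83 0 = t := by rw [hs₅.nat 83 rfl, d83]
    refine Tri.seq (T₁ := 360 * (B + 1) ^ 2 + 360 * (B + 1)) (T₂ := 40) (Q' := fun m' =>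
      m'.nat 84 0 = if (t ≤ 1 ∨ t < B) ∨ ∃ d < t, 2 ≤ d ∧ t % d = 0 then 0 else 1) ?_ ?_ ?_
    · refine Tri.forC (n := t) (T := 60 * (t + 1) + 40) (fun s m' =>
        m'.nat 84 0 = if (t ≤ 1 ∨ t < B) ∨ ∃ d < s, 2 ≤ d ∧ t % d = 0 then 0 else 1)
        (by simp only [NExp.eval, e83]) rfl rfl ?_ ?_ ?_ ?_ (fun _ _ h => h)
      · intro a ha
        simp [NExp.reads] at ha
        subst ha; rfl
      · rw [writeNat_nat_of_ne _ _ _ (by decide), e84]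
        simp
      · rintro s hs m₆ hs₆ h85 hJ
        have f83 : m₆.nat 83 0 = t := by rw [hs₆.nat 83 rfl, e83]
        refine Tri.ite (T₁ := 60 * (t + 1) + 30) ?_ ?_ (by
          have : (Cond.natLe (.const 2) (rd 85)).size ≤ 5 := by decide
          omega)
        · intro hc
          simp only [Cond.Holds, NExp.eval, h85] at hc
          refine Tri.seq (T₁ := 60 * (t + 1)) (T₂ := 30) ((divModC_spec (by decide) (by decide)
            (by decide) rfl rfl rfl rfl rfl rfl (by simp only [NExp.eval, h85]; omega)
            le_rfl).mono ?_ (fun _ _ h => h)) ?_ le_rfl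
          · simp only [NExp.eval, NExp.size, f83]; exact Nat.mul_le_mul (by omega) le_rfl
          · rintro m₇ hs₇ ⟨-, h87⟩
            simp only [NExp.eval, f83, h85] at h87
            have g84 : m₇.nat 84 0 = m₆.nat 84 0 := by rw [hs₇.nat 84 rfl]
            refine Tri.line rfl (by decide) ?_
            rw [writeNat_nat_of_ne _ _ _ (by decide)]
            simp only [Cmd.exec, Cond.Holds, NExp.eval, h87]
            by_cases hz : t % s = 0
            · rw [if_pos hz.le, if_pos (Or.inr ⟨s, by omega, hc, hz⟩)]
              simp [writeNat_nat]
            · rw [if_neg (by omega), g84, hJ]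
              congr 1
              apply propext
              refine or_congr_right ⟨?_, ?_⟩
              · rintro ⟨d, h1, h2⟩; exact ⟨d, by omega, h2⟩
              · rintro ⟨d, h1, h2, h3⟩
                refine ⟨d, lt_of_le_of_ne (by omega) ?_, h2, h3⟩
                rintro rfl; exact hz h3
        · intro hc
          simp only [Cond.Holds, NExp.eval, h85] at hc
          refine Tri.line rfl (by simp [Cmd.cost]) ?_
          rw [writeNat_nat_of_ne _ _ _ (by decide)]
          simp only [Cmd.exec, hJ]
          congr 1
          apply propext
          refine or_congr_right ⟨?_, ?_⟩
          · rintro ⟨d, h1, h2⟩; exact ⟨d, by omega, h2⟩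
          · rintro ⟨d, h1, h2, h3⟩; exact ⟨d, by omega, h2, h3⟩
      · simp only [NExp.size]
        have h1 : 60 * (t + 1) + 40 + (1 + 1) + 12 ≤ 180 * (B + 1) := by omega
        refine (Nat.mul_le_mul h1 (show t + 1 ≤ 2 * (B + 1) by omega)).trans ?_
        have : 180 * (B + 1) * (2 * (B + 1)) = 360 * (B + 1) ^ 2 := by ring
        omega
    · intro m₆ hs₆ g84
      have g83 : m₆.nat 83 0 = t := by rw [hs₆.nat 83 rfl, e83]
      have g89 : m₆.nat 89 0 = m₂.nat 89 0 := by
        rw [hs₆.nat 89 rfl, hs₅.nat 89 rfl, hs₄.nat 89 rfl, hs₃.nat 89 rfl]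
      have hprime : (¬ ((t ≤ 1 ∨ t < B) ∨ ∃ d < t, 2 ≤ d ∧ t % d = 0)) ↔ B ≤ t ∧ t.Prime := by
        constructor
        · intro h
          push Not at h
          obtain ⟨⟨h1, h2⟩, h3⟩ := h
          refine ⟨h2, Nat.prime_def_lt'.mpr ⟨by omega, fun d hd hdt hdvd => ?_⟩⟩
          exact h3 d hdt hd (Nat.mod_eq_zero_of_dvd hdvd)
        · rintro ⟨h1, h2⟩ h
          have h2' := h2.two_le
          rcases h with h | ⟨d, h3, h4, h5⟩
          · omega
          · rcases (Nat.dvd_prime h2).mp (Nat.dvd_of_mod_eq_zero h5) with h | h <;> omega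
      refine Tri.line rfl (by decide) ?_
      rw [writeNat_nat_of_ne _ _ _ (by decide)]
      simp only [Cmd.exec, Cond.Holds, NExp.eval, g84, g83]
      by_cases hp : B ≤ t ∧ t.Prime
      · rw [if_neg (hprime.mpr hp), if_pos le_rfl]
        right
        simp only [writeNat_nat, and_self, if_true]
        exact ⟨hp.2, hp.1, by omega⟩
      · have hno := hp
        rw [← hprime, not_not] at hp
        rw [if_pos hp, if_neg (by omega), g89]
        rcases hI with ⟨k1, k2⟩ | k
        · refine Or.inl ⟨k1, fun c hc hBc hcp => ?_⟩
          rcases Nat.lt_succ_iff_lt_or_eq.mp hc with h | rfl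
          · exact k2 c h hBc hcp
          · exact hno ⟨hBc, hcp⟩
        · exact Or.inr k
    · have : 1 ≤ (B + 1) ^ 2 := Nat.one_le_pow _ _ (by omega)
      omega
  · simp only [NExp.size]
    have h1 : 1 ≤ (B + 1) ^ 2 := Nat.one_le_pow _ _ (by omega)
    calc (800 * (B + 1) ^ 2 + (1 + 1 + (1 + 1) + 1 + 1 + 1) + 12) * (2 * B + 1 + 1)
        ≤ (900 * (B + 1) ^ 2) * (2 * (B + 1)) := Nat.mul_le_mul (by omega) (by omega)
      _ = 1800 * (B + 1) ^ 3 := by ring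
      _ ≤ _ := Nat.mul_le_mul (by omega) le_rfl
  · rintro m₂ - (⟨-, h⟩ | h)
    -- Bertrand's postulate excludes that the search ends without a prime.
    · obtain ⟨p, hp, h1, h2⟩ := Nat.exists_prime_lt_and_le_two_mul B (by omega)
      exact absurd hp (h p (by omega) h1.le)
    · exact h

/-- Number of levels, buckets and offsets. -/
structure LevelInv (q : ℕ) (m : Memory K) : Prop where
  pos : ∀ j < m.nat 98 0, 0 < q / 2 ^ j
  zero : q / 2 ^ m.nat 98 0 = 0
  le : m.nat 98 0 ≤ q + 1
  buck : ∀ i < q + 1, m.nat 103 i = buckets q i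
  off : ∀ i < q + 1, m.nat 104 i = offset q i

/-- Register 98 becomes the first level `i` with `q / 2 ^ i = 0`, where the peeling has nothing
left; `q + 1` iterations suffice as `q < 2 ^ q`. -/
theorem levelsC_spec {q : ℕ} (h4 : m.nat 4 0 = q) :
    Tri w levelsC m (200 * (q + 2) ^ 2) (LevelInv q) := by
  have h200 : 200 * (q + 2) ^ 2 = 200 * (q + 1) * (q + 2) + 200 * q + 400 := by ring
  refine Tri.step rfl (T₂ := 200 * (q + 1) * (q + 2) + 200 * q + 390) ?_ (by
    have : (setR 97 (rd 4)).cost ≤ 10 := by decide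
    omega)
  intro m₁ hs₁ he₁
  have a97 : m₁.nat 97 0 = q := by rw [he₁]; simp [Cmd.exec, NExp.eval, writeNat_nat, h4]
  refine Tri.step rfl (T₂ := 200 * (q + 1) * (q + 2) + 200 * q + 380) ?_ (by
    have : (setR 98 (.const 0)).cost ≤ 10 := by decide
    omega)
  intro m₂ hs₂ he₂
  have a98 : m₂.nat 98 0 = 0 := by rw [he₂]; simp [Cmd.exec, NExp.eval, writeNat_nat]
  refine Tri.step rfl (T₂ := 200 * (q + 1) * (q + 2)) ?_ (by
    have : (setR 104 (.const 0)).cost ≤ 10 := by decide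
    omega)
  intro m₃ hs₃ he₃
  have a104 : m₃.nat 104 0 = 0 := by rw [he₃]; simp [Cmd.exec, NExp.eval, writeNat_nat]
  have hmono : ∀ i j, i ≤ j → q / 2 ^ j ≤ q / 2 ^ i := fun i j h =>
    Nat.div_le_div_left (Nat.pow_le_pow_right (by omega) h) (by positivity)
  refine Tri.forC (n := q + 1) (T := 60 * (q + 1) + 70) (fun t m' => m'.nat 97 0 = q / 2 ^ t ∧
      (m'.nat 98 0 ≤ t ∧ (∀ j < m'.nat 98 0, 0 < q / 2 ^ j) ∧
        (m'.nat 98 0 = t ∨ q / 2 ^ m'.nat 98 0 = 0)) ∧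
      (∀ i < t, m'.nat 103 i = buckets q i) ∧ ∀ i ≤ t, m'.nat 104 i = offset q i)
    (by simp only [NExp.eval, hs₃.nat 4 rfl, hs₂.nat 4 rfl, hs₁.nat 4 rfl, h4]) rfl rfl ?_ ?_ ?_ ?_ ?_
  · intro a ha
    simp [NExp.reads] at ha
    subst ha; rfl
  · have e98 : m₃.nat 98 0 = 0 := by rw [hs₃.nat 98 rfl, a98]
    refine ⟨?_, ⟨?_, ?_, Or.inl ?_⟩, fun i hi => by omega, ?_⟩
    · rw [writeNat_nat_of_ne _ _ _ (by decide), hs₃.nat 97 rfl, hs₂.nat 97 rfl, a97]; simp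
    · rw [writeNat_nat_of_ne _ _ _ (by decide), e98]
    · rw [writeNat_nat_of_ne _ _ _ (by decide), e98]; intro j hj; omega
    · rw [writeNat_nat_of_ne _ _ _ (by decide), e98]
    · intro i hi
      obtain rfl : i = 0 := by omega
      rw [writeNat_nat_of_ne _ _ _ (by decide), a104]; rfl
  · rintro t ht m₄ hs₄ h99 ⟨k1, ⟨k2, k3, k4⟩, k5, k6⟩
    have hle : q / 2 ^ t ≤ q := Nat.div_le_self _ _
    refine Tri.seq (T₁ := 20) (T₂ := 60 * (q + 1) + 50) (Q' := fun m' => m'.nat 98 0 ≤ t + 1 ∧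
      (∀ j < m'.nat 98 0, 0 < q / 2 ^ j) ∧ (m'.nat 98 0 = t + 1 ∨ q / 2 ^ m'.nat 98 0 = 0))
      (Tri.line rfl (by decide) ?_) ?_ (by omega)
    · simp only [Cmd.exec, Cond.Holds, NExp.eval, k1, h99]
      by_cases hc : 1 ≤ q / 2 ^ t
      · rw [if_pos hc]
        simp only [writeNat_nat, and_self, if_true]
        refine ⟨le_rfl, fun j hj => ?_, Or.inl trivial⟩
        have := hmono j t (by omega); omega
      · rw [if_neg hc]
        refine ⟨by omega, k3, Or.inr ?_⟩
        rcases k4 with h | h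
        · rw [h]; omega
        · exact h
    intro m₅ hs₅ hL
    have b97 : m₅.nat 97 0 = q / 2 ^ t := by rw [hs₅.nat 97 rfl, k1]
    have b99 : m₅.nat 99 0 = t := by rw [hs₅.nat 99 rfl, h99]
    refine Tri.step rfl (T₂ := 60 * (q + 1) + 35) ?_ (by
      have : (Cmd.setNat 103 (rd 99) (rd 97 +ₙ rd 97 +ₙ rd 97 +ₙ rd 97)).cost ≤ 15 := by decide
      omega)
    intro m₆ hs₆ he₆
    have c103 : ∀ i, m₆.nat 103 i = if i = t then buckets q t else m₅.nat 103 i := by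
      intro i
      rw [he₆]
      simp only [Cmd.exec, NExp.eval, writeNat_nat, b99, b97, true_and]
      split_ifs
      · rw [buckets]; omega
      · rfl
    have c104 : m₆.nat 104 = m₄.nat 104 := by rw [hs₆.nat 104 rfl, hs₅.nat 104 rfl]
    have c99 : m₆.nat 99 0 = t := by rw [hs₆.nat 99 rfl, b99]
    refine Tri.step rfl (T₂ := 60 * (q + 1) + 15) ?_ (by
      have : (Cmd.setNat 104 (rd 99 +ₙ .const 1) (.read 104 (rd 99) +ₙ .read 103 (rd 99))).cost
        ≤ 20 := by decide
      omega)
    intro m₇ hs₇ he₇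
    have d104 : ∀ i, m₇.nat 104 i = if i = t + 1 then offset q (t + 1) else m₄.nat 104 i := by
      intro i
      rw [he₇]
      simp only [Cmd.exec, NExp.eval, writeNat_nat, c99, true_and, c104, c103, if_true,
        k6 t le_rfl, offset]
    have d97 : m₇.nat 97 0 = q / 2 ^ t := by rw [hs₇.nat 97 rfl, hs₆.nat 97 rfl, b97]
    refine Tri.seq (T₁ := 60 * (q + 1)) (T₂ := 15) ((divModC_spec (by decide) (by decide) (by decide)
      rfl rfl rfl rfl rfl rfl (by simp [NExp.eval]) le_rfl).mono ?_ (fun _ _ h => h)) ?_ le_rfl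
    · simp only [NExp.eval, NExp.size, d97]; exact Nat.mul_le_mul (by omega) (by omega)
    rintro m₈ hs₈ ⟨h100, -⟩
    simp only [NExp.eval, d97] at h100
    refine Tri.line rfl (by decide) ?_
    have e98 : m₈.nat 98 = m₅.nat 98 := by rw [hs₈.nat 98 rfl, hs₇.nat 98 rfl, hs₆.nat 98 rfl]
    have e103 : m₈.nat 103 = m₆.nat 103 := by rw [hs₈.nat 103 rfl, hs₇.nat 103 rfl]
    have e104 : m₈.nat 104 = m₇.nat 104 := hs₈.nat 104 rfl
    rw [writeNat_nat_of_ne _ _ _ (by decide), writeNat_nat_of_ne _ _ _ (by decide),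
      writeNat_nat_of_ne _ _ _ (by decide), writeNat_nat_of_ne _ _ _ (by decide)]
    simp only [Cmd.exec, NExp.eval, h100]
    rw [writeNat_nat_of_ne _ _ _ (show 98 ≠ 97 by decide),
      writeNat_nat_of_ne _ _ _ (show 103 ≠ 97 by decide),
      writeNat_nat_of_ne _ _ _ (show 104 ≠ 97 by decide), e98, e103, e104]
    refine ⟨?_, hL, ?_, ?_⟩
    · simp [writeNat_nat, pow_succ, Nat.div_div_eq_div_mul]
    · intro i hi
      rw [c103]
      split_ifs with h
      · rw [h]
      · rw [hs₅.nat 103 rfl]; exact k5 i (by omega)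
    · intro i hi
      rw [d104]
      split_ifs with h
      · rw [h]
      · exact k6 i (by omega)
  · simp only [NExp.size]
    exact Nat.mul_le_mul (by omega) le_rfl
  · rintro m' - ⟨-, ⟨k2, k3, k4⟩, k5, k6⟩
    have hz : q / 2 ^ q = 0 := Nat.div_eq_of_lt Nat.lt_two_pow_self
    refine ⟨k3, ?_, k2, k5, fun i hi => k6 i hi.le⟩
    rcases k4 with h | h
    · have := k3 q (by omega); omega
    · exact h

end Gadgets

end RejSched

namespace RejSched

/-! ### One coloring -/

/-- Every sequence of digits is the expansion of a number. -/
theorem exists_digits {B : ℕ} (n : ℕ) : ∀ (a : ℕ → ℕ), (∀ i, a i < B) →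
    ∃ g < B ^ n, ∀ i < n, g / B ^ i % B = a i := by
  induction n with
  | zero => intro a _; exact ⟨0, by simp, by simp⟩
  | succ n ih =>
    intro a ha
    obtain ⟨g, hg, h⟩ := ih (fun i => a (i + 1)) (fun i => ha _)
    have h0 := ha 0
    refine ⟨a 0 + B * g, ?_, ?_⟩
    · calc a 0 + B * g < B * (g + 1) := by rw [mul_add]; omega
        _ ≤ B * B ^ n := Nat.mul_le_mul le_rfl hg
        _ = _ := by ring
    · rintro (_ | i) hi
      · simp [Nat.mod_eq_of_lt h0]
      · rw [pow_succ', ← Nat.div_div_eq_div_mul, Nat.add_mul_div_left _ _ (by omega),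
          Nat.div_eq_of_lt h0, zero_add]
        exact h i (by omega)

theorem rank_congr {A A' : ℕ → Prop} [DecidablePred A] [DecidablePred A'] {c : ℕ}
    (h : ∀ d < c, A d ↔ A' d) : rank A c = rank A' c := by
  unfold rank
  congr 1
  exact Finset.filter_congr (fun d hd => h d (Finset.mem_range.mp hd))

theorem rank_succ (A : ℕ → Prop) [DecidablePred A] (c : ℕ) :
    rank A (c + 1) = rank A c + if A c then 1 else 0 := by
  unfold rank
  rw [Finset.range_add_one, Finset.filter_insert]
  split_ifs
  · rw [Finset.card_insert_of_notMem (by simp)]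
  · rfl

theorem levelColor_lt_mul {q p i z : ℕ} {a : ℕ → ℕ} (h : 0 < q / 2 ^ i) :
    levelColor q p a i z < 8 * q :=
  (levelColor_lt h).trans_le ((Nat.le_add_right _ _).trans (offset_add_le q (i + 1)))

/-- A coloring depends on finitely many data only, the multipliers of the levels and the activity of
`8 * q` colors, which makes it enumerable by the digits of two numbers. -/
theorem peelColor_congr {q p : ℕ} {a a' : ℕ → ℕ} {A A' : ℕ → Prop} [DecidablePred A]
    [DecidablePred A'] {i : ℕ} (z : ℕ) (hpos : ∀ j < i, 0 < q / 2 ^ j)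
    (ha : ∀ j < i, a j = a' j) (hA : ∀ c < 8 * q, A c ↔ A' c) :
    peelColor q p a A i z = peelColor q p a' A' i z := by
  induction i with
  | zero => rfl
  | succ i ih =>
    have h1 : levelColor q p a i z = levelColor q p a' i z := by simp [levelColor, ha i (by omega)]
    have h2 := levelColor_lt_mul (p := p) (a := a') (z := z) (hpos i (by omega))
    have h3 := hA _ h2
    have h4 : rank A (levelColor q p a' i z) = rank A' (levelColor q p a' i z) :=
      rank_congr (fun d hd => hA d (by omega))
    simp only [peelColor, ih (fun j hj => hpos j (by omega)) (fun j hj => ha j (by omega)), h1, h3, h4]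

/-- Numbers of active colors below each color. -/
def rankC : Cmd :=
  .setNat 133 (.const 0) (.const 0) ⨟
  forC 131 (rd 110) (.setNat 133 (rd 131 +ₙ .const 1) (.read 133 (rd 131) +ₙ .read 132 (rd 131)))

/-- The colors of the hash values. -/
def peelC : Cmd :=
  forC 138 (rd 95) ((setR 150 (rd 4) ⨟ forC 146 (rd 98)
    (hashC (.read 125 (rd 146)) (rd 96) (.read 103 (rd 146)) (rd 138) ⨟
     setR 151 (.read 104 (rd 146) +ₙ rd 145) ⨟
     ifC (.and (.natLe (rd 4) (rd 150)) (.natLe (.const 1) (.read 132 (rd 151))))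
       (setR 150 (.read 133 (rd 151))))) ⨟
    .setNat 139 (rd 138) (rd 150))

/-- Color the jobs and run the dynamic program. -/
def colorC (mode : Mode) : Cmd :=
  digitsC 132 (rd 129) (.const 2) (rd 110) ⨟ rankC ⨟ peelC ⨟
  forC 134 (rd 0) (.skip ⨟ .setNat 6 (rd 134) (.read 139 (.read 113 (rd 134)))) ⨟ runC mode

/-- Enumeration of the colorings with `rd 4` colors. -/
def hashedC (mode : Mode) : Cmd :=
  mulC 93 94 (rd 4) (rd 4) ⨟ setR 95 (rd 93 +ₙ rd 93) ⨟ setR 82 (rd 95) ⨟ primeC ⨟ setR 96 (rd 89) ⨟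
  levelsC ⨟ powC 105 (rd 96) (rd 98) ⨟ mulC 110 135 (.const 8) (rd 4) ⨟ powC 109 (.const 2) (rd 110) ⨟
  forC 111 (rd 81)
    (forC 112 (rd 0) (hashC (rd 111) (rd 81) (rd 95) (rd 112) ⨟ .setNat 113 (rd 112) (rd 145)) ⨟
     forC 122 (rd 105) (digitsC 125 (rd 122) (rd 96) (rd 98) ⨟ forC 129 (rd 109) (colorC mode)))

/-- Enumeration of the single jobs. -/
def singlesC (mode : Mode) : Cmd :=
  setR 4 (.const 1) ⨟
  forC 90 (rd 0)
    (forC 91 (rd 0) (.skip ⨟ .setNat 6 (rd 91) (.const 1)) ⨟ .setNat 6 (rd 90) (.const 0) ⨟ runC mode)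

/-- Write the best schedule to the output. -/
def outputC : Cmd :=
  .setNat 1 (.const 0) (rd 21) ⨟
  forC 136 (rd 21) (.setNat 2 (rd 136) (.read 19 (rd 20 +ₙ rd 136)) ⨟
    .setNum 3 (rd 136) (.read 8 (rd 20 +ₙ rd 136)) ⨟ .setNum 4 (rd 136) (.read 9 (rd 20 +ₙ rd 136)))

/-- The algorithm. -/
def mainC (mode : Mode) : Cmd :=
  setR 80 (.read 0 (.const 1)) ⨟ ifC (.natLe (rd 0) (rd 80)) (setR 80 (rd 0)) ⨟
  ifC (.natLe (.const 1) (rd 80))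
    (singlesC mode ⨟ setR 82 (rd 0) ⨟ primeC ⨟ setR 81 (rd 89) ⨟
     forC 92 (rd 80 -ₙ .const 1) (setR 4 (rd 92 +ₙ .const 2) ⨟ hashedC mode)) ⨟
  outputC

section Coloring

variable {K : Type} [CommRing K] [LinearOrder K] [IsStrictOrderedRing K]
variable {w : ℕ → K → K} {m : Memory K}

theorem rankC_spec {N : ℕ} {A : ℕ → Prop} [DecidablePred A] (h110 : m.nat 110 0 = N)
    (h : ∀ c < N, m.nat 132 c = if A c then 1 else 0) :
    Tri w rankC m (60 * (N + 1)) (fun m' => ∀ c ≤ N, m'.nat 133 c = rank A c) := by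
  refine Tri.step rfl (T₂ := 40 * (N + 1)) ?_ (by
    have : (Cmd.setNat 133 (.const 0) (.const 0)).cost ≤ 10 := by decide
    omega)
  intro m₁ hs₁ he₁
  refine Tri.forC (n := N) (T := 20) (fun t m' => ∀ c ≤ t, m'.nat 133 c = rank A c)
    (by simp only [NExp.eval, hs₁.nat 110 rfl, h110]) rfl rfl ?_ ?_ ?_ ?_ (fun _ _ h => h)
  · intro a ha
    simp [NExp.reads] at ha
    subst ha; rfl
  · intro c hc
    obtain rfl : c = 0 := by omega
    rw [writeNat_nat_of_ne _ _ _ (by decide), he₁]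
    simp [Cmd.exec, NExp.eval, writeNat_nat, rank]
  · intro t ht m₂ hs₂ h131 hI
    refine Tri.line rfl (by decide) ?_
    intro c hc
    rw [writeNat_nat_of_ne _ _ _ (by decide)]
    simp only [Cmd.exec, NExp.eval, h131, writeNat_nat, true_and, hI t le_rfl, hs₂.nat 132 rfl,
      hs₁.nat 132 rfl, h t ht]
    split_ifs with h1 h2
    · rw [h1, rank_succ, if_pos h2]
    · rw [h1, rank_succ, if_neg h2]
    · exact hI c (by omega)
  · simp only [NExp.size]
    exact Nat.mul_le_mul (by omega) le_rfl

/-- Colors are tabulated over the values of the first hash function and not over the jobs, so the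
time does not depend on the number of jobs. -/
theorem peelC_spec {q p M : ℕ} {a : ℕ → ℕ} {A : ℕ → Prop} [DecidablePred A] (h4 : m.nat 4 0 = q)
    (h95 : m.nat 95 0 = M) (h96 : m.nat 96 0 = p) (hp : 0 < p) (hM : M ≤ p) (hL : LevelInv q m)
    (h125 : ∀ i < m.nat 98 0, m.nat 125 i = a i) (ha : ∀ i < m.nat 98 0, a i ≤ p)
    (h132 : ∀ c < 8 * q, m.nat 132 c = if A c then 1 else 0)
    (h133 : ∀ c < 8 * q, m.nat 133 c = rank A c) :
    Tri w peelC m (2000 * (p + 1) ^ 3 * (m.nat 98 0 + 1)) (fun m' => ∀ z < M,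
      m'.nat 139 z = peelColor q p a A (m.nat 98 0) z) := by
  set l := m.nat 98 0 with hl
  have hp1 : 1 ≤ (p + 1) ^ 2 := Nat.one_le_pow _ _ (by omega)
  have hl1 : 1 ≤ (p + 1) ^ 2 * (l + 1) := Nat.mul_pos hp1 (by omega)
  refine Tri.tabulate (n := M) (T := 1000 * ((p + 1) ^ 2 * (l + 1))) _
    (by simp only [NExp.eval, h95]) rfl rfl (by decide) rfl rfl ?_ ?_ ?_
  · intro b hb
    simp [NExp.reads] at hb
    subst hb; rfl
  · intro z hz m₁ hs₁ h138
    refine Tri.step rfl (T₂ := 900 * ((p + 1) ^ 2 * (l + 1))) ?_ (by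
      have : (setR 150 (rd 4)).cost ≤ 10 := by decide
      omega)
    intro m₂ hs₂ he₂
    have a98 : m₂.nat 98 0 = l := by rw [hs₂.nat 98 rfl, hs₁.nat 98 rfl]
    refine Tri.forC (n := l) (T := 400 * (p + 1) ^ 2 + 60)
      (fun i m' => m'.nat 150 0 = peelColor q p a A i z)
      (by simp only [NExp.eval, a98]) rfl rfl ?_ ?_ ?_ ?_ (fun _ _ h => h)
    · intro b hb
      simp [NExp.reads] at hb
      subst hb; rfl
    · rw [writeNat_nat_of_ne _ _ _ (by decide), he₂]
      simp [Cmd.exec, NExp.eval, writeNat_nat, hs₁.nat 4 rfl, h4, peelColor]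
    · intro i hi m₃ hs₃ h146 hI
      have hli : i < q + 1 := by have := hL.le; omega
      have hpos := hL.pos i hi
      have e125 : m₃.nat 125 i = a i := by
        rw [hs₃.nat 125 rfl, hs₂.nat 125 rfl, hs₁.nat 125 rfl, h125 i hi]
      have e103 : m₃.nat 103 i = buckets q i := by
        rw [hs₃.nat 103 rfl, hs₂.nat 103 rfl, hs₁.nat 103 rfl, hL.buck i hli]
      have e138 : m₃.nat 138 0 = z := by rw [hs₃.nat 138 rfl, hs₂.nat 138 rfl, h138]
      have e96 : m₃.nat 96 0 = p := by
        rw [hs₃.nat 96 rfl, hs₂.nat 96 rfl, hs₁.nat 96 rfl, h96]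
      refine Tri.seq (T₁ := 400 * (p + 1) ^ 2) (T₂ := 60) (hashC_spec (A := a i) (P := p)
        (Q := buckets q i) (Z := z) (by simp only [NExp.eval, h146, e125])
        (by simp only [NExp.eval, e96]) (by simp only [NExp.eval, h146, e103])
        (by simp only [NExp.eval, e138]) rfl rfl rfl rfl (by decide) hp (by
          rw [buckets]; omega) (ha i hi) le_rfl (by omega)) ?_ le_rfl
      intro m₄ hs₄ h145
      have c146 : m₄.nat 146 0 = i := by rw [hs₄.nat 146 rfl, h146]
      have c104 : m₄.nat 104 i = offset q i := by
        rw [hs₄.nat 104 rfl, hs₃.nat 104 rfl, hs₂.nat 104 rfl, hs₁.nat 104 rfl, hL.off i hli]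
      refine Tri.step rfl (T₂ := 45) ?_ (by
        have : (setR 151 (.read 104 (rd 146) +ₙ rd 145)).cost ≤ 15 := by decide
        omega)
      intro m₅ hs₅ he₅
      have d151 : m₅.nat 151 0 = levelColor q p a i z := by
        rw [he₅]; simp [Cmd.exec, NExp.eval, writeNat_nat, c146, c104, h145, levelColor]
      have hlt := levelColor_lt_mul (p := p) (a := a) (z := z) hpos
      have d132 : m₅.nat 132 (levelColor q p a i z) = if A (levelColor q p a i z) then 1 else 0 := by
        rw [hs₅.nat 132 rfl, hs₄.nat 132 rfl, hs₃.nat 132 rfl, hs₂.nat 132 rfl, hs₁.nat 132 rfl,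
          h132 _ hlt]
      have d133 : m₅.nat 133 (levelColor q p a i z) = rank A (levelColor q p a i z) := by
        rw [hs₅.nat 133 rfl, hs₄.nat 133 rfl, hs₃.nat 133 rfl, hs₂.nat 133 rfl, hs₁.nat 133 rfl,
          h133 _ hlt]
      have d150 : m₅.nat 150 0 = peelColor q p a A i z := by
        rw [hs₅.nat 150 rfl, hs₄.nat 150 rfl, hI]
      have d4 : m₅.nat 4 0 = q := by
        rw [hs₅.nat 4 rfl, hs₄.nat 4 rfl, hs₃.nat 4 rfl, hs₂.nat 4 rfl, hs₁.nat 4 rfl, h4]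
      refine Tri.line rfl (by decide) ?_
      rw [writeNat_nat_of_ne _ _ _ (by decide)]
      simp only [Cmd.exec, Cond.Holds, NExp.eval, d4, d150, d151, d132, d133, peelColor]
      by_cases hA : A (levelColor q p a i z)
      · by_cases hq : q ≤ peelColor q p a A i z
        · rw [if_pos ⟨hq, by simp [hA]⟩, if_pos ⟨hq, hA⟩]; simp [writeNat_nat]
        · rw [if_neg (fun h => hq h.1), if_neg (fun h => hq h.1), d150]
      · rw [if_neg (fun h => by simp [hA] at h), if_neg (fun h => hA h.2), d150]
    · simp only [NExp.size]
      have h : 400 * (p + 1) ^ 2 + 60 + (1 + 1) + 12 ≤ 900 * (p + 1) ^ 2 := by omega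
      exact (Nat.mul_le_mul h le_rfl).trans (by rw [mul_assoc])
  · simp only [NExp.size]
    have h : 1000 * ((p + 1) ^ 2 * (l + 1)) + (1 + 1) + (1 + 1) + 20
      ≤ 2000 * ((p + 1) ^ 2 * (l + 1)) := by omega
    refine (Nat.mul_le_mul h (show M + 1 ≤ p + 1 by omega)).trans (le_of_eq ?_)
    ring

end Coloring

end RejSched

/-! ### Search loops and the number of colorings -/

namespace RejSched

section Search

variable {K : Type} [CommRing K] [LinearOrder K] [IsStrictOrderedRing K]
variable {I : Problem K} {mode : Mode} {m : Memory K}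

/-- Cost of a schedule in comparison with the rejection of all jobs. -/
def Problem.relCost (I : Problem K) (S : Schedule K I.n) : K :=
  ∑ j ∈ S.scheduled, (I.w j (I.completion S j) - I.e j)

/-- The memory holds the instance and a best schedule so far. -/
structure Kept (I : Problem K) (mode : Mode) (m : Memory K) : Prop where
  inst : Inst I m
  best : BestOK I mode m

theorem Kept.congr {m' : Memory K} (h : Kept I mode m)
    (ha : Agree [0, 18, 19, 20, 21] [0, 1, 2, 8, 9, 10] m m') : Kept I mode m' :=
  ⟨h.inst.congr (ha.nat 0 (by simp)) (ha.num 0 (by simp)) (ha.num 1 (by simp)) (ha.num 2 (by simp)),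
    h.best.congr (ha.sub (by simp) (by simp))⟩

/-- The best schedule in `m'` is as good as the one in `m` and as the schedules with `P`. -/
structure Improves (I : Problem K) (mode : Mode) (P : Schedule K I.n → Prop) (m m' : Memory K) :
    Prop where
  kept : Kept I mode m'
  le : m'.num 10 0 ≤ m.num 10 0
  done : ∀ S, I.Feasible mode S → P S → m'.num 10 0 ≤ I.relCost S

theorem Improves.congr {P : Schedule K I.n → Prop} {m₁ m₂ : Memory K} (h : Improves I mode P m₁ m₂)
    (h10 : m₁.num 10 = m.num 10) : Improves I mode P m m₂ :=
  ⟨h.kept, by rw [← h10]; exact h.le, h.done⟩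

/-- If iteration `x` beats all schedules with `P x`, the loop beats all that satisfy some `P x`. The
best schedule is the only information passed between iterations. -/
theorem Tri.search {i n T T' : ℕ} {N : NExp} {body : Cmd} (P : ℕ → Schedule K I.n → Prop)
    (hn : N.eval m = n) (hi : body.wN i = false) (hNi : N.reads i = false)
    (hN : ∀ a, N.reads a = true → body.wN a = false) (hc : i ∉ [0, 18, 19, 20, 21])
    (hk : Kept I mode m)
    (hbody : ∀ x < n, ∀ m₁, Same (RejSched.forC i N body) m m₁ → m₁.nat i 0 = x → Kept I mode m₁ →
      Tri I.oracle body m₁ T (Improves I mode (P x) m₁))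
    (hT : (T + N.size + 12) * (n + 1) ≤ T') :
    Tri I.oracle (RejSched.forC i N body) m T' (Improves I mode (fun S => ∃ x < n, P x S) m) := by
  refine (Tri.forAll (T := T) (Kept I mode) (fun m m' => m'.num 10 0 ≤ m.num 10 0)
    (fun x m' => ∀ S, I.Feasible mode S → P x S → m'.num 10 0 ≤ I.relCost S) hn hi hNi hN
    (fun m v h => h.congr (Agree.writeNat m 0 v hc)) (fun m v => le_rfl)
    (fun _ _ _ h h' => h'.trans h) (fun x m₁ m₂ h h' S hS hP => h.trans (h' S hS hP)) hk
    (fun x hx m₁ hs h1 h2 _ => (hbody x hx m₁ hs h1 h2).mono le_rfl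
      (fun m₂ _ h => ⟨h.kept, h.le, h.done⟩)) hT).mono le_rfl ?_
  rintro m' - ⟨h1, h2, h3⟩
  exact ⟨h1, h2, fun S hS ⟨x, hx, hP⟩ => h3 x hx S hS hP⟩

theorem numTypes_le (I : Problem K) (col : ℕ → ℕ) (q x : ℕ) : numTypes I col q x ≤ I.numProcTimes :=
  Finset.card_le_card (Finset.image_subset_image (Finset.filter_subset _ _))

theorem rangeY_mono {q k k' : ℕ} (h : k ≤ k') : rangeY q k ≤ rangeY q k' :=
  Nat.mul_le_mul le_rfl (Nat.mul_le_mul le_rfl (Nat.pow_le_pow_right (by omega) h))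

theorem runC_improves (hA : I.Admissible) (hn : 0 < I.n) {q k : ℕ} (hI : Kept I mode m)
    (h4 : m.nat 4 0 = q) (hq : 0 < q) (hqs : q ≤ I.s) (hk : numTypes I (m.nat 6) q I.n ≤ k) :
    Tri I.oracle (runC mode) m (4000000 * (I.n ^ 3 * rangeY q k ^ 7)) (Improves I mode (fun S =>
      S.scheduled.card = q ∧ (∀ j ∈ S.scheduled, m.nat 6 j < q) ∧
        Set.InjOn (fun j : Fin I.n => m.nat 6 j) S.scheduled) m) := by
  refine (runC_spec hA hn hI.inst h4 hqs hI.best).mono (Nat.mul_le_mul le_rfl (Nat.mul_le_mul le_rfl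
    (Nat.pow_le_pow_left (rangeY_mono hk) 7))) ?_
  rintro m' hs ⟨h1, h2, h3⟩
  refine ⟨⟨hI.inst.congr ?_ ?_ ?_ ?_, h1⟩, h2, fun S hS hP => h3 S hS hq hP.1 hP.2.1 hP.2.2⟩
  · exact hs.nat 0 (by cases mode <;> rfl)
  · exact hs.num 0 (by cases mode <;> rfl)
  · exact hs.num 1 (by cases mode <;> rfl)
  · exact hs.num 2 (by cases mode <;> rfl)

/-- The common bound for the parameters of the enumeration. -/
def enumBound (q : ℕ) : ℕ := 2 ^ (17 * q)

/-- The modulus `p` is at most `4 * q * q` and there are at most `Nat.log 2 q + 1` levels. So `p ^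
l` is `2` to a power of order `(log q) ^ 2`, which is below `2 ^ (16 * q)`; the sets of active
colors contribute `2 ^ (8 * q)`. -/
theorem enum_bounds {q p l : ℕ} (hq : 2 ≤ q) (hp : p ≤ 2 * (q * q + q * q))
    (hl : ∀ j < l, 0 < q / 2 ^ j) (hl' : l ≤ q + 1) :
    p + 2 ≤ enumBound q ∧ l + 2 ≤ enumBound q ∧ 8 * q + 2 ≤ enumBound q ∧
      p ^ l + 2 ≤ enumBound q ∧ 2 ^ (8 * q) + 2 ≤ enumBound q := by
  have h1 : q + 1 ≤ 2 ^ q := Nat.lt_two_pow_self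
  have hstep : ∀ x y, x ≤ 2 ^ y → 2 ≤ y → y < 17 * q → x + 2 ≤ enumBound q := by
    intro x y hx hy hyq
    have h2 : 2 ^ (y + 1) ≤ enumBound q := Nat.pow_le_pow_right (by omega) hyq
    have h3 : 2 ^ 2 ≤ 2 ^ y := Nat.pow_le_pow_right (by omega) hy
    rw [pow_succ] at h2
    omega
  have hp2 : p ≤ 2 ^ (2 * q + 2) := by
    have : q * q ≤ 2 ^ q * 2 ^ q := Nat.mul_le_mul (by omega) (by omega)
    have h : 2 ^ (2 * q + 2) = 4 * (2 ^ q * 2 ^ q) := by ring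
    omega
  refine ⟨hstep _ _ hp2 (by omega) (by omega), hstep _ q (by omega) (by omega) (by omega),
    hstep _ (q + 3) ?_ (by omega) (by omega), hstep _ (16 * q) ?_ (by omega) (by omega),
    hstep _ (8 * q) le_rfl (by omega) (by omega)⟩
  · rw [pow_add]; omega
  · rcases l with _ | l
    · simpa using Nat.one_le_two_pow
    · have h2 : 2 ^ l ≤ q := by
        have := hl l (by omega)
        by_contra h
        rw [Nat.div_eq_of_lt (by omega)] at this
        omega
      have hpp : p ≤ 2 ^ (2 * Nat.log 2 q + 4) := by
        have h3 := Nat.lt_pow_succ_log_self (b := 2) (by omega) q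
        have : q * q ≤ 2 ^ (Nat.log 2 q + 1) * 2 ^ (Nat.log 2 q + 1) :=
          Nat.mul_le_mul h3.le h3.le
        have h : 2 ^ (2 * Nat.log 2 q + 4) =
          4 * (2 ^ (Nat.log 2 q + 1) * 2 ^ (Nat.log 2 q + 1)) := by ring
        omega
      have hll : l ≤ Nat.log 2 q := Nat.le_log_of_pow_le (by omega) h2
      calc p ^ (l + 1) ≤ (2 ^ (2 * Nat.log 2 q + 4)) ^ (l + 1) := Nat.pow_le_pow_left hpp _
        _ = 2 ^ ((2 * Nat.log 2 q + 4) * (l + 1)) := by rw [← pow_mul]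
        _ ≤ 2 ^ (16 * q) := Nat.pow_le_pow_right (by omega) ?_
      -- For `x = Nat.log 2 q`, the square of the logarithm is absorbed by `2 ^ x ≤ q`.
      have h5 : ∀ x : ℕ, (2 * x + 4) * (x + 1) ≤ 16 * 2 ^ x := by
        intro x
        induction x with
        | zero => norm_num
        | succ x ih =>
          have hx : x + 1 ≤ 2 ^ x := Nat.lt_two_pow_self
          rw [pow_succ]
          have e : (2 * (x + 1) + 4) * (x + 1 + 1) = (2 * x + 4) * (x + 1) + (4 * x + 8) := by ring
          omega
      calc (2 * Nat.log 2 q + 4) * (l + 1) ≤ (2 * Nat.log 2 q + 4) * (Nat.log 2 q + 1) :=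
            Nat.mul_le_mul le_rfl (by omega)
        _ ≤ 16 * 2 ^ Nat.log 2 q := h5 _
        _ ≤ 16 * q := Nat.mul_le_mul le_rfl (Nat.pow_log_le_self 2 (by omega))

/-- The constants of the enumeration. -/
structure EnumInv (I : Problem K) (q p₀ p₁ : ℕ) (m : Memory K) : Prop where
  n_eq : m.nat 0 0 = I.n
  q_eq : m.nat 4 0 = q
  p0 : m.nat 81 0 = p₀
  m0 : m.nat 95 0 = q * q + q * q
  p1 : m.nat 96 0 = p₁
  lev : LevelInv q m
  g1 : m.nat 105 0 = p₁ ^ m.nat 98 0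
  n8 : m.nat 110 0 = 8 * q
  g2 : m.nat 109 0 = 2 ^ (8 * q)

theorem EnumInv.congr {q p₀ p₁ : ℕ} {m' : Memory K} (h : EnumInv I q p₀ p₁ m)
    (ha : Agree [0, 4, 81, 95, 96, 98, 103, 104, 105, 109, 110] [] m m') : EnumInv I q p₀ p₁ m' := by
  have e98 := ha.nat 98 (by simp)
  have e103 := ha.nat 103 (by simp)
  have e104 := ha.nat 104 (by simp)
  refine ⟨?_, ?_, ?_, ?_, ?_, ⟨?_, ?_, ?_, ?_, ?_⟩, ?_, ?_, ?_⟩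
  · rw [ha.nat 0 (by simp), h.n_eq]
  · rw [ha.nat 4 (by simp), h.q_eq]
  · rw [ha.nat 81 (by simp), h.p0]
  · rw [ha.nat 95 (by simp), h.m0]
  · rw [ha.nat 96 (by simp), h.p1]
  · rw [e98]; exact h.lev.pos
  · rw [e98]; exact h.lev.zero
  · rw [e98]; exact h.lev.le
  · rw [e103]; exact h.lev.buck
  · rw [e104]; exact h.lev.off
  · rw [ha.nat 105 (by simp), e98, h.g1]
  · rw [ha.nat 110 (by simp), h.n8]
  · rw [ha.nat 109 (by simp), h.g2]

/-- The schedule gets different colors from the coloring with the given parameters. -/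
def Colors (I : Problem K) (q p₀ p₁ l a g₁ g₂ : ℕ) (S : Schedule K I.n) : Prop :=
  let f : ℕ → ℕ := fun j => peelColor q p₁ (fun i => g₁ / p₁ ^ i % p₁) (fun c => g₂ / 2 ^ c % 2 = 1) l
    (hash a p₀ (q * q + q * q) j)
  S.scheduled.card = q ∧ (∀ j ∈ S.scheduled, f j < q) ∧
    Set.InjOn (fun j : Fin I.n => f j) S.scheduled

/-- Two injective maps are composed: the first reduces the scheduled jobs to `2 * q * q` values, the
second separates these values by `q` colors. After the reduction everything but `a` has a range that
depends on `q` only. -/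
theorem exists_colors {q p₀ p₁ l : ℕ} (hp₀ : p₀.Prime) (hp₁ : p₁.Prime) (hn : I.n ≤ p₀)
    (hm : q * q + q * q ≤ p₁) (hq : 0 < q) (hpos : ∀ j < l, 0 < q / 2 ^ j) (hz : q / 2 ^ l = 0)
    {S : Schedule K I.n} (hS : S.scheduled.card = q) :
    ∃ a < p₀, ∃ g₁ < p₁ ^ l, ∃ g₂ < 2 ^ (8 * q), Colors I q p₀ p₁ l a g₁ g₂ S := by
  have hqq : 0 < q * q := Nat.mul_pos hq hq
  set X : Finset ℕ := S.scheduled.image (fun j : Fin I.n => (j : ℕ)) with hX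
  have hXc : X.card = q := by
    rw [hX, Finset.card_image_of_injective _ Fin.val_injective, hS]
  have hmem : ∀ j ∈ S.scheduled, (j : ℕ) ∈ X := fun j hj => Finset.mem_image_of_mem _ hj
  obtain ⟨a, ha, hinj⟩ := exists_injOn_hash hp₀ (m := q * q + q * q) X (by
    intro x hx
    obtain ⟨j, -, rfl⟩ := Finset.mem_image.mp hx
    have := j.2; omega) (by rw [hXc]; omega) (by omega)
  set Z : Finset ℕ := X.image (hash a p₀ (q * q + q * q)) with hZ
  have hZc : Z.card = q := by rw [hZ, Finset.card_image_of_injOn hinj, hXc]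
  obtain ⟨b, A, hb, hA, hlt, hinj'⟩ := exists_peelColor hp₁ Z (by
    intro x hx
    obtain ⟨j, -, rfl⟩ := Finset.mem_image.mp hx
    exact (Nat.mod_lt _ (by omega)).trans_le hm) hZc.le l hpos hz
  obtain ⟨g₁, hg₁, h₁⟩ := exists_digits l b hb
  -- `g₁` lists the multipliers in base `p₁`; `g₂` is the characteristic bit string of the active
  -- colors.
  obtain ⟨g₂, hg₂, h₂⟩ := exists_digits (B := 2) (8 * q) (fun c => if c ∈ A then 1 else 0)
    (fun c => by split_ifs <;> omega)
  have hpeel : ∀ z, peelColor q p₁ (fun i => g₁ / p₁ ^ i % p₁) (fun c => g₂ / 2 ^ c % 2 = 1) l z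
      = peelColor q p₁ b (· ∈ A) l z := by
    intro z
    refine peelColor_congr z hpos h₁ (fun c hc => ?_)
    rw [h₂ c hc]; split_ifs with h <;> simp [h]
  refine ⟨a, ha, g₁, hg₁, g₂, hg₂, hS, ?_, ?_⟩
  · intro j hj
    exact (hpeel _).trans_lt (hlt _ (Finset.mem_image_of_mem _ (hmem j hj)))
  · intro i hi j hj hij
    have := hinj' (Finset.mem_coe.mpr (Finset.mem_image_of_mem _ (hmem i hi)))
      (Finset.mem_coe.mpr (Finset.mem_image_of_mem _ (hmem j hj)))
      ((hpeel _).symm.trans (Eq.trans hij (hpeel _)))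
    exact Fin.ext (hinj (hmem i hi) (hmem j hj) this)

end Search

end RejSched

/-! ### Enumeration of the colorings for a fixed number of jobs -/

namespace RejSched

section Enumeration

variable {K : Type} [CommRing K] [LinearOrder K] [IsStrictOrderedRing K]
variable {I : Problem K} {mode : Mode} {m : Memory K}

theorem rangeY_pos (q k : ℕ) : 0 < rangeY q k :=
  Nat.mul_pos (by omega) (Nat.mul_pos (by positivity) (by positivity))

theorem color_time_le {n Y W x y z v : ℕ} (hn : 0 < n) (hY : 0 < Y) (hx : x + 1 ≤ W) (hy : y + 2 ≤ W)
    (hz : z + 1 ≤ W) (hv : v + 1 ≤ W) :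
    200 * (x + 1) * (y + 2) + (60 * (y + 1) + (2000 * (z + 1) ^ 3 * (v + 1)
      + (30 * (n + 1) + 4000000 * (n ^ 3 * Y ^ 7)))) ≤ 5000000 * (n ^ 3 * Y ^ 7 * W ^ 4) := by
  have hW : 1 ≤ W := by omega
  have hX : 0 < n ^ 3 * Y ^ 7 := by positivity
  have h4 : W ^ 4 ≤ n ^ 3 * Y ^ 7 * W ^ 4 := Nat.le_mul_of_pos_left _ hX
  have e1 : 200 * (x + 1) * (y + 2) ≤ 200 * W ^ 4 := by
    calc 200 * (x + 1) * (y + 2) ≤ 200 * W * W := Nat.mul_le_mul (Nat.mul_le_mul le_rfl hx) hy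
      _ = 200 * W ^ 2 := by ring
      _ ≤ _ := Nat.mul_le_mul le_rfl (Nat.pow_le_pow_right hW (by omega))
  have e2 : 60 * (y + 1) ≤ 60 * W ^ 4 :=
    Nat.mul_le_mul le_rfl ((by omega : y + 1 ≤ W).trans (Nat.le_self_pow (by omega) W))
  have e3 : 2000 * (z + 1) ^ 3 * (v + 1) ≤ 2000 * W ^ 4 := by
    calc 2000 * (z + 1) ^ 3 * (v + 1) ≤ 2000 * W ^ 3 * W :=
          Nat.mul_le_mul (Nat.mul_le_mul le_rfl (Nat.pow_le_pow_left hz 3)) hv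
      _ = _ := by ring
  have e4 : n ^ 3 * Y ^ 7 ≤ n ^ 3 * Y ^ 7 * W ^ 4 := Nat.le_mul_of_pos_right _ (by positivity)
  have e5 : n ≤ n ^ 3 * Y ^ 7 :=
    (Nat.le_self_pow (by omega) n).trans (Nat.le_mul_of_pos_right _ (by positivity))
  omega

theorem colorC_spec (hA : I.Admissible) (hn : 0 < I.n) {q p₀ p₁ a g₁ g₂ W : ℕ} (hI : Kept I mode m)
    (hE : EnumInv I q p₀ p₁ m) (hq : 2 ≤ q) (hqs : q ≤ I.s) (hp₁ : 0 < p₁) (hm : q * q + q * q ≤ p₁)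
    (h113 : ∀ j < I.n, m.nat 113 j = hash a p₀ (q * q + q * q) j)
    (h125 : ∀ i < m.nat 98 0, m.nat 125 i = g₁ / p₁ ^ i % p₁) (h129 : m.nat 129 0 = g₂)
    (hg₂ : g₂ + 1 ≤ W) (hqW : 8 * q + 2 ≤ W) (hpW : p₁ + 1 ≤ W) (hlW : m.nat 98 0 + 1 ≤ W) :
    Tri I.oracle (colorC mode) m (5000000 * (I.n ^ 3 * rangeY q I.numProcTimes ^ 7 * W ^ 4))
      (Improves I mode (Colors I q p₀ p₁ (m.nat 98 0) a g₁ g₂) m) := by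
  set l := m.nat 98 0 with hl
  have htime := color_time_le hn (rangeY_pos q I.numProcTimes) hg₂ hqW hpW hlW
  refine Tri.seq (digitsC_spec (G := g₂) (B := 2) (n := 8 * q) (by simp only [NExp.eval, h129]) rfl
    (by simp only [NExp.eval, hE.n8]) (by decide) rfl rfl (by decide) (by omega)) ?_ htime
  intro m₁ hs₁ hd
  have a132 : ∀ c < 8 * q, m₁.nat 132 c = if g₂ / 2 ^ c % 2 = 1 then 1 else 0 := by
    intro c hc
    rw [hd c hc]
    split_ifs <;> omega
  refine Tri.seq (rankC_spec (N := 8 * q) (by rw [hs₁.nat 110 rfl, hE.n8]) a132) ?_ le_rfl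
  intro m₂ hs₂ h133
  have hag₂ : Agree [0, 4, 95, 96, 98, 103, 104, 113, 125, 18, 19, 20, 21, 81, 105, 109, 110]
      [0, 1, 2, 8, 9, 10] m m₂ :=
    (hs₁.agree (by decide) (by decide)).trans (hs₂.agree (by decide) (by decide))
  have hE₂ : EnumInv I q p₀ p₁ m₂ := hE.congr (hag₂.sub (by decide) (by decide))
  have b98 : m₂.nat 98 0 = l := by rw [hag₂.nat 98 (by simp)]
  refine Tri.seq ((peelC_spec (p := p₁) (a := fun i => g₁ / p₁ ^ i % p₁)
    (A := fun c => g₂ / 2 ^ c % 2 = 1) hE₂.q_eq hE₂.m0 hE₂.p1 hp₁ hm hE₂.lev ?_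
    (fun i _ => (Nat.mod_lt _ hp₁).le) ?_ (fun c hc => h133 c hc.le)).mono (by rw [b98])
    (fun _ _ h => h)) ?_ le_rfl
  · intro i hi
    rw [hag₂.nat 125 (by simp)]
    exact h125 i (by rw [← b98]; exact hi)
  · intro c hc
    rw [hs₂.nat 132 rfl, a132 c hc]
  intro m₃ hs₃ h139
  rw [b98] at h139
  have hag₃ := hag₂.trans (hs₃.agree (by decide) (by decide))
  refine Tri.seq (T₁ := 30 * (I.n + 1)) (Tri.tabulate (n := I.n) (T := 1) (fun j => peelColor q p₁
    (fun i => g₁ / p₁ ^ i % p₁) (fun c => g₂ / 2 ^ c % 2 = 1) l (hash a p₀ (q * q + q * q) j))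
    (by simp only [NExp.eval, hag₃.nat 0 (by simp), hE.n_eq]) rfl rfl (by decide) rfl rfl ?_ ?_ ?_)
    ?_ le_rfl
  · intro b hb
    simp [NExp.reads] at hb
    subst hb; rfl
  · intro j hj m₄ hs₄ h134
    refine Tri.line rfl (by decide) ?_
    have e113 : m₄.nat 113 = m.nat 113 := by rw [hs₄.nat 113 rfl, hag₃.nat 113 (by simp)]
    simp only [Cmd.exec, NExp.eval, h134, e113, h113 j hj, hs₄.nat 139 rfl]
    exact h139 _ (Nat.mod_lt _ (by have := Nat.mul_pos (show 0 < q by omega) (show 0 < q by omega)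
                                   omega))
  · simp only [NExp.size]
    exact Nat.mul_le_mul (by omega) le_rfl
  intro m₄ hs₄ h6
  have hag₄ := hag₃.trans (hs₄.agree (by decide) (by decide))
  have h10 : m₄.num 10 = m.num 10 := hag₄.num 10 (by simp)
  refine (runC_improves hA hn (hI.congr (hag₄.sub (by decide) (by decide)))
    (by rw [hag₄.nat 4 (by simp), hE.q_eq]) (by omega) hqs (numTypes_le I _ _ _)).mono le_rfl ?_
  intro m₅ hs₅ h
  refine ⟨h.kept, by rw [← h10]; exact h.le, fun S hS hP => h.done S hS ⟨hP.1, ?_, ?_⟩⟩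
  · intro j hj
    rw [h6 j j.2]; exact hP.2.1 j hj
  · intro i hi j hj hij
    dsimp only at hij
    rw [h6 i i.2, h6 j j.2] at hij
    exact hP.2.2 hi hj hij

/-- The two inner loops multiply the time by `W` each, and the loop over the first multiplier by a
multiple of `n`, as `t ≤ 2 * n`. The tabulation of the first hash function, cubic in `n`, is
absorbed by `X`. -/
theorem enum_time_le {n X W t G l x : ℕ} (hn : 0 < n) (hX : n ^ 3 ≤ X) (ht : t ≤ 2 * n)
    (hG : G + 2 ≤ W) (hl : l + 2 ≤ W) (hx : x + 2 ≤ W) :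
    (5000000 * (X * W ^ 4) + 2 + 12) * (x + 1) ≤ 6000000 * (X * W ^ 5) ∧
    (200 * G * (l + 2) + 6000000 * (X * W ^ 5) + 2 + 12) * (G + 1) ≤ 7000000 * (X * W ^ 6) ∧
    (400 * (2 * n + 1) ^ 2 + 24) * (n + 1) ≤ 8000 * (X * W ^ 6) ∧
    (8000 * (X * W ^ 6) + 7000000 * (X * W ^ 6) + 2 + 12) * (t + 1) ≤ 24000000 * (n * X * W ^ 6) := by
  have hW : 1 ≤ W := by omega
  have hn3 : 0 < n ^ 3 := by positivity
  have hX0 : 0 < X := by omega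
  have e4 : 0 < X * W ^ 4 := by positivity
  have e5 : 0 < X * W ^ 5 := by positivity
  have e6 : 0 < X * W ^ 6 := by positivity
  refine ⟨?_, ?_, ?_, ?_⟩
  · calc _ ≤ (6000000 * (X * W ^ 4)) * W := Nat.mul_le_mul (by omega) (by omega)
      _ = _ := by ring
  · have h : 200 * G * (l + 2) ≤ 200 * (X * W ^ 5) := by
      calc 200 * G * (l + 2) ≤ 200 * W * W :=
            Nat.mul_le_mul (Nat.mul_le_mul le_rfl (by omega)) (by omega)
        _ = 200 * (1 * W ^ 2) := by ring
        _ ≤ _ := Nat.mul_le_mul le_rfl (Nat.mul_le_mul hX0 (Nat.pow_le_pow_right hW (by omega)))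
    calc _ ≤ (7000000 * (X * W ^ 5)) * W := Nat.mul_le_mul (by omega) (by omega)
      _ = _ := by ring
  · have h1 : 1 ≤ n ^ 2 := Nat.one_le_pow _ _ hn
    have h2 : (2 * n + 1) ^ 2 ≤ 9 * n ^ 2 := by
      calc (2 * n + 1) ^ 2 ≤ (3 * n) ^ 2 := Nat.pow_le_pow_left (by omega) 2
        _ = _ := by ring
    calc _ ≤ (4000 * n ^ 2) * (2 * n) := Nat.mul_le_mul (by omega) (by omega)
      _ = 8000 * (n ^ 3 * 1) := by ring
      _ ≤ _ := Nat.mul_le_mul le_rfl (Nat.mul_le_mul hX (Nat.one_le_pow _ _ hW))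
  · calc _ ≤ (8000000 * (X * W ^ 6)) * (3 * n) := Nat.mul_le_mul (by omega) (by omega)
      _ = _ := by ring

/-- Three nested searches over the parameters of `Colors`, with a run of the dynamic program inside.
Each separates some of the schedules with `q` jobs; `exists_colors` says that none is missed. -/
theorem hashedC_spec (hA : I.Admissible) (hn : 0 < I.n) {q p₀ : ℕ} (hI : Kept I mode m)
    (hq : 2 ≤ q) (hqs : q ≤ I.s) (h4 : m.nat 4 0 = q) (h81 : m.nat 81 0 = p₀) (hp₀ : p₀.Prime)
    (hp₀n : I.n ≤ p₀) (hp₀n' : p₀ ≤ 2 * I.n) :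
    Tri I.oracle (hashedC mode) m
      (25000000 * (I.n * (I.n ^ 3 * rangeY q I.numProcTimes ^ 7) * enumBound q ^ 6))
      (Improves I mode (fun S => S.scheduled.card = q) m) := by
  set M := q * q + q * q with hM
  have hqq : 0 < q * q := Nat.mul_pos (by omega) (by omega)
  set W := enumBound q with hW
  set X := I.n ^ 3 * rangeY q I.numProcTimes ^ 7 with hX
  have hnX : I.n ^ 3 ≤ X := Nat.le_mul_of_pos_right _ (pow_pos (rangeY_pos _ _) _)
  have hn3 : 0 < I.n ^ 3 := by positivity
  obtain ⟨b1, -, b3, -, -⟩ := enum_bounds (p := 2 * M) (l := 0) hq le_rfl (by simp) (by omega)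
  rw [← hW] at b1 b3
  have hW3 : W ≤ W ^ 3 := Nat.le_self_pow (by omega) W
  have hM3 : (M + 1) ^ 3 ≤ W ^ 3 := Nat.pow_le_pow_left (by omega) 3
  have hq3 : (q + 2) ^ 2 ≤ W ^ 3 :=
    (Nat.pow_le_pow_left (by omega) 2).trans (Nat.pow_le_pow_right (by omega) (by omega))
  have hW6 : W ^ 3 ≤ I.n * X * W ^ 6 :=
    (Nat.pow_le_pow_right (by omega) (by omega)).trans
      (Nat.le_mul_of_pos_left _ (Nat.mul_pos hn (by omega)))
  set D := 24000000 * (I.n * X * W ^ 6) with hD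
  have hsplit : 25000000 * (I.n * X * W ^ 6) = D + 1000000 * (I.n * X * W ^ 6) := by rw [hD]; ring
  refine Tri.seq (T₁ := 30 * (q + 1)) (T₂ := D + 3900 * W ^ 3) ((mulC_spec (by decide) rfl rfl rfl rfl
    le_rfl).mono ?_ (fun _ _ h => h)) ?_ (by omega)
  · simp only [NExp.eval, NExp.size, h4]; exact Nat.mul_le_mul (by omega) le_rfl
  intro m₁ hs₁ h93
  simp only [NExp.eval, h4] at h93
  refine Tri.step rfl (T₂ := D + 3800 * W ^ 3) ?_ (by
    have : (setR 95 (rd 93 +ₙ rd 93)).cost ≤ 10 := by decide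
    omega)
  intro m₂ hs₂ he₂
  have a95 : m₂.nat 95 0 = M := by rw [he₂]; simp [Cmd.exec, NExp.eval, writeNat_nat, h93, hM]
  refine Tri.step rfl (T₂ := D + 3700 * W ^ 3) ?_ (by
    have : (setR 82 (rd 95)).cost ≤ 10 := by decide
    omega)
  intro m₃ hs₃ he₃
  have a82 : m₃.nat 82 0 = M := by rw [he₃]; simp [Cmd.exec, NExp.eval, writeNat_nat, a95]
  refine Tri.seq (T₂ := D + 1700 * W ^ 3) (primeC_spec a82 (by omega)) ?_ (by omega)
  rintro m₄ hs₄ ⟨hp, hMp, hpM⟩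
  set p₁ := m₄.nat 89 0 with hp₁
  refine Tri.step rfl (T₂ := D + 1600 * W ^ 3) ?_ (by
    have : (setR 96 (rd 89)).cost ≤ 10 := by decide
    omega)
  intro m₅ hs₅ he₅
  have a96 : m₅.nat 96 0 = p₁ := by rw [he₅]; simp [Cmd.exec, NExp.eval, writeNat_nat, hp₁]
  have a4 : m₅.nat 4 0 = q := by
    rw [hs₅.nat 4 rfl, hs₄.nat 4 rfl, hs₃.nat 4 rfl, hs₂.nat 4 rfl, hs₁.nat 4 rfl, h4]
  refine Tri.seq (T₂ := D + 1400 * W ^ 3) (levelsC_spec a4) ?_ (by omega)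
  intro m₆ hs₆ hL
  set l := m₆.nat 98 0 with hl
  obtain ⟨c1, c2, -, c4, c5⟩ := enum_bounds (p := p₁) (l := l) hq (by omega) hL.pos hL.le
  rw [← hW] at c1 c2 c4 c5
  have hpl : (p₁ + 1) * (l + 2) ≤ W ^ 3 := by
    calc (p₁ + 1) * (l + 2) ≤ W * W := Nat.mul_le_mul (by omega) c2
      _ = W ^ 2 := by ring
      _ ≤ _ := Nat.pow_le_pow_right (by omega) (by omega)
  have b96 : m₆.nat 96 0 = p₁ := by rw [hs₆.nat 96 rfl, a96]
  refine Tri.seq (T₁ := 100 * (p₁ + 1) * (l + 2)) (T₂ := D + 1300 * W ^ 3) (powC_spec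
    (by simp only [NExp.eval, b96]) hl.symm (by decide) rfl rfl (by decide))
    ?_ (by rw [mul_assoc]; omega)
  intro m₇ hs₇ h105
  refine Tri.seq (T₁ := 300) (T₂ := D + 900 * W ^ 3) ((mulC_spec (by decide) rfl rfl rfl rfl
    le_rfl).mono (by simp [NExp.eval, NExp.size]) (fun _ _ h => h)) ?_ (by omega)
  intro m₈ hs₈ h110
  simp only [NExp.eval, hs₇.nat 4 rfl, hs₆.nat 4 rfl, a4] at h110
  refine Tri.seq (T₁ := 100 * (2 + 1) * (8 * q + 2)) (T₂ := D) (powC_spec (X := 2) (n := 8 * q)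
    rfl (by simp only [NExp.eval, h110]) (by decide) rfl rfl (by decide)) ?_ (by omega)
  intro m₉ hs₉ h109
  have hE : EnumInv I q p₀ p₁ m₉ := by
    have e98 : m₉.nat 98 0 = l := by rw [hs₉.nat 98 rfl, hs₈.nat 98 rfl, hs₇.nat 98 rfl]
    refine ⟨?_, ?_, ?_, ?_, ?_, ⟨?_, ?_, ?_, ?_, ?_⟩, ?_, ?_, h109⟩
    · rw [hs₉.nat 0 rfl, hs₈.nat 0 rfl, hs₇.nat 0 rfl, hs₆.nat 0 rfl, hs₅.nat 0 rfl, hs₄.nat 0 rfl,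
        hs₃.nat 0 rfl, hs₂.nat 0 rfl, hs₁.nat 0 rfl, hI.inst.n_eq]
    · rw [hs₉.nat 4 rfl, hs₈.nat 4 rfl, hs₇.nat 4 rfl, hs₆.nat 4 rfl, a4]
    · rw [hs₉.nat 81 rfl, hs₈.nat 81 rfl, hs₇.nat 81 rfl, hs₆.nat 81 rfl, hs₅.nat 81 rfl,
        hs₄.nat 81 rfl, hs₃.nat 81 rfl, hs₂.nat 81 rfl, hs₁.nat 81 rfl, h81]
    · rw [hs₉.nat 95 rfl, hs₈.nat 95 rfl, hs₇.nat 95 rfl, hs₆.nat 95 rfl, hs₅.nat 95 rfl,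
        hs₄.nat 95 rfl, hs₃.nat 95 rfl, a95]
    · rw [hs₉.nat 96 rfl, hs₈.nat 96 rfl, hs₇.nat 96 rfl, b96]
    · rw [e98]; exact hL.pos
    · rw [e98]; exact hL.zero
    · rw [e98]; exact hL.le
    · rw [hs₉.nat 103 rfl, hs₈.nat 103 rfl, hs₇.nat 103 rfl]; exact hL.buck
    · rw [hs₉.nat 104 rfl, hs₈.nat 104 rfl, hs₇.nat 104 rfl]; exact hL.off
    · rw [hs₉.nat 105 rfl, hs₈.nat 105 rfl, h105, e98]
    · rw [hs₉.nat 110 rfl, h110]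
  have e98 : m₉.nat 98 0 = l := by rw [hs₉.nat 98 rfl, hs₈.nat 98 rfl, hs₇.nat 98 rfl]
  have hag : Agree [0, 18, 19, 20, 21] [0, 1, 2, 8, 9, 10] m m₉ :=
    (hs₁.agree (by decide) (by decide)).trans <| (hs₂.agree (by decide) (by decide)).trans <|
    (hs₃.agree (by decide) (by decide)).trans <| (hs₄.agree (by decide) (by decide)).trans <|
    (hs₅.agree (by decide) (by decide)).trans <| (hs₆.agree (by decide) (by decide)).trans <|
    (hs₇.agree (by decide) (by decide)).trans <| (hs₈.agree (by decide) (by decide)).trans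
      (hs₉.agree (by decide) (by decide))
  -- Time budgets from the inside out: `t1` for active sets, `t2` for the multipliers of the levels,
  -- `t3` for the first hash values, `t4` for the loop over `a`.
  obtain ⟨t1, t2, t3, t4⟩ := enum_time_le (G := p₁ ^ l) (x := 2 ^ (8 * q)) hn hnX hp₀n' c4 c2 c5
  refine (Tri.search (n := p₀) (T := 8000 * (X * W ^ 6) + 7000000 * (X * W ^ 6))
    (fun a S => ∃ g₁ < p₁ ^ l, ∃ g₂ < 2 ^ (8 * q), Colors I q p₀ p₁ l a g₁ g₂ S)
    (by simp only [NExp.eval, hE.p0]) (by cases mode <;> rfl) rfl ?_ (by decide)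
    (hI.congr hag) ?_ t4).mono le_rfl ?_
  · intro b hb
    simp [NExp.reads] at hb
    subst hb; cases mode <;> rfl
  rotate_left
  · rintro m' - h
    refine (Improves.congr ⟨h.kept, h.le, fun S hS hP => h.done S hS ?_⟩ (hag.num 10 (by simp)))
    exact exists_colors hp₀ hp hp₀n hMp (by omega) hL.pos hL.zero hP
  intro a ha u₁ hu₁ h111 hk₁
  have hE₁ : EnumInv I q p₀ p₁ u₁ := hE.congr (hu₁.agree (by cases mode <;> decide) (by simp))
  have f98 : u₁.nat 98 0 = l := by rw [hu₁.nat 98 (by cases mode <;> rfl), e98]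
  refine Tri.seq (T₁ := 8000 * (X * W ^ 6)) (T₂ := 7000000 * (X * W ^ 6)) (Tri.tabulate (n := I.n)
    (T := 400 * (2 * I.n + 1) ^ 2) (fun j => hash a p₀ M j) (by simp only [NExp.eval, hE₁.n_eq])
    rfl rfl (by decide) rfl rfl ?_ ?_ ?_) ?_ le_rfl
  · intro b hb
    simp [NExp.reads] at hb
    subst hb; rfl
  · intro j hj u₂ hu₂ h112
    refine (hashC_spec (A := a) (P := p₀) (Q := M) (Z := j) (b := 2 * I.n) ?_ ?_ ?_ ?_ rfl rfl rfl rfl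
      (by decide) hp₀.pos (by omega) (by omega) hp₀n' (by omega)).mono le_rfl (fun _ _ h => h)
    · simp only [NExp.eval, hu₂.nat 111 rfl, h111]
    · simp only [NExp.eval, hu₂.nat 81 rfl, hE₁.p0]
    · simp only [NExp.eval, hu₂.nat 95 rfl, hE₁.m0]; rfl
    · simp only [NExp.eval, h112]
  · simp only [NExp.size]
    exact (Nat.mul_le_mul (by omega) le_rfl).trans t3
  intro u₂ hu₂ h113
  have hag₂ : Agree [0, 4, 81, 95, 96, 98, 103, 104, 105, 109, 110, 18, 19, 20, 21, 111]
      [0, 1, 2, 8, 9, 10] u₁ u₂ := hu₂.agree (by decide) (by decide)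
  have hE₂ : EnumInv I q p₀ p₁ u₂ := hE₁.congr (hag₂.sub (by decide) (by simp))
  have g98 : u₂.nat 98 0 = l := by rw [hag₂.nat 98 (by simp), f98]
  have h10 : u₂.num 10 = u₁.num 10 := hag₂.num 10 (by simp)
  refine (Tri.search (n := p₁ ^ l) (T := 200 * p₁ ^ l * (l + 2) + 6000000 * (X * W ^ 5))
    (fun g₁ S => ∃ g₂ < 2 ^ (8 * q), Colors I q p₀ p₁ l a g₁ g₂ S)
    (by simp only [NExp.eval, hE₂.g1, g98]) (by cases mode <;> rfl) rfl ?_ (by decide)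
    (hk₁.congr (hag₂.sub (by decide) (by decide))) ?_ t2).mono le_rfl (fun _ _ h => h.congr h10)
  · intro b hb
    simp [NExp.reads] at hb
    subst hb; cases mode <;> rfl
  intro g₁ hg₁ u₃ hu₃ h122 hk₃
  have hE₃ : EnumInv I q p₀ p₁ u₃ := hE₂.congr (hu₃.agree (by cases mode <;> decide) (by simp))
  have i98 : u₃.nat 98 0 = l := by rw [hu₃.nat 98 (by cases mode <;> rfl), g98]
  have i113 : u₃.nat 113 = u₂.nat 113 := hu₃.nat 113 (by cases mode <;> rfl)
  refine Tri.seq (T₁ := 200 * p₁ ^ l * (l + 2)) (T₂ := 6000000 * (X * W ^ 5)) ((digitsC_spec (G := g₁)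
    (B := p₁) (n := l) (by simp only [NExp.eval, h122]) (by simp only [NExp.eval, hE₃.p1])
    (by simp only [NExp.eval, i98]) (by decide) rfl rfl (by decide) hp.pos).mono
    (Nat.mul_le_mul (Nat.mul_le_mul le_rfl hg₁) le_rfl) (fun _ _ h => h)) ?_ le_rfl
  intro u₄ hu₄ h125
  have hag₄ : Agree [0, 4, 81, 95, 96, 98, 103, 104, 105, 109, 110, 18, 19, 20, 21, 113]
      [0, 1, 2, 8, 9, 10] u₃ u₄ := hu₄.agree (by decide) (by decide)
  have hE₄ : EnumInv I q p₀ p₁ u₄ := hE₃.congr (hag₄.sub (by decide) (by simp))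
  have j98 : u₄.nat 98 0 = l := by rw [hag₄.nat 98 (by simp), i98]
  have j10 : u₄.num 10 = u₃.num 10 := hag₄.num 10 (by simp)
  refine (Tri.search (n := 2 ^ (8 * q)) (T := 5000000 * (X * W ^ 4))
    (fun g₂ S => Colors I q p₀ p₁ l a g₁ g₂ S)
    (by simp only [NExp.eval, hE₄.g2]) (by cases mode <;> rfl) rfl ?_ (by decide)
    (hk₃.congr (hag₄.sub (by decide) (by decide))) ?_ t1).mono le_rfl (fun _ _ h => h.congr j10)
  · intro b hb
    simp [NExp.reads] at hb
    subst hb; cases mode <;> rfl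
  intro g₂ hg₂ u₅ hu₅ h129 hk₅
  have hE₅ : EnumInv I q p₀ p₁ u₅ := hE₄.congr (hu₅.agree (by cases mode <;> decide) (by simp))
  have k98 : u₅.nat 98 0 = l := by rw [hu₅.nat 98 (by cases mode <;> rfl), j98]
  have h := colorC_spec (mode := mode) (a := a) (g₁ := g₁) (g₂ := g₂) (W := W) hA hn hk₅ hE₅ hq hqs
    hp.pos hMp
    (fun j hj => by rw [hu₅.nat 113 (by cases mode <;> rfl), hag₄.nat 113 (by simp), i113, h113 j hj])
    (fun i hi => by rw [hu₅.nat 125 (by cases mode <;> rfl), h125 i (by rw [← k98]; exact hi)])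
    h129 (by omega) b3 (by omega) (by rw [k98]; omega)
  rw [k98] at h
  exact h

end Enumeration

end RejSched

/-! ### Single jobs, the whole algorithm and its running time -/

namespace RejSched

section Main

variable {K : Type} [CommRing K] [LinearOrder K] [IsStrictOrderedRing K]
variable {I : Problem K} {mode : Mode} {m : Memory K} {w : ℕ → K → K}

/-- Coloring one job at a time makes all other jobs invisible to the dynamic program, so it sees a
single processing time. This avoids the factor `(q + 1) ^ k`, which `s ^ O(k)` does not dominate for
`s = 1`, and `n` runs cost `O(n ^ 4)`. -/
theorem singlesC_spec (hA : I.Admissible) (hn : 0 < I.n) (hs : 1 ≤ I.s) (hI : Kept I mode m) :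
    Tri I.oracle (singlesC mode) m (40000000000000 * I.n ^ 4)
      (Improves I mode (fun S => S.scheduled.card = 1) m) := by
  have hn4 : 0 < I.n ^ 4 := by positivity
  have hn3 : I.n ≤ I.n ^ 3 := Nat.le_self_pow (by omega) _
  refine Tri.step rfl (T₂ := 30000000000000 * I.n ^ 4) ?_ (by
    have : (setR 4 (.const 1)).cost ≤ 10 := by decide
    omega)
  intro m₁ hs₁ he₁
  have hk₁ : Kept I mode m₁ := hI.congr (hs₁.agree (by decide) (by decide))
  refine (Tri.search (n := I.n) (T := 10000000000000 * I.n ^ 3) (fun x S => S.scheduled.card = 1 ∧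
    ∀ j ∈ S.scheduled, (j : ℕ) = x) (by simp only [NExp.eval, hk₁.inst.n_eq]) (by cases mode <;> rfl)
    rfl ?_ (by decide) hk₁ ?_ ?_).mono le_rfl ?_
  · intro b hb
    simp [NExp.reads] at hb
    subst hb; cases mode <;> rfl
  · intro x hx m₂ hs₂ h90 hk₂
    have a4 : m₂.nat 4 0 = 1 := by
      rw [hs₂.nat 4 (by cases mode <;> rfl), he₁]; simp [Cmd.exec, NExp.eval, writeNat_nat]
    refine Tri.seq (T₁ := 30 * (I.n + 1)) (T₂ := 9000000000000 * I.n ^ 3) (Tri.tabulate (n := I.n)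
      (T := 1) (fun _ => 1) (by simp only [NExp.eval, hk₂.inst.n_eq]) rfl rfl (by decide) rfl rfl
      ?_ ?_ ?_) ?_ (by omega)
    · intro b hb
      simp [NExp.reads] at hb
      subst hb; rfl
    · intro j hj m₃ hs₃ h91
      exact Tri.line rfl (by decide) rfl
    · simp only [NExp.size]
      exact Nat.mul_le_mul (by omega) le_rfl
    intro m₃ hs₃ h6
    refine Tri.step rfl (T₂ := 4000000 * (I.n ^ 3 * rangeY 1 1 ^ 7)) ?_ (by
      have : (Cmd.setNat 6 (rd 90) (.const 0)).cost ≤ 10 := by decide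
      have : rangeY 1 1 ^ 7 = 2097152 := rfl
      rw [this]
      omega)
    intro m₄ hs₄ he₄
    have b6 : ∀ j < I.n, m₄.nat 6 j = if j = x then 0 else 1 := by
      intro j hj
      rw [he₄]
      simp only [Cmd.exec, NExp.eval, hs₃.nat 90 rfl, h90, writeNat_nat, true_and, h6 j hj]
    have hag : Agree [4, 0, 18, 19, 20, 21] [0, 1, 2, 8, 9, 10] m₂ m₄ :=
      (hs₃.agree (by decide) (by decide)).trans (hs₄.agree (by decide) (by decide))
    refine (runC_improves hA hn (k := 1) (hk₂.congr (hag.sub (by decide) (by decide)))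
      (by rw [hag.nat 4 (by simp), a4]) Nat.one_pos hs ?_).mono le_rfl ?_
    -- Only job `x` has a color below 1.
    · rw [numTypes]
      refine Finset.card_image_le.trans (Finset.card_le_one.mpr ?_)
      intro i hi j hj
      simp only [Finset.mem_filter, Finset.mem_univ, true_and] at hi hj
      rw [b6 i i.2] at hi
      rw [b6 j j.2] at hj
      have e1 : (i : ℕ) = x := by by_contra h; simp [h] at hi
      have e2 : (j : ℕ) = x := by by_contra h; simp [h] at hj
      exact Fin.ext (e1.trans e2.symm)
    · intro m₅ _ h
      have h10 : m₄.num 10 = m₂.num 10 := hag.num 10 (by simp)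
      refine ⟨h.kept, by rw [← h10]; exact h.le, fun S hS hP => h.done S hS ⟨hP.1, ?_, ?_⟩⟩
      · intro j hj
        rw [b6 j j.2, if_pos (hP.2 j hj)]; exact one_pos
      · intro i hi j hj _
        exact Fin.ext ((hP.2 i hi).trans (hP.2 j hj).symm)
  · simp only [NExp.size]
    calc _ ≤ (15000000000000 * I.n ^ 3) * (2 * I.n) := Nat.mul_le_mul (by omega) (by omega)
      _ = _ := by ring
  · intro m' _ h
    refine (Improves.congr ⟨h.kept, h.le, fun S hS hP => h.done S hS ?_⟩ (hs₁.num 10 rfl))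
    obtain ⟨j, hj⟩ := Finset.card_eq_one.mp hP
    refine ⟨j, j.2, hP, fun i hi => ?_⟩
    rw [hj, Finset.mem_singleton] at hi
    rw [hi]

theorem outputC_spec {L : Schedule K I.n} (h : Slice m (m.nat 20 0) L) (h21 : m.nat 21 0 = L.length) :
    Tri w outputC m (100 * (L.length + 1)) (fun m' => m'.Outputs L) := by
  refine Tri.step rfl (T₂ := 80 * (L.length + 1)) ?_ (by
    have : (Cmd.setNat 1 (.const 0) (rd 21)).cost ≤ 10 := by decide
    omega)
  intro m₁ hs₁ he₁
  have a21 : m₁.nat 21 0 = L.length := by rw [hs₁.nat 21 rfl, h21]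
  have a1 : m₁.nat 1 0 = L.length := by rw [he₁]; simp [Cmd.exec, NExp.eval, writeNat_nat, h21]
  refine Tri.forC (n := L.length) (T := 50) (fun t m' => ∀ (i : ℕ) (hi : i < L.length), i < t →
    m'.nat 2 i = L[i].job ∧ m'.num 3 i = L[i].start ∧ m'.num 4 i = L[i].finish)
    (by simp only [NExp.eval, a21]) rfl rfl ?_ ?_ ?_ ?_ ?_
  · intro a ha
    simp [NExp.reads] at ha
    subst ha; rfl
  · intro i hi h; omega
  · intro t ht m₂ hs₂ h136 hI
    refine Tri.line rfl (by decide) ?_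
    intro i hi hit
    have e19 : m₂.nat 19 = m.nat 19 := by rw [hs₂.nat 19 rfl, hs₁.nat 19 rfl]
    have e20 : m₂.nat 20 = m.nat 20 := by rw [hs₂.nat 20 rfl, hs₁.nat 20 rfl]
    have e8 : m₂.num 8 = m.num 8 := by rw [hs₂.num 8 rfl, hs₁.num 8 rfl]
    have e9 : m₂.num 9 = m.num 9 := by rw [hs₂.num 9 rfl, hs₁.num 9 rfl]
    rw [writeNat_nat_of_ne _ _ _ (by decide), writeNat_num]
    simp only [Cmd.exec, NExp.eval, KExp.eval, writeNum_nat, writeNat_num, writeNat_nat, writeNum_num,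
      h136, e19, e20, e8, e9]
    rcases Nat.lt_succ_iff_lt_or_eq.mp hit with hlt | rfl
    · have hne : i ≠ t := hlt.ne
      simpa [hne] using hI i hi hlt
    · have hc := h i hi
      simp only [cell, Piece.toCell, Prod.mk.injEq] at hc
      simpa using hc
  · simp only [NExp.size]
    exact Nat.mul_le_mul (by omega) le_rfl
  · intro m' hs' hI
    exact ⟨by rw [hs'.nat 1 rfl, a1], fun i hi => hI i hi hi⟩

theorem card_scheduled_le {S : Schedule K I.n} (hS : I.Feasible mode S) :
    S.scheduled.card ≤ I.n ∧ S.scheduled.card ≤ I.s := by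
  have h1 : S.scheduled.card ≤ I.n := by simpa using Finset.card_le_univ S.scheduled
  have h2 := hS.2.2.2.1
  rw [Schedule.rejected, Finset.card_sdiff_of_subset (Finset.subset_univ _), Finset.card_univ,
    Fintype.card_fin] at h2
  omega

/-- In the zero memory the best schedule is the empty one, of relative cost 0: rejecting everything
is the initial solution. -/
theorem kept_input (I : Problem K) (mode : Mode) : Kept I mode I.input := by
  refine ⟨⟨rfl, ?_, ?_, ?_⟩, [], ?_, rfl, le_rfl, ?_, ?_, Nat.zero_le _⟩
  · intro j; simp [Problem.input, toArray]
  · intro j; simp [Problem.input, toArray]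
  · intro j; simp [Problem.input, toArray]
  · intro i hi; simp at hi
  · refine ⟨by simp, by simp, by simp [Schedule.scheduled], ?_, by cases mode <;> simp⟩
    simp [Schedule.rejected, Schedule.scheduled]
  · rw [cost_eq]; simp [Schedule.scheduled, Problem.input]

/-- Time bound for the schedules with `q` jobs. -/
def hashedTime (n q k : ℕ) : ℕ := 25000000 * (n * (n ^ 3 * rangeY q k ^ 7) * enumBound q ^ 6)

theorem hashedTime_mono {n q q' k : ℕ} (h : q ≤ q') : hashedTime n q k ≤ hashedTime n q' k := by
  have h1 : rangeY q k ≤ rangeY q' k :=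
    Nat.mul_le_mul (by omega) (Nat.mul_le_mul (Nat.pow_le_pow_right (by omega) h)
      (Nat.pow_le_pow_left (by omega) k))
  have h2 : enumBound q ≤ enumBound q' := Nat.pow_le_pow_right (by omega) (by omega)
  exact Nat.mul_le_mul le_rfl (Nat.mul_le_mul (Nat.mul_le_mul le_rfl (Nat.mul_le_mul le_rfl
    (Nat.pow_le_pow_left h1 7))) (Nat.pow_le_pow_left h2 6))

/-- Time bound of the algorithm. -/
def mainTime (n s k : ℕ) : ℕ :=
  50000000000000 * n ^ 4 + ((if 2 ≤ s then hashedTime n s k else 0) + 50) * (s + 1)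
    + 100 * (2 ^ s + 1) + 100

/-- Schedules are classified by their number of jobs, which is at most `min I.s I.n`: zero is
covered by the initial solution, one by `singlesC`, and each larger number by one call of `hashedC`.
-/
theorem mainC_spec (hA : I.Admissible) :
    Tri I.oracle (mainC mode) I.input (mainTime I.n I.s I.numProcTimes)
      (fun m' => ∃ S : Schedule K I.n, m'.Outputs S ∧ I.IsOptimal mode S) := by
  set H := if 2 ≤ I.s then hashedTime I.n I.s I.numProcTimes else 0 with hH
  set T₁ := 50000000000000 * I.n ^ 4 + (H + 50) * (I.s + 1) + 20 with hT₁
  have hkept := kept_input I mode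
  have hT : mainTime I.n I.s I.numProcTimes = T₁ + 100 * (2 ^ I.s + 1) + 80 := by
    rw [mainTime, hT₁, ← hH]; ring
  refine Tri.step rfl (T₂ := T₁ + 100 * (2 ^ I.s + 1) + 70) ?_ (by
    have : (setR 80 (.read 0 (.const 1))).cost ≤ 10 := by decide
    omega)
  intro m₁ hs₁ he₁
  have a80 : m₁.nat 80 0 = I.s := by
    rw [he₁]; simp [Cmd.exec, NExp.eval, writeNat_nat, Problem.input]
  have a0 : m₁.nat 0 0 = I.n := by rw [hs₁.nat 0 rfl]; rfl
  refine Tri.seq (T₁ := 20) (T₂ := T₁ + 100 * (2 ^ I.s + 1) + 50) (Q' := fun m' =>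
    m'.nat 80 0 = min I.s I.n) (Tri.line rfl (by decide) ?_) ?_ (by omega)
  · simp only [Cmd.exec, Cond.Holds, NExp.eval, a0, a80]
    split_ifs with h
    · simp [writeNat_nat, h]
    · rw [a80]; omega
  intro m₂ hs₂ b80
  have hag₂ : Agree [0, 18, 19, 20, 21] [0, 1, 2, 8, 9, 10] I.input m₂ :=
    (hs₁.agree (by decide) (by decide)).trans (hs₂.agree (by decide) (by decide))
  have hk₂ : Kept I mode m₂ := hkept.congr hag₂
  have h10 : m₂.num 10 0 = 0 := by rw [hag₂.num 10 (by simp)]; rfl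
  refine Tri.seq (T₁ := T₁ + 10) (T₂ := 100 * (2 ^ I.s + 1)) (Q' := Improves I mode (fun _ => True) m₂)
    ?_ ?_ (by omega)
  · have hempty : ∀ S : Schedule K I.n, S.scheduled.card = 0 → I.relCost S = 0 := by
      intro S hS
      rw [Problem.relCost, Finset.card_eq_zero.mp hS, Finset.sum_empty]
    refine Tri.ite (T₁ := T₁) ?_ ?_ (by
      have : (Cond.natLe (.const 1) (rd 80)).size ≤ 5 := by decide
      omega)
    rotate_left
    · intro hc
      simp only [Cond.Holds, NExp.eval, b80] at hc
      refine Tri.line rfl (by simp only [Cmd.cost]; omega)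
        ⟨hk₂, le_rfl, fun S hS _ => ?_⟩
      have := card_scheduled_le hS
      rw [hempty S (by omega)]
      exact h10.le
    · intro hc
      simp only [Cond.Holds, NExp.eval, b80] at hc
      have hn : 0 < I.n := by omega
      have hn4 : 0 < I.n ^ 4 := by positivity
      refine Tri.seq (T₂ := T₁ - 40000000000000 * I.n ^ 4) (singlesC_spec hA hn (by omega) hk₂) ?_
        (by omega)
      intro m₃ hs₃ hi₃
      refine Tri.step rfl (T₂ := T₁ - 41000000000000 * I.n ^ 4) ?_ (by
        have : (setR 82 (rd 0)).cost ≤ 10 := by decide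
        omega)
      intro m₄ hs₄ he₄
      have c82 : m₄.nat 82 0 = I.n := by
        rw [he₄]; simp [Cmd.exec, NExp.eval, writeNat_nat, hi₃.kept.inst.n_eq]
      have hn3 : 2000 * (I.n + 1) ^ 3 ≤ 16000 * I.n ^ 4 := by
        calc 2000 * (I.n + 1) ^ 3 ≤ 2000 * (2 * I.n) ^ 3 :=
              Nat.mul_le_mul le_rfl (Nat.pow_le_pow_left (by omega) 3)
          _ = 16000 * I.n ^ 3 := by ring
          _ ≤ _ := Nat.mul_le_mul le_rfl (Nat.pow_le_pow_right hn (by omega))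
      refine Tri.seq (T₂ := T₁ - 42000000000000 * I.n ^ 4) (primeC_spec c82 hn) ?_ (by omega)
      rintro m₅ hs₅ ⟨hp, hp1, hp2⟩
      set p₀ := m₅.nat 89 0 with hp₀
      refine Tri.step rfl (T₂ := T₁ - 43000000000000 * I.n ^ 4) ?_ (by
        have : (setR 81 (rd 89)).cost ≤ 10 := by decide
        omega)
      intro m₆ hs₆ he₆
      have d81 : m₆.nat 81 0 = p₀ := by rw [he₆]; simp [Cmd.exec, NExp.eval, writeNat_nat, hp₀]
      have d80 : m₆.nat 80 0 = min I.s I.n := by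
        rw [hs₆.nat 80 rfl, hs₅.nat 80 rfl, hs₄.nat 80 rfl, hs₃.nat 80 (by cases mode <;> rfl), b80]
      have hag₆ : Agree [0, 18, 19, 20, 21] [0, 1, 2, 8, 9, 10] m₃ m₆ :=
        (hs₄.agree (by decide) (by decide)).trans <| (hs₅.agree (by decide) (by decide)).trans
          (hs₆.agree (by decide) (by decide))
      have e10 : m₆.num 10 = m₃.num 10 := hag₆.num 10 (by simp)
      refine (Tri.search (n := min I.s I.n - 1) (T := H + 15) (fun x S => S.scheduled.card = x + 2)
        (by simp only [NExp.eval, d80]) (by cases mode <;> rfl) rfl ?_ (by decide)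
        (hi₃.kept.congr hag₆) ?_ ?_).mono le_rfl ?_
      · intro b hb
        simp [NExp.reads] at hb
        subst hb; cases mode <;> rfl
      · intro x hx m₇ hs₇ h92 hk₇
        have hle : hashedTime I.n (x + 2) I.numProcTimes ≤ H := by
          rw [hH, if_pos (by omega)]; exact hashedTime_mono (by omega)
        refine Tri.step rfl (T₂ := H) ?_ (by
          have : (setR 4 (rd 92 +ₙ .const 2)).cost ≤ 15 := by decide
          omega)
        intro m₈ hs₈ he₈
        have f4 : m₈.nat 4 0 = x + 2 := by rw [he₈]; simp [Cmd.exec, NExp.eval, writeNat_nat, h92]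
        have f81 : m₈.nat 81 0 = p₀ := by
          rw [hs₈.nat 81 rfl, hs₇.nat 81 (by cases mode <;> rfl), d81]
        refine (hashedC_spec hA hn (hk₇.congr (hs₈.agree (by decide) (by decide))) (by omega) (by omega)
          f4 f81 hp hp1 hp2).mono hle (fun _ _ h => h.congr (hs₈.num 10 rfl))
      · simp only [NExp.size]
        calc _ ≤ (H + 50) * (I.s + 1) := Nat.mul_le_mul (by omega) (by omega)
          _ ≤ _ := by omega
      · intro m₇ _ h
        refine ⟨h.kept, h.le.trans ?_, fun S hS _ => ?_⟩
        · rw [e10]; exact hi₃.le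
        · have hcard := card_scheduled_le hS
          -- The best cost never increases, so comparisons made by earlier phases remain valid at
          -- the end.
          rcases Nat.lt_or_ge S.scheduled.card 2 with hlt | hge
          · refine h.le.trans ?_
            rw [e10]
            rcases Nat.lt_or_ge S.scheduled.card 1 with h0 | h1
            · rw [hempty S (by omega), ← h10]; exact hi₃.le
            · exact hi₃.done S hS (by omega)
          · exact h.done S hS ⟨S.scheduled.card - 2, by omega, by omega⟩
  · intro m₃ _ h
    obtain ⟨L, hL1, hL2, -, hL4, hL5, hL6⟩ := h.kept.best
    refine (outputC_spec hL1 hL2).mono (by omega) (fun m' _ ho => ⟨L, ho, hL4, fun S hS => ?_⟩)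
    rw [cost_eq I S]
    exact hL5.trans (add_le_add_left (h.done S hS trivial) _)

/-- For `s = 1` the hashed phase is empty and only `O(n ^ 4)` remains. For `s ≥ 2` the base `s + 1`
of the codes is at most `s ^ 2`, which turns `(s + 1) ^ k` into `s ^ (2 * k)`. -/
theorem mainTime_le {n s k : ℕ} (hn : 0 < n) (hs : 1 ≤ s) :
    mainTime n s k ≤ 2 ^ (200 * s) * s ^ (200 * k) * n ^ 4 := by
  have hn4 : 0 < n ^ 4 := by positivity
  rcases hs.eq_or_lt with rfl | hs2
  · simp only [mainTime, one_pow, mul_one]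
    have h : 2 ^ 48 * n ^ 4 ≤ 2 ^ 200 * n ^ 4 :=
      Nat.mul_le_mul (Nat.pow_le_pow_right (by omega) (by omega)) le_rfl
    norm_num at h ⊢
    omega
  · have hs0 : 0 < s := by omega
    set U := 2 ^ (116 * s) * s ^ (14 * k) * n ^ 4 with hU
    have hU0 : 0 < U := by positivity
    have hs' : s + 1 ≤ 2 ^ s := Nat.lt_two_pow_self
    have hY : rangeY s k ≤ 2 ^ s * (2 ^ s * s ^ (2 * k)) := by
      refine Nat.mul_le_mul hs' (Nat.mul_le_mul le_rfl ?_)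
      rw [pow_mul]
      refine Nat.pow_le_pow_left ?_ k
      have : 2 * s ≤ s * s := Nat.mul_le_mul hs2 le_rfl
      rw [pow_two]; omega
    have hH : hashedTime n s k ≤ 2 ^ 25 * U := by
      calc hashedTime n s k
          ≤ 2 ^ 25 * (n * (n ^ 3 * (2 ^ s * (2 ^ s * s ^ (2 * k))) ^ 7) * enumBound s ^ 6) :=
            Nat.mul_le_mul (by norm_num) (Nat.mul_le_mul (Nat.mul_le_mul le_rfl
              (Nat.mul_le_mul le_rfl (Nat.pow_le_pow_left hY 7))) le_rfl)
        _ = 2 ^ 25 * ((2 ^ s) ^ 14 * (2 ^ (17 * s)) ^ 6 * (s ^ (2 * k)) ^ 7 * n ^ 4) := by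
            rw [enumBound]; ring
        _ = 2 ^ 25 * U := by
            have e1 : (2 ^ s) ^ 14 * (2 ^ (17 * s)) ^ 6 = 2 ^ (116 * s) := by
              rw [← pow_mul, ← pow_mul, ← pow_add]; congr 1; ring
            have e2 : (s ^ (2 * k)) ^ 7 = s ^ (14 * k) := by rw [← pow_mul]; congr 1; ring
            rw [hU, e1, e2]
    have h1 : (hashedTime n s k + 50) * (s + 1) ≤ 2 ^ 26 * (U * 2 ^ s) := by
      calc _ ≤ (2 ^ 26 * U) * 2 ^ s := Nat.mul_le_mul (by omega) hs'
        _ = _ := by ring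
    have h2 : n ^ 4 ≤ U * 2 ^ s :=
      (Nat.le_mul_of_pos_left _ (by positivity)).trans (Nat.le_mul_of_pos_right _ (by positivity))
    have h3 : 2 ^ s ≤ U * 2 ^ s := Nat.le_mul_of_pos_left _ hU0
    have h4 : mainTime n s k ≤ 2 ^ 49 * (U * 2 ^ s) := by
      rw [mainTime, if_pos (show 2 ≤ s from hs2)]; omega
    refine h4.trans ?_
    calc 2 ^ 49 * (U * 2 ^ s) = 2 ^ (49 + 117 * s) * s ^ (14 * k) * n ^ 4 := by rw [hU]; ring
      _ ≤ _ := Nat.mul_le_mul (Nat.mul_le_mul (Nat.pow_le_pow_right (by omega) (by omega))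
        (Nat.pow_le_pow_right hs0 (by omega))) le_rfl

/-- The logarithm is not needed: `log n ≥ 1 / 2` for `n ≥ 2`, and the lost factor 2 is absorbed by
raising 200 to 201. -/
theorem mainTime_le_real {n s k : ℕ} (hn : 2 ≤ n) (hs : 1 ≤ s) :
    (mainTime n s k : ℝ) ≤ (2 : ℝ) ^ (201 * s) * (s : ℝ) ^ (201 * k) * (n : ℝ) ^ 4
      * Real.log (n : ℝ) := by
  have h1 : (mainTime n s k : ℝ) ≤ (2 : ℝ) ^ (200 * s) * (s : ℝ) ^ (200 * k) * (n : ℝ) ^ 4 := by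
    exact_mod_cast mainTime_le (k := k) (by omega : 0 < n) hs
  have h2 : (1 : ℝ) / 2 ≤ Real.log n := by
    have h3 : Real.log 2 ≤ Real.log n := Real.log_le_log (by norm_num) (by exact_mod_cast hn)
    have := Real.log_two_gt_d9
    linarith
  have hs1 : (1 : ℝ) ≤ s := by exact_mod_cast hs
  have h3 : (s : ℝ) ^ (200 * k) ≤ (s : ℝ) ^ (201 * k) := pow_le_pow_right₀ hs1 (by omega)
  have h4 : (2 : ℝ) ^ (200 * s) * 2 ≤ (2 : ℝ) ^ (201 * s) := by
    rw [← pow_succ]; exact pow_le_pow_right₀ (by norm_num) (by omega)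
  calc (mainTime n s k : ℝ) ≤ (2 : ℝ) ^ (200 * s) * (s : ℝ) ^ (200 * k) * (n : ℝ) ^ 4 := h1
    _ = ((2 : ℝ) ^ (200 * s) * 2) * (s : ℝ) ^ (200 * k) * (n : ℝ) ^ 4 * (1 / 2) := by ring
    _ ≤ _ := by gcongr

end Main

end RejSched

theorem mainTheorem10 :
    (∀ mode : RejSched.Mode, ∃ (prog : RejSched.Cmd) (c : ℕ),
      ∀ (K : Type) [CommRing K] [LinearOrder K] [IsStrictOrderedRing K] (I : RejSched.Problem K),
        I.Admissible →
        ∃ (t : ℕ) (m : RejSched.Memory K) (S : RejSched.Schedule K I.n),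
          RejSched.Runs I.oracle prog I.input t m ∧ m.Outputs S ∧ I.IsOptimal mode S ∧
          (2 ≤ I.n → 1 ≤ I.s →
            (t : ℝ) ≤ (2 : ℝ) ^ (c * I.s) * (I.s : ℝ) ^ (c * I.numProcTimes)
              * (I.n : ℝ) ^ 4 * Real.log (I.n : ℝ))) ∧
    (∀ (K : Type) [CommRing K] [LinearOrder K] [IsStrictOrderedRing K]
      (n s : ℕ) (r p e ω d : Fin n → K), (∀ j, 0 < p j) → (∀ j, 0 ≤ ω j) →
        ((RejSched.weightedFlowTime n s r p e ω).Admissible ∧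
          ∀ S : RejSched.Schedule K n, (RejSched.weightedFlowTime n s r p e ω).cost S =
            ∑ j ∈ S.scheduled,
              ω j * ((RejSched.weightedFlowTime n s r p e ω).completion S j - r j) +
            ∑ j ∈ S.rejected, e j) ∧
        ((RejSched.weightedTardiness n s r p e ω d).Admissible ∧
          ∀ S : RejSched.Schedule K n, (RejSched.weightedTardiness n s r p e ω d).cost S =
            ∑ j ∈ S.scheduled,
              ω j * max 0 ((RejSched.weightedTardiness n s r p e ω d).completion S j - d j) +
            ∑ j ∈ S.rejected, e j) ∧
        ((RejSched.weightedCompletionTime n s r p e ω).Admissible ∧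
          ∀ S : RejSched.Schedule K n, (RejSched.weightedCompletionTime n s r p e ω).cost S =
            ∑ j ∈ S.scheduled,
              ω j * (RejSched.weightedCompletionTime n s r p e ω).completion S j +
            ∑ j ∈ S.rejected, e j)) := by
  refine ⟨fun mode => ⟨RejSched.mainC mode, 201, fun K _ _ _ I hA => ?_⟩, ?_⟩
  · obtain ⟨t, m, hr, ht, S, ho, hopt⟩ := RejSched.mainC_spec (mode := mode) hA
    refine ⟨t, m, S, hr, ho, hopt, fun hn hs => ?_⟩
    exact (Nat.cast_le.mpr ht).trans (RejSched.mainTime_le_real hn hs)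
  -- For nonnegative weights the three cost functions are monotone on all of `K`, and the cost
  -- formulas hold by definition.
  · intro K _ _ _ n s r p e ω d hp hω
    refine ⟨⟨⟨hp, fun j x _ y _ hxy => ?_⟩, fun S => rfl⟩, ⟨⟨hp, fun j x _ y _ hxy => ?_⟩, fun S => rfl⟩,
      ⟨⟨hp, fun j x _ y _ hxy => ?_⟩, fun S => rfl⟩⟩
    · exact mul_le_mul_of_nonneg_left (sub_le_sub_right hxy _) (hω j)
    · exact mul_le_mul_of_nonneg_left (max_le_max le_rfl (sub_le_sub_right hxy _)) (hω j)
    · exact mul_le_mul_of_nonneg_left hxy (hω j)
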